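/- **Setting.** The set of constants is $\mathbf{dom}=\mathbb{N}_{\ge 1}$. A schema $\sigma$ is a finite set of relation symbols $R$ with arities $\mathrm{ar}(R)\ge 0$; a $\sigma$-database $D$ assigns to each $R$ a finite set $R^D\subseteq \mathbf{dom}^{\mathrm{ar}(R)}$; $\mathrm{adom}(D)$ is the set of constants occurring in $D$, and $\|D\|=|\sigma|+\sum_R\mathrm{ar}(R)+|\mathrm{adom}(D)|+\sum_R \mathrm{ar}(R)\,|R^D|$. An update inserts a tuple into, or deletes a tuple from, one relation. A $k$-ary conjunctive query (CQ) is $q=\{(u_1,\dots,u_k):\exists y_1\cdots\exists y_\ell(\psi_1\wedge\dots\wedge\psi_d)\}$ with $d\ge1$, pairwise distinct variables $y_j$, atoms $\psi_j$ of the form $Rv_1\cdots v_r$ over variables and constants, and $u_1,\dots,u_k$ constants or free variables such that every free variable occurs among them. Here $\mathrm{free}(q)=\mathrm{Vars}(q)\setminus\{y_1,\dots,y_\ell\}$, $\mathrm{Cons}(q)$ is the set of constants occurring in $q$, $\|q\|$ is the length of $q$ as a word, and $q(D)\subseteq\mathbf{dom}^k$ is the set of tuples $(\beta(u_1),\dots,\beta(u_k))$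 for all homomorphisms $\beta:q\to D$. Two $k$-ary CQs are equivalent if they have the same result on every database. A homomorphism between two $k$-ary CQs is the identity on constants, maps head to head componentwise, and maps atoms to atoms. A subquery of $q$ has the same head and the same free variables, and some of the quantifiers and atoms of $q$. A CQ is a homomorphic core if it has no homomorphism into a proper subquery of itself; the homomorphic core of $q$ is the homomorphic core equivalent to $q$, which is unique up to renaming of variables. Let $\mathrm{atoms}(x)$ be the set of atoms of $q$ that contain the variable $x$. The CQ $q$ is *t-hierarchical* if 1. for all $x,y\in\mathrm{Vars}(q)\setminus\mathrm{free}(q)$: $\mathrm{atoms}(x)\subseteq\mathrm{atoms}(y)$ or $\mathrm{atoms}(y)\subseteq\mathrm{atoms}(x)$ or $\mathrm{atoms}(x)\cap\mathrm{atoms}(y)=\emptyset$, and 2. for all $x\in\mathrm{free}(q)$, $y\in\mathrm{Vars}(q)\setminus\mathrm{free}(q)$: $\mathrm{atoms}(x)\cap\mathrm{atoms}(y)=\emptyset$ or $\mathrm{atoms}(y)\subseteq\mathrm{atoms}(x)$. A database $D$ maps homomorphically into $q$ if there is $g:\mathrm{adom}(D)\to\mathrm{Vars}(q)\cup\mathrm{Cons}(q)$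 such that $Rg(a_1)\cdots g(a_r)$ is an atom of $q$ for every $(a_1,\dots,a_r)\in R^D$. Algorithms are deterministic random access machine programs with unit cost, arrays of every dimension initialised to $0$, and words of $O(\log n)$ bits: the numbers in words are polynomially bounded in the input size $n$ (for dynamic algorithms: in the largest value so far of $\|q\|+\|D\|$ plus the largest number in the current input). A *dynamic algorithm for testing* consists of a routine preprocess that receives $q$ and an initial database and builds a data structure, a routine update that receives an update of the current database $D$ and maintains the data structure, and a routine test that receives $\bar a\in\mathbf{dom}^k$ and decides whether $\bar a\in q(D)$. All time bounds are worst-case bounds for a single call. The *OMv problem* is: preprocess a Boolean $n\times n$ matrix $M$, then receive Boolean vectors $v^1,\dots,v^n$ one by one and output the Boolean product $Mv^t$ before receiving $v^{t+1}$. The *OMv conjecture* says that there is no $\varepsilon>0$ such that the OMv problem can be solved in overall time $O(n^{3-\varepsilon})$. **Theorem.** (a) There are a dynamic algorithm and polynomials in $\|q\|$, denoted $\mathrm{poly}(q)$, such that for every schema $\sigma$, every $k\ge 0$ and every t-hierarchical $k$-ary CQ $q$ over $\sigma$, the algorithm, upon receiving $q$ and a $\sigma$-database $D_0$, solves the testing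 problem for $q$ with preprocessing time $\mathrm{poly}(q)\cdot O(\|D_0\|)$, update time $\mathrm{poly}(q)$ and testing time $\mathrm{poly}(q)$. (b) Let $\varepsilon>0$ and let $q$ be a $k$-ary CQ whose homomorphic core is not t-hierarchical; this is the case if and only if $q$ is not equivalent to a t-hierarchical CQ. Unless the OMv conjecture fails, there is no dynamic algorithm with arbitrary preprocessing time and update time $O(n^{1-\varepsilon})$ that tests for any input tuple $\bar a\in\mathbf{dom}^k$ whether $\bar a\in q(D)$ within testing time $O(n^{1-\varepsilon})$, where $n=|\mathrm{adom}(D)|$ for the current database $D$. This remains true if only databases that map homomorphically into $q$ are considered. -/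

import Mathlib

namespace DynCQ

/-! ## Schemas and databases -/

/-- The domain of database entries (constants). -/
abbrev Dom : Type := ℕ+

/-- A finite schema: relation symbols `0, …, numRel - 1`, each with an arity (possibly `0`). -/
structure Schema where
  numRel : ℕ
  ar : Fin numRel → ℕ

/-- `‖σ‖ = |σ| + ∑ ar(R)`. -/
def Schema.size (σ : Schema) : ℕ := σ.numRel + ∑ R, σ.ar R

/-- A database: a finite set of tuples of constants for every relation symbol. -/
def Database (σ : Schema) : Type := (R : Fin σ.numRel) → Finset (Fin (σ.ar R) → Dom)

/-- The active domain. -/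
def Database.adom {σ : Schema} (D : Database σ) : Finset Dom :=
  Finset.univ.biUnion fun R => (D R).biUnion fun t => Finset.univ.image t

/-- `‖D‖ = ‖σ‖ + |adom(D)| + ∑ ar(R)·|R^D|`. -/
def Database.size {σ : Schema} (D : Database σ) : ℕ :=
  σ.size + D.adom.card + ∑ R, σ.ar R * (D R).card

/-- An update command: insertion (`ins = true`) or deletion (`ins = false`) of a tuple. -/
structure Update (σ : Schema) where
  ins : Bool
  rel : Fin σ.numRel
  tuple : Fin (σ.ar rel) → Dom

/-- The database obtained by carrying out an update command. -/
def Database.apply {σ : Schema} (D : Database σ) (u : Update σ) : Database σ :=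
  Function.update D u.rel
    (if u.ins = true then insert u.tuple (D u.rel) else (D u.rel).erase u.tuple)

/-! ## Conjunctive queries -/

/-- Terms: variables (numbered by `ℕ`) and constants. -/
inductive Term where
  | var (x : ℕ)
  | const (a : Dom)

/-- Apply a map to the variables of a term; constants are fixed. -/
def Term.subst (h : ℕ → Term) : Term → Term
  | .var x => h x
  | .const a => .const a

/-- The value of a term under a valuation of the variables; constants are fixed. -/
def Term.eval (β : ℕ → Dom) : Term → Dom
  | .var x => β x
  | .const a => a

/-- An atomic formula `R w₁ ⋯ w_r`. -/
structure Atom (σ : Schema) where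
  rel : Fin σ.numRel
  args : Fin (σ.ar rel) → Term

/-- The variables of an atom. -/
def Atom.vars {σ : Schema} (ψ : Atom σ) : Set ℕ := {x | ∃ i, ψ.args i = .var x}

/-- The atom `R h(w₁) ⋯ h(w_r)`. -/
def Atom.subst {σ : Schema} (h : ℕ → Term) (ψ : Atom σ) : Atom σ :=
  ⟨ψ.rel, fun i => (ψ.args i).subst h⟩

/-- A `k`-ary conjunctive query `{ (u₁,…,u_k) : ∃ y₁ ⋯ ∃ y_ℓ (ψ₁ ∧ ⋯ ∧ ψ_d) }` with `d ≥ 1`,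
pairwise distinct `y₁,…,y_ℓ`, and whose head variables are exactly the free variables. -/
structure CQ (σ : Schema) (k : ℕ) where
  head : Fin k → Term
  quant : List ℕ
  atoms : List (Atom σ)
  quant_nodup : quant.Nodup
  atoms_ne_nil : atoms ≠ []
  head_free : ∀ x, (∃ i, head i = .var x) ↔ ((∃ ψ ∈ atoms, x ∈ ψ.vars) ∧ x ∉ quant)

namespace CQ

variable {σ : Schema} {k : ℕ}

/-- `Vars(q)`: all variables that occur in the formula. -/
def vars (q : CQ σ k) : Set ℕ := {x | x ∈ q.quant ∨ ∃ ψ ∈ q.atoms, x ∈ ψ.vars}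

/-- `free(q) = Vars(q) ∖ {y₁,…,y_ℓ}`. -/
def free (q : CQ σ k) : Set ℕ := {x | x ∈ q.vars ∧ x ∉ q.quant}

/-- `Cons(q)`: the constants that occur in the atoms or in the head. -/
def cons (q : CQ σ k) : Set Dom :=
  {a | (∃ ψ ∈ q.atoms, ∃ i, ψ.args i = .const a) ∨ ∃ i, q.head i = .const a}

/-- `atoms(x)`: the set of all atoms in which `x` occurs. -/
def atomsOf (q : CQ σ k) (x : ℕ) : Set (Atom σ) := {ψ | ψ ∈ q.atoms ∧ x ∈ ψ.vars}

/-- The length of `{ (u₁,…,u_k) : ∃y₁⋯∃y_ℓ (ψ₁ ∧ ⋯ ∧ ψ_d) }` as a word: two braces, four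
parentheses, one colon, `k` head terms with `k - 1` commas (none if `k = 0`), the quantifier
prefix, and `d` atoms with `d - 1` conjunction symbols. -/
def size (q : CQ σ k) : ℕ :=
  7 + k + (k - 1) + 2 * q.quant.length
    + (q.atoms.map fun ψ => 1 + σ.ar ψ.rel).sum + (q.atoms.length - 1)

/-- `β` is a homomorphism from `q` to the database `D`. -/
def IsHomDB (q : CQ σ k) (D : Database σ) (β : ℕ → Dom) : Prop :=
  ∀ ψ ∈ q.atoms, (fun i => (ψ.args i).eval β) ∈ D ψ.rel

/-- The query result `q(D)`. -/
def result (q : CQ σ k) (D : Database σ) : Set (Fin k → Dom) :=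
  {a | ∃ β, q.IsHomDB D β ∧ ∀ i, a i = (q.head i).eval β}

/-- Equivalence of queries. -/
def Equivalent (q q' : CQ σ k) : Prop := ∀ D : Database σ, q.result D = q'.result D

/-- `h` (extended by the identity on constants) is a homomorphism from `q` to `q'`. -/
def IsHom (q q' : CQ σ k) (h : ℕ → Term) : Prop :=
  (∀ x ∈ q.vars, ∀ z, h x = .var z → z ∈ q'.vars) ∧
  (∀ i, (q.head i).subst h = q'.head i) ∧
  ∀ ψ ∈ q.atoms, ψ.subst h ∈ q'.atoms

/-- `q'` is a subquery of `q`: it keeps the head (hence the free variables) and some of the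
quantifiers and atoms. -/
def IsSubquery (q' q : CQ σ k) : Prop :=
  q'.head = q.head ∧ q'.quant.Sublist q.quant ∧ q'.atoms.Sublist q.atoms

/-- `q` is a homomorphic core: there is no homomorphism into a proper subquery. -/
def IsCore (q : CQ σ k) : Prop :=
  ∀ q' : CQ σ k, q'.IsSubquery q → q' ≠ q → ¬ ∃ h, q.IsHom q' h

/-- `q'` is the homomorphic core of `q` (it is unique up to renaming of variables). -/
def IsCoreOf (q' q : CQ σ k) : Prop := q'.IsCore ∧ q'.Equivalent q

/-- `t`-hierarchical queries. -/
def THierarchical (q : CQ σ k) : Prop :=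
  (∀ x ∈ q.vars \ q.free, ∀ y ∈ q.vars \ q.free,
    q.atomsOf x ⊆ q.atomsOf y ∨ q.atomsOf y ⊆ q.atomsOf x ∨ q.atomsOf x ∩ q.atomsOf y = ∅) ∧
  (∀ x ∈ q.free, ∀ y ∈ q.vars \ q.free,
    q.atomsOf x ∩ q.atomsOf y = ∅ ∨ q.atomsOf y ⊆ q.atomsOf x)

/-- The homomorphic core of `q` is not `t`-hierarchical. -/
def CoreNotTHierarchical (q : CQ σ k) : Prop :=
  ∃ q' : CQ σ k, q'.IsCoreOf q ∧ ¬ q'.THierarchical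

end CQ

/-- There is a homomorphism from the database `D` to `q`: a map from the active domain to
`Vars(q) ∪ Cons(q)` that sends every tuple of `R^D` to an `R`-atom of `q`. -/
def Database.MapsInto {σ : Schema} {k : ℕ} (D : Database σ) (q : CQ σ k) : Prop :=
  ∃ g : Dom → Term,
    (∀ a ∈ D.adom, (∃ x ∈ q.vars, g a = .var x) ∨ ∃ c ∈ q.cons, g a = .const c) ∧
    ∀ R, ∀ t ∈ D R, (⟨R, fun i => g (t i)⟩ : Atom σ) ∈ q.atoms

/-! ## Random access machines with bounded words and uniform cost -/

/-- The configuration of the machine: registers, the address tuple of the memory cell that is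
accessed next, and the memory. A memory cell is addressed by a tuple of numbers of arbitrary
length (array name and indices), so that arrays of every dimension are available. -/
structure State where
  reg : ℕ → ℕ
  addr : List ℕ
  mem : List ℕ → ℕ

/-- Elementary instructions. -/
inductive Instr where
  | const (d c : ℕ)
  | copy (d r : ℕ)
  | add (d r₁ r₂ : ℕ)
  | sub (d r₁ r₂ : ℕ)
  | mul (d r₁ r₂ : ℕ)
  | div (d r₁ r₂ : ℕ)
  /-- empty the address tuple -/
  | clear
  /-- append the content of register `r` to the address tuple -/
  | push (r : ℕ)
  /-- load the addressed memory cell into register `d` -/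
  | load (d : ℕ)
  /-- store the content of register `r` in the addressed memory cell -/
  | store (r : ℕ)

/-- Write `v` into register `d`. -/
def State.setReg (s : State) (d v : ℕ) : State := { s with reg := Function.update s.reg d v }

/-- The effect of an elementary instruction. -/
def Instr.step (s : State) : Instr → State
  | .const d c => s.setReg d c
  | .copy d r => s.setReg d (s.reg r)
  | .add d r₁ r₂ => s.setReg d (s.reg r₁ + s.reg r₂)
  | .sub d r₁ r₂ => s.setReg d (s.reg r₁ - s.reg r₂)
  | .mul d r₁ r₂ => s.setReg d (s.reg r₁ * s.reg r₂)
  | .div d r₁ r₂ => s.setReg d (s.reg r₁ / s.reg r₂)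
  | .clear => { s with addr := [] }
  | .push r => { s with addr := s.addr ++ [s.reg r] }
  | .load d => s.setReg d (s.mem s.addr)
  | .store r => { s with mem := Function.update s.mem s.addr (s.reg r) }

/-- Programs: `ite r p p'` executes `p` if register `r` is nonzero and `p'` otherwise, and
`loop r p` repeats `p` as long as register `r` is nonzero. -/
inductive Prog where
  | skip
  | instr (i : Instr)
  | seq (p p' : Prog)
  | ite (r : ℕ) (p p' : Prog)
  | loop (r : ℕ) (p : Prog)

/-- `Exec B p s t s'`: started in `s`, the program `p` halts after `t` steps in `s'`, and no
register ever holds a number larger than `B` (words are the numbers `0, …, B`, and an overflow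
is not permitted). Every instruction and every test of a register costs one step. -/
inductive Exec (B : ℕ) : Prog → State → ℕ → State → Prop
  | skip (s : State) : Exec B .skip s 1 s
  | instr (i : Instr) (s : State) (h : ∀ r, (i.step s).reg r ≤ B) :
      Exec B (.instr i) s 1 (i.step s)
  | seq {p p' : Prog} {s s' s'' : State} {t t' : ℕ} :
      Exec B p s t s' → Exec B p' s' t' s'' → Exec B (.seq p p') s (t + t') s''
  | ite_pos {r : ℕ} {p p' : Prog} {s s' : State} {t : ℕ} :
      s.reg r ≠ 0 → Exec B p s t s' → Exec B (.ite r p p') s (1 + t) s'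
  | ite_neg {r : ℕ} {p p' : Prog} {s s' : State} {t : ℕ} :
      s.reg r = 0 → Exec B p' s t s' → Exec B (.ite r p p') s (1 + t) s'
  | loop_stop {r : ℕ} {p : Prog} {s : State} :
      s.reg r = 0 → Exec B (.loop r p) s 1 s
  | loop_step {r : ℕ} {p : Prog} {s s' s'' : State} {t t' : ℕ} :
      s.reg r ≠ 0 → Exec B p s t s' → Exec B (.loop r p) s' t' s'' →
        Exec B (.loop r p) s (1 + t + t') s''

/-- The initial configuration: everything is `0`. -/
def State.init : State := ⟨fun _ => 0, [], fun _ => 0⟩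

/-- Hand over an input word by word: its `i`-th entry is put into the cell with address
`(0, i)`. -/
def State.input (s : State) (xs : List ℕ) : State :=
  { s with mem := fun a => match a with
      | [0, i] => (xs[i]?).getD (s.mem [0, i])
      | a => s.mem a }

/-- The `i`-th entry of the output is found in the cell with address `(1, i)`. -/
def State.output (s : State) (i : ℕ) : ℕ := s.mem [1, i]

/-- The largest number in an input. -/
def maxWord (xs : List ℕ) : ℕ := xs.foldr max 0

/-! ## Inputs -/

def Term.code : Term → List ℕ
  | .var x => [0, x]
  | .const a => [1, (a : ℕ)]

/-- Relation symbol, arity, arguments. -/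
def Atom.code {σ : Schema} (ψ : Atom σ) : List ℕ :=
  ((ψ.rel : ℕ) :: σ.ar ψ.rel :: (List.ofFn ψ.args).flatMap Term.code)

def CQ.code {σ : Schema} {k : ℕ} (q : CQ σ k) : List ℕ :=
  (k :: (List.ofFn q.head).flatMap Term.code) ++ (q.quant.length :: q.quant)
    ++ (q.atoms.length :: q.atoms.flatMap Atom.code)

def Schema.code (σ : Schema) : List ℕ := σ.numRel :: List.ofFn σ.ar

/-- A fact `R(a₁,…,a_r)`. -/
abbrev Fact (σ : Schema) : Type := (R : Fin σ.numRel) × (Fin (σ.ar R) → Dom)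

/-- `L` enumerates the tuples of `D` without repetition, in some order. -/
def Lists {σ : Schema} (L : List (Fact σ)) (D : Database σ) : Prop :=
  L.Nodup ∧ ∀ R t, (⟨R, t⟩ : Fact σ) ∈ L ↔ t ∈ D R

def Fact.code {σ : Schema} (f : Fact σ) : List ℕ :=
  (f.1 : ℕ) :: List.ofFn fun i => (f.2 i : ℕ)

/-- The input of the preprocessing routine: query, schema and database. -/
def preprocessInput {σ : Schema} {k : ℕ} (q : CQ σ k) (L : List (Fact σ)) : List ℕ :=
  q.code ++ σ.code ++ (L.length :: L.flatMap Fact.code)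

/-- The input of the update routine: type of the command, relation symbol, tuple. -/
def updateInput {σ : Schema} (u : Update σ) : List ℕ :=
  u.ins.toNat :: (u.rel : ℕ) :: List.ofFn fun i => (u.tuple i : ℕ)

/-- The input of the testing routine: a tuple. -/
def testInput {k : ℕ} (a : Fin k → Dom) : List ℕ := List.ofFn fun i => (a i : ℕ)

/-! ## Dynamic algorithms for testing -/

/-- A dynamic algorithm with the routines preprocess, update and test. The data structure is the
configuration of the machine, which is kept between calls. Words have `O(log n)` bits:
`wordExp` is the exponent of the polynomial that bounds the numbers in words. -/
structure DynAlg where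
  preprocess : Prog
  update : Prog
  test : Prog
  wordExp : ℕ

/-- The size of query, database and of the largest number in the current input. -/
def inputSize {σ : Schema} {k : ℕ} (q : CQ σ k) (D : Database σ) (xs : List ℕ) : ℕ :=
  q.size + D.size + maxWord xs

/-- `Reachable A q 𝒞 N D s`: some sequence of calls of the routines of `A`, with query `q` and all
databases in `𝒞`, leads to the configuration `s` and the current database `D`, and `N` is the
maximum of the input sizes so far. -/
inductive Reachable {σ : Schema} {k : ℕ} (A : DynAlg) (q : CQ σ k) (𝒞 : Set (Database σ)) :
    ℕ → Database σ → State → Prop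
  | preprocess {D : Database σ} {L : List (Fact σ)} {t : ℕ} {s : State} :
      D ∈ 𝒞 → Lists L D →
      Exec (inputSize q D (preprocessInput q L) ^ A.wordExp) A.preprocess
        (State.init.input (preprocessInput q L)) t s →
      Reachable A q 𝒞 (inputSize q D (preprocessInput q L)) D s
  | update {N : ℕ} {D : Database σ} {s s' : State} {t : ℕ} (u : Update σ) :
      Reachable A q 𝒞 N D s → D.apply u ∈ 𝒞 →
      Exec (max N (inputSize q (D.apply u) (updateInput u)) ^ A.wordExp) A.update
        (s.input (updateInput u)) t s' →
      Reachable A q 𝒞 (max N (inputSize q (D.apply u) (updateInput u))) (D.apply u) s'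
  | test {N : ℕ} {D : Database σ} {s s' : State} {t : ℕ} (a : Fin k → Dom) :
      Reachable A q 𝒞 N D s →
      Exec (max N (inputSize q D (testInput a)) ^ A.wordExp) A.test
        (s.input (testInput a)) t s' →
      Reachable A q 𝒞 (max N (inputSize q D (testInput a))) D s'

/-- `A` solves the testing problem for `q` under updates on the databases in `𝒞`, with
preprocessing time `tp`, update time `tu` and testing time `tt` as functions of the current
database. -/
structure SolvesTesting {σ : Schema} {k : ℕ} (A : DynAlg) (q : CQ σ k) (𝒞 : Set (Database σ))
    (tp tu tt : Database σ → ℝ) : Prop where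
  preprocess : ∀ D ∈ 𝒞, ∀ L, Lists L D → ∃ t s,
    Exec (inputSize q D (preprocessInput q L) ^ A.wordExp) A.preprocess
      (State.init.input (preprocessInput q L)) t s ∧ (t : ℝ) ≤ tp D
  update : ∀ N D s, Reachable A q 𝒞 N D s → ∀ u : Update σ, D.apply u ∈ 𝒞 → ∃ t s',
    Exec (max N (inputSize q (D.apply u) (updateInput u)) ^ A.wordExp) A.update
      (s.input (updateInput u)) t s' ∧ (t : ℝ) ≤ tu D
  test : ∀ N D s, Reachable A q 𝒞 N D s → ∀ a : Fin k → Dom, ∃ t s',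
    Exec (max N (inputSize q D (testInput a)) ^ A.wordExp) A.test
      (s.input (testInput a)) t s' ∧ (t : ℝ) ≤ tt D ∧
      (a ∈ q.result D → s'.output 0 = 1) ∧ (a ∉ q.result D → s'.output 0 = 0)

/-- Some dynamic algorithm solves the testing problem for `q` on `𝒞` with arbitrary
preprocessing time, and with update time and testing time `O(n^{1-ε})`, where `n` is the size of
the active domain of the current database. -/
def SublinearTesting {σ : Schema} {k : ℕ} (q : CQ σ k) (𝒞 : Set (Database σ)) (ε : ℝ) : Prop :=
  ∃ (A : DynAlg) (tp : Database σ → ℝ) (C : ℝ),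
    SolvesTesting A q 𝒞 tp
      (fun D => C * ((D.adom.card : ℝ) + 1) ^ (1 - ε))
      (fun D => C * ((D.adom.card : ℝ) + 1) ^ (1 - ε))

/-! ## Online Boolean matrix-vector multiplication -/

/-- The input of the preprocessing phase: dimension and matrix (row by row). -/
def matrixInput {n : ℕ} (M : Matrix (Fin n) (Fin n) Bool) : List ℕ :=
  n :: (List.ofFn fun i => List.ofFn fun j => (M i j).toNat).flatten

def vectorInput {n : ℕ} (v : Fin n → Bool) : List ℕ := List.ofFn fun j => (v j).toNat

/-- `OMvRounds B p M s vs T`: started in configuration `s`, the program `p`, run once for each of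
the vectors in `vs` in turn, outputs the Boolean products `M v`, in total time `T`. -/
inductive OMvRounds (B : ℕ) (p : Prog) {n : ℕ} (M : Matrix (Fin n) (Fin n) Bool) :
    State → List (Fin n → Bool) → ℕ → Prop
  | nil (s : State) : OMvRounds B p M s [] 0
  | cons {s s' : State} {v : Fin n → Bool} {vs : List (Fin n → Bool)} {t T : ℕ} :
      Exec B p (s.input (vectorInput v)) t s' →
      (∀ i : Fin n, ((∃ j, M i j = true ∧ v j = true) → s'.output i = 1) ∧
        ((¬ ∃ j, M i j = true ∧ v j = true) → s'.output i = 0)) →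
      OMvRounds B p M s' vs T →
      OMvRounds B p M s (v :: vs) (t + T)

/-- The OMv problem can be solved in overall time `f n` (preprocessing of the `n × n` matrix and
`n` online multiplications) on a machine with `O(log n)`-bit words. -/
def OMvSolvable (f : ℕ → ℝ) : Prop :=
  ∃ (pre mult : Prog) (c : ℕ), ∀ (n : ℕ) (M : Matrix (Fin n) (Fin n) Bool)
    (v : Fin n → Fin n → Bool), ∃ (t T : ℕ) (s : State),
      Exec ((n + 2) ^ c) pre (State.init.input (matrixInput M)) t s ∧
      OMvRounds ((n + 2) ^ c) mult M s (List.ofFn v) T ∧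
      ((t + T : ℕ) : ℝ) ≤ f n

/-- There is no `ε > 0` such that the OMv problem can be solved in time `O(n^{3-ε})`. -/
def OMvConjecture : Prop :=
  ¬ ∃ ε > (0 : ℝ), ∃ C : ℝ, OMvSolvable fun n => C * ((n : ℝ) + 1) ^ (3 - ε)

end DynCQ

open DynCQ

/-!
The theorem has an upper bound, which is an algorithm, and a conditional lower bound, which is a
reduction. Both are programs, and a small program logic (`Tri`) with a syntactic time bound
(`PL.cost`, `PL.cost_le`) serves to verify them.

*The upper bound.* In a `t`-hierarchical query the quantified variables are eliminated one after
the other, in the order of the number of atoms that contain them. When the turn of `z` has come,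
all atoms with `z` have the same remaining variables (`CQ.layout_wf`). So all of them can be
replaced by one truth value for each assignment to the other remaining variables: is there a value
for `z` that satisfies all the atoms with `z`? The data structure stores two numbers for each `z`:
how many of its atoms hold, for every assignment that includes `z` (`cnt`), and how many values
for `z` satisfy all of them, for every assignment to the other variables (`wit`). An update
changes the truth value of an atom for at most one assignment, and an elimination carries a change
for one assignment over to a change for at most one assignment (`Diff.step`). Hence a single
counter of each kind has to be updated for each variable (`Layout.tri_level`, `Layout.tri_prop`,
`Layout.tri_core`). After all eliminations only free variables are left. Their values are given by
the tuple that is tested, so that the test is one lookup for each atom (`exists_val_iff`,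
`Layout.tri_test`). The preprocessing inserts the facts one by one. Counters are kept in an array
whose index is the whole assignment.

*The homomorphic core.* An endomorphism of a core is onto, and therefore it has an inverse
(`CQ.IsCore.exists_inverse`). It follows that a core inherits being `t`-hierarchical from every
equivalent query (`CQ.IsCore.tHierarchical`), which gives `CQ.coreNotTHierarchical_iff`.

*The lower bound.* If a core `c` is not `t`-hierarchical, then it has variables `x`, `y`, an atom
with both of them, and an atom with `y` but without `x`, where `y` is quantified. Moreover, there
is an atom with `x` but without `y`, or `x` occurs in the head (`Gadget`). Rows of a matrix `M`
are encoded as values of `x` and columns as values of `y`; all other variables have one value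
each. The facts for the first atom encode `M`, those for the second one encode a vector `v`, and
the third atom or the tested tuple selects a row. The test then computes one entry of `M v`; a
homomorphism into such a database may permute the variables of `c`, which is undone by the inverse
of an endomorphism of `c` (`Gadget.Rep.tuple_mem_result`). Hence one product takes `O(n)` updates
and tests on a database with `O(n)` constants. The databases map homomorphically into `c`, and
hence into every query that is equivalent to `c` (`Gadget.Rep.mapsInto`).

To turn this into a machine for OMv, the dynamic algorithm is simulated with registers and arrays
of its own, where its address tuple is represented by a node of a tree, such that each step takes
a constant number of steps (`sim_exec`). The preprocessing time does not matter: only the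
preprocessing of the empty database is needed, and its time is a constant for a fixed query. The
matrix is encoded by `O(n²)` updates. Altogether this takes time `O(n² · n^(1-ε))`
(`Gadget.exists_omvRounds`, `not_sublinearTesting`).
-/

namespace DynCQ

/-! ### Execution of programs -/

theorem Exec.det {B B' : ℕ} {p : Prog} {s s₁ s₂ : State} {t₁ t₂ : ℕ}
    (h₁ : Exec B p s t₁ s₁) (h₂ : Exec B' p s t₂ s₂) : t₁ = t₂ ∧ s₁ = s₂ := by
  induction h₁ generalizing t₂ s₂ with
  | skip s => cases h₂; exact ⟨rfl, rfl⟩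
  | instr i s h => cases h₂; exact ⟨rfl, rfl⟩
  | seq _ _ ih₁ ih₂ =>
    cases h₂ with
    | seq a b =>
      obtain ⟨rfl, rfl⟩ := ih₁ a
      obtain ⟨rfl, rfl⟩ := ih₂ b
      exact ⟨rfl, rfl⟩
  | ite_pos h _ ih =>
    cases h₂ with
    | ite_pos _ a => obtain ⟨rfl, rfl⟩ := ih a; exact ⟨rfl, rfl⟩
    | ite_neg h' _ => exact absurd h' h
  | ite_neg h _ ih =>
    cases h₂ with
    | ite_pos h' _ => exact absurd h h'
    | ite_neg _ a => obtain ⟨rfl, rfl⟩ := ih a; exact ⟨rfl, rfl⟩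
  | loop_stop h =>
    cases h₂ with
    | loop_stop _ => exact ⟨rfl, rfl⟩
    | loop_step h' _ _ => exact absurd h h'
  | loop_step h _ _ ih₁ ih₂ =>
    cases h₂ with
    | loop_stop h' => exact absurd h' h
    | loop_step _ a b =>
      obtain ⟨rfl, rfl⟩ := ih₁ a
      obtain ⟨rfl, rfl⟩ := ih₂ b
      exact ⟨rfl, rfl⟩

/-- Every register and every memory cell holds a word, that is, a number at most `B`. -/
def State.Bdd (B : ℕ) (s : State) : Prop := (∀ r, s.reg r ≤ B) ∧ ∀ a, s.mem a ≤ B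

theorem State.Bdd.mono {B B' : ℕ} {s : State} (h : s.Bdd B) (hB : B ≤ B') : s.Bdd B' :=
  ⟨fun r => (h.1 r).trans hB, fun a => (h.2 a).trans hB⟩

/-! ### Structured programs with a syntactic time bound -/

/-- Programs with marked calls of routines. The marks serve only to state time bounds. -/
inductive PL where
  | skip
  | instr (i : Instr)
  | seq (P P' : PL)
  | ite (r : ℕ) (P P' : PL)
  | loop (r : ℕ) (P : PL)
  | call (p : Prog)

namespace PL

/-- The underlying machine program. -/
def prog : PL → Prog
  | skip => .skip
  | instr i => .instr i
  | seq P P' => .seq P.prog P'.prog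
  | ite r P P' => .ite r P.prog P'.prog
  | loop r P => .loop r P.prog
  | call p => p

/-- A bound on the running time if every loop makes at most `S` iterations and every call takes
at most `τ` steps. -/
def cost (S τ : ℕ) : PL → ℕ
  | skip => 1
  | instr _ => 1
  | seq P P' => P.cost S τ + P'.cost S τ
  | ite _ P P' => 1 + P.cost S τ + P'.cost S τ
  | loop _ P => 1 + S * (1 + P.cost S τ)
  | call _ => τ

/-- The number of nodes of the syntax tree. -/
def len : PL → ℕ
  | skip => 1
  | instr _ => 1
  | seq P P' => P.len + P'.len
  | ite _ P P' => 1 + P.len + P'.len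
  | loop _ P => 2 + P.len
  | call _ => 1

/-- The nesting depth of loops. -/
def depth : PL → ℕ
  | skip => 0
  | instr _ => 0
  | seq P P' => max P.depth P'.depth
  | ite _ P P' => max P.depth P'.depth
  | loop _ P => P.depth + 1
  | call _ => 0

/-- The time bound is at most the length of the program, times a factor for each nesting level of
loops, times the cost of a call. -/
theorem cost_le (S τ : ℕ) (P : PL) :
    P.cost S τ ≤ P.len * (S + 1) ^ P.depth * (τ + 1) := by
  have pow_le : ∀ {a b : ℕ}, a ≤ b → (S + 1) ^ a ≤ (S + 1) ^ b := fun h =>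
    Nat.pow_le_pow_right (by omega) h
  have one_le : ∀ a : ℕ, 1 ≤ (S + 1) ^ a * (τ + 1) := fun a =>
    Nat.succ_le_of_lt (by positivity)
  induction P with
  | skip => simp [cost, len, depth]
  | instr i => simp [cost, len, depth]
  | call p => simp [cost, len, depth]
  | seq P P' ih ih' =>
    simp only [cost, len, depth]
    have h := pow_le (le_max_left P.depth P'.depth)
    have h' := pow_le (le_max_right P.depth P'.depth)
    calc _ ≤ _ := add_le_add ih ih'
      _ ≤ P.len * (S + 1) ^ (max P.depth P'.depth) * (τ + 1)
          + P'.len * (S + 1) ^ (max P.depth P'.depth) * (τ + 1) := by gcongr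
      _ = _ := by ring
  | ite _ P P' ih ih' =>
    simp only [cost, len, depth]
    have h := pow_le (le_max_left P.depth P'.depth)
    have h' := pow_le (le_max_right P.depth P'.depth)
    calc _ ≤ _ := add_le_add (add_le_add (one_le (max P.depth P'.depth)) ih) ih'
      _ ≤ (S + 1) ^ (max P.depth P'.depth) * (τ + 1)
          + P.len * (S + 1) ^ (max P.depth P'.depth) * (τ + 1)
          + P'.len * (S + 1) ^ (max P.depth P'.depth) * (τ + 1) := by gcongr
      _ = _ := by ring
  | loop _ P ih =>
    simp only [cost, len, depth]
    have h1 := one_le (P.depth + 1)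
    have h2 := one_le P.depth
    calc 1 + S * (1 + P.cost S τ)
        ≤ (S + 1) ^ (P.depth + 1) * (τ + 1)
          + (S + 1) * ((S + 1) ^ P.depth * (τ + 1)
            + P.len * (S + 1) ^ P.depth * (τ + 1)) := by gcongr; omega
      _ = _ := by ring

end PL

/-- Sequential composition. -/
scoped infixr:60 " ;; " => PL.seq

/-! ### A program logic for total correctness -/

/-- The logical registers: the program logic speaks only about the registers with even number;
the registers with odd number are scratch space for the evaluation of expressions. -/
def State.vars (s : State) : ℕ → ℕ := fun i => s.reg (2 * i)

/-- Memory contents. -/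
abbrev Mem : Type := List ℕ → ℕ

/-- Total correctness: started with logical registers `ρ` and memory `m`, the program halts
within its syntactic time bound and establishes `Q`. -/
def Tri (B S τ : ℕ) (P : PL) (ρ : ℕ → ℕ) (m : Mem) (Q : (ℕ → ℕ) → Mem → Prop) : Prop :=
  ∀ s : State, s.Bdd B → s.vars = ρ → s.mem = m →
    ∃ t s', Exec B P.prog s t s' ∧ t ≤ P.cost S τ ∧ s'.Bdd B ∧ Q s'.vars s'.mem

section Rules

variable {B S τ : ℕ} {ρ : ℕ → ℕ} {m : Mem} {Q Q' : (ℕ → ℕ) → Mem → Prop}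

theorem Tri.conseq {P : PL} (h : Tri B S τ P ρ m Q) (hQ : ∀ ρ m, Q ρ m → Q' ρ m) :
    Tri B S τ P ρ m Q' := fun s hs hρ hm => by
  obtain ⟨t, s', h1, h2, h3, h4⟩ := h s hs hρ hm
  exact ⟨t, s', h1, h2, h3, hQ _ _ h4⟩

/-- The words in registers and memory may be assumed to be bounded. -/
theorem Tri.bdd {P : PL} (h : (∀ r, ρ r ≤ B) → (∀ a, m a ≤ B) → Tri B S τ P ρ m Q) :
    Tri B S τ P ρ m Q := fun s hs hρ hm =>
  h (fun _ => hρ ▸ hs.1 _) (fun a => hm ▸ hs.2 a) s hs hρ hm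

theorem Tri.skip (h : Q ρ m) : Tri B S τ .skip ρ m Q := fun s hs hρ hm =>
  ⟨1, s, .skip s, le_rfl, hs, by rw [hρ, hm]; exact h⟩

theorem Tri.seq {P P' : PL} (h : Tri B S τ P ρ m fun ρ' m' => Tri B S τ P' ρ' m' Q) :
    Tri B S τ (P ;; P') ρ m Q := fun s hs hρ hm => by
  obtain ⟨t, s', h1, h2, h3, h4⟩ := h s hs hρ hm
  obtain ⟨t', s'', h1', h2', h3', h4'⟩ := h4 s' h3 rfl rfl
  exact ⟨t + t', s'', .seq h1 h1', add_le_add h2 h2', h3', h4'⟩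

/-- Composition with a specification of the first part. -/
theorem Tri.seq' {P P' : PL} {R : (ℕ → ℕ) → Mem → Prop} (h : Tri B S τ P ρ m R)
    (h' : ∀ ρ' m', R ρ' m' → Tri B S τ P' ρ' m' Q) :
    Tri B S τ (P ;; P') ρ m Q := .seq (h.conseq h')

end Rules

/-! ### Expressions and structured statements -/

/-- Expressions over the logical registers, with access to one- and two-dimensional arrays. -/
inductive Ex where
  | reg (r : ℕ)
  | lit (c : ℕ)
  | add (a b : Ex)
  | sub (a b : Ex)
  | mul (a b : Ex)
  | ld (n : ℕ) (a : Ex)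
  | ld₂ (n : ℕ) (a b : Ex)

namespace Ex

@[simp] def eval (ρ : ℕ → ℕ) (m : Mem) : Ex → ℕ
  | reg r => ρ r
  | lit c => c
  | add a b => a.eval ρ m + b.eval ρ m
  | sub a b => a.eval ρ m - b.eval ρ m
  | mul a b => a.eval ρ m * b.eval ρ m
  | ld n a => m [n, a.eval ρ m]
  | ld₂ n a b => m [n, a.eval ρ m, b.eval ρ m]

/-- No overflow occurs in the evaluation. -/
@[simp] def Ok (B : ℕ) (ρ : ℕ → ℕ) (m : Mem) : Ex → Prop
  | reg _ => True
  | lit c => c ≤ B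
  | add a b => a.Ok B ρ m ∧ b.Ok B ρ m ∧ a.eval ρ m + b.eval ρ m ≤ B
  | sub a b => a.Ok B ρ m ∧ b.Ok B ρ m
  | mul a b => a.Ok B ρ m ∧ b.Ok B ρ m ∧ a.eval ρ m * b.eval ρ m ≤ B
  | ld n a => n ≤ B ∧ a.Ok B ρ m
  | ld₂ n a b => n ≤ B ∧ a.Ok B ρ m ∧ b.Ok B ρ m

/-- `a = b`, as a number. -/
def eq (a b : Ex) : Ex := sub (lit 1) (add (sub a b) (sub b a))

@[simp] theorem eval_eq (ρ : ℕ → ℕ) (m : Mem) (a b : Ex) :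
    (eq a b).eval ρ m = if a.eval ρ m = b.eval ρ m then 1 else 0 := by
  simp only [eq, eval]; split <;> omega

/-- Evaluation into the scratch register number `t`. -/
def comp : Ex → ℕ → PL
  | reg r, t => .instr (.copy (2 * t + 1) (2 * r))
  | lit c, t => .instr (.const (2 * t + 1) c)
  | add a b, t => a.comp t ;; b.comp (t + 1) ;;
      .instr (.add (2 * t + 1) (2 * t + 1) (2 * (t + 1) + 1))
  | sub a b, t => a.comp t ;; b.comp (t + 1) ;;
      .instr (.sub (2 * t + 1) (2 * t + 1) (2 * (t + 1) + 1))
  | mul a b, t => a.comp t ;; b.comp (t + 1) ;;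
      .instr (.mul (2 * t + 1) (2 * t + 1) (2 * (t + 1) + 1))
  | ld n a, t => a.comp t ;; .instr (.const (2 * (t + 1) + 1) n) ;; .instr .clear ;;
      .instr (.push (2 * (t + 1) + 1)) ;; .instr (.push (2 * t + 1)) ;;
      .instr (.load (2 * t + 1))
  | ld₂ n a b, t => a.comp t ;; b.comp (t + 1) ;; .instr (.const (2 * (t + 2) + 1) n) ;;
      .instr .clear ;; .instr (.push (2 * (t + 2) + 1)) ;; .instr (.push (2 * t + 1)) ;;
      .instr (.push (2 * (t + 1) + 1)) ;; .instr (.load (2 * t + 1))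

end Ex

/-- Total correctness on configurations, with full information about the final state. -/
def STri (B S τ : ℕ) (P : PL) (s : State) (Q : State → Prop) : Prop :=
  s.Bdd B → ∃ t s', Exec B P.prog s t s' ∧ t ≤ P.cost S τ ∧ s'.Bdd B ∧ Q s'

section SRules

variable {B S τ : ℕ} {s : State} {Q Q' : State → Prop}

theorem STri.conseq {P : PL} (h : STri B S τ P s Q) (hQ : ∀ s, Q s → Q' s) :
    STri B S τ P s Q' := fun hs => by
  obtain ⟨t, s', h1, h2, h3, h4⟩ := h hs
  exact ⟨t, s', h1, h2, h3, hQ _ h4⟩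

theorem STri.seq {P P' : PL} (h : STri B S τ P s fun s' => STri B S τ P' s' Q) :
    STri B S τ (P ;; P') s Q := fun hs => by
  obtain ⟨t, s', h1, h2, h3, h4⟩ := h hs
  obtain ⟨t', s'', h1', h2', h3', h4'⟩ := h4 h3
  exact ⟨t + t', s'', .seq h1 h1', add_le_add h2 h2', h3', h4'⟩

theorem STri.instr {i : Instr} (h : s.Bdd B → (i.step s).Bdd B) (hQ : Q (i.step s)) :
    STri B S τ (.instr i) s Q := fun hs =>
  ⟨1, _, .instr i s (h hs).1, le_rfl, h hs, hQ⟩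

theorem State.Bdd.setReg (hs : s.Bdd B) {d v : ℕ} (hv : v ≤ B) : (s.setReg d v).Bdd B := by
  refine ⟨fun r => ?_, hs.2⟩
  by_cases h : r = d <;> simp [State.setReg, h, hv, hs.1]

theorem STri.const {d c : ℕ} (hc : c ≤ B) (h : Q (s.setReg d c)) :
    STri B S τ (.instr (.const d c)) s Q := .instr (fun hs => hs.setReg hc) h

theorem STri.copy {d r : ℕ} (h : Q (s.setReg d (s.reg r))) :
    STri B S τ (.instr (.copy d r)) s Q := .instr (fun hs => hs.setReg (hs.1 r)) h

theorem STri.add {d a b : ℕ} (hb : s.reg a + s.reg b ≤ B)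
    (h : Q (s.setReg d (s.reg a + s.reg b))) :
    STri B S τ (.instr (.add d a b)) s Q := .instr (fun hs => hs.setReg hb) h

theorem STri.sub {d a b : ℕ} (h : Q (s.setReg d (s.reg a - s.reg b))) :
    STri B S τ (.instr (.sub d a b)) s Q :=
  .instr (fun hs => hs.setReg ((Nat.sub_le _ _).trans (hs.1 a))) h

theorem STri.mul {d a b : ℕ} (hb : s.reg a * s.reg b ≤ B)
    (h : Q (s.setReg d (s.reg a * s.reg b))) :
    STri B S τ (.instr (.mul d a b)) s Q := .instr (fun hs => hs.setReg hb) h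

theorem STri.clear (h : Q { s with addr := [] }) : STri B S τ (.instr .clear) s Q :=
  .instr (fun hs => hs) h

theorem STri.push {r : ℕ} (h : Q { s with addr := s.addr ++ [s.reg r] }) :
    STri B S τ (.instr (.push r)) s Q := .instr (fun hs => hs) h

theorem STri.load {d : ℕ} (h : Q (s.setReg d (s.mem s.addr))) :
    STri B S τ (.instr (.load d)) s Q := .instr (fun hs => hs.setReg (hs.2 _)) h

theorem STri.store {r : ℕ}
    (h : Q { s with mem := Function.update s.mem s.addr (s.reg r) }) :
    STri B S τ (.instr (.store r)) s Q := .instr (fun hs => ⟨hs.1, fun a => by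
      by_cases ha : a = s.addr <;> simp [Instr.step, ha, hs.1, hs.2]⟩) h

theorem STri.ite {r : ℕ} {P P' : PL} (h : s.reg r ≠ 0 → STri B S τ P s Q)
    (h' : s.reg r = 0 → STri B S τ P' s Q) : STri B S τ (.ite r P P') s Q := fun hs => by
  by_cases hr : s.reg r = 0
  · obtain ⟨t, s', h1, h2, h3, h4⟩ := h' hr hs
    exact ⟨_, s', .ite_neg hr h1, by simp only [PL.cost]; omega, h3, h4⟩
  · obtain ⟨t, s', h1, h2, h3, h4⟩ := h hr hs
    exact ⟨_, s', .ite_pos hr h1, by simp only [PL.cost]; omega, h3, h4⟩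

/-- A loop whose variant `N` starts at most at `S`. -/
theorem STri.loop {r : ℕ} {P : PL} (I : ℕ → State → Prop) (N : ℕ) (hN : N ≤ S)
    (h0 : I N s)
    (hI : ∀ j s, I j s → (s.reg r = 0 ↔ j = 0))
    (hstep : ∀ j < N, ∀ s, I (j + 1) s → STri B S τ P s (I j))
    (hQ : ∀ s, I 0 s → Q s) : STri B S τ (.loop r P) s Q := by
  have key : ∀ j ≤ N, ∀ s : State, s.Bdd B → I j s → ∃ t s', Exec B (PL.loop r P).prog s t s' ∧
      t ≤ 1 + j * (1 + P.cost S τ) ∧ s'.Bdd B ∧ Q s' := by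
    intro j
    induction j with
    | zero =>
      intro _ s hs h
      exact ⟨1, s, Exec.loop_stop ((hI 0 s h).2 rfl), by omega, hs, hQ s h⟩
    | succ j ih =>
      intro hj s hs h
      obtain ⟨t, s', h1, h2, h3, h4⟩ := hstep j (by omega) s h hs
      obtain ⟨t', s'', h1', h2', h3', h4'⟩ := ih (by omega) s' h3 h4
      refine ⟨1 + t + t', s'', .loop_step (fun h0 => ?_) h1 h1', ?_, h3', h4'⟩
      · exact absurd ((hI _ s h).1 h0) (by omega)
      · rw [Nat.succ_mul]; omega
  intro hs
  obtain ⟨t, s', h1, h2, h3, h4⟩ := key N le_rfl s hs h0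
  refine ⟨t, s', h1, h2.trans ?_, h3, h4⟩
  simp only [PL.cost]
  gcongr

end SRules

theorem tri_iff {B S τ : ℕ} {P : PL} {ρ : ℕ → ℕ} {m : Mem} {Q : (ℕ → ℕ) → Mem → Prop} :
    Tri B S τ P ρ m Q ↔ ∀ s : State, s.vars = ρ → s.mem = m →
      STri B S τ P s fun s' => Q s'.vars s'.mem :=
  ⟨fun h s hρ hm hs => h s hs hρ hm, fun h s hs hρ hm => h s hρ hm hs⟩

section Statements

variable {B S τ : ℕ} {ρ : ℕ → ℕ} {m : Mem} {Q Q' : (ℕ → ℕ) → Mem → Prop}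

theorem State.setReg_reg (s : State) (d v r : ℕ) :
    (s.setReg d v).reg r = if r = d then v else s.reg r := by
  simp [State.setReg, Function.update_apply]

@[simp] theorem State.setReg_mem (s : State) (d v : ℕ) : (s.setReg d v).mem = s.mem := rfl

@[simp] theorem State.setReg_addr (s : State) (d v : ℕ) : (s.setReg d v).addr = s.addr := rfl

/-- Evaluation of an expression into a scratch register keeps the logical registers, the memory,
and the scratch registers with smaller number. -/
theorem Ex.comp_spec (e : Ex) : ∀ (t : ℕ) (s : State), e.Ok B s.vars s.mem →
    STri B S τ (e.comp t) s fun s' => s'.mem = s.mem ∧ s'.vars = s.vars ∧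
      s'.reg (2 * t + 1) = e.eval s.vars s.mem ∧
      ∀ u < t, s'.reg (2 * u + 1) = s.reg (2 * u + 1) := by
  have vars_set : ∀ (s : State) (t v : ℕ), (s.setReg (2 * t + 1) v).vars = s.vars := by
    intro s t v; funext i
    have h : 2 * i ≠ 2 * t + 1 := by omega
    simp [State.vars, State.setReg_reg, h]
  have odd_set : ∀ (s : State) (t v u : ℕ), u < t →
      (s.setReg (2 * t + 1) v).reg (2 * u + 1) = s.reg (2 * u + 1) := by
    intro s t v u h
    have h : u ≠ t := by omega
    simp [State.setReg_reg, h]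
  have self_set : ∀ (s : State) (d v : ℕ), (s.setReg d v).reg d = v := by
    intro s d v; simp [State.setReg_reg]
  induction e with
  | reg r =>
    intro t s _
    refine .copy ⟨rfl, vars_set _ _ _, ?_, fun u hu => odd_set _ _ _ _ hu⟩
    simp [State.vars, self_set]
  | lit c =>
    intro t s h
    exact .const h ⟨rfl, vars_set _ _ _, by simp [self_set], fun u hu => odd_set _ _ _ _ hu⟩
  | add a b iha ihb =>
    rintro t s ⟨ha, hb, hab⟩
    refine .seq ((iha t s ha).conseq fun s₁ ⟨m1, v1, e1, o1⟩ => ?_)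
    refine .seq ((ihb (t + 1) s₁ (by rw [m1, v1]; exact hb)).conseq fun s₂ ⟨m2, v2, e2, o2⟩ => ?_)
    rw [m1, v1] at e2
    rw [v1] at v2
    have e1' := (o2 t (by omega)).trans e1
    refine .add (by rw [e1', e2]; exact hab) ⟨by simp [m1, m2], by rw [vars_set, v2], ?_, ?_⟩
    · rw [self_set, e1', e2]; rfl
    · intro u hu
      rw [odd_set _ _ _ _ hu, o2 u (by omega), o1 u hu]
  | sub a b iha ihb =>
    rintro t s ⟨ha, hb⟩
    refine .seq ((iha t s ha).conseq fun s₁ ⟨m1, v1, e1, o1⟩ => ?_)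
    refine .seq ((ihb (t + 1) s₁ (by rw [m1, v1]; exact hb)).conseq fun s₂ ⟨m2, v2, e2, o2⟩ => ?_)
    rw [m1, v1] at e2
    rw [v1] at v2
    have e1' := (o2 t (by omega)).trans e1
    refine .sub ⟨by simp [m1, m2], by rw [vars_set, v2], ?_, ?_⟩
    · rw [self_set, e1', e2]; rfl
    · intro u hu
      rw [odd_set _ _ _ _ hu, o2 u (by omega), o1 u hu]
  | mul a b iha ihb =>
    rintro t s ⟨ha, hb, hab⟩
    refine .seq ((iha t s ha).conseq fun s₁ ⟨m1, v1, e1, o1⟩ => ?_)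
    refine .seq ((ihb (t + 1) s₁ (by rw [m1, v1]; exact hb)).conseq fun s₂ ⟨m2, v2, e2, o2⟩ => ?_)
    rw [m1, v1] at e2
    rw [v1] at v2
    have e1' := (o2 t (by omega)).trans e1
    refine .mul (by rw [e1', e2]; exact hab) ⟨by simp [m1, m2], by rw [vars_set, v2], ?_, ?_⟩
    · rw [self_set, e1', e2]; rfl
    · intro u hu
      rw [odd_set _ _ _ _ hu, o2 u (by omega), o1 u hu]
  | ld n a iha =>
    rintro t s ⟨hn, ha⟩
    refine .seq ((iha t s ha).conseq fun s₁ ⟨m1, v1, e1, o1⟩ => ?_)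
    refine .seq (.const hn (.seq (.clear (.seq (.push (.seq (.push (.load
      ⟨by simp [m1], ?_, ?_, ?_⟩))))))))
    · rw [vars_set, ← v1]; exact vars_set _ _ _
    · rw [self_set]
      have h : 2 * t + 1 ≠ 2 * (t + 1) + 1 := by omega
      simp [State.setReg_reg, e1, m1]
    · intro u hu
      rw [odd_set _ _ _ _ hu, ← o1 u hu]
      exact odd_set _ _ _ _ (by omega)
  | ld₂ n a b iha ihb =>
    rintro t s ⟨hn, ha, hb⟩
    refine .seq ((iha t s ha).conseq fun s₁ ⟨m1, v1, e1, o1⟩ => ?_)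
    refine .seq ((ihb (t + 1) s₁ (by rw [m1, v1]; exact hb)).conseq fun s₂ ⟨m2, v2, e2, o2⟩ => ?_)
    rw [m1, v1] at e2
    rw [v1] at v2
    have e1' := (o2 t (by omega)).trans e1
    refine .seq (.const hn (.seq (.clear (.seq (.push (.seq (.push (.seq (.push (.load
      ⟨by simp [m1, m2], ?_, ?_, ?_⟩))))))))))
    · rw [vars_set, ← v2]; exact vars_set _ _ _
    · rw [self_set]
      have h : t ≠ t + 2 := by omega
      simp [State.setReg_reg, e1', e2, m1, m2]
    · intro u hu
      rw [odd_set _ _ _ _ hu, ← o1 u hu, ← o2 u (by omega)]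
      exact odd_set _ _ _ _ (by omega)

/-- Assignment of the value of an expression to a logical register. -/
def asg (d : ℕ) (e : Ex) : PL := e.comp 0 ;; .instr (.copy (2 * d) 1)

/-- Assignment to an entry of a one-dimensional array. -/
def st (n : ℕ) (a v : Ex) : PL :=
  a.comp 0 ;; v.comp 1 ;; .instr (.const 5 n) ;; .instr .clear ;; .instr (.push 5) ;;
    .instr (.push 1) ;; .instr (.store 3)

/-- Assignment to an entry of a two-dimensional array. -/
def st₂ (n : ℕ) (a b v : Ex) : PL :=
  a.comp 0 ;; b.comp 1 ;; v.comp 2 ;; .instr (.const 7 n) ;; .instr .clear ;; .instr (.push 7) ;;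
    .instr (.push 1) ;; .instr (.push 3) ;; .instr (.store 5)

/-- Branching on an expression. -/
def ifE (e : Ex) (P P' : PL) : PL := e.comp 0 ;; .ite 1 P P'

/-- `for i < e do P`; the bound `e` is evaluated anew before every iteration. -/
def forE (i : ℕ) (e : Ex) (P : PL) : PL :=
  asg i (.lit 0) ;; (Ex.sub e (.reg i)).comp 0 ;;
    .loop 1 (P ;; asg i (.add (.reg i) (.lit 1)) ;; (Ex.sub e (.reg i)).comp 0)

theorem State.vars_setReg_even (s : State) (d v : ℕ) :
    (s.setReg (2 * d) v).vars = Function.update s.vars d v := by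
  funext i
  by_cases h : i = d <;> simp [State.vars, State.setReg_reg, h]

theorem State.vars_setReg_odd (s : State) (d v : ℕ) :
    (s.setReg (2 * d + 1) v).vars = s.vars := by
  funext i
  have h : 2 * i ≠ 2 * d + 1 := by omega
  simp [State.vars, State.setReg_reg, h]

theorem STri.asg {s : State} {d : ℕ} {e : Ex} (he : e.Ok B s.vars s.mem) :
    STri B S τ (asg d e) s fun s' =>
      s'.vars = Function.update s.vars d (e.eval s.vars s.mem) ∧ s'.mem = s.mem := by
  refine .seq ((e.comp_spec 0 s he).conseq fun s₁ ⟨m1, v1, e1, _⟩ => .copy ?_)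
  exact ⟨by rw [State.vars_setReg_even, v1, ← e1], m1⟩

theorem Tri.asg {d : ℕ} {e : Ex} (he : e.Ok B ρ m)
    (h : Q (Function.update ρ d (e.eval ρ m)) m) : Tri B S τ (asg d e) ρ m Q :=
  tri_iff.2 fun s hρ hm => by
    subst hρ hm
    exact (STri.asg he).conseq fun s' ⟨h1, h2⟩ => by rw [h1, h2]; exact h

theorem Tri.st {n : ℕ} {a v : Ex} (hn : n ≤ B) (ha : a.Ok B ρ m) (hv : v.Ok B ρ m)
    (h : Q ρ (Function.update m [n, a.eval ρ m] (v.eval ρ m))) : Tri B S τ (st n a v) ρ m Q :=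
  tri_iff.2 fun s hρ hm => by
    subst hρ hm
    refine .seq ((a.comp_spec 0 s ha).conseq fun s₁ ⟨m1, v1, e1, _⟩ => ?_)
    refine .seq ((v.comp_spec 1 s₁ (by rwa [m1, v1])).conseq fun s₂ ⟨m2, v2, e2, o2⟩ => ?_)
    have e1' := (o2 0 (by omega)).trans e1
    refine .seq (.const hn (.seq (.clear (.seq (.push (.seq (.push (.store ?_))))))))
    simp only [State.setReg_reg, State.setReg_mem, List.nil_append]
    have e2' : s₂.reg 3 = v.eval s.vars s.mem := by rw [← m1, ← v1]; exact e2
    have e1'' : s₂.reg 1 = a.eval s.vars s.mem := e1'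
    rw [m1] at m2
    rw [v1] at v2
    have h2 : (s₂.setReg (2 * 2 + 1) n).vars = s.vars := by
      rw [← v2]; exact State.vars_setReg_odd s₂ 2 n
    convert h using 1
    · exact h2
    · simp [e2', e1'', m2]

theorem Tri.st₂ {n : ℕ} {a b v : Ex} (hn : n ≤ B) (ha : a.Ok B ρ m) (hb : b.Ok B ρ m)
    (hv : v.Ok B ρ m)
    (h : Q ρ (Function.update m [n, a.eval ρ m, b.eval ρ m] (v.eval ρ m))) :
    Tri B S τ (st₂ n a b v) ρ m Q :=
  tri_iff.2 fun s hρ hm => by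
    subst hρ hm
    refine .seq ((a.comp_spec 0 s ha).conseq fun s₁ ⟨m1, v1, e1, _⟩ => ?_)
    refine .seq ((b.comp_spec 1 s₁ (by rwa [m1, v1])).conseq fun s₂ ⟨m2, v2, e2, o2⟩ => ?_)
    rw [m1, v1] at e2
    rw [v1] at v2
    rw [m1] at m2
    refine .seq ((v.comp_spec 2 s₂ (by rwa [m2, v2])).conseq fun s₃ ⟨m3, v3, e3, o3⟩ => ?_)
    rw [m2, v2] at e3
    rw [v2] at v3
    rw [m2] at m3
    have e1' : s₃.reg 1 = a.eval s.vars s.mem :=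
      (o3 0 (by omega)).trans ((o2 0 (by omega)).trans e1)
    have e2' : s₃.reg 3 = b.eval s.vars s.mem := (o3 1 (by omega)).trans e2
    have e3' : s₃.reg 5 = v.eval s.vars s.mem := e3
    refine .seq (.const hn (.seq (.clear (.seq (.push (.seq (.push (.seq (.push
      (.store ?_))))))))))
    simp only [State.setReg_reg, State.setReg_mem, List.nil_append]
    have h2 : (s₃.setReg (2 * 3 + 1) n).vars = s.vars := by
      rw [← v3]; exact State.vars_setReg_odd s₃ 3 n
    convert h using 1
    · exact h2
    · simp [e3', e2', e1', m3]

theorem Tri.ifE {e : Ex} {P P' : PL} (he : e.Ok B ρ m)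
    (h : e.eval ρ m ≠ 0 → Tri B S τ P ρ m Q) (h' : e.eval ρ m = 0 → Tri B S τ P' ρ m Q) :
    Tri B S τ (ifE e P P') ρ m Q :=
  tri_iff.2 fun s hρ hm => by
    subst hρ hm
    refine .seq ((e.comp_spec 0 s he).conseq fun s₁ ⟨m1, v1, e1, _⟩ => .ite ?_ ?_)
    · intro h1; exact tri_iff.1 (h (by rwa [← e1])) s₁ v1 m1
    · intro h1; exact tri_iff.1 (h' (by rwa [← e1])) s₁ v1 m1

/-- The rule for counting loops, with an invariant that may mention the number of iterations. -/
theorem Tri.forE {i : ℕ} {e : Ex} {P : PL} (I : ℕ → (ℕ → ℕ) → Mem → Prop) (N : ℕ)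
    (hN : N ≤ S) (hB : N ≤ B) (h0 : I 0 (Function.update ρ i 0) m)
    (hI : ∀ j ρ m, j ≤ N → I j ρ m → ρ i = j ∧ e.eval ρ m = N ∧ e.Ok B ρ m)
    (hstep : ∀ j < N, ∀ ρ m, I j ρ m →
      Tri B S τ P ρ m fun ρ' m' => ρ' i = j ∧ I (j + 1) (Function.update ρ' i (j + 1)) m')
    (hQ : ∀ ρ m, I N ρ m → Q ρ m) : Tri B S τ (forE i e P) ρ m Q :=
  tri_iff.2 fun s hρ hm => by
    subst hρ hm
    refine .seq ((STri.asg (by simp)).conseq fun s₁ ⟨v1, m1⟩ => ?_)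
    simp only [Ex.eval] at v1
    rw [← v1, ← m1] at h0
    obtain ⟨hi, he, hok⟩ := hI _ _ _ (Nat.zero_le _) h0
    refine .seq (((Ex.sub e (.reg i)).comp_spec 0 s₁ ⟨hok, trivial⟩).conseq
      fun s₂ ⟨m2, v2, e2, _⟩ => ?_)
    refine .loop (fun j s => j ≤ N ∧ I (N - j) s.vars s.mem ∧ s.reg 1 = j) N hN
      ⟨le_rfl, by rw [Nat.sub_self, v2, m2]; exact h0, ?_⟩ ?_ ?_ ?_
    · have := e2; simp only [Ex.eval, he, hi] at this; simpa using this
    · rintro j s ⟨_, _, h⟩; rw [h]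
    · rintro j hj s₃ ⟨_, hI3, _⟩
      have := hstep (N - (j + 1)) (by omega) _ _ hI3
      have hj' : N - (j + 1) + 1 = N - j := by omega
      rw [hj'] at this
      refine .seq ((tri_iff.1 this s₃ rfl rfl).conseq fun s₄ ⟨hi4, hI4⟩ => ?_)
      refine .seq ((STri.asg (by simp [hi4]; omega)).conseq fun s₅ ⟨v5, m5⟩ => ?_)
      have e5 : (Ex.add (.reg i) (.lit 1)).eval s₄.vars s₄.mem = N - j := by
        simp only [Ex.eval, hi4]; omega
      rw [e5] at v5
      rw [← v5, ← m5] at hI4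
      obtain ⟨h1, h2, h3⟩ := hI _ _ _ (by omega) hI4
      refine ((Ex.sub e (.reg i)).comp_spec 0 s₅ ⟨h3, trivial⟩).conseq
        fun s₆ ⟨m6, v6, e6, _⟩ => ⟨by omega, by rw [v6, m6]; exact hI4, ?_⟩
      have : s₆.reg 1 = _ := e6
      simp only [Ex.eval, h1, h2] at this
      omega
    · rintro s ⟨_, h, _⟩
      exact hQ _ _ (by simpa using h)

/-- The address that is reached from `a` after following `k` pointers: every step appends to the
address the content of the cell at this address. -/
def pathAddr (m : Mem) (a : List ℕ) : ℕ → List ℕ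
  | 0 => a
  | k + 1 => pathAddr m a k ++ [m (pathAddr m a k)]

/-- Move to the address `pathAddr m [n, x, y] k`, where `x`, `y`, `k` are the contents of the
logical registers `g`, `d`, `c`. A load does not change the address tuple, which makes it possible
to build address tuples of unbounded length from memory contents. -/
def walk (n g d c : ℕ) : PL :=
  .instr (.const 1 n) ;; .instr .clear ;; .instr (.push 1) ;; .instr (.push (2 * g)) ;;
    .instr (.push (2 * d)) ;; .instr (.copy 1 (2 * c)) ;; .instr (.const 5 1) ;;
    .loop 1 (.instr (.load 3) ;; .instr (.push 3) ;; .instr (.sub 1 1 5))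

/-- Load from the end of a pointer path. -/
def walkLd (n g d c r : ℕ) : PL := walk n g d c ;; .instr (.load (2 * r))

/-- Store at the end of a pointer path. -/
def walkSt (n g d c r : ℕ) : PL := walk n g d c ;; .instr (.store (2 * r))

theorem STri.walk {s : State} {n g d c : ℕ} (hn : n ≤ B) (h1 : 1 ≤ B) (hc : s.vars c ≤ S) :
    STri B S τ (walk n g d c) s fun s' => s'.vars = s.vars ∧ s'.mem = s.mem ∧
      s'.addr = pathAddr s.mem [n, s.vars g, s.vars d] (s.vars c) := by
  refine .seq (.const hn (.seq (.clear (.seq (.push (.seq (.push (.seq (.push (.seq (.copy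
    (.seq (.const h1 ?_)))))))))))))
  refine .loop (fun j s' => s'.vars = s.vars ∧ s'.mem = s.mem ∧ s'.reg 1 = j ∧ s'.reg 5 = 1 ∧
    j ≤ s.vars c ∧ s'.addr = pathAddr s.mem [n, s.vars g, s.vars d] (s.vars c - j)) (s.vars c) hc
    ?_ ?_ ?_ ?_
  · have hodd : ∀ a : ℕ, 2 * a ≠ 1 := by omega
    refine ⟨?_, rfl, ?_, by simp [State.setReg_reg], le_rfl, ?_⟩
    · rw [State.vars_setReg_odd _ 2, State.vars_setReg_odd _ 0]
      exact State.vars_setReg_odd s 0 n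
    · simp [State.setReg_reg, State.vars, hodd]
    · simp [State.setReg_reg, State.vars, hodd, pathAddr]
  · rintro j s' ⟨_, _, h, _⟩; rw [h]
  · rintro j hj s' ⟨v, hm, e1, e5, hle, ha⟩
    refine .seq (.load (.seq (.push (.sub ⟨?_, hm, ?_, ?_, by omega, ?_⟩))))
    · rw [State.vars_setReg_odd _ 0, ← v]
      exact State.vars_setReg_odd s' 1 _
    · simp [State.setReg_reg, e1, e5]
    · simp [State.setReg_reg, e5]
    · have : s.vars c - j = s.vars c - (j + 1) + 1 := by omega
      rw [this, pathAddr, ← ha]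
      simp [State.setReg_reg, hm]
  · rintro s' ⟨v, hm, _, _, _, ha⟩
    exact ⟨v, hm, ha⟩

theorem Tri.walkLd {n g d c r : ℕ} (hn : n ≤ B) (h1 : 1 ≤ B) (hc : ρ c ≤ S)
    (h : Q (Function.update ρ r (m (pathAddr m [n, ρ g, ρ d] (ρ c)))) m) :
    Tri B S τ (walkLd n g d c r) ρ m Q :=
  tri_iff.2 fun s hρ hm => by
    subst hρ hm
    refine .seq ((STri.walk hn h1 hc).conseq fun s' ⟨v, hm, ha⟩ => .load ?_)
    rw [State.vars_setReg_even, State.setReg_mem, v, hm, ha]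
    exact h

theorem Tri.walkSt {n g d c r : ℕ} (hn : n ≤ B) (h1 : 1 ≤ B) (hc : ρ c ≤ S)
    (h : Q ρ (Function.update m (pathAddr m [n, ρ g, ρ d] (ρ c)) (ρ r))) :
    Tri B S τ (walkSt n g d c r) ρ m Q :=
  tri_iff.2 fun s hρ hm => by
    subst hρ hm
    refine .seq ((STri.walk hn h1 hc).conseq fun s' ⟨v, hm, ha⟩ => .store ?_)
    have hr : s'.reg (2 * r) = s.vars r := congrFun v r
    rw [hm, ha, hr]
    convert h using 1
    exact v

end Statements

end DynCQ

namespace DynCQ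

variable {σ : Schema} {k : ℕ}

/-! ### Homomorphisms and homomorphic cores -/

theorem Term.subst_var (t : Term) : t.subst .var = t := by cases t <;> rfl

theorem Term.subst_subst (t : Term) (h g : ℕ → Term) :
    (t.subst h).subst g = t.subst fun x => (h x).subst g := by cases t <;> rfl

theorem Term.eval_subst (t : Term) (h : ℕ → Term) (β : ℕ → Dom) :
    (t.subst h).eval β = t.eval fun x => (h x).eval β := by cases t <;> rfl

theorem Atom.subst_subst (ψ : Atom σ) (h g : ℕ → Term) :
    (ψ.subst h).subst g = ψ.subst fun x => (h x).subst g := by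
  simp [Atom.subst, Term.subst_subst]

theorem Atom.subst_var (ψ : Atom σ) : ψ.subst .var = ψ := by
  simp [Atom.subst, Term.subst_var]

theorem Atom.mem_vars_subst {ψ : Atom σ} {h : ℕ → Term} {x z : ℕ} (hx : x ∈ ψ.vars)
    (hz : h x = .var z) : z ∈ (ψ.subst h).vars := by
  obtain ⟨i, hi⟩ := hx
  exact ⟨i, by simp [Atom.subst, hi, Term.subst, hz]⟩

theorem Atom.exists_of_mem_vars_subst {ψ : Atom σ} {h : ℕ → Term} {z : ℕ}
    (hz : z ∈ (ψ.subst h).vars) : ∃ x ∈ ψ.vars, h x = .var z := by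
  obtain ⟨i, hi⟩ := hz
  simp only [Atom.subst] at hi
  cases ht : ψ.args i with
  | var x => exact ⟨x, ⟨i, ht⟩, by simpa [ht, Term.subst] using hi⟩
  | const a => simp [ht, Term.subst] at hi

theorem Atom.subst_congr {ψ : Atom σ} {h h' : ℕ → Term} (e : ∀ x ∈ ψ.vars, h x = h' x) :
    ψ.subst h = ψ.subst h' := by
  simp only [Atom.subst, Atom.mk.injEq, heq_eq_eq, true_and]
  funext i
  cases ht : ψ.args i with
  | var x => exact e x ⟨i, ht⟩
  | const a => rfl

theorem Atom.finite_vars (ψ : Atom σ) : ψ.vars.Finite := by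
  have : ψ.vars ⊆ (fun x : ℕ => Term.var x) ⁻¹' (Set.range ψ.args) := by
    rintro x ⟨i, hi⟩; exact ⟨i, hi⟩
  exact ((Set.finite_range _).preimage (fun _ _ _ _ h => Term.var.inj h)).subset this

namespace CQ

/-- The variables that occur in the atoms. -/
def occ (q : CQ σ k) : Set ℕ := {x | ∃ ψ ∈ q.atoms, x ∈ ψ.vars}

theorem finite_occ (q : CQ σ k) : q.occ.Finite := by
  have : q.occ = ⋃ ψ ∈ {ψ | ψ ∈ q.atoms}, ψ.vars := by ext; simp [occ]
  rw [this]
  exact (List.finite_toSet q.atoms).biUnion fun ψ _ => ψ.finite_vars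

theorem mem_occ_of_head {q : CQ σ k} {i : Fin k} {x : ℕ} (h : q.head i = .var x) : x ∈ q.occ :=
  ((q.head_free x).1 ⟨i, h⟩).1

theorem mem_free {q : CQ σ k} {x : ℕ} : x ∈ q.free ↔ ∃ i, q.head i = .var x := by
  rw [q.head_free]
  simp only [free, vars, Set.mem_ofPred_eq]
  tauto

theorem mem_vars_diff_free {q : CQ σ k} {x : ℕ} : x ∈ q.vars \ q.free ↔ x ∈ q.quant := by
  simp only [free, vars, Set.mem_sdiff, Set.mem_ofPred_eq]
  by_cases h : x ∈ q.quant <;> simp [h]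

/-- Homomorphisms without the condition on variables that occur in no atom. -/
def PreHom (q q' : CQ σ k) (h : ℕ → Term) : Prop :=
  (∀ i, (q.head i).subst h = q'.head i) ∧ ∀ ψ ∈ q.atoms, ψ.subst h ∈ q'.atoms

variable {q q' q'' : CQ σ k} {h g : ℕ → Term}

theorem IsHom.preHom (H : q.IsHom q' h) : q.PreHom q' h := H.2

theorem PreHom.congr (H : q.PreHom q' h) (e : ∀ x ∈ q.occ, h x = g x) : q.PreHom q' g := by
  refine ⟨fun i => ?_, fun ψ hψ => ?_⟩
  · rw [← H.1 i]
    cases hi : q.head i with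
    | var x => exact (e x (mem_occ_of_head hi)).symm
    | const a => rfl
  · rw [← Atom.subst_congr fun x hx => e x ⟨ψ, hψ, hx⟩]
    exact H.2 ψ hψ

theorem PreHom.comp (H : q.PreHom q' h) (H' : q'.PreHom q'' g) :
    q.PreHom q'' fun x => (h x).subst g :=
  ⟨fun i => by rw [← Term.subst_subst, H.1, H'.1],
    fun ψ hψ => by rw [← Atom.subst_subst]; exact H'.2 _ (H.2 ψ hψ)⟩

theorem PreHom.refl (q : CQ σ k) : q.PreHom q .var :=
  ⟨fun i => Term.subst_var _, fun ψ hψ => by rwa [Atom.subst_var]⟩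

theorem PreHom.mem_occ (H : q.PreHom q' h) {x z : ℕ} (hx : x ∈ q.occ) (hz : h x = .var z) :
    z ∈ q'.occ := by
  obtain ⟨ψ, hψ, hx⟩ := hx
  exact ⟨_, H.2 ψ hψ, Atom.mem_vars_subst hx hz⟩

open Classical in
theorem PreHom.exists_isHom (H : q.PreHom q' h) : ∃ h', q.IsHom q' h' := by
  let h' : ℕ → Term := fun x => if x ∈ q.occ then h x else .const 1
  have H' : q.PreHom q' h' := H.congr fun x hx => by simp [h', hx]
  refine ⟨h', fun x _ z hz => ?_, H'⟩
  by_cases hx : x ∈ q.occ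
  · exact .inr (H'.mem_occ hx hz)
  · simp [h', hx] at hz

theorem PreHom.result_subset (H : q.PreHom q' h) (D : Database σ) :
    q'.result D ⊆ q.result D := by
  rintro a ⟨β, hβ, ha⟩
  refine ⟨fun x => (h x).eval β, fun ψ hψ => ?_, fun i => ?_⟩
  · have : (fun i => ((ψ.args i).subst h).eval β) ∈ D ψ.rel := hβ _ (H.2 ψ hψ)
    simpa only [Term.eval_subst] using this
  · rw [ha, ← H.1, Term.eval_subst]

open Classical in
/-- An endomorphism of a core maps onto all atoms: its image is a subquery, which cannot be
proper. -/
theorem IsCore.exists_subst_eq (hq : q.IsCore) (H : q.PreHom q h) {ψ : Atom σ}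
    (hψ : ψ ∈ q.atoms) : ∃ ψ' ∈ q.atoms, ψ'.subst h = ψ := by
  let as := q.atoms.filter fun φ => ∃ ψ' ∈ q.atoms, ψ'.subst h = φ
  have has : ∀ ψ' ∈ q.atoms, ψ'.subst h ∈ as := fun ψ' hψ' => by
    simp only [as, List.mem_filter, decide_eq_true_eq]
    exact ⟨H.2 _ hψ', ψ', hψ', rfl⟩
  have as_sub : ∀ φ ∈ as, φ ∈ q.atoms := fun φ hφ => List.mem_of_mem_filter hφ
  let q₁ : CQ σ k :=
    { head := q.head
      quant := q.quant.filter fun x => ∃ φ ∈ as, x ∈ φ.vars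
      atoms := as
      quant_nodup := q.quant_nodup.filter _
      atoms_ne_nil := List.ne_nil_of_mem (has ψ hψ)
      head_free := fun x => by
        constructor
        · rintro ⟨i, hi⟩
          obtain ⟨⟨ψ', hψ', hx⟩, hxq⟩ := (q.head_free x).1 ⟨i, hi⟩
          refine ⟨⟨_, has ψ' hψ', Atom.mem_vars_subst hx ?_⟩,
            fun h' => hxq (List.mem_of_mem_filter h')⟩
          have := H.1 i
          rwa [hi] at this
        · rintro ⟨⟨φ, hφ, hx⟩, hxq⟩
          refine (q.head_free x).2 ⟨⟨φ, as_sub φ hφ, hx⟩, fun h' => hxq ?_⟩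
          simp only [List.mem_filter, decide_eq_true_eq]
          exact ⟨h', φ, hφ, hx⟩ }
  have H₁ : q.PreHom q₁ h := ⟨H.1, has⟩
  have hsub : q₁.IsSubquery q := ⟨rfl, List.filter_sublist, List.filter_sublist⟩
  have heq : q₁ = q := by
    by_contra hne
    exact hq q₁ hsub hne H₁.exists_isHom
  have : ψ ∈ q₁.atoms := heq ▸ hψ
  simpa [q₁, as] using (List.mem_filter.1 this).2

/-- Every endomorphism of a core can be undone by an endomorphism, one of its powers. -/
theorem IsCore.exists_inverse (hq : q.IsCore) (H : q.PreHom q h) :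
    ∃ h', q.PreHom q h' ∧ ∀ x ∈ q.occ, (h' x).subst h = .var x := by
  have surj : ∀ z : q.occ, ∃ x : q.occ, h x = .var z := by
    rintro ⟨z, ψ, hψ, hz⟩
    obtain ⟨ψ', hψ', rfl⟩ := hq.exists_subst_eq H hψ
    obtain ⟨x, hx, e⟩ := Atom.exists_of_mem_vars_subst hz
    exact ⟨⟨x, ψ', hψ', hx⟩, e⟩
  choose f hf using surj
  have := q.finite_occ.to_subtype
  have f_inj : Function.Injective f := fun a b e => by
    have := hf a
    rw [e, hf b] at this
    exact Subtype.ext (Term.var.inj this).symm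
  let e : Equiv.Perm q.occ := .ofBijective f ⟨f_inj, Finite.injective_iff_surjective.1 f_inj⟩
  have he : ∀ x : q.occ, h x = .var ((e⁻¹ : Equiv.Perm q.occ) x : q.occ) := fun x => by
    have h1 : e ((e⁻¹ : Equiv.Perm q.occ) x) = x := e.apply_symm_apply x
    conv_lhs => rw [← h1]
    exact hf _
  let it : ℕ → ℕ → Term := fun n => n.rec .var fun _ g x => (g x).subst h
  have it_hom : ∀ n, q.PreHom q (it n) := fun n => by
    induction n with
    | zero => exact .refl q
    | succ n ih => exact ih.comp H
  have it_eq : ∀ n (x : q.occ), it n x = .var (((e⁻¹) ^ n : Equiv.Perm q.occ) x : q.occ) := by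
    intro n x
    induction n with
    | zero => rfl
    | succ n ih =>
      change (it n x).subst h = _
      rw [ih, pow_succ']
      exact he _
  obtain ⟨n, hn⟩ : ∃ n, orderOf e⁻¹ = n + 1 :=
    Nat.exists_eq_succ_of_ne_zero (orderOf_pos (e⁻¹)).ne'
  refine ⟨it n, it_hom n, fun x hx => ?_⟩
  have := it_eq (n + 1) ⟨x, hx⟩
  rw [show e⁻¹ ^ (n + 1) = 1 by rw [← hn, pow_orderOf_eq_one]] at this
  exact this

/-- A core that is a retract of a `t`-hierarchical query is `t`-hierarchical. -/
theorem IsCore.tHierarchical (hq : q.IsCore) (H : q.PreHom q' h) (H' : q'.PreHom q g)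
    (ht : q'.THierarchical) : q.THierarchical := by
  obtain ⟨u, hu, hid⟩ := hq.exists_inverse (H.comp H')
  -- replace `h` by a homomorphism that is a section of `g`
  obtain ⟨f, hf, hid⟩ : ∃ f, q.PreHom q' f ∧ ∀ x ∈ q.occ, (f x).subst g = .var x :=
    ⟨_, hu.comp H, fun x hx => by rw [Term.subst_subst]; exact hid x hx⟩
  have fvar : ∀ x ∈ q.occ, ∃ z, f x = .var z ∧ g z = .var x := fun x hx => by
    have := hid x hx
    cases e : f x with
    | var z => rw [e] at this; exact ⟨z, rfl, this⟩
    | const a => rw [e] at this; cases this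
  have quant_of : ∀ x ∈ q.occ, x ∈ q.quant → ∀ z, f x = .var z → z ∈ q'.quant := by
    intro x hx hxq z hz
    by_contra hzq
    obtain ⟨i, hi⟩ := (q'.head_free z).2 ⟨hf.mem_occ hx hz, hzq⟩
    obtain ⟨z', h1, h2⟩ := fvar x hx
    obtain rfl : z = z' := Term.var.inj (hz.symm.trans h1)
    have := H'.1 i
    rw [hi] at this
    exact ((q.head_free x).1 ⟨i, this.symm.trans h2⟩).2 hxq
  have free_of : ∀ x ∈ q.free, ∀ z, f x = .var z → z ∈ q'.free := by
    intro x hx z hz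
    obtain ⟨i, hi⟩ := mem_free.1 hx
    refine mem_free.2 ⟨i, ?_⟩
    rw [← hf.1 i, hi]; exact hz
  have atoms_iff : ∀ x ∈ q.occ, ∀ z, f x = .var z → ∀ ψ ∈ q.atoms,
      (ψ ∈ q.atomsOf x ↔ ψ.subst f ∈ q'.atomsOf z) := by
    intro x hx z hz ψ hψ
    constructor
    · exact fun ⟨_, hx⟩ => ⟨hf.2 _ hψ, Atom.mem_vars_subst hx hz⟩
    · rintro ⟨_, hz'⟩
      obtain ⟨y, hy, e⟩ := Atom.exists_of_mem_vars_subst hz'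
      obtain ⟨z', h1, h2⟩ := fvar y ⟨ψ, hψ, hy⟩
      obtain ⟨z'', h1', h2'⟩ := fvar x hx
      obtain rfl : z = z' := Term.var.inj (e.symm.trans h1)
      obtain rfl : z = z'' := Term.var.inj (hz.symm.trans h1')
      obtain rfl : y = x := Term.var.inj (h2.symm.trans h2')
      exact ⟨hψ, hy⟩
  have empty_of : ∀ x ∉ q.occ, q.atomsOf x = ∅ := fun x hx => by
    ext ψ
    simp only [atomsOf, Set.mem_ofPred_eq, Set.mem_empty_iff_false, iff_false]
    exact fun ⟨h1, h2⟩ => hx ⟨ψ, h1, h2⟩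
  refine ⟨fun x hx y hy => ?_, fun x hx y hy => ?_⟩
  · rw [mem_vars_diff_free] at hx hy
    by_cases hxo : x ∈ q.occ
    · by_cases hyo : y ∈ q.occ
      · obtain ⟨X, hX, _⟩ := fvar x hxo
        obtain ⟨Y, hY, _⟩ := fvar y hyo
        rcases ht.1 X (mem_vars_diff_free.2 (quant_of x hxo hx X hX)) Y
          (mem_vars_diff_free.2 (quant_of y hyo hy Y hY)) with h1 | h1 | h1
        · exact .inl fun ψ hψ => (atoms_iff y hyo Y hY ψ hψ.1).2
            (h1 ((atoms_iff x hxo X hX ψ hψ.1).1 hψ))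
        · exact .inr (.inl fun ψ hψ => (atoms_iff x hxo X hX ψ hψ.1).2
            (h1 ((atoms_iff y hyo Y hY ψ hψ.1).1 hψ)))
        · refine .inr (.inr (Set.eq_empty_iff_forall_notMem.2 fun ψ ⟨h2, h3⟩ => ?_))
          exact Set.eq_empty_iff_forall_notMem.1 h1 _ ⟨(atoms_iff x hxo X hX ψ h2.1).1 h2,
            (atoms_iff y hyo Y hY ψ h2.1).1 h3⟩
      · exact .inr (.inl (by simp [empty_of y hyo]))
    · exact .inl (by simp [empty_of x hxo])
  · rw [mem_vars_diff_free] at hy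
    by_cases hyo : y ∈ q.occ
    · have hxo : x ∈ q.occ := by obtain ⟨i, hi⟩ := mem_free.1 hx; exact mem_occ_of_head hi
      obtain ⟨X, hX, _⟩ := fvar x hxo
      obtain ⟨Y, hY, _⟩ := fvar y hyo
      rcases ht.2 X (free_of x hx X hX) Y
        (mem_vars_diff_free.2 (quant_of y hyo hy Y hY)) with h1 | h1
      · refine .inl (Set.eq_empty_iff_forall_notMem.2 fun ψ ⟨h2, h3⟩ => ?_)
        exact Set.eq_empty_iff_forall_notMem.1 h1 _ ⟨(atoms_iff x hxo X hX ψ h2.1).1 h2,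
          (atoms_iff y hyo Y hY ψ h2.1).1 h3⟩
      · exact .inr fun ψ hψ => (atoms_iff x hxo X hX ψ hψ.1).2
          (h1 ((atoms_iff y hyo Y hY ψ hψ.1).1 hψ))
    · exact .inr (by simp [empty_of y hyo])

theorem IsSubquery.length_lt (h : q'.IsSubquery q) (hne : q' ≠ q) :
    q'.quant.length + q'.atoms.length < q.quant.length + q.atoms.length := by
  obtain ⟨h1, h2, h3⟩ := h
  by_contra hlt
  have h2' := h2.length_le
  have h3' := h3.length_le
  have e2 := h2.eq_of_length (by omega)
  have e3 := h3.eq_of_length (by omega)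
  apply hne
  cases q; cases q'; simp_all

/-- A shortest equivalent subquery is a core. -/
theorem exists_isCoreOf (q : CQ σ k) : ∃ q' : CQ σ k, q'.IsCoreOf q := by
  induction hn : q.quant.length + q.atoms.length using Nat.strong_induction_on generalizing q with
  | _ n ih =>
    by_cases hq : q.IsCore
    · exact ⟨q, hq, fun _ => rfl⟩
    · simp only [IsCore, not_forall, not_not] at hq
      obtain ⟨q₁, hsub, hne, h, hh⟩ := hq
      obtain ⟨q', hc, he⟩ := ih _ (hn ▸ hsub.length_lt hne) q₁ rfl
      refine ⟨q', hc, fun D => (he D).trans (Set.Subset.antisymm (hh.preHom.result_subset D) ?_)⟩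
      rintro a ⟨β, hβ, ha⟩
      exact ⟨β, fun ψ hψ => hβ ψ (hsub.2.2.subset hψ), by rwa [hsub.1]⟩

theorem Equivalent.symm (h : q.Equivalent q') : q'.Equivalent q := fun D => (h D).symm

theorem Equivalent.trans (h : q.Equivalent q') (h' : q'.Equivalent q'') : q.Equivalent q'' :=
  fun D => (h D).trans (h' D)

theorem finite_cons (q : CQ σ k) : q.cons.Finite := by
  have hc : ∀ {n : ℕ} (f : Fin n → Term), {a | ∃ i, f i = .const a}.Finite := fun f =>
    ((Set.finite_range f).preimage (f := Term.const)
      (fun _ _ _ _ h => Term.const.inj h)).subset fun a ⟨i, hi⟩ => ⟨i, hi⟩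
  have : q.cons ⊆ (⋃ ψ ∈ {ψ | ψ ∈ q.atoms}, {a | ∃ i, ψ.args i = .const a}) ∪
      {a | ∃ i, q.head i = .const a} := by
    rintro a (⟨ψ, hψ, hi⟩ | hi)
    · exact .inl (Set.mem_biUnion (show ψ ∈ {ψ | ψ ∈ q.atoms} from hψ) hi)
    · exact .inr hi
  exact (((List.finite_toSet q.atoms).biUnion fun ψ _ => hc ψ.args).union (hc q.head)).subset this

theorem exists_cons_bound (q : CQ σ k) : ∃ b : ℕ, ∀ a ∈ q.cons, (a : ℕ) ≤ b := by
  obtain ⟨b, hb⟩ := (q.finite_cons.image fun a : Dom => (a : ℕ)).bddAbove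
  exact ⟨b, fun a ha => hb ⟨a, ha, rfl⟩⟩

/-- A homomorphism from `q` to a database `D`, followed by a map `g` from `D` to `q'` that fixes
the constants of `q`, is a homomorphism from `q` to `q'`. -/
theorem IsHomDB.preHom {D : Database σ} {β : ℕ → Dom} (hβ : q.IsHomDB D β) {g : Dom → Term}
    (hg : ∀ R, ∀ t ∈ D R, (⟨R, fun i => g (t i)⟩ : Atom σ) ∈ q'.atoms)
    (hc : ∀ a ∈ q.cons, g a = .const a)
    (hh : ∀ i, g ((q.head i).eval β) = q'.head i) : q.PreHom q' fun x => g (β x) := by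
  refine ⟨fun i => ?_, fun ψ hψ => ?_⟩
  · rw [← hh i]
    cases hi : q.head i with
    | var x => rfl
    | const a => exact (hc a (.inr ⟨i, hi⟩)).symm
  · have := hg _ _ (hβ ψ hψ)
    convert this using 1
    simp only [Atom.subst, Atom.mk.injEq, heq_eq_eq, true_and]
    funext i
    cases hi : ψ.args i with
    | var x => rfl
    | const a => exact (hc a (.inl ⟨ψ, hψ, i, hi⟩)).symm

end CQ

/-- The fact that an atom becomes under a valuation of its variables. -/
def Atom.fact (ψ : Atom σ) (β : ℕ → Dom) : Fact σ := ⟨ψ.rel, fun i => (ψ.args i).eval β⟩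

/-- The database with a given finite set of facts. -/
noncomputable def Database.ofSet (F : Set (Fact σ)) (hF : F.Finite) : Database σ := fun R =>
  (hF.preimage (f := fun t : Fin (σ.ar R) → Dom => (⟨R, t⟩ : Fact σ))
    (fun _ _ _ _ h => by simpa using h)).toFinset

theorem Database.mem_ofSet {F : Set (Fact σ)} {hF : F.Finite} {R : Fin σ.numRel}
    {t : Fin (σ.ar R) → Dom} : t ∈ Database.ofSet F hF R ↔ (⟨R, t⟩ : Fact σ) ∈ F := by
  simp [Database.ofSet]

namespace CQ

variable {q q' q'' : CQ σ k}

/-- Evaluating `q` on the canonical database of an equivalent query yields a homomorphism. -/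
theorem Equivalent.exists_preHom (h : q.Equivalent q') : ∃ f, q.PreHom q' f := by
  obtain ⟨b, hb⟩ := q.exists_cons_bound
  obtain ⟨b', hb'⟩ := q'.exists_cons_bound
  let β : ℕ → Dom := fun x => ⟨max b b' + x + 1, by omega⟩
  let g : Dom → Term := fun a =>
    if (a : ℕ) ≤ max b b' then .const a else .var ((a : ℕ) - (max b b' + 1))
  have gβ : ∀ x, g (β x) = .var x := fun x => by
    have h1 : ¬ (max b b' + x + 1 ≤ max b b') := by omega
    simp only [g, β, PNat.mk_coe, h1, if_false, Term.var.injEq]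
    omega
  have gc : ∀ a ∈ q.cons, g a = .const a := fun a ha =>
    if_pos ((hb a ha).trans (le_max_left _ _))
  have gc' : ∀ a ∈ q'.cons, g a = .const a := fun a ha =>
    if_pos ((hb' a ha).trans (le_max_right _ _))
  let F : Set (Fact σ) := {f | ∃ ψ ∈ q'.atoms, ψ.fact β = f}
  have hF : F.Finite :=
    (List.finite_toSet q'.atoms).image fun ψ : Atom σ => ψ.fact β
  let D := Database.ofSet F hF
  have hg : ∀ R, ∀ t ∈ D R, (⟨R, fun i => g (t i)⟩ : Atom σ) ∈ q'.atoms := by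
    intro R t ht
    obtain ⟨ψ, hψ, e⟩ := Database.mem_ofSet.1 ht
    cases e
    convert hψ using 1
    obtain ⟨R, args⟩ := ψ
    simp only [Atom.mk.injEq, heq_eq_eq, true_and]
    funext i
    cases hi : args i with
    | var x => exact gβ x
    | const a => exact gc' a (.inl ⟨_, hψ, i, hi⟩)
  have hmem : (fun i => (q'.head i).eval β) ∈ q'.result D :=
    ⟨β, fun ψ hψ => Database.mem_ofSet.2 ⟨ψ, hψ, rfl⟩, fun _ => rfl⟩
  rw [← h D] at hmem
  obtain ⟨γ, hγ, hhead⟩ := hmem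
  refine ⟨_, hγ.preHom hg gc fun i => ?_⟩
  rw [← hhead i]
  change g ((q'.head i).eval β) = q'.head i
  cases hi : q'.head i with
  | var x => exact gβ x
  | const a => exact gc' a (.inr ⟨i, hi⟩)

/-- The homomorphic core is `t`-hierarchical if and only if some equivalent query is. -/
theorem coreNotTHierarchical_iff :
    q.CoreNotTHierarchical ↔ ∀ q' : CQ σ k, q.Equivalent q' → ¬ q'.THierarchical := by
  constructor
  · rintro ⟨c, ⟨hc, hce⟩, hct⟩ q' he ht
    obtain ⟨f, hf⟩ := (hce.trans he).exists_preHom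
    obtain ⟨g, hg⟩ := (hce.trans he).symm.exists_preHom
    exact hct (hc.tHierarchical hf hg ht)
  · intro h
    obtain ⟨c, hc⟩ := q.exists_isCoreOf
    exact ⟨c, hc, h c hc.2.symm⟩

end CQ

end DynCQ

namespace DynCQ

variable {σ : Schema} {k : ℕ}

/-! ### Facts of databases after an update -/

theorem mem_update_insert (D : (R : Fin σ.numRel) → Finset (Fin (σ.ar R) → Dom))
    (R : Fin σ.numRel) (t : Fin (σ.ar R) → Dom) (f : Fact σ) :
    f.2 ∈ Function.update D R (insert t (D R)) f.1 ↔ f = ⟨R, t⟩ ∨ f.2 ∈ D f.1 := by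
  obtain ⟨R', t'⟩ := f
  by_cases h : R' = R
  · subst h
    simp
  · simp [h]

theorem mem_update_erase (D : (R : Fin σ.numRel) → Finset (Fin (σ.ar R) → Dom))
    (R : Fin σ.numRel) (t : Fin (σ.ar R) → Dom) (f : Fact σ) :
    f.2 ∈ Function.update D R ((D R).erase t) f.1 ↔ f ≠ ⟨R, t⟩ ∧ f.2 ∈ D f.1 := by
  obtain ⟨R', t'⟩ := f
  by_cases h : R' = R
  · subst h
    simp
  · simp [h]

theorem mem_apply_insert {D : Database σ} {R : Fin σ.numRel} {t : Fin (σ.ar R) → Dom}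
    {f : Fact σ} : f.2 ∈ D.apply ⟨true, R, t⟩ f.1 ↔ f = ⟨R, t⟩ ∨ f.2 ∈ D f.1 :=
  mem_update_insert D R t f

theorem mem_apply_erase {D : Database σ} {R : Fin σ.numRel} {t : Fin (σ.ar R) → Dom}
    {f : Fact σ} : f.2 ∈ D.apply ⟨false, R, t⟩ f.1 ↔ f ≠ ⟨R, t⟩ ∧ f.2 ∈ D f.1 :=
  mem_update_erase D R t f

/-! ### Encoding vector-matrix-vector products into databases -/

/-- A witness that `c` is not `t`-hierarchical: an atom `ψxy` with the variables `x` and `y`, an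
atom `ψy` with `y` but not `x`, where `y` is quantified, and either a third atom with `x` but not
`y` (stored in `ψx`), or an occurrence of `x` in the head (and then `ψx = none`). The numbers `b`
and `w` bound the constants and the variables of `c`. -/
structure Gadget (c : CQ σ k) where
  x : ℕ
  y : ℕ
  b : ℕ
  w : ℕ
  ψxy : Atom σ
  ψy : Atom σ
  ψx : Option (Atom σ)
  ψxy_mem : ψxy ∈ c.atoms
  ψy_mem : ψy ∈ c.atoms
  x_mem_xy : x ∈ ψxy.vars
  y_mem_xy : y ∈ ψxy.vars
  y_mem_y : y ∈ ψy.vars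
  x_notMem_y : x ∉ ψy.vars
  y_head : ∀ i, c.head i ≠ .var y
  x_cases : (∃ ψ ∈ ψx, ψ ∈ c.atoms ∧ x ∈ ψ.vars ∧ y ∉ ψ.vars) ∨ (ψx = none ∧ ∃ i, c.head i = .var x)
  cons_le : ∀ a ∈ c.cons, (a : ℕ) ≤ b
  occ_lt : ∀ z ∈ c.occ, z < w

/-- If the first condition fails for `x` and `y`, then some atoms contain both, only `x`, and only
`y`. If the second one fails for `x` and `y`, then some atoms contain both and only `y`, and the
free variable `x` occurs in the head. -/
theorem CQ.exists_gadget {c : CQ σ k} (h : ¬ c.THierarchical) : Nonempty (Gadget c) := by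
  obtain ⟨b, hb⟩ := c.exists_cons_bound
  obtain ⟨w, hw⟩ := c.finite_occ.bddAbove
  have hw' : ∀ z ∈ c.occ, z < w + 1 := fun z hz => Nat.lt_succ_of_le (hw hz)
  have y_head : ∀ {y}, y ∈ c.vars \ c.free → ∀ i, c.head i ≠ .var y := fun hy i hi =>
    hy.2 (CQ.mem_free.2 ⟨i, hi⟩)
  simp only [CQ.THierarchical, not_and_or, not_forall, not_or] at h
  rcases h with ⟨x, hx, y, hy, hxy, hyx, hne⟩ | ⟨x, hx, y, hy, hne, hyx⟩
  · obtain ⟨ψ₁, ⟨h1, h1x⟩, h1y⟩ := Set.not_subset.1 hxy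
    obtain ⟨ψ₂, ⟨h2, h2y⟩, h2x⟩ := Set.not_subset.1 hyx
    obtain ⟨ψ, ⟨h3, h3x⟩, _, h3y⟩ := Set.nonempty_iff_ne_empty.2 hne
    exact ⟨⟨x, y, b, w + 1, ψ, ψ₂, some ψ₁, h3, h2, h3x, h3y, h2y, fun h => h2x ⟨h2, h⟩,
      y_head hy, .inl ⟨ψ₁, rfl, h1, h1x, fun h => h1y ⟨h1, h⟩⟩, hb, hw'⟩⟩
  · obtain ⟨ψ₂, ⟨h2, h2y⟩, h2x⟩ := Set.not_subset.1 hyx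
    obtain ⟨ψ, ⟨h3, h3x⟩, _, h3y⟩ := Set.nonempty_iff_ne_empty.2 hne
    exact ⟨⟨x, y, b, w + 1, ψ, ψ₂, none, h3, h2, h3x, h3y, h2y, fun h => h2x ⟨h2, h⟩,
      y_head hy, .inr ⟨rfl, CQ.mem_free.1 hx⟩, hb, hw'⟩⟩

namespace Gadget

variable {c : CQ σ k} (G : Gadget c)

theorem x_ne_y : G.x ≠ G.y := fun h => G.x_notMem_y (h ▸ G.y_mem_y)

/-- The number that encodes the variable `z` in the context of row `i` and column `j`: the
variables `x` and `y` are encoded together with the row and the column, respectively. -/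
def code (i j z : ℕ) : ℕ :=
  if z = G.x then G.b + 1 + G.w + 2 * i else if z = G.y then G.b + 1 + G.w + (2 * j + 1)
    else G.b + 1 + z

/-- The valuation of the variables for row `i` and column `j`. -/
def val (i j : ℕ) : ℕ → Dom := fun z => ⟨G.code i j z, by unfold code; split_ifs <;> omega⟩

/-- The variable or constant that is encoded by an element. -/
def back (a : Dom) : Term :=
  if (a : ℕ) ≤ G.b then .const a else if (a : ℕ) < G.b + 1 + G.w then .var ((a : ℕ) - (G.b + 1))
    else if ((a : ℕ) - (G.b + 1 + G.w)) % 2 = 0 then .var G.x else .var G.y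

theorem back_val (i j : ℕ) {z : ℕ} (hz : z ∈ c.occ) : G.back (G.val i j z) = .var z := by
  have := G.occ_lt z hz
  simp only [back, val, code, PNat.mk_coe]
  split_ifs <;> first | omega | simp_all

theorem back_cons {a : Dom} (ha : a ∈ c.cons) : G.back a = .const a := if_pos (G.cons_le a ha)

theorem back_eval (i j : ℕ) {ψ : Atom σ} (hψ : ψ ∈ c.atoms) (l : Fin (σ.ar ψ.rel)) :
    G.back ((ψ.args l).eval (G.val i j)) = ψ.args l := by
  cases h : ψ.args l with
  | var z => exact G.back_val i j ⟨ψ, hψ, l, h⟩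
  | const a => exact G.back_cons (.inl ⟨ψ, hψ, l, h⟩)

/-- The facts of `D` are the atoms `ψ` of `c` in the context of row `i` and column `j`, for all
`ψ`, `i`, `j` with `A ψ i j`. -/
def Rep (D : Database σ) (A : Atom σ → ℕ → ℕ → Prop) : Prop :=
  ∀ f : Fact σ, f.2 ∈ D f.1 ↔ ∃ ψ ∈ c.atoms, ∃ i j, A ψ i j ∧ ψ.fact (G.val i j) = f

variable {G} {D : Database σ} {A A' : Atom σ → ℕ → ℕ → Prop}

theorem Rep.congr (h : G.Rep D A) (hA : ∀ ψ ∈ c.atoms, ∀ i j, A ψ i j ↔ A' ψ i j) :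
    G.Rep D A' := fun f => by
  rw [h f]
  refine exists_congr fun ψ => and_congr_right fun hψ => ?_
  simp only [hA ψ hψ]

/-- The command that inserts or deletes the fact for an atom, a row and a column. -/
def upd (G : Gadget c) (b : Bool) (ψ : Atom σ) (i j : ℕ) : Update σ :=
  ⟨b, ψ.rel, fun l => (ψ.args l).eval (G.val i j)⟩

theorem Rep.insert (h : G.Rep D A) {ψ₀ : Atom σ} (hψ : ψ₀ ∈ c.atoms) (i₀ j₀ : ℕ) :
    G.Rep (D.apply (G.upd true ψ₀ i₀ j₀))
      fun ψ i j => A ψ i j ∨ (ψ = ψ₀ ∧ i = i₀ ∧ j = j₀) := fun f => by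
  refine mem_apply_insert.trans ?_
  rw [h f]
  constructor
  · rintro (rfl | ⟨ψ, h1, i, j, h2, h3⟩)
    · exact ⟨ψ₀, hψ, i₀, j₀, .inr ⟨rfl, rfl, rfl⟩, rfl⟩
    · exact ⟨ψ, h1, i, j, .inl h2, h3⟩
  · rintro ⟨ψ, h1, i, j, h2 | ⟨rfl, rfl, rfl⟩, h3⟩
    · exact .inr ⟨ψ, h1, i, j, h2, h3⟩
    · exact .inl h3.symm

theorem Rep.erase (h : G.Rep D A) (ψ₀ : Atom σ) (i₀ j₀ : ℕ) :
    G.Rep (D.apply (G.upd false ψ₀ i₀ j₀))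
      fun ψ i j => A ψ i j ∧ ψ.fact (G.val i j) ≠ ψ₀.fact (G.val i₀ j₀) := fun f => by
  refine mem_apply_erase.trans ?_
  rw [h f]
  constructor
  · rintro ⟨h0, ψ, h1, i, j, h2, rfl⟩
    exact ⟨ψ, h1, i, j, ⟨h2, h0⟩, rfl⟩
  · rintro ⟨ψ, h1, i, j, ⟨h2, h0⟩, rfl⟩
    exact ⟨h0, ψ, h1, i, j, h2, rfl⟩

theorem eq_of_back_eq {ψ ψ' : Atom σ} {β : ℕ → Dom} {i j : ℕ} (hψ : ψ ∈ c.atoms)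
    (hψ' : ψ' ∈ c.atoms) (hβ : ∀ z ∈ c.occ, G.back (β z) = .var z)
    (h : ψ.fact (G.val i j) = ψ'.fact β) : ψ = ψ' := by
  have hb := fun l => G.back_eval i j hψ l
  obtain ⟨R, args⟩ := ψ
  obtain ⟨R', args'⟩ := ψ'
  simp only [Atom.fact, Sigma.mk.injEq] at h
  obtain ⟨rfl, h⟩ := h
  have h := eq_of_heq h
  simp only [Atom.mk.injEq, heq_eq_eq, true_and]
  funext l
  refine (hb l).symm.trans ?_
  change G.back ((args l).eval (G.val i j)) = _
  rw [congrFun h l]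
  cases hl : args' l with
  | var z => exact hβ z ⟨_, hψ', l, hl⟩
  | const a => exact G.back_cons (.inl ⟨_, hψ', l, hl⟩)

theorem eq_of_fact_eq {ψ ψ' : Atom σ} {i j i' j' : ℕ} (hψ : ψ ∈ c.atoms) (hψ' : ψ' ∈ c.atoms)
    (h : ψ.fact (G.val i j) = ψ'.fact (G.val i' j')) : ψ = ψ' :=
  eq_of_back_eq hψ hψ' (fun _ hz => G.back_val i' j' hz) h

theorem eval_eq_of_fact_eq {ψ : Atom σ} {β γ : ℕ → Dom} (h : ψ.fact β = ψ.fact γ) {z : ℕ}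
    (hz : z ∈ ψ.vars) : β z = γ z := by
  obtain ⟨l, hl⟩ := hz
  simp only [Atom.fact, Sigma.mk.injEq, heq_eq_eq, true_and] at h
  have := congrFun h l
  rwa [hl] at this

theorem val_x (i j : ℕ) : (G.val i j G.x : ℕ) = G.b + 1 + G.w + 2 * i := by simp [val, code]

theorem val_y (i j : ℕ) : (G.val i j G.y : ℕ) = G.b + 1 + G.w + (2 * j + 1) := by
  simp [val, code, G.x_ne_y.symm]

theorem val_congr {i j i' j' z : ℕ} (hx : z = G.x → i = i') (hy : z = G.y → j = j') :
    G.val i j z = G.val i' j' z := by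
  refine PNat.coe_injective ?_
  simp only [val, code, PNat.mk_coe]
  split_ifs with h1 h2
  · rw [hx h1]
  · rw [hy h2]
  · rfl

theorem fact_congr {ψ : Atom σ} {i j i' j' : ℕ} (hx : G.x ∈ ψ.vars → i = i')
    (hy : G.y ∈ ψ.vars → j = j') : ψ.fact (G.val i j) = ψ.fact (G.val i' j') := by
  simp only [Atom.fact, Sigma.mk.injEq, heq_eq_eq, true_and]
  funext l
  cases hl : ψ.args l with
  | var z =>
    exact val_congr (fun h => hx ⟨l, h ▸ hl⟩) (fun h => hy ⟨l, h ▸ hl⟩)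
  | const a => rfl

/-- The tuple that is tested for row `i`. -/
def tuple (G : Gadget c) (i : ℕ) : Fin k → Dom := fun l => (c.head l).eval (G.val i 0)

/-- The map `back` is a homomorphism from the database to `c`. -/
theorem Rep.back_mem (h : G.Rep D A) (R : Fin σ.numRel) (t : Fin (σ.ar R) → Dom) (ht : t ∈ D R) :
    (⟨R, fun l => G.back (t l)⟩ : Atom σ) ∈ c.atoms := by
  obtain ⟨ψ, hψ, i, j, _, e⟩ := (h ⟨R, t⟩).1 ht
  have hb := fun l => G.back_eval i j hψ l
  cases e
  convert hψ using 1
  obtain ⟨R, args⟩ := ψ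
  simp only [Atom.mk.injEq, heq_eq_eq, true_and]
  funext l
  exact hb l

/-- The test for row `i₀` computes one entry of the matrix-vector product. That `c` is a core
makes sure that every homomorphism into the database can be replaced by one that respects the
encoding of the variables. -/
theorem Rep.tuple_mem_result (hc : c.IsCore) (h : G.Rep D A) {M : ℕ → ℕ → Prop} {v : ℕ → Prop}
    {i₀ : ℕ} (hxy : ∀ i j, A G.ψxy i j → M i j) (hy : ∀ i j, A G.ψy i j → v j)
    (hx : ∀ ψ ∈ G.ψx, ∀ i j, A ψ i j → i = i₀)
    (hcomp : ∀ j, M i₀ j → v j → ∀ ψ ∈ c.atoms, ∃ i' j', A ψ i' j' ∧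
      ψ.fact (G.val i' j') = ψ.fact (G.val i₀ j)) :
    G.tuple i₀ ∈ c.result D ↔ ∃ j, M i₀ j ∧ v j := by
  constructor
  · rintro ⟨β, hβ, hhead⟩
    have H : c.PreHom c fun z => G.back (β z) := by
      refine hβ.preHom h.back_mem (fun a ha => G.back_cons ha) fun l => ?_
      rw [← hhead l]
      change G.back ((c.head l).eval (G.val i₀ 0)) = _
      cases hl : c.head l with
      | var z => exact G.back_val _ _ (CQ.mem_occ_of_head hl)
      | const a => exact G.back_cons (.inr ⟨l, hl⟩)
    obtain ⟨u, hu, hid⟩ := hc.exists_inverse H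
    let γ : ℕ → Dom := fun z => (u z).eval β
    have hγ : ∀ z ∈ c.occ, G.back (γ z) = .var z := fun z hz => by
      have := hid z hz
      cases e : u z with
      | var z' =>
        rw [e] at this
        simp only [γ, e]
        exact this
      | const a => rw [e] at this; cases this
    have hhead' : ∀ l, G.tuple i₀ l = (c.head l).eval γ := fun l => by
      rw [hhead l, ← Term.eval_subst, hu.1]
    have hfact : ∀ ψ ∈ c.atoms, ∃ i j, A ψ i j ∧ ∀ z ∈ ψ.vars, G.val i j z = γ z := by
      intro ψ hψ
      have h1 : (fun l => ((ψ.args l).subst u).eval β) ∈ D ψ.rel := hβ _ (hu.2 ψ hψ)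
      simp only [Term.eval_subst] at h1
      obtain ⟨ψ', hψ', i, j, hA, e⟩ := (h ⟨ψ.rel, _⟩).1 h1
      have e' : ψ'.fact (G.val i j) = ψ.fact γ := e
      obtain rfl := eq_of_back_eq hψ' hψ hγ e'
      exact ⟨i, j, hA, fun z hz => eval_eq_of_fact_eq e' hz⟩
    obtain ⟨i, j, hA, hz⟩ := hfact _ G.ψxy_mem
    obtain ⟨i', j', hA', hz'⟩ := hfact _ G.ψy_mem
    have ex := hz _ G.x_mem_xy
    have ey := (hz _ G.y_mem_xy).trans (hz' _ G.y_mem_y).symm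
    have ej : j = j' := by
      have := congrArg (fun a : Dom => (a : ℕ)) ey
      simp only [val_y] at this; omega
    have ei : i = i₀ := by
      rcases G.x_cases with ⟨ψ, h1, h2, h3, h4⟩ | ⟨_, l, hl⟩
      · obtain ⟨i'', j'', hA'', hz''⟩ := hfact ψ h2
        obtain rfl := hx ψ h1 _ _ hA''
        have := congrArg (fun a : Dom => (a : ℕ)) (ex.trans (hz'' _ h3).symm)
        simp only [val_x] at this; omega
      · have h1 := hhead' l
        simp only [tuple, hl, Term.eval] at h1
        have := congrArg (fun a : Dom => (a : ℕ)) (ex.trans h1.symm)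
        simp only [val_x] at this; omega
    subst ej ei
    exact ⟨j, hxy _ _ hA, hy _ _ hA'⟩
  · rintro ⟨j, hM, hv⟩
    refine ⟨G.val i₀ j, fun ψ hψ => ?_, fun l => ?_⟩
    · obtain ⟨i', j', hA, e⟩ := hcomp j hM hv ψ hψ
      exact (h (ψ.fact (G.val i₀ j))).2 ⟨ψ, hψ, i', j', hA, e⟩
    · cases hl : c.head l with
      | var z =>
        simp only [tuple, hl, Term.eval]
        exact val_congr (fun _ => rfl) fun e => absurd (e ▸ hl) (G.y_head l)
      | const a => simp [tuple, hl, Term.eval]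

/-- The encoded databases map homomorphically into every query to which the core maps. -/
theorem Rep.mapsInto (h : G.Rep D A) {q : CQ σ k} {f : ℕ → Term} (hf : c.PreHom q f) :
    D.MapsInto q := by
  have key : ∀ R, ∀ t ∈ D R, (⟨R, fun i => (G.back (t i)).subst f⟩ : Atom σ) ∈ q.atoms :=
    fun R t ht => hf.2 _ (h.back_mem R t ht)
  refine ⟨fun a => (G.back a).subst f, fun a ha => ?_, key⟩
  simp only [Database.adom, Finset.mem_biUnion, Finset.mem_image, Finset.mem_univ, true_and] at ha
  obtain ⟨R, t, ht, l, rfl⟩ := ha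
  cases e : (G.back (t l)).subst f with
  | var z => exact .inl ⟨z, .inr ⟨_, key R t ht, l, e⟩, e⟩
  | const a => exact .inr ⟨a, .inl ⟨_, key R t ht, l, e⟩, e⟩

/-- A bound on the numbers in the encoding of an instance of dimension `n`. -/
def bound (G : Gadget c) (n : ℕ) : ℕ := G.b + 1 + G.w + 2 * n

theorem eval_le {i j n : ℕ} (hi : i < n) (hj : j < n) {ψ : Atom σ} (hψ : ψ ∈ c.atoms)
    (l : Fin (σ.ar ψ.rel)) : ((ψ.args l).eval (G.val i j) : ℕ) ≤ G.bound n := by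
  cases h : ψ.args l with
  | var z =>
    have := G.occ_lt z ⟨ψ, hψ, l, h⟩
    simp only [Term.eval, val, code, PNat.mk_coe, bound]
    split_ifs <;> omega
  | const a =>
    have := G.cons_le a (.inl ⟨ψ, hψ, l, h⟩)
    simp only [Term.eval, bound]; omega

theorem Rep.le_bound (h : G.Rep D A) {n : ℕ} (hA : ∀ ψ ∈ c.atoms, ∀ i j, A ψ i j → i < n ∧ j < n)
    (R : Fin σ.numRel) (t : Fin (σ.ar R) → Dom) (ht : t ∈ D R) (l : Fin (σ.ar R)) :
    (t l : ℕ) ≤ G.bound n := by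
  obtain ⟨ψ, hψ, i, j, hij, e⟩ := (h ⟨R, t⟩).1 ht
  cases e
  exact eval_le (hA _ hψ _ _ hij).1 (hA _ hψ _ _ hij).2 hψ l

end Gadget

/-- A bound on the size of databases all of whose entries are at most `H`. -/
def Schema.dbBound (σ : Schema) (H : ℕ) : ℕ := σ.size + H + ∑ R, σ.ar R * H ^ σ.ar R

theorem Database.card_adom_le {D : Database σ} {H : ℕ}
    (hD : ∀ R, ∀ t ∈ D R, ∀ l, (t l : ℕ) ≤ H) : D.adom.card ≤ H := by
  have hsub : D.adom.image (fun a : Dom => (a : ℕ)) ⊆ Finset.Icc 1 H := by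
    intro a ha
    simp only [Finset.mem_image, Database.adom, Finset.mem_biUnion, Finset.mem_univ,
      true_and] at ha
    obtain ⟨_, ⟨R, t, ht, l, rfl⟩, rfl⟩ := ha
    exact Finset.mem_Icc.2 ⟨(t l).pos, hD R t ht l⟩
  have := Finset.card_le_card hsub
  rwa [Finset.card_image_of_injective _ PNat.coe_injective, Nat.card_Icc,
    Nat.add_sub_cancel] at this

theorem Database.size_le {D : Database σ} {H : ℕ}
    (hD : ∀ R, ∀ t ∈ D R, ∀ l, (t l : ℕ) ≤ H) : D.size ≤ σ.dbBound H := by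
  have h2 : ∀ R, (D R).card ≤ H ^ σ.ar R := fun R => by
    have hsub : (D R).image (fun (t : Fin (σ.ar R) → Dom) l => (t l : ℕ)) ⊆
        Fintype.piFinset fun _ => Finset.Icc 1 H := by
      intro a ha
      obtain ⟨t, ht, rfl⟩ := Finset.mem_image.1 ha
      exact Fintype.mem_piFinset.2 fun l => Finset.mem_Icc.2 ⟨(t l).pos, hD R t ht l⟩
    have := Finset.card_le_card hsub
    rw [Finset.card_image_of_injective] at this
    · simpa using this
    · exact fun t t' e => funext fun l => PNat.coe_injective (congrFun e l)
  unfold Database.size Schema.dbBound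
  have h1 := Database.card_adom_le hD
  gcongr
  exact h2 _

end DynCQ

namespace DynCQ

/-! ### Simulation of a machine inside another one -/

/-- The simulation of an instruction. The simulated registers are the logical registers from
number `40` on. The address tuple of the simulated machine is represented by a number, the node
that it reaches in a tree: logical register `1` holds the current node, logical register `2` the
number of nodes; the cell `(8, v, a)` holds the child of `v` for the entry `a`, and `(9, v)` the
content of the simulated cell at node `v`. The root is `0`, and `0` also means that a child does
not exist yet. In this way the simulation leaves the real address tuple at the disposal of the
simulating machine. -/
def simInstr : Instr → PL
  | .const d c => .instr (.const (2 * (d + 40)) c)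
  | .copy d r => .instr (.copy (2 * (d + 40)) (2 * (r + 40)))
  | .add d a b => .instr (.add (2 * (d + 40)) (2 * (a + 40)) (2 * (b + 40)))
  | .sub d a b => .instr (.sub (2 * (d + 40)) (2 * (a + 40)) (2 * (b + 40)))
  | .mul d a b => .instr (.mul (2 * (d + 40)) (2 * (a + 40)) (2 * (b + 40)))
  | .div d a b => .instr (.div (2 * (d + 40)) (2 * (a + 40)) (2 * (b + 40)))
  | .clear => .instr (.const (2 * 1) 0)
  | .push r => .instr (.const (2 * 0 + 1) 8) ;; .instr .clear ;; .instr (.push (2 * 0 + 1)) ;;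
      .instr (.push (2 * 1)) ;; .instr (.push (2 * (r + 40))) ;; .instr (.load (2 * 1 + 1)) ;;
      .ite (2 * 1 + 1) (.instr (.copy (2 * 1) (2 * 1 + 1)))
        (.instr (.const (2 * 2 + 1) 1) ;; .instr (.add (2 * 2) (2 * 2) (2 * 2 + 1)) ;;
          .instr (.store (2 * 2)) ;; .instr (.copy (2 * 1) (2 * 2)))
  | .load d => .instr (.const (2 * 0 + 1) 9) ;; .instr .clear ;; .instr (.push (2 * 0 + 1)) ;;
      .instr (.push (2 * 1)) ;; .instr (.load (2 * (d + 40)))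
  | .store r => .instr (.const (2 * 0 + 1) 9) ;; .instr .clear ;; .instr (.push (2 * 0 + 1)) ;;
      .instr (.push (2 * 1)) ;; .instr (.store (2 * (r + 40)))

/-- The simulation of a program. -/
def simProg : Prog → Prog
  | .skip => .skip
  | .instr i => (simInstr i).prog
  | .seq p p' => .seq (simProg p) (simProg p')
  | .ite r p p' => .ite (2 * (r + 40)) (simProg p) (simProg p')
  | .loop r p => .loop (2 * (r + 40)) (simProg p)

/-- `id` maps the address tuples with a node to this node, and all others to `0`. -/
structure SimWith (id : List ℕ → ℕ) (sA : State) (sv : List ℕ) (ρ : ℕ → ℕ) (m : Mem) : Prop where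
  nil : id [] = 0
  inj : ∀ a b, id a ≠ 0 → id a = id b → a = b
  parent : ∀ a x, id (a ++ [x]) ≠ 0 → a = [] ∨ id a ≠ 0
  le : ∀ a, id a ≤ ρ 2
  node : ρ 1 = id sA.addr
  addr : sA.addr = [] ∨ id sA.addr ≠ 0
  child : ∀ a x, a = [] ∨ id a ≠ 0 → m [8, id a, x] = id (a ++ [x])
  child_free : ∀ v x, ρ 2 < v → m [8, v, x] = 0
  cell : ∀ a, a = [] ∨ id a ≠ 0 → m [9, id a] = sA.mem a
  cell_none : ∀ a, a ≠ [] → id a = 0 → sA.mem a = 0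
  cell_free : ∀ v, ρ 2 < v → m [9, v] = 0
  reg : ∀ r, ρ (r + 40) = sA.reg r
  saved : ρ 3 = id sv
  saved_addr : sv = [] ∨ id sv ≠ 0

/-- The simulating machine represents the configuration `sA`, and logical register `3` holds the
node of the address tuple `sv`. -/
def Sim (sA : State) (sv : List ℕ) (ρ : ℕ → ℕ) (m : Mem) : Prop := ∃ id, SimWith id sA sv ρ m

/-- The simulation changes only the registers and arrays that belong to it. -/
def Frame (ρ : ℕ → ℕ) (m : Mem) (ρ' : ℕ → ℕ) (m' : Mem) : Prop :=
  (∀ i, 10 ≤ i → i < 40 → ρ' i = ρ i) ∧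
    ∀ a : List ℕ, a.head? ≠ some 8 → a.head? ≠ some 9 → m' a = m a

theorem Frame.refl (ρ : ℕ → ℕ) (m : Mem) : Frame ρ m ρ m :=
  ⟨fun _ _ _ => rfl, fun _ _ _ => rfl⟩

theorem Frame.trans {ρ ρ' ρ'' : ℕ → ℕ} {m m' m'' : Mem} (h : Frame ρ m ρ' m')
    (h' : Frame ρ' m' ρ'' m'') : Frame ρ m ρ'' m'' :=
  ⟨fun i h1 h2 => (h'.1 i h1 h2).trans (h.1 i h1 h2),
    fun a h1 h2 => (h'.2 a h1 h2).trans (h.2 a h1 h2)⟩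

theorem SimWith.setReg {id : List ℕ → ℕ} {sA : State} {sv : List ℕ} {ρ : ℕ → ℕ}
    {m : Mem} (h : SimWith id sA sv ρ m) (d v : ℕ) :
    SimWith id (sA.setReg d v) sv (Function.update ρ (d + 40) v) m := by
  have e : ∀ i < 40, Function.update ρ (d + 40) v i = ρ i := fun i hi =>
    Function.update_of_ne (by omega) _ _
  refine ⟨h.nil, h.inj, h.parent, ?_, ?_, h.addr, h.child, ?_, h.cell, h.cell_none, ?_, ?_,
    ?_, h.saved_addr⟩
  · rw [e 2 (by omega)]; exact h.le
  · rw [e 1 (by omega)]; exact h.node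
  · rw [e 2 (by omega)]; exact h.child_free
  · rw [e 2 (by omega)]; exact h.cell_free
  · intro r
    rw [State.setReg_reg]
    by_cases hr : r = d
    · subst hr; simp
    · rw [if_neg hr, Function.update_of_ne (by omega), h.reg]
  · rw [e 3 (by omega)]; exact h.saved

theorem Frame.update_reg (ρ : ℕ → ℕ) (m : Mem) {d v : ℕ} (hd : d < 10 ∨ 40 ≤ d) :
    Frame ρ m (Function.update ρ d v) m :=
  ⟨fun i h1 h2 => Function.update_of_ne (by omega) _ _, fun _ _ _ => rfl⟩

theorem Frame.update_mem (ρ : ℕ → ℕ) (m : Mem) {n v : ℕ} {l : List ℕ} (hn : n = 8 ∨ n = 9) :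
    Frame ρ m ρ (Function.update m (n :: l) v) :=
  ⟨fun _ _ _ => rfl, fun a h1 h2 => Function.update_of_ne
    (by rintro rfl; rcases hn with rfl | rfl <;> simp at h1 h2) _ _⟩

theorem State.reg_even (s : State) (i : ℕ) : s.reg (2 * i) = s.vars i := rfl

/-- Storing a word in the simulated memory. -/
theorem SimWith.store {id : List ℕ → ℕ} {sA : State} {sv : List ℕ} {ρ : ℕ → ℕ}
    {m : Mem} (h : SimWith id sA sv ρ m) (v : ℕ) :
    SimWith id { sA with mem := Function.update sA.mem sA.addr v } sv ρ
      (Function.update m [9, ρ 1] v) := by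
  refine ⟨h.nil, h.inj, h.parent, h.le, h.node, h.addr, ?_, ?_, ?_, ?_, ?_, h.reg,
    h.saved, h.saved_addr⟩
  · intro a x ha
    rw [Function.update_of_ne (by simp)]; exact h.child a x ha
  · intro v x hv
    rw [Function.update_of_ne (by simp)]; exact h.child_free v x hv
  · intro a ha
    by_cases e : a = sA.addr
    · subst e; simp [h.node]
    · have : id a ≠ id sA.addr := fun e' => by
        rcases ha with rfl | ha
        · rcases h.addr with h0 | h0
          · exact e h0.symm
          · exact h0 (e'.symm.trans h.nil)
        · exact e (h.inj _ _ ha e')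
      rw [Function.update_of_ne (by simpa [h.node] using this)]
      simp only [Function.update_of_ne e]
      exact h.cell a ha
  · intro a ha h0
    have e : a ≠ sA.addr := fun e => by
      rcases h.addr with h1 | h1
      · exact ha (e.trans h1)
      · exact h1 (e ▸ h0)
    simp only [Function.update_of_ne e]
    exact h.cell_none a ha h0
  · intro w hw
    have : w ≠ ρ 1 := fun e => by
      have := h.le sA.addr
      rw [← h.node] at this; omega
    rw [Function.update_of_ne (by simpa using this)]
    exact h.cell_free w hw

/-- Moving to a child that exists. -/
theorem SimWith.push {id : List ℕ → ℕ} {sA : State} {sv : List ℕ} {ρ : ℕ → ℕ}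
    {m : Mem} (h : SimWith id sA sv ρ m) (x : ℕ) (hx : m [8, ρ 1, x] ≠ 0) :
    SimWith id { sA with addr := sA.addr ++ [x] } sv (Function.update ρ 1 (m [8, ρ 1, x])) m := by
  have hc := h.child sA.addr x h.addr
  rw [← h.node] at hc
  have e : ∀ i, i ≠ 1 → Function.update ρ 1 (m [8, ρ 1, x]) i = ρ i := fun i hi =>
    Function.update_of_ne hi _ _
  refine ⟨h.nil, h.inj, h.parent, ?_, ?_, ?_, h.child, ?_, h.cell, h.cell_none, ?_, ?_, ?_,
    h.saved_addr⟩
  · rw [e 2 (by omega)]; exact h.le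
  · simpa using hc
  · right; change id (sA.addr ++ [x]) ≠ 0; rwa [← hc]
  · rw [e 2 (by omega)]; exact h.child_free
  · rw [e 2 (by omega)]; exact h.cell_free
  · intro r; rw [e _ (by omega)]; exact h.reg r
  · rw [e 3 (by omega)]; exact h.saved

/-- Moving to a new child. -/
theorem SimWith.push_new {id : List ℕ → ℕ} {sA : State} {sv : List ℕ} {ρ : ℕ → ℕ}
    {m : Mem} (h : SimWith id sA sv ρ m) (x : ℕ) (hx : m [8, ρ 1, x] = 0) :
    SimWith (Function.update id (sA.addr ++ [x]) (ρ 2 + 1)) { sA with addr := sA.addr ++ [x] } sv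
      (Function.update (Function.update ρ 2 (ρ 2 + 1)) 1 (ρ 2 + 1))
      (Function.update m [8, ρ 1, x] (ρ 2 + 1)) := by
  have hc := h.child sA.addr x h.addr
  rw [← h.node, hx] at hc
  set b := sA.addr ++ [x] with hb
  have hb0 : b ≠ [] := by simp [hb]
  have e : ∀ i, i ≠ 1 → i ≠ 2 →
      Function.update (Function.update ρ 2 (ρ 2 + 1)) 1 (ρ 2 + 1) i = ρ i := fun i h1 h2 => by
    rw [Function.update_of_ne h1, Function.update_of_ne h2]
  have e2 : Function.update (Function.update ρ 2 (ρ 2 + 1)) 1 (ρ 2 + 1) 2 = ρ 2 + 1 := by simp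
  have idb : Function.update id b (ρ 2 + 1) b = ρ 2 + 1 := by simp
  have idn : ∀ {a}, a ≠ b → Function.update id b (ρ 2 + 1) a = id a := fun ha =>
    Function.update_of_ne ha _ _
  have hne : ∀ a, a = [] ∨ id a ≠ 0 → a ≠ b := by
    rintro a ha e
    rcases ha with h1 | h1
    · exact hb0 (e.symm.trans h1)
    · exact h1 (e ▸ hc.symm)
  -- the new node has no children yet
  have hleaf : ∀ y, b ++ [y] ≠ b ∧ id (b ++ [y]) = 0 := fun y => by
    refine ⟨by simp, ?_⟩
    by_contra h0
    rcases h.parent b y h0 with h1 | h1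
    · exact hb0 h1
    · exact h1 hc.symm
  refine ⟨?_, ?_, ?_, ?_, ?_, ?_, ?_, ?_, ?_, ?_, ?_, ?_, ?_, ?_⟩
  · rw [idn hb0.symm]; exact h.nil
  · intro a a' ha haa
    by_cases h1 : a = b
    · by_cases h2 : a' = b
      · rw [h1, h2]
      · subst h1
        rw [idb, idn h2] at haa
        have := h.le a'; omega
    · by_cases h2 : a' = b
      · subst h2
        rw [idb, idn h1] at haa
        have := h.le a; omega
      · rw [idn h1] at ha haa
        rw [idn h2] at haa
        exact h.inj _ _ ha haa
  · intro a y ha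
    by_cases h1 : a = b
    · right; rw [h1, idb]; omega
    · rw [idn h1]
      by_cases h2 : a ++ [y] = b
      · have := (List.append_inj' h2 rfl).1
        rw [this]; exact h.addr
      · rw [idn h2] at ha
        exact h.parent a y ha
  · intro a
    rw [e2]
    by_cases h1 : a = b
    · rw [h1, idb]
    · rw [idn h1]; exact (h.le a).trans (Nat.le_succ _)
  · simp
  · right; change Function.update id b (ρ 2 + 1) b ≠ 0; rw [idb]; omega
  · intro a y ha
    by_cases h1 : a = b
    · subst h1
      rw [idb, idn (hleaf y).1, (hleaf y).2, Function.update_of_ne]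
      · exact h.child_free _ _ (Nat.lt_succ_self _)
      · have := h.le sA.addr
        rw [← h.node] at this
        simp; omega
    · rw [idn h1] at ha ⊢
      by_cases h2 : a ++ [y] = b
      · obtain ⟨h3, h4⟩ := List.append_inj' h2 rfl
        have h4 : y = x := by simpa using h4
        rw [h2, idb, h3, h4, ← h.node]; simp
      · rw [idn h2, Function.update_of_ne]
        · exact h.child a y ha
        · rintro h3
          simp only [List.cons.injEq, true_and, and_true] at h3
          obtain ⟨h3, rfl⟩ := h3
          rw [h.node] at h3
          apply h2
          rw [hb]; congr 1
          rcases ha with rfl | ha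
          · rcases h.addr with h5 | h5
            · exact h5.symm
            · exact absurd (h3.symm.trans h.nil) h5
          · exact h.inj _ _ ha h3
  · intro v y hv
    rw [e2] at hv
    rw [Function.update_of_ne]
    · exact h.child_free v y (by omega)
    · have := h.le sA.addr
      rw [← h.node] at this
      simp; omega
  · intro a ha
    rw [Function.update_of_ne (by simp)]
    by_cases h1 : a = b
    · rw [h1, idb, h.cell_free _ (Nat.lt_succ_self _)]
      exact (h.cell_none b hb0 hc.symm).symm
    · rw [idn h1] at ha ⊢
      exact h.cell a ha
  · intro a ha ha0
    by_cases h1 : a = b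
    · subst h1; rw [idb] at ha0; omega
    · rw [idn h1] at ha0; exact h.cell_none a ha ha0
  · intro v hv
    rw [e2] at hv
    rw [Function.update_of_ne (by simp)]
    exact h.cell_free v (by omega)
  · intro r
    rw [e _ (by omega) (by omega)]; exact h.reg r
  · rw [e _ (by omega) (by omega), idn (hne _ h.saved_addr)]; exact h.saved
  · rw [idn (hne _ h.saved_addr)]; exact h.saved_addr

section

variable {B S τ : ℕ} {sA : State} {sv : List ℕ} {s : State}

theorem STri.goto_cell {P : PL} {Q : State → Prop} (hB : 9 ≤ B)
    (h : STri B S τ P ⟨(s.setReg (2 * 0 + 1) 9).reg, [9, s.vars 1], s.mem⟩ Q) :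
    STri B S τ (.instr (.const (2 * 0 + 1) 9) ;; .instr .clear ;; .instr (.push (2 * 0 + 1)) ;;
      .instr (.push (2 * 1)) ;; P) s Q :=
  .seq (.const hB (.seq (.clear (.seq (.push (.seq (.push (by
    simpa [State.setReg_reg, State.vars] using h))))))))

/-- The simulation of one instruction. Only `push` can create a node. -/
theorem simInstr_spec (hsim : Sim sA sv s.vars s.mem) (hB : 9 ≤ B) (hc : s.vars 2 + 1 ≤ B)
    (i : Instr) (hi : ∀ r, (i.step sA).reg r ≤ B) :
    STri B S τ (simInstr i) s fun s' => Sim (i.step sA) sv s'.vars s'.mem ∧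
      s'.vars 2 ≤ s.vars 2 + 1 ∧ Frame s.vars s.mem s'.vars s'.mem := by
  obtain ⟨id, h⟩ := hsim
  have hreg : ∀ r, s.reg (2 * (r + 40)) = sA.reg r := h.reg
  -- the effect of all instructions that change only one simulated register
  have set : ∀ (t : State) (d v : ℕ), t.vars = s.vars → t.mem = s.mem →
      Sim (sA.setReg d v) sv (t.setReg (2 * (d + 40)) v).vars (t.setReg (2 * (d + 40)) v).mem ∧
      (t.setReg (2 * (d + 40)) v).vars 2 ≤ s.vars 2 + 1 ∧
      Frame s.vars s.mem (t.setReg (2 * (d + 40)) v).vars (t.setReg (2 * (d + 40)) v).mem := by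
    intro t d v ht hm
    rw [State.vars_setReg_even, State.setReg_mem, ht, hm]
    refine ⟨⟨id, h.setReg d v⟩, ?_, .update_reg _ _ (by omega)⟩
    rw [Function.update_of_ne (by omega)]; omega
  have hself : ∀ d v : ℕ, (∀ r, (sA.setReg d v).reg r ≤ B) → v ≤ B := fun d v hv => by
    have := hv d; simpa [State.setReg_reg] using this
  cases i with
  | const d c => exact .const (hself d c hi) (set s d c rfl rfl)
  | copy d r =>
    refine .copy ?_
    rw [hreg]; exact set s d _ rfl rfl
  | add d a b =>
    have := hself d _ hi
    refine .add (by rwa [hreg, hreg]) ?_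
    rw [hreg, hreg]; exact set s d _ rfl rfl
  | sub d a b =>
    refine .sub ?_
    rw [hreg, hreg]; exact set s d _ rfl rfl
  | mul d a b =>
    have := hself d _ hi
    refine .mul (by rwa [hreg, hreg]) ?_
    rw [hreg, hreg]; exact set s d _ rfl rfl
  | div d a b =>
    have := hself d _ hi
    refine .instr (fun hs => hs.setReg (by rwa [hreg, hreg])) ?_
    have := set s d (sA.reg a / sA.reg b) rfl rfl
    simp only [Instr.step, hreg]; exact this
  | clear =>
    refine .const (Nat.zero_le _) ?_
    rw [State.vars_setReg_even, State.setReg_mem]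
    have e : ∀ i, i ≠ 1 → Function.update s.vars 1 0 i = s.vars i := fun i hi =>
      Function.update_of_ne hi _ _
    refine ⟨⟨id, h.nil, h.inj, h.parent, ?_, ?_, .inl rfl, h.child, ?_, h.cell, h.cell_none, ?_,
      ?_, ?_, h.saved_addr⟩, ?_, .update_reg _ _ (by omega)⟩
    · rw [e 2 (by omega)]; exact h.le
    · simp [Instr.step, h.nil]
    · rw [e 2 (by omega)]; exact h.child_free
    · rw [e 2 (by omega)]; exact h.cell_free
    · intro r; rw [e _ (by omega)]; exact h.reg r
    · rw [e 3 (by omega)]; exact h.saved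
    · rw [e 2 (by omega)]; omega
  | push r =>
    refine .seq (.const (by omega) (.seq (.clear (.seq (.push (.seq (.push (.seq (.push
      (.seq (.load ?_)))))))))))
    set s₁ : State := (State.mk _ _ _).setReg (2 * 1 + 1) _ with hs₁
    have v1 : s₁.vars = s.vars := by
      rw [hs₁, State.vars_setReg_odd]; exact State.vars_setReg_odd s 0 8
    have m1 : s₁.mem = s.mem := rfl
    have a1 : s₁.addr = [8, s.vars 1, sA.reg r] := by
      have h1 : ((2 * (r + 40) = 1) = False) := eq_false (by omega)
      simp [hs₁, State.setReg_reg, State.reg_even, ← h.reg, h1]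
      rfl
    have r1 : s₁.reg (2 * 1 + 1) = s.mem [8, s.vars 1, sA.reg r] := by
      rw [← a1]; simp [hs₁, State.setReg_reg]
    clear_value s₁
    refine .ite (fun hne => .copy ?_) fun hz => ?_
    · rw [State.vars_setReg_even, State.setReg_mem, v1, m1, r1]
      rw [r1] at hne
      exact ⟨⟨id, h.push _ hne⟩, by rw [Function.update_of_ne (by omega)]; omega,
        .update_reg _ _ (by omega)⟩
    · rw [r1] at hz
      have v2 : s₁.reg (2 * 2) = s.vars 2 := by rw [State.reg_even, v1]
      have v2' : ∀ v, (s₁.setReg (2 * 2 + 1) v).reg (2 * 2) = s.vars 2 := fun v => by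
        rw [State.setReg_reg, if_neg (by omega), v2]
      have e5 : (s₁.setReg (2 * 2 + 1) 1).reg (2 * 2 + 1) = 1 := by simp [State.setReg_reg]
      refine .seq (.const (by omega) (.seq (.add (by rw [v2', e5]; exact hc)
        (.seq (.store (.copy ?_))))))
      rw [State.vars_setReg_even, State.setReg_mem, v2', e5]
      have e6 : ∀ v, ((s₁.setReg (2 * 2 + 1) 1).setReg (2 * 2) v).reg (2 * 2) = v := fun v => by
        simp [State.setReg_reg]
      have e7 : ∀ v, ((s₁.setReg (2 * 2 + 1) 1).setReg (2 * 2) v).vars =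
          Function.update s.vars 2 v := fun v => by
        rw [State.vars_setReg_even, State.vars_setReg_odd, v1]
      simp only [e6, State.setReg_mem, State.setReg_addr, a1, m1]
      have e8 : ∀ (v : ℕ) (a : List ℕ) (m' : Mem),
          (State.mk ((s₁.setReg (2 * 2 + 1) 1).setReg (2 * 2) v).reg a m').vars =
          Function.update s.vars 2 v := fun v a m' => e7 v
      rw [e8]
      refine ⟨⟨_, h.push_new _ hz⟩, by simp, ?_⟩
      exact ((Frame.update_reg _ _ (by omega)).trans (.update_reg _ _ (by omega))).trans
        (.update_mem _ _ (by omega))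
  | load d =>
    refine .goto_cell hB (.load ?_)
    have hcell : s.mem [9, s.vars 1] = sA.mem sA.addr := by rw [h.node]; exact h.cell _ h.addr
    change Sim (sA.setReg d (sA.mem sA.addr)) sv _ _ ∧ _
    rw [← hcell]
    exact set ⟨(s.setReg (2 * 0 + 1) 9).reg, [9, s.vars 1], s.mem⟩ d (s.mem [9, s.vars 1])
      (State.vars_setReg_odd s 0 9) rfl
  | store r =>
    have h1 : ((2 * (r + 40) = 1) = False) := eq_false (by omega)
    have e8 : ∀ (a : List ℕ) (m' : Mem),
        (State.mk (s.setReg (2 * 0 + 1) 9).reg a m').vars = s.vars := fun a m' =>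
      State.vars_setReg_odd s 0 9
    refine .goto_cell hB (.store ?_)
    rw [e8]
    simp only [State.setReg_reg, Nat.mul_zero, Nat.zero_add, h1, if_false, hreg]
    exact ⟨⟨id, h.store _⟩, by omega, .update_mem _ _ (by omega)⟩

end

theorem simInstr_cost (S τ : ℕ) (i : Instr) : (simInstr i).cost S τ ≤ 16 := by
  cases i <;> simp [simInstr, PL.cost]

/-- A run of `t` steps is simulated in at most `16 t` steps, and creates at most `t` nodes. -/
theorem sim_exec {B B' : ℕ} {p : Prog} {sA sA' : State} {sv : List ℕ} {t : ℕ}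
    (hBB : B ≤ B') (hB : 9 ≤ B')
    (h : Exec B p sA t sA') : ∀ s : State, Sim sA sv s.vars s.mem → s.Bdd B' → s.vars 2 + t ≤ B' →
      ∃ t' s', Exec B' (simProg p) s t' s' ∧ t' ≤ 16 * t ∧ s'.Bdd B' ∧ Sim sA' sv s'.vars s'.mem ∧
        s'.vars 2 ≤ s.vars 2 + t ∧ Frame s.vars s.mem s'.vars s'.mem := by
  induction h with
  | skip sA =>
    exact fun s hs hb hc => ⟨1, s, .skip s, by omega, hb, hs, by omega, .refl _ _⟩
  | instr i sA hi =>
    intro s hs hb hc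
    obtain ⟨t', s', h1, h2, h3, h4, h5, h6⟩ :=
      simInstr_spec (S := 0) (τ := 0) hs hB hc i (fun r => (hi r).trans hBB) hb
    exact ⟨t', s', h1, h2.trans (simInstr_cost 0 0 i), h3, h4, h5, h6⟩
  | seq _ _ ih₁ ih₂ =>
    intro s hs hb hc
    obtain ⟨t₁, s₁, h1, h2, h3, h4, h5, h6⟩ := ih₁ s hs hb (by omega)
    obtain ⟨t₂, s₂, h1', h2', h3', h4', h5', h6'⟩ := ih₂ s₁ h4 h3 (by omega)
    exact ⟨_, s₂, .seq h1 h1', by omega, h3', h4', by omega, h6.trans h6'⟩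
  | ite_pos hr _ ih =>
    intro s hs hb hc
    obtain ⟨t₁, s₁, h1, h2, h3, h4, h5, h6⟩ := ih s hs hb (by omega)
    refine ⟨_, s₁, .ite_pos ?_ h1, by omega, h3, h4, by omega, h6⟩
    obtain ⟨id, hid⟩ := hs
    exact fun e => hr ((hid.reg _).symm.trans e)
  | ite_neg hr _ ih =>
    intro s hs hb hc
    obtain ⟨t₁, s₁, h1, h2, h3, h4, h5, h6⟩ := ih s hs hb (by omega)
    refine ⟨_, s₁, .ite_neg ?_ h1, by omega, h3, h4, by omega, h6⟩
    obtain ⟨id, hid⟩ := hs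
    exact (hid.reg _).trans hr
  | loop_stop hr =>
    intro s hs hb hc
    refine ⟨1, s, Exec.loop_stop ?_, by omega, hb, hs, by omega, .refl _ _⟩
    obtain ⟨id, hid⟩ := hs
    exact (hid.reg _).trans hr
  | loop_step hr _ _ ih₁ ih₂ =>
    intro s hs hb hc
    obtain ⟨t₁, s₁, h1, h2, h3, h4, h5, h6⟩ := ih₁ s hs hb (by omega)
    obtain ⟨t₂, s₂, h1', h2', h3', h4', h5', h6'⟩ := ih₂ s₁ h4 h3 (by omega)
    refine ⟨_, s₂, .loop_step ?_ h1 h1', by omega, h3', h4', by omega, h6.trans h6'⟩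
    obtain ⟨id, hid⟩ := hs
    exact fun e => hr ((hid.reg _).symm.trans e)

theorem Sim.init : Sim .init [] (fun _ => 0) fun _ => 0 :=
  ⟨fun _ => 0, rfl, fun _ _ h => absurd rfl h, fun _ _ h => absurd rfl h, fun _ => le_rfl, rfl,
    .inl rfl, fun _ _ _ => rfl, fun _ _ _ => rfl, fun _ _ => rfl, fun _ _ _ => rfl,
    fun _ _ => rfl, fun _ => rfl, rfl, .inl rfl⟩

end DynCQ

namespace DynCQ

/-! ### Calling the routines of a simulated algorithm -/

/-- The driver of the simulation owns the logical registers from `11` to `39` and all arrays but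
`8` and `9`; these are kept. -/
def Keeps (ρ : ℕ → ℕ) (m : Mem) (ρ' : ℕ → ℕ) (m' : Mem) : Prop :=
  (∀ i, 11 ≤ i → i < 40 → ρ' i = ρ i) ∧
    ∀ a : List ℕ, a.head? ≠ some 8 → a.head? ≠ some 9 → m' a = m a

theorem Keeps.refl (ρ : ℕ → ℕ) (m : Mem) : Keeps ρ m ρ m :=
  ⟨fun _ _ _ => rfl, fun _ _ _ => rfl⟩

theorem Keeps.trans {ρ ρ' ρ'' : ℕ → ℕ} {m m' m'' : Mem} (h : Keeps ρ m ρ' m')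
    (h' : Keeps ρ' m' ρ'' m'') : Keeps ρ m ρ'' m'' :=
  ⟨fun i h1 h2 => (h'.1 i h1 h2).trans (h.1 i h1 h2),
    fun a h1 h2 => (h'.2 a h1 h2).trans (h.2 a h1 h2)⟩

theorem Frame.keeps {ρ ρ' : ℕ → ℕ} {m m' : Mem} (h : Frame ρ m ρ' m') : Keeps ρ m ρ' m' :=
  ⟨fun i h1 h2 => h.1 i (by omega) h2, h.2⟩

theorem Keeps.update (ρ : ℕ → ℕ) (m : Mem) {d v : ℕ} (hd : d < 11 ∨ 40 ≤ d) :
    Keeps ρ m (Function.update ρ d v) m :=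
  ⟨fun i h1 h2 => Function.update_of_ne (by omega) _ _, fun _ _ _ => rfl⟩

section Sim

variable {sA : State} {sv : List ℕ} {ρ ρ' : ℕ → ℕ} {m m' : Mem}

theorem Sim.congr (h : Sim sA sv ρ m) (hρ : ∀ i, i < 10 ∨ 40 ≤ i → ρ' i = ρ i)
    (hm : ∀ a : List ℕ, a.head? = some 8 ∨ a.head? = some 9 → m' a = m a) : Sim sA sv ρ' m' := by
  obtain ⟨id, h⟩ := h
  have h8 : ∀ v x, m' [8, v, x] = m [8, v, x] := fun v x => hm _ (.inl rfl)
  have h9 : ∀ v, m' [9, v] = m [9, v] := fun v => hm _ (.inr rfl)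
  have e1 := hρ 1 (by omega)
  have e2 := hρ 2 (by omega)
  have e3 := hρ 3 (by omega)
  refine ⟨id, h.nil, h.inj, h.parent, ?_, ?_, h.addr, ?_, ?_, ?_, h.cell_none, ?_, ?_, ?_,
    h.saved_addr⟩
  · rw [e2]; exact h.le
  · rw [e1]; exact h.node
  · simp only [h8]; exact h.child
  · simp only [h8, e2]; exact h.child_free
  · simp only [h9]; exact h.cell
  · simp only [h9, e2]; exact h.cell_free
  · intro r; rw [hρ _ (by omega)]; exact h.reg r
  · rw [e3]; exact h.saved

theorem Sim.save (h : Sim sA sv ρ m) : Sim sA sA.addr (Function.update ρ 3 (ρ 1)) m := by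
  obtain ⟨id, h⟩ := h
  have e : ∀ i, i ≠ 3 → Function.update ρ 3 (ρ 1) i = ρ i := fun i hi =>
    Function.update_of_ne hi _ _
  refine ⟨id, h.nil, h.inj, h.parent, ?_, ?_, h.addr, h.child, ?_, h.cell, h.cell_none, ?_, ?_,
    ?_, h.addr⟩
  · rw [e 2 (by omega)]; exact h.le
  · rw [e 1 (by omega)]; exact h.node
  · rw [e 2 (by omega)]; exact h.child_free
  · rw [e 2 (by omega)]; exact h.cell_free
  · intro r; rw [e _ (by omega)]; exact h.reg r
  · simpa using h.node

theorem Sim.restore (h : Sim sA sv ρ m) :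
    Sim { sA with addr := sv } sv (Function.update ρ 1 (ρ 3)) m := by
  obtain ⟨id, h⟩ := h
  have e : ∀ i, i ≠ 1 → Function.update ρ 1 (ρ 3) i = ρ i := fun i hi =>
    Function.update_of_ne hi _ _
  refine ⟨id, h.nil, h.inj, h.parent, ?_, ?_, h.saved_addr, h.child, ?_, h.cell, h.cell_none,
    ?_, ?_, ?_, h.saved_addr⟩
  · rw [e 2 (by omega)]; exact h.le
  · simpa using h.saved
  · rw [e 2 (by omega)]; exact h.child_free
  · rw [e 2 (by omega)]; exact h.cell_free
  · intro r; rw [e _ (by omega)]; exact h.reg r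
  · rw [e 3 (by omega)]; exact h.saved

theorem Sim.setReg_zero (h : Sim sA sv ρ m) (v : ℕ) :
    Sim (sA.setReg 0 v) sv (Function.update ρ 40 v) m := by
  obtain ⟨id, h⟩ := h
  exact ⟨id, h.setReg 0 v⟩

theorem Sim.reg_eq (h : Sim sA sv ρ m) (r : ℕ) : ρ (r + 40) = sA.reg r := by
  obtain ⟨id, h⟩ := h
  exact h.reg r

end Sim

section Driver

variable {B S τ : ℕ} {sA : State} {sv : List ℕ} {ρ : ℕ → ℕ} {m : Mem}
  {Q : (ℕ → ℕ) → Mem → Prop}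

/-- One instruction of the simulated machine, issued by the driver. -/
theorem Tri.simInstr (hs : Sim sA sv ρ m) (hB : 9 ≤ B) (hc : ρ 2 + 1 ≤ B) (i : Instr)
    (hi : (∀ r, sA.reg r ≤ B) → (∀ a, sA.mem a ≤ B) → ∀ r, (i.step sA).reg r ≤ B)
    (h : ∀ ρ' m', Sim (i.step sA) sv ρ' m' → ρ' 2 ≤ ρ 2 + 1 → Frame ρ m ρ' m' → Q ρ' m') :
    Tri B S τ (simInstr i) ρ m Q := by
  refine .bdd fun hρ hm => tri_iff.2 fun s e1 e2 => ?_
  subst e1 e2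
  have h1 : ∀ r, sA.reg r ≤ B := fun r => by rw [← hs.reg_eq]; exact hρ _
  have h2 : ∀ a, sA.mem a ≤ B := fun a => by
    obtain ⟨id, hid⟩ := hs
    by_cases ha : a = [] ∨ id a ≠ 0
    · rw [← hid.cell a ha]; exact hm _
    · rw [not_or, not_not] at ha
      rw [hid.cell_none a ha.1 ha.2]; omega
  exact (simInstr_spec hs hB hc i (hi h1 h2)).conseq fun s' ⟨h3, h4, h5⟩ => h _ _ h3 h4 h5

/-- Go to the cell `(0, idx)` or `(1, idx)` of the simulated memory, keeping the address tuple and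
register `0` of the simulated machine in the logical registers `3` and `10`. -/
def goto (a idx : ℕ) : PL :=
  asg 3 (.reg 1) ;; asg 10 (.reg 40) ;; simInstr .clear ;; asg 40 (.lit a) ;;
    simInstr (.push 0) ;; asg 40 (.lit idx) ;; simInstr (.push 0)

/-- Undo the effect of `goto`. -/
def goback : PL := asg 1 (.reg 3) ;; asg 40 (.reg 10)

/-- Write the content of the logical register `d` to the input cell `(0, idx)`. -/
def wr (idx d : ℕ) : PL := goto 0 idx ;; asg 40 (.reg d) ;; simInstr (.store 0) ;; goback

/-- Read the output cell `(1, 0)` into the logical register `d`. -/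
def rd (d : ℕ) : PL := goto 1 0 ;; simInstr (.load 0) ;; asg d (.reg 40) ;; goback

theorem Tri.goto (hs : Sim sA sv ρ m) (hB : 9 ≤ B) (hc : ρ 2 + 3 ≤ B) {a idx : ℕ} (ha : a ≤ B)
    (hidx : idx ≤ B)
    (h : ∀ v ρ' m', Sim ({ sA with addr := [a, idx] }.setReg 0 v) sA.addr ρ' m' →
      ρ' 2 ≤ ρ 2 + 3 → ρ' 10 = sA.reg 0 → Keeps ρ m ρ' m' → Q ρ' m') :
    Tri B S τ (goto a idx) ρ m Q := by
  refine .seq (.asg trivial (.seq (.asg trivial (.seq ?_))))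
  have h0 : Function.update ρ 3 (ρ 1) 40 = sA.reg 0 := hs.save.reg_eq 0
  simp only [Ex.eval, h0]
  have hs₁ := hs.save.congr (ρ' := Function.update (Function.update ρ 3 (ρ 1)) 10 (sA.reg 0))
    (fun i hi => Function.update_of_ne (by omega) _ _) fun _ _ => rfl
  have hk₁ := (Keeps.update ρ m (d := 3) (v := ρ 1) (by omega)).trans
    (.update _ _ (d := 10) (v := sA.reg 0) (by omega))
  have hc₁ : Function.update (Function.update ρ 3 (ρ 1)) 10 (sA.reg 0) 2 = ρ 2 := by simp
  have ht₁ : Function.update (Function.update ρ 3 (ρ 1)) 10 (sA.reg 0) 10 = sA.reg 0 := by simp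
  generalize Function.update (Function.update ρ 3 (ρ 1)) 10 (sA.reg 0) = ρ₁ at hs₁ hk₁ hc₁ ht₁
  refine .simInstr hs₁ hB (by omega) _ (fun h1 _ => h1) fun ρ₂ m₂ hs₂ hc₂ hf₂ => ?_
  refine .seq (.asg ha (.seq ?_))
  have ht₂ := (hf₂.1 10 (by omega) (by omega)).trans ht₁
  have hk₂ := hk₁.trans hf₂.keeps
  have e2 : ∀ v, Function.update ρ₂ 40 v 2 = ρ₂ 2 := fun v => by simp
  refine .simInstr (hs₂.setReg_zero _) hB (by rw [e2]; omega) _ (fun h1 _ => h1)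
    fun ρ₃ m₃ hs₃ hc₃ hf₃ => ?_
  rw [e2] at hc₃
  have ht₃ : ρ₃ 10 = sA.reg 0 := by rw [hf₃.1 10 (by omega) (by omega)]; simpa using ht₂
  have hk₃ := (hk₂.trans (.update ρ₂ m₂ (d := 40) (v := a) (by omega))).trans hf₃.keeps
  refine .seq (.asg hidx ?_)
  have e3 : ∀ v, Function.update ρ₃ 40 v 2 = ρ₃ 2 := fun v => by simp
  refine .simInstr (hs₃.setReg_zero _) hB (by rw [e3]; omega) _ (fun h1 _ => h1)
    fun ρ₄ m₄ hs₄ hc₄ hf₄ => ?_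
  rw [e3] at hc₄
  refine h idx _ _ ?_ (by omega) ?_ ((hk₃.trans (.update ρ₃ m₃ (d := 40) (v := idx)
    (by omega))).trans hf₄.keeps)
  · convert hs₄ using 1
    simp [State.setReg, Instr.step]
  · rw [hf₄.1 10 (by omega) (by omega)]; simpa using ht₃

theorem Tri.goback {sA' : State} (hs : Sim sA' sv ρ m) (h10 : ρ 10 = sA.reg 0)
    (hreg : ∀ r, r ≠ 0 → sA'.reg r = sA.reg r) (hsv : sv = sA.addr) (hmem : sA'.mem = sA.mem)
    (h : ∀ ρ', Sim sA sv ρ' m → ρ' 2 = ρ 2 → Keeps ρ m ρ' m → Q ρ' m) :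
    Tri B S τ goback ρ m Q := by
  refine .seq (.asg trivial (.asg trivial ?_))
  have := hs.restore.setReg_zero (ρ 10)
  refine h _ ?_ ?_ ((Keeps.update ρ m (d := 1) (by omega)).trans (.update _ _ (by omega)))
  · convert this using 1
    · obtain ⟨r, a, mm⟩ := sA
      simp only [State.setReg, State.mk.injEq]
      refine ⟨?_, hsv.symm, hmem.symm⟩
      funext i
      by_cases hi : i = 0
      · subst hi; simp [h10]
      · simpa [Function.update_of_ne hi] using (hreg i hi).symm
    · simp
  · simp

theorem Tri.wr (hs : Sim sA sv ρ m) (hB : 9 ≤ B) (hc : ρ 2 + 4 ≤ B) {idx d : ℕ} (hidx : idx ≤ B)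
    (hd : 11 ≤ d) (hd' : d < 40)
    (h : ∀ ρ' m', Sim { sA with mem := Function.update sA.mem [0, idx] (ρ d) } sA.addr ρ' m' →
      ρ' 2 ≤ ρ 2 + 4 → Keeps ρ m ρ' m' → Q ρ' m') :
    Tri B S τ (wr idx d) ρ m Q := by
  refine .seq (.goto hs hB (by omega) (Nat.zero_le _) hidx fun v ρ₁ m₁ hs₁ hc₁ ht₁ hk₁ => ?_)
  refine .seq (.asg trivial (.seq ?_))
  have e1 : ∀ v, Function.update ρ₁ 40 v 2 = ρ₁ 2 := fun v => by simp
  refine .simInstr (hs₁.setReg_zero _) hB (by rw [e1]; omega) _ (fun h1 _ => h1)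
    fun ρ₂ m₂ hs₂ hc₂ hf₂ => ?_
  rw [e1] at hc₂
  have ht₂ : ρ₂ 10 = sA.reg 0 := by rw [hf₂.1 10 (by omega) (by omega)]; simpa using ht₁
  have hk₂ := (hk₁.trans (.update ρ₁ m₁ (d := 40) (by omega))).trans hf₂.keeps
  refine .goback (sA := { sA with mem := Function.update sA.mem [0, idx] (ρ d) }) hs₂ ht₂
    ?_ rfl ?_ fun ρ₃ hs₃ hc₃ hk₃ => h _ _ hs₃ (by omega) (hk₂.trans hk₃)
  · intro r hr; simp [State.setReg, Instr.step, Function.update_of_ne hr]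
  · simp [State.setReg, Instr.step, hk₁.1 d hd hd']

theorem Tri.rd (hs : Sim sA sv ρ m) (hB : 9 ≤ B) (hc : ρ 2 + 4 ≤ B) {d : ℕ}
    (hd : 11 ≤ d) (hd' : d < 40)
    (h : ∀ ρ' m', Sim sA sA.addr ρ' m' → ρ' 2 ≤ ρ 2 + 4 →
      Keeps (Function.update ρ d (sA.output 0)) m ρ' m' → Q ρ' m') :
    Tri B S τ (rd d) ρ m Q := by
  refine .seq (.goto hs hB (by omega) (by omega) (Nat.zero_le _)
    fun v ρ₁ m₁ hs₁ hc₁ ht₁ hk₁ => .seq ?_)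
  refine .simInstr hs₁ hB (by omega) _ (fun h1 h2 r => ?_) fun ρ₂ m₂ hs₂ hc₂ hf₂ => ?_
  · by_cases hr : r = 0
    · subst hr; simpa [Instr.step, State.setReg] using h2 _
    · have := h1 r
      simpa [Instr.step, State.setReg, hr] using this
  refine .seq (.asg trivial ?_)
  have h40 : ρ₂ 40 = sA.output 0 := by
    rw [hs₂.reg_eq 0]; simp [Instr.step, State.setReg, State.output]
  simp only [Ex.eval, h40]
  have e2 : ∀ v, Function.update ρ₂ d v 2 = ρ₂ 2 := fun v => Function.update_of_ne (by omega) _ _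
  have e10 : ∀ v, Function.update ρ₂ d v 10 = ρ₂ 10 := fun v =>
    Function.update_of_ne (by omega) _ _
  refine .goback (sA := sA) (hs₂.congr (fun i hi => Function.update_of_ne (by omega) _ _)
    fun _ _ => rfl) ?_ ?_ rfl rfl fun ρ₃ hs₃ hc₃ hk₃ => h _ _ hs₃ (by rw [e2] at hc₃; omega) ?_
  · rw [e10, hf₂.1 10 (by omega) (by omega), ht₁]
  · intro r hr; simp [State.setReg, Instr.step, Function.update_of_ne hr]
  · have hk₂ := hk₁.trans hf₂.keeps
    refine Keeps.trans ⟨fun i h1 h2 => ?_, hk₂.2⟩ hk₃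
    by_cases hi : i = d
    · subst hi; simp
    · rw [Function.update_of_ne hi, Function.update_of_ne hi, hk₂.1 i h1 h2]

/-- Write the values of expressions to consecutive input cells, starting with number `i`. -/
def wrs : ℕ → List Ex → PL
  | _, [] => .skip
  | i, e :: es => asg 11 e ;; wr i 11 ;; wrs (i + 1) es

/-- The configuration after the words `xs` have been written to the input cells from number `i`
on. -/
def State.inputFrom (s : State) : ℕ → List ℕ → State
  | _, [] => s
  | i, x :: xs => State.inputFrom { s with mem := Function.update s.mem [0, i] x } (i + 1) xs

theorem State.inputFrom_reg (xs : List ℕ) : ∀ (s : State) (i : ℕ),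
    (s.inputFrom i xs).reg = s.reg ∧ (s.inputFrom i xs).addr = s.addr := by
  induction xs with
  | nil => exact fun _ _ => ⟨rfl, rfl⟩
  | cons x xs ih => exact fun s i => ih _ _

theorem State.inputFrom_mem (xs : List ℕ) : ∀ (s : State) (i : ℕ) (a : List ℕ),
    (s.inputFrom i xs).mem a = match a with
      | [0, j] => if i ≤ j then (xs[j - i]?).getD (s.mem [0, j]) else s.mem [0, j]
      | a => s.mem a := by
  induction xs with
  | nil =>
    intro s i a
    simp only [State.inputFrom]
    split <;> simp
  | cons x xs ih =>
    intro s i a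
    rw [State.inputFrom, ih]
    split
    · rename_i j
      rcases lt_trichotomy i j with h | rfl | h
      · have h1 : j - i = j - (i + 1) + 1 := by omega
        have h2 : i + 1 ≤ j := h
        have h3 : i ≤ j := h.le
        have h4 : [0, j] ≠ [0, i] := by simp; omega
        rw [if_pos h2, if_pos h3, h1, List.getElem?_cons_succ]
        exact congrArg _ (Function.update_of_ne h4 _ _)
      · simp
      · have h2 : ¬ i + 1 ≤ j := by omega
        have h3 : ¬ i ≤ j := by omega
        have h4 : [0, j] ≠ [0, i] := by simp; omega
        rw [if_neg h2, if_neg h3]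
        exact Function.update_of_ne h4 _ _
    · rename_i a h
      exact Function.update_of_ne (fun e => h _ e) _ _

theorem State.input_eq (s : State) (xs : List ℕ) : s.input xs = s.inputFrom 0 xs := by
  obtain ⟨h1, h2⟩ := State.inputFrom_reg xs s 0
  have h3 : (s.inputFrom 0 xs).mem = (s.input xs).mem := by
    funext a
    rw [State.inputFrom_mem]
    simp only [State.input]
    split <;> simp
  cases h : s.inputFrom 0 xs
  rw [h] at h1 h2 h3
  simp only [State.input] at *
  simp [h1, h2, h3]

/-- An expression that only refers to registers of the driver other than the scratch register
`11`. -/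
def Ex.Simple : Ex → Prop
  | .lit _ => True
  | .reg r => 12 ≤ r ∧ r < 40
  | _ => False

theorem Tri.wrs (es : List Ex) : ∀ (i : ℕ) (sA : State) (sv : List ℕ) (ρ : ℕ → ℕ) (m : Mem)
    (Q : (ℕ → ℕ) → Mem → Prop), Sim sA sv ρ m → 9 ≤ B → ρ 2 + 4 * es.length ≤ B →
    i + es.length ≤ B → (∀ e ∈ es, e.Simple) → (∀ e ∈ es, e.eval ρ m ≤ B) →
    (∀ v ρ' m' sv', Sim (sA.inputFrom i (es.map (Ex.eval ρ m))) sv' ρ' m' →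
      ρ' 2 ≤ ρ 2 + 4 * es.length → Keeps (Function.update ρ 11 v) m ρ' m' → Q ρ' m') →
    Tri B S τ (wrs i es) ρ m Q := by
  induction es with
  | nil =>
    intro i sA sv ρ m Q hs _ _ _ _ _ h
    refine .skip (h (ρ 11) _ _ _ hs (by omega) ?_)
    simpa using Keeps.refl ρ m
  | cons e es ih =>
    intro i sA sv ρ m Q hs hB hc hi hes hle h
    simp only [List.length_cons] at hc hi
    have he : e.Ok B ρ m := by
      have h1 := hes e (by simp)
      have h2 := hle e (by simp)
      cases e with
      | reg r => trivial
      | lit c => exact h2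
      | _ => exact h1.elim
    refine .seq (.asg he (.seq ?_))
    set x := e.eval ρ m with hx
    have hs₁ : Sim sA sv (Function.update ρ 11 x) m :=
      hs.congr (fun i hi => Function.update_of_ne (by omega) _ _) fun _ _ => rfl
    have e2 : Function.update ρ 11 x 2 = ρ 2 := by simp
    refine .wr hs₁ hB (by omega) (by omega) le_rfl (by omega) fun ρ₂ m₂ hs₂ hc₂ hk₂ => ?_
    have hev : ∀ e' ∈ es, e'.eval ρ₂ m₂ = e'.eval ρ m := fun e' he' => by
      have h1 := hes e' (by simp [he'])
      cases e' with
      | reg r =>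
        obtain ⟨h2, h3⟩ := h1
        simp only [Ex.eval]
        rw [hk₂.1 r (by omega) h3, Function.update_of_ne (by omega)]
      | lit c => rfl
      | _ => exact h1.elim
    refine ih (i + 1) _ _ _ _ Q hs₂ hB (by omega) (by omega)
      (fun e' he' => hes e' (by simp [he'])) (fun e' he' => by
        rw [hev e' he']; exact hle e' (by simp [he'])) fun v ρ₃ m₃ sv' hs₃ hc₃ hk₃ => ?_
    refine h v _ _ sv' ?_ ?_ ?_
    · rw [List.map_congr_left hev] at hs₃
      simpa [State.inputFrom] using hs₃
    · simp only [List.length_cons]; omega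
    · refine ⟨fun j h1 h2 => ?_, fun a h1 h2 => (hk₃.2 a h1 h2).trans (hk₂.2 a h1 h2)⟩
      rw [hk₃.1 j h1 h2]
      by_cases hj : j = 11
      · subst hj; simp
      · rw [Function.update_of_ne hj, Function.update_of_ne hj, hk₂.1 j h1 h2,
          Function.update_of_ne hj]

/-- Call a routine of the simulated algorithm on an input given by expressions. -/
def callOn (es : List Ex) (p : Prog) : PL := wrs 0 es ;; .call (simProg p)

theorem Tri.callOn {es : List Ex} {p : Prog} {BA t : ℕ} {sA' : State} (hs : Sim sA sv ρ m)
    (hB : 9 ≤ B) (hBA : BA ≤ B) (hc : ρ 2 + (4 * es.length + t) ≤ B) (hlen : es.length ≤ B)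
    (hes : ∀ e ∈ es, e.Simple) (hle : ∀ e ∈ es, e.eval ρ m ≤ B)
    (hex : Exec BA p (sA.input (es.map (Ex.eval ρ m))) t sA') (ht : 16 * t ≤ τ)
    (h : ∀ v ρ' m' sv', Sim sA' sv' ρ' m' → ρ' 2 ≤ ρ 2 + (4 * es.length + t) →
      Keeps (Function.update ρ 11 v) m ρ' m' → Q ρ' m') :
    Tri B S τ (callOn es p) ρ m Q := by
  refine .seq (.wrs es 0 sA sv ρ m _ hs hB (by omega) (by omega) hes hle
    fun v ρ₁ m₁ sv₁ hs₁ hc₁ hk₁ => ?_)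
  rw [← State.input_eq] at hs₁
  intro s hb e1 e2
  subst e1 e2
  obtain ⟨t', s', h1, h2, h3, h4, h5, h6⟩ := sim_exec hBA hB hex s hs₁ hb (by omega)
  exact ⟨t', s', h1, h2.trans ht, h3, h v _ _ _ h4 (by omega) (hk₁.trans h6.keeps)⟩

end Driver

end DynCQ

namespace DynCQ

variable {σ : Schema} {k : ℕ}

/-! ### Matrix-vector multiplication by means of a dynamic algorithm for testing -/

theorem le_maxWord {xs : List ℕ} {x : ℕ} (h : x ∈ xs) : x ≤ maxWord xs := by
  induction xs with
  | nil => simp at h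
  | cons y ys ih =>
    rcases List.mem_cons.1 h with rfl | h
    · exact le_max_left _ _
    · exact (ih h).trans (le_max_right _ _)

theorem maxWord_le {xs : List ℕ} {b : ℕ} (h : ∀ x ∈ xs, x ≤ b) : maxWord xs ≤ b := by
  induction xs with
  | nil => exact Nat.zero_le _
  | cons y ys ih =>
    exact max_le (h y (by simp)) (ih fun x hx => h x (by simp [hx]))

/-- The driver owns the logical registers from `12` to `39` across calls, and all arrays but `8`
and `9`. -/
def Kept (ρ : ℕ → ℕ) (m : Mem) (ρ' : ℕ → ℕ) (m' : Mem) : Prop :=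
  (∀ i, 12 ≤ i → i < 40 → ρ' i = ρ i) ∧
    ∀ a : List ℕ, a.head? ≠ some 8 → a.head? ≠ some 9 → m' a = m a

theorem Kept.refl (ρ : ℕ → ℕ) (m : Mem) : Kept ρ m ρ m :=
  ⟨fun _ _ _ => rfl, fun _ _ _ => rfl⟩

theorem Kept.trans {ρ ρ' ρ'' : ℕ → ℕ} {m m' m'' : Mem} (h : Kept ρ m ρ' m')
    (h' : Kept ρ' m' ρ'' m'') : Kept ρ m ρ'' m'' :=
  ⟨fun i h1 h2 => (h'.1 i h1 h2).trans (h.1 i h1 h2),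
    fun a h1 h2 => (h'.2 a h1 h2).trans (h.2 a h1 h2)⟩

theorem Keeps.kept {ρ ρ' : ℕ → ℕ} {m m' : Mem} {v : ℕ}
    (h : Keeps (Function.update ρ 11 v) m ρ' m') : Kept ρ m ρ' m' :=
  ⟨fun i h1 h2 => (h.1 i (by omega) h2).trans (Function.update_of_ne (by omega) _ _), h.2⟩

namespace Gadget

variable {c : CQ σ k} (G : Gadget c)

/-- The value of a term, where register `13` holds the code of the row and register `14` that of
the column. -/
def termEx : Term → Ex
  | .var z => if z = G.x then .reg 13 else if z = G.y then .reg 14 else .lit (G.b + 1 + z)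
  | .const a => .lit a

/-- The input of the update routine for an atom in the context of a row and a column. -/
def atomEx (ins : Bool) (ψ : Atom σ) : List Ex :=
  .lit ins.toNat :: .lit ψ.rel :: (List.ofFn ψ.args).map G.termEx

/-- Registers `13` and `14` hold the codes of row `i` and column `j`. -/
def At (i j : ℕ) (ρ : ℕ → ℕ) : Prop :=
  ρ 13 = G.b + 1 + G.w + 2 * i ∧ ρ 14 = G.b + 1 + G.w + (2 * j + 1)

variable {G}

theorem eval_termEx {i j : ℕ} {ρ : ℕ → ℕ} {m : Mem} (h : G.At i j ρ) (t : Term) :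
    (G.termEx t).eval ρ m = (t.eval (G.val i j) : ℕ) := by
  cases t with
  | var z =>
    simp only [termEx, Term.eval, val, code, PNat.mk_coe]
    split_ifs <;> simp [h.1, h.2]
  | const a => rfl

theorem simple_termEx (t : Term) : (G.termEx t).Simple := by
  cases t with
  | var z => simp only [termEx]; split_ifs <;> simp [Ex.Simple]
  | const a => trivial

theorem eval_atomEx {i j : ℕ} {ρ : ℕ → ℕ} {m : Mem} (h : G.At i j ρ) (ins : Bool) (ψ : Atom σ) :
    (G.atomEx ins ψ).map (Ex.eval ρ m) = updateInput (G.upd ins ψ i j) := by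
  simp only [atomEx, List.map_cons, Ex.eval, updateInput, upd, List.map_ofFn]
  congr 3
  funext l
  exact eval_termEx h _

theorem simple_atomEx (ins : Bool) (ψ : Atom σ) : ∀ e ∈ G.atomEx ins ψ, e.Simple := by
  intro e he
  simp only [atomEx, List.mem_cons, List.mem_map] at he
  rcases he with rfl | rfl | ⟨t, _, rfl⟩
  · trivial
  · trivial
  · exact simple_termEx t

theorem eval_headEx {i : ℕ} {ρ : ℕ → ℕ} {m : Mem} (h : G.At i 0 ρ) :
    ((List.ofFn c.head).map G.termEx).map (Ex.eval ρ m) = testInput (G.tuple i) := by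
  simp only [List.map_ofFn, testInput, tuple]
  congr 1
  funext l
  exact eval_termEx h _

theorem maxWord_updateInput_le {n i j : ℕ} (hi : i < n) (hj : j < n) (ins : Bool) {ψ : Atom σ}
    (hψ : ψ ∈ c.atoms) :
    maxWord (updateInput (G.upd ins ψ i j)) ≤ G.bound n + σ.numRel + 1 := by
  refine maxWord_le fun x hx => ?_
  simp only [updateInput, upd, List.mem_cons, List.mem_ofFn] at hx
  rcases hx with rfl | rfl | ⟨l, rfl⟩
  · have := Bool.toNat_le ins; omega
  · have := ψ.rel.isLt; omega
  · have := eval_le (G := G) hi hj hψ l; omega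

theorem maxWord_testInput_le {n i : ℕ} (hi : i < n) :
    maxWord (testInput (G.tuple i)) ≤ G.bound n + σ.numRel + 1 := by
  refine maxWord_le fun x hx => ?_
  simp only [testInput, tuple, List.mem_ofFn] at hx
  obtain ⟨l, rfl⟩ := hx
  cases hl : c.head l with
  | var z =>
    have := G.occ_lt z (CQ.mem_occ_of_head hl)
    simp only [Term.eval, val, code, PNat.mk_coe, bound]
    split_ifs <;> omega
  | const a =>
    have := G.cons_le a (.inr ⟨l, hl⟩)
    simp only [Term.eval, bound]; omega

/-- The facts concern only the first `n` rows and columns. -/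
def Adm (c : CQ σ k) (n : ℕ) (F : Atom σ → ℕ → ℕ → Prop) : Prop :=
  ∀ ψ ∈ c.atoms, ∀ i j, F ψ i j → i < n ∧ j < n

variable (G) in
/-- What the driver for dimension `n` needs to know about the dynamic algorithm `A` and about the
bounds: `N₀` bounds the input sizes, `B` the words, `τ` the simulated time of a call, and `Y` the
number of nodes that the simulation creates in a call. -/
structure Env (A : DynAlg) (q : CQ σ k) (𝒞 : Set (Database σ)) (n N₀ B τ Y : ℕ) : Prop where
  nine_le : 9 ≤ B
  pow_le : N₀ ^ A.wordExp ≤ B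
  size_le_word : N₀ ≤ B
  mem : ∀ D F, G.Rep D F → Adm c n F → D ∈ 𝒞
  size_le : ∀ D F, G.Rep D F → Adm c n F →
    q.size + D.size + (G.bound n + σ.numRel + 1) ≤ N₀
  update : ∀ N D s F, Reachable A q 𝒞 N D s → G.Rep D F → Adm c n F → ∀ u : Update σ,
    D.apply u ∈ 𝒞 → ∃ t s', Exec (max N (inputSize q (D.apply u) (updateInput u)) ^ A.wordExp)
      A.update (s.input (updateInput u)) t s' ∧ 16 * t ≤ τ
  test : ∀ N D s F, Reachable A q 𝒞 N D s → G.Rep D F → Adm c n F → ∀ a : Fin k → Dom,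
    ∃ t s', Exec (max N (inputSize q D (testInput a)) ^ A.wordExp) A.test
      (s.input (testInput a)) t s' ∧ 16 * t ≤ τ ∧
      (a ∈ c.result D → s'.output 0 = 1) ∧ (a ∉ c.result D → s'.output 0 = 0)
  update_nodes : ∀ R, 4 * (2 + σ.ar R) + τ ≤ Y
  test_nodes : 4 * k + τ + 4 ≤ Y
  consts : G.bound n + 2 ≤ B

/-- The simulated algorithm has been run on the database described by `F`, and the simulation
has created at most `b` nodes. -/
def Good (G : Gadget c) (A : DynAlg) (q : CQ σ k) (𝒞 : Set (Database σ)) (n N₀ b : ℕ)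
    (F : Atom σ → ℕ → ℕ → Prop) (ρ : ℕ → ℕ) (m : Mem) : Prop :=
  ∃ D N sA sv, G.Rep D F ∧ Adm c n F ∧ Reachable A q 𝒞 N D sA ∧ N ≤ N₀ ∧ Sim sA sv ρ m ∧
    ρ 2 ≤ b

variable {A : DynAlg} {q : CQ σ k} {𝒞 : Set (Database σ)} {n N₀ B S τ Y b : ℕ}
  {F F' : Atom σ → ℕ → ℕ → Prop} {ρ ρ' : ℕ → ℕ} {m m' : Mem} {Q : (ℕ → ℕ) → Mem → Prop}

theorem Good.congr (h : Good G A q 𝒞 n N₀ b F ρ m)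
    (hF : ∀ ψ ∈ c.atoms, ∀ i j, F ψ i j ↔ F' ψ i j) : Good G A q 𝒞 n N₀ b F' ρ m := by
  obtain ⟨D, N, sA, sv, h1, h2, h3⟩ := h
  exact ⟨D, N, sA, sv, h1.congr hF, fun ψ hψ i j h => h2 ψ hψ i j ((hF ψ hψ i j).2 h), h3⟩

theorem Good.mono {b' : ℕ} (h : Good G A q 𝒞 n N₀ b F ρ m) (hb : b ≤ b') :
    Good G A q 𝒞 n N₀ b' F ρ m := by
  obtain ⟨D, N, sA, sv, h1, h2, h3, h4, h5, h6⟩ := h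
  exact ⟨D, N, sA, sv, h1, h2, h3, h4, h5, h6.trans hb⟩

theorem Good.frame (h : Good G A q 𝒞 n N₀ b F ρ m) (hρ : ∀ i, i < 10 ∨ 40 ≤ i → ρ' i = ρ i)
    (hm : ∀ a : List ℕ, a.head? = some 8 ∨ a.head? = some 9 → m' a = m a) :
    Good G A q 𝒞 n N₀ b F ρ' m' := by
  obtain ⟨D, N, sA, sv, h1, h2, h3, h4, h5, h6⟩ := h
  exact ⟨D, N, sA, sv, h1, h2, h3, h4, h5.congr hρ hm, by rw [hρ 2 (by omega)]; exact h6⟩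

theorem Good.asg (h : Good G A q 𝒞 n N₀ b F ρ m) {d v : ℕ} (h1 : 10 ≤ d) (h2 : d < 40) :
    Good G A q 𝒞 n N₀ b F (Function.update ρ d v) m :=
  h.frame (fun _ _ => Function.update_of_ne (by omega) _ _) fun _ _ => rfl

/-- Run the update routine for an atom in the context of a row and a column. -/
def cmd (G : Gadget c) (A : DynAlg) (ins : Bool) (ψ : Atom σ) : PL :=
  callOn (G.atomEx ins ψ) A.update

/-- A simulated update keeps the invariant of the simulation. -/
theorem tri_cmd (E : Env G A q 𝒞 n N₀ B τ Y) {ins : Bool} {ψ₀ : Atom σ} {i₀ j₀ : ℕ}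
    (hF : ∀ D, G.Rep D F → G.Rep (D.apply (G.upd ins ψ₀ i₀ j₀)) F') (hF' : Adm c n F')
    (hψ : ψ₀ ∈ c.atoms) (hi : i₀ < n) (hj : j₀ < n) (hat : G.At i₀ j₀ ρ) (hb : b + Y ≤ B)
    (hg : Good G A q 𝒞 n N₀ b F ρ m)
    (h : ∀ ρ' m', Good G A q 𝒞 n N₀ (b + Y) F' ρ' m' → Kept ρ m ρ' m' → Q ρ' m') :
    Tri B S τ (cmd G A ins ψ₀) ρ m Q := by
  obtain ⟨D, N, sA, sv, h1, h2, h3, h4, h5, h6⟩ := hg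
  have hrep := hF D h1
  have hD := E.mem _ _ hrep hF'
  obtain ⟨t, s', hex, ht⟩ := E.update N D sA F h3 h1 h2 _ hD
  have hsize : inputSize q (D.apply (G.upd ins ψ₀ i₀ j₀)) (updateInput (G.upd ins ψ₀ i₀ j₀)) ≤ N₀ :=
    (Nat.add_le_add_left (maxWord_updateInput_le hi hj ins hψ) _).trans (E.size_le _ _ hrep hF')
  have hlen : (G.atomEx ins ψ₀).length = 2 + σ.ar ψ₀.rel := by
    simp [atomEx]; omega
  have hY := E.update_nodes ψ₀.rel
  have hword := E.size_le_word
  refine .callOn h5 E.nine_le ((Nat.pow_le_pow_left (max_le h4 hsize) _).trans E.pow_le)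
    (by rw [hlen]; omega) (by rw [hlen]; omega) (simple_atomEx ins ψ₀) (fun e he => ?_)
    (by rw [eval_atomEx (m := m) hat ins ψ₀]; exact hex) ht fun v ρ' m' sv' hs hc hk => ?_
  · have h7 : e.eval ρ m ∈ updateInput (G.upd ins ψ₀ i₀ j₀) := by
      rw [← eval_atomEx (m := m) hat ins ψ₀]; exact List.mem_map_of_mem he
    refine (le_maxWord h7).trans (le_trans ?_ (hsize.trans hword))
    exact Nat.le_add_left _ _
  · refine h _ _ ⟨_, _, s', sv', hrep, hF', .update _ h3 hD hex, max_le h4 hsize, hs, ?_⟩ hk.kept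
    rw [hlen] at hc; omega

theorem tri_insert (E : Env G A q 𝒞 n N₀ B τ Y) {ψ₀ : Atom σ} {i₀ j₀ : ℕ}
    (hψ : ψ₀ ∈ c.atoms) (hi : i₀ < n) (hj : j₀ < n) (hat : G.At i₀ j₀ ρ) (hb : b + Y ≤ B)
    (hg : Good G A q 𝒞 n N₀ b F ρ m)
    (h : ∀ ρ' m', Good G A q 𝒞 n N₀ (b + Y)
      (fun ψ i j => F ψ i j ∨ (ψ = ψ₀ ∧ i = i₀ ∧ j = j₀)) ρ' m' → Kept ρ m ρ' m' → Q ρ' m') :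
    Tri B S τ (cmd G A true ψ₀) ρ m Q := by
  obtain ⟨_, _, _, _, _, hadm, _⟩ := id hg
  refine tri_cmd E (fun D hD => hD.insert hψ i₀ j₀) ?_ hψ hi hj hat hb hg h
  rintro ψ hψ i j (h1 | ⟨rfl, rfl, rfl⟩)
  · exact hadm ψ hψ i j h1
  · exact ⟨hi, hj⟩

theorem tri_erase (E : Env G A q 𝒞 n N₀ B τ Y) {ψ₀ : Atom σ} {i₀ j₀ : ℕ}
    (hψ : ψ₀ ∈ c.atoms) (hi : i₀ < n) (hj : j₀ < n) (hat : G.At i₀ j₀ ρ) (hb : b + Y ≤ B)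
    (hg : Good G A q 𝒞 n N₀ b F ρ m)
    (h : ∀ ρ' m', Good G A q 𝒞 n N₀ (b + Y)
      (fun ψ i j => F ψ i j ∧ ψ.fact (G.val i j) ≠ ψ₀.fact (G.val i₀ j₀)) ρ' m' →
      Kept ρ m ρ' m' → Q ρ' m') :
    Tri B S τ (cmd G A false ψ₀) ρ m Q := by
  obtain ⟨_, _, _, _, _, hadm, _⟩ := id hg
  exact tri_cmd E (fun D hD => hD.erase ψ₀ i₀ j₀) (fun ψ hψ i j h1 => hadm ψ hψ i j h1.1)
    hψ hi hj hat hb hg h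

/-- Run the test routine for the current row, and read its answer into register `18`. -/
def testRow (G : Gadget c) (A : DynAlg) : PL :=
  callOn ((List.ofFn c.head).map G.termEx) A.test ;; rd 18

open Classical in
theorem tri_testRow (E : Env G A q 𝒞 n N₀ B τ Y) {i₀ : ℕ} {p : Prop} (hi : i₀ < n)
    (hat : G.At i₀ 0 ρ) (hb : b + Y ≤ B) (hg : Good G A q 𝒞 n N₀ b F ρ m)
    (hp : ∀ D, G.Rep D F → (G.tuple i₀ ∈ c.result D ↔ p))
    (h : ∀ ρ' m', Good G A q 𝒞 n N₀ (b + Y) F ρ' m' →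
      Kept (Function.update ρ 18 (if p then 1 else 0)) m ρ' m' → Q ρ' m') :
    Tri B S τ (testRow G A) ρ m Q := by
  obtain ⟨D, N, sA, sv, h1, h2, h3, h4, h5, h6⟩ := hg
  obtain ⟨t, s', hex, ht, hyes, hno⟩ := E.test N D sA F h3 h1 h2 (G.tuple i₀)
  have hsize : inputSize q D (testInput (G.tuple i₀)) ≤ N₀ :=
    (Nat.add_le_add_left (maxWord_testInput_le hi) _).trans (E.size_le _ _ h1 h2)
  have hlen : ((List.ofFn c.head).map G.termEx).length = k := by simp
  have hY := E.test_nodes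
  have hword := E.size_le_word
  have hev := eval_headEx (m := m) hat
  refine .seq (.callOn h5 E.nine_le ((Nat.pow_le_pow_left (max_le h4 hsize) _).trans E.pow_le)
    (by rw [hlen]; omega) (by rw [hlen]; omega) ?_ (fun e he => ?_)
    (by rw [hev]; exact hex) ht fun v ρ₁ m₁ sv₁ hs₁ hc₁ hk₁ => ?_)
  · intro e he
    obtain ⟨t, _, rfl⟩ := List.mem_map.1 he
    exact simple_termEx t
  · have h7 : e.eval ρ m ∈ testInput (G.tuple i₀) := by
      rw [← hev]; exact List.mem_map_of_mem he
    exact (le_maxWord h7).trans (le_trans (Nat.le_add_left _ _) (hsize.trans hword))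
  · rw [hlen] at hc₁
    refine .rd hs₁ E.nine_le (by omega) (by omega) (by omega) fun ρ₂ m₂ hs₂ hc₂ hk₂ => ?_
    have hout : s'.output 0 = if p then 1 else 0 := by
      split_ifs with hp'
      · exact hyes ((hp D h1).2 hp')
      · exact hno fun h' => hp' ((hp D h1).1 h')
    refine h _ _ ⟨D, _, s', _, h1, h2, .test _ h3 hex, max_le h4 hsize, hs₂, by omega⟩ ?_
    have hk₁ := hk₁.kept
    refine ⟨fun i hi1 hi2 => ?_, fun a h1 h2 => (hk₂.2 a h1 h2).trans (hk₁.2 a h1 h2)⟩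
    rw [hk₂.1 i (by omega) hi2, hout]
    by_cases hi : i = 18
    · subst hi; simp
    · rw [Function.update_of_ne hi, Function.update_of_ne hi, hk₁.1 i hi1 hi2]

open Classical in
/-- Insert the facts for a list of atoms, in the context of the current row and column. Register
`15` tells whether the fact for `ψxy` is inserted. -/
noncomputable def insAll (G : Gadget c) (A : DynAlg) : List (Atom σ) → PL
  | [] => .skip
  | ψ :: l => (if ψ = G.ψxy then ifE (.reg 15) (cmd G A true ψ) .skip else cmd G A true ψ) ;;
      insAll G A l

theorem tri_insAll (E : Env G A q 𝒞 n N₀ B τ Y) {i₀ j₀ : ℕ} (hi : i₀ < n) (hj : j₀ < n)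
    (l : List (Atom σ)) : ∀ (b : ℕ) (F : Atom σ → ℕ → ℕ → Prop) (ρ : ℕ → ℕ) (m : Mem)
      (Q : (ℕ → ℕ) → Mem → Prop), (∀ ψ ∈ l, ψ ∈ c.atoms) → G.At i₀ j₀ ρ → b + l.length * Y ≤ B →
      Good G A q 𝒞 n N₀ b F ρ m →
      (∀ ρ' m', Good G A q 𝒞 n N₀ (b + l.length * Y)
        (fun ψ i j => F ψ i j ∨ (ψ ∈ l ∧ (ψ = G.ψxy → ρ 15 ≠ 0) ∧ i = i₀ ∧ j = j₀)) ρ' m' →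
        Kept ρ m ρ' m' → Q ρ' m') →
      Tri B S τ (insAll G A l) ρ m Q := by
  induction l with
  | nil =>
    intro b F ρ m Q _ _ _ hg h
    refine .skip (h _ _ ?_ (.refl _ _))
    exact (hg.congr (by simp)).mono (by omega)
  | cons ψ₀ l ih =>
    intro b F ρ m Q hl hat hb hg h
    have hlen : (ψ₀ :: l).length * Y = Y + l.length * Y := by
      rw [List.length_cons, Nat.succ_mul, Nat.add_comm]
    rw [hlen] at hb h
    have hψ₀ := hl ψ₀ (by simp)
    -- both cases continue with the rest of the list
    have rest : ∀ ρ₁ m₁, Good G A q 𝒞 n N₀ (b + Y) (fun ψ i j => F ψ i j ∨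
        (ψ = ψ₀ ∧ (ψ = G.ψxy → ρ 15 ≠ 0) ∧ i = i₀ ∧ j = j₀)) ρ₁ m₁ → Kept ρ m ρ₁ m₁ →
        Tri B S τ (insAll G A l) ρ₁ m₁ Q := by
      intro ρ₁ m₁ hg₁ hk₁
      have h15 := hk₁.1 15 (by omega) (by omega)
      refine ih (b + Y) _ ρ₁ m₁ Q (fun ψ hψ => hl ψ (by simp [hψ]))
        ⟨(hk₁.1 13 (by omega) (by omega)).trans hat.1,
          (hk₁.1 14 (by omega) (by omega)).trans hat.2⟩ (by omega) hg₁ fun ρ₂ m₂ hg₂ hk₂ => ?_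
      refine h _ _ ((hg₂.congr fun ψ _ i j => ?_).mono (by omega)) (hk₁.trans hk₂)
      rw [h15]
      simp only [List.mem_cons]
      tauto
    simp only [Gadget.insAll]
    refine .seq ?_
    split_ifs with hxy
    · refine .ifE trivial (fun h15 => ?_) fun h15 => ?_
      · refine tri_insert E hψ₀ hi hj hat (by omega) hg fun ρ₁ m₁ hg₁ hk₁ => rest _ _ ?_ hk₁
        refine hg₁.congr fun ψ _ i j => ?_
        have : ρ 15 ≠ 0 := h15
        tauto
      · refine .skip (rest _ _ ((hg.congr fun ψ _ i j => ?_).mono (by omega)) (.refl _ _))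
        have : ¬ ρ 15 ≠ 0 := not_not.2 h15
        constructor
        · exact .inl
        · rintro (h1 | ⟨rfl, h1, _⟩)
          · exact h1
          · exact absurd (h1 hxy) this
    · refine tri_insert E hψ₀ hi hj hat (by omega) hg fun ρ₁ m₁ hg₁ hk₁ => rest _ _ ?_ hk₁
      refine hg₁.congr fun ψ _ i j => ?_
      constructor
      · rintro (h1 | ⟨rfl, h1⟩)
        · exact .inl h1
        · exact .inr ⟨rfl, fun h2 => absurd h2 hxy, h1⟩
      · rintro (h1 | ⟨rfl, _, h1⟩)
        · exact .inl h1
        · exact .inr ⟨rfl, h1⟩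

end Gadget

end DynCQ

namespace DynCQ

variable {σ : Schema} {k : ℕ}

namespace Gadget

variable {c : CQ σ k} {G : Gadget c} {A : DynAlg} {q : CQ σ k} {𝒞 : Set (Database σ)}
  {n N₀ B S τ Y b : ℕ} {F F' : Atom σ → ℕ → ℕ → Prop} {ρ ρ' : ℕ → ℕ} {m m' : Mem}
  {Q : (ℕ → ℕ) → Mem → Prop}

/-- The code of a row. -/
def rowEx (G : Gadget c) (e : Ex) : Ex := .add (.lit (G.b + 1 + G.w)) (.add e e)

/-- The code of a column. -/
def colEx (G : Gadget c) (e : Ex) : Ex :=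
  .add (.lit (G.b + 1 + G.w)) (.add (.add e e) (.lit 1))

theorem rowEx_eval (e : Ex) :
    (G.rowEx e).eval ρ m = G.b + 1 + G.w + 2 * e.eval ρ m := by
  simp only [rowEx, Ex.eval]; omega

theorem colEx_eval (e : Ex) :
    (G.colEx e).eval ρ m = G.b + 1 + G.w + (2 * e.eval ρ m + 1) := by
  simp only [colEx, Ex.eval]; omega

theorem rowEx_ok (E : Env G A q 𝒞 n N₀ B τ Y) {e : Ex} (he : e.Ok B ρ m) (h : e.eval ρ m ≤ n) :
    (G.rowEx e).Ok B ρ m := by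
  have := E.consts
  simp only [bound] at this
  refine ⟨?_, ⟨he, he, ?_⟩, ?_⟩ <;> (try simp only [Ex.Ok, Ex.eval]) <;> omega

theorem colEx_ok (E : Env G A q 𝒞 n N₀ B τ Y) {e : Ex} (he : e.Ok B ρ m) (h : e.eval ρ m ≤ n) :
    (G.colEx e).Ok B ρ m := by
  have := E.consts
  simp only [bound] at this
  refine ⟨?_, ⟨⟨he, he, ?_⟩, ?_, ?_⟩, ?_⟩ <;> (try simp only [Ex.Ok, Ex.eval]) <;> omega

/-- The facts for the atoms in `bs` in the context of the pairs in `P`, where the fact for `ψxy`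
is present only for the nonzero entries of the matrix `bit`. -/
def fillF (G : Gadget c) (bs : List (Atom σ)) (bit : ℕ → ℕ → ℕ) (P : ℕ → ℕ → Prop) :
    Atom σ → ℕ → ℕ → Prop :=
  fun ψ i j => P i j ∧ ψ ∈ bs ∧ (ψ = G.ψxy → bit i j ≠ 0)

/-- Insert the facts for the atoms in `bs` for all pairs of a row and a column. -/
noncomputable def fill (G : Gadget c) (A : DynAlg) (bs : List (Atom σ)) : PL :=
  forE 16 (.reg 12) (asg 13 (G.rowEx (.reg 16)) ;; forE 17 (.reg 12)
    (asg 14 (G.colEx (.reg 17)) ;;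
      asg 15 (.ld 0 (.add (.lit 1) (.add (.mul (.reg 16) (.reg 12)) (.reg 17)))) ;;
      insAll G A bs))

/-- Afterwards the database encodes the matrix. -/
theorem tri_fill (E : Env G A q 𝒞 n N₀ B τ Y) {bs : List (Atom σ)} (hbs : ∀ ψ ∈ bs, ψ ∈ c.atoms)
    (h12 : ρ 12 = n) (hnS : n ≤ S) (hn : n * n + 1 ≤ B)
    (hb : b + n * (n * (bs.length * Y)) ≤ B) {bit : ℕ → ℕ → ℕ}
    (hbit : ∀ i < n, ∀ j < n, m [0, 1 + (i * n + j)] = bit i j)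
    (hg : Good G A q 𝒞 n N₀ b (fun _ _ _ => False) ρ m)
    (h : ∀ ρ' m', Good G A q 𝒞 n N₀ (b + n * (n * (bs.length * Y)))
      (G.fillF bs bit fun i j => i < n ∧ j < n) ρ' m' → ρ' 12 = n →
      (∀ a : List ℕ, a.head? ≠ some 8 → a.head? ≠ some 9 → m' a = m a) → Q ρ' m') :
    Tri B S τ (fill G A bs) ρ m Q := by
  have hnB : n ≤ B := (Nat.le_mul_self n).trans (by omega)
  refine .forE (fun i ρ' m' => Good G A q 𝒞 n N₀ (b + i * (n * (bs.length * Y)))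
      (G.fillF bs bit fun i' j' => i' < i ∧ j' < n) ρ' m' ∧ ρ' 12 = n ∧ ρ' 16 = i ∧
      ∀ a : List ℕ, a.head? ≠ some 8 → a.head? ≠ some 9 → m' a = m a) n hnS hnB ?_ ?_ ?_ ?_
  · refine ⟨(hg.asg (by omega) (by omega)).congr (by simp [fillF]) |>.mono (by omega), by simpa,
      by simp, fun _ _ _ => rfl⟩
  · rintro j ρ m - ⟨_, h1, h2, _⟩; exact ⟨h2, h1, trivial⟩
  · rintro i hi ρ₁ m₁ ⟨hg₁, e12, e16, hm₁⟩
    have hbi : b + (i + 1) * (n * (bs.length * Y)) ≤ B :=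
      (Nat.add_le_add_left (Nat.mul_le_mul_right _ hi) _).trans hb
    rw [Nat.succ_mul] at hbi
    refine .seq (.asg (rowEx_ok E trivial (by simp only [Ex.eval]; omega)) ?_)
    rw [rowEx_eval]
    simp only [Ex.eval, e16]
    refine .forE (fun j ρ' m' => Good G A q 𝒞 n N₀
      (b + i * (n * (bs.length * Y)) + j * (bs.length * Y))
      (G.fillF bs bit fun i' j' => i' < i ∧ j' < n ∨ i' = i ∧ j' < j) ρ' m' ∧ ρ' 12 = n ∧
      ρ' 13 = G.b + 1 + G.w + 2 * i ∧ ρ' 16 = i ∧ ρ' 17 = j ∧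
      ∀ a : List ℕ, a.head? ≠ some 8 → a.head? ≠ some 9 → m' a = m a) n hnS hnB ?_ ?_ ?_ ?_
    · refine ⟨(((hg₁.asg (by omega) (by omega)).asg (by omega) (by omega)).congr
        (by simp [fillF])).mono (by omega), by simpa, by simp, by simpa, by simp, hm₁⟩
    · rintro j ρ m - ⟨_, h1, _, _, h2, _⟩; exact ⟨h2, h1, trivial⟩
    · rintro j hj ρ₂ m₂ ⟨hg₂, f12, f13, f16, f17, hm₂⟩
      have hbj : (j + 1) * (bs.length * Y) ≤ n * (bs.length * Y) := Nat.mul_le_mul_right _ hj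
      rw [Nat.succ_mul] at hbj
      have hij : i * n + j + 1 ≤ n * n := by
        have := Nat.mul_le_mul_right n (show i + 1 ≤ n from hi)
        rw [Nat.succ_mul] at this; omega
      refine .seq (.asg (colEx_ok E trivial (by simp only [Ex.eval]; omega)) ?_)
      rw [colEx_eval]
      simp only [Ex.eval, f17]
      refine .seq (.asg ?_ ?_)
      · simp [f12, f16, f17]; omega
      · have hread : (Ex.ld 0 (.add (.lit 1) (.add (.mul (.reg 16) (.reg 12)) (.reg 17)))).eval
            (Function.update ρ₂ 14 (G.b + 1 + G.w + (2 * j + 1))) m₂ = bit i j := by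
          simp only [Ex.eval]
          rw [hm₂ _ (by simp) (by simp)]
          simp [f12, f16, f17, hbit i hi j hj]
        rw [hread]
        refine tri_insAll E hi hj bs _ _ _ _ _ hbs ⟨by simpa, by simp⟩ ?_
          ((hg₂.asg (by omega) (by omega)).asg (by omega) (by omega)) fun ρ₃ m₃ hg₃ hk₃ => ?_
        · omega
        · have k : ∀ r, 12 ≤ r → r < 40 → r ≠ 14 → r ≠ 15 → ρ₃ r = ρ₂ r := fun r h1 h2 h3 h4 => by
            rw [hk₃.1 r h1 h2, Function.update_of_ne h4, Function.update_of_ne h3]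
          refine ⟨by rw [k] <;> omega, ?_, ?_, ?_, ?_, ?_, fun a h1 h2 =>
            (hk₃.2 a h1 h2).trans (hm₂ a h1 h2)⟩
          · refine ((hg₃.asg (by omega) (by omega)).congr fun ψ _ i' j' => ?_).mono ?_
            · simp only [fillF, Function.update_self]
              constructor
              · rintro (⟨h1 | ⟨rfl, h1⟩, h2⟩ | ⟨h1, h2, rfl, rfl⟩)
                · exact ⟨.inl h1, h2⟩
                · exact ⟨.inr ⟨rfl, by omega⟩, h2⟩
                · exact ⟨.inr ⟨rfl, by omega⟩, h1, h2⟩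
              · rintro ⟨h1 | ⟨rfl, h1⟩, h2⟩
                · exact .inl ⟨.inl h1, h2⟩
                · rcases Nat.lt_succ_iff_lt_or_eq.1 h1 with h3 | rfl
                  · exact .inl ⟨.inr ⟨rfl, h3⟩, h2⟩
                  · exact .inr ⟨h2.1, h2.2, rfl, rfl⟩
            · rw [Nat.succ_mul]; omega
          · rw [Function.update_of_ne (by omega), k] <;> omega
          · rw [Function.update_of_ne (by omega), k] <;> omega
          · rw [Function.update_of_ne (by omega), k] <;> omega
          · simp
    · rintro ρ₂ m₂ ⟨hg₂, f12, f13, f16, f17, hm₂⟩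
      refine ⟨f16, (((hg₂.asg (by omega) (by omega)).congr fun ψ _ i' j' => ?_).mono ?_), by simpa,
        by simp, hm₂⟩
      · simp only [fillF]
        refine and_congr_left fun _ => ?_
        omega
      · rw [Nat.succ_mul]; omega
  · rintro ρ₁ m₁ ⟨hg₁, e12, _, hm₁⟩
    exact h _ _ hg₁ e12 hm₁

end Gadget

end DynCQ

namespace DynCQ

variable {σ : Schema} {k : ℕ}

namespace Gadget

variable {c : CQ σ k} {G : Gadget c} {A : DynAlg} {q : CQ σ k} {𝒞 : Set (Database σ)}
  {n N₀ B S τ Y b : ℕ} {F F' : Atom σ → ℕ → ℕ → Prop} {ρ ρ' : ℕ → ℕ} {m m' : Mem}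
  {Q : (ℕ → ℕ) → Mem → Prop}

/-- The facts in `F` together with the facts for `ψy` that describe the vector `v` at the places
in `P`. -/
def markF (G : Gadget c) (F : Atom σ → ℕ → ℕ → Prop) (v : ℕ → ℕ) (P : ℕ → Prop) :
    Atom σ → ℕ → ℕ → Prop :=
  fun ψ i j => F ψ i j ∨ (ψ = G.ψy ∧ i = 0 ∧ P j ∧ v j ≠ 0)

/-- Insert the facts that describe the input vector. -/
def mark (G : Gadget c) (A : DynAlg) : PL :=
  forE 17 (.reg 12) (asg 13 (.lit (G.b + 1 + G.w)) ;; asg 14 (G.colEx (.reg 17)) ;;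
    ifE (.ld 0 (.reg 17)) (cmd G A true G.ψy) .skip)

/-- Delete the facts that describe the input vector. -/
def unmark (G : Gadget c) (A : DynAlg) : PL :=
  forE 17 (.reg 12) (asg 13 (.lit (G.b + 1 + G.w)) ;; asg 14 (G.colEx (.reg 17)) ;;
    cmd G A false G.ψy)

/-- Afterwards the database encodes the vector as well, after `n` updates. -/
theorem tri_mark (E : Env G A q 𝒞 n N₀ B τ Y) (h12 : ρ 12 = n) (hnS : n ≤ S)
    (hb : b + n * Y ≤ B) {v : ℕ → ℕ} (hv : ∀ j < n, m [0, j] = v j)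
    (hg : Good G A q 𝒞 n N₀ b F ρ m)
    (h : ∀ ρ' m', Good G A q 𝒞 n N₀ (b + n * Y) (G.markF F v fun j => j < n) ρ' m' →
      ρ' 12 = n → (∀ a : List ℕ, a.head? ≠ some 8 → a.head? ≠ some 9 → m' a = m a) → Q ρ' m') :
    Tri B S τ (mark G A) ρ m Q := by
  have hc := E.consts
  simp only [bound] at hc
  have hnB : n ≤ B := by omega
  refine .forE (fun j ρ' m' => Good G A q 𝒞 n N₀ (b + j * Y) (G.markF F v fun j' => j' < j) ρ' m' ∧
    ρ' 12 = n ∧ ρ' 17 = j ∧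
    ∀ a : List ℕ, a.head? ≠ some 8 → a.head? ≠ some 9 → m' a = m a) n hnS hnB ?_ ?_ ?_ ?_
  · exact ⟨((hg.asg (by omega) (by omega)).congr (by simp [markF])).mono (by omega), by simpa,
      by simp, fun _ _ _ => rfl⟩
  · rintro j ρ m - ⟨_, h1, h2, _⟩; exact ⟨h2, h1, trivial⟩
  · rintro j hj ρ₁ m₁ ⟨hg₁, e12, e17, hm₁⟩
    have hbj : b + (j + 1) * Y ≤ B := (Nat.add_le_add_left (Nat.mul_le_mul_right _ hj) _).trans hb
    rw [Nat.succ_mul] at hbj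
    refine .seq (.asg (by simp only [Ex.Ok]; omega) ?_)
    simp only [Ex.eval]
    refine .seq (.asg (colEx_ok E trivial (by simp [e17]; omega)) ?_)
    rw [colEx_eval]
    simp only [Ex.eval, Function.update_of_ne (show (17 : ℕ) ≠ 13 by omega), e17]
    have hat : G.At 0 j (Function.update (Function.update ρ₁ 13 (G.b + 1 + G.w)) 14
        (G.b + 1 + G.w + (2 * j + 1))) := ⟨by simp, by simp⟩
    have hg₂ := (hg₁.asg (d := 13) (v := G.b + 1 + G.w) (by omega) (by omega)).asg
      (d := 14) (v := G.b + 1 + G.w + (2 * j + 1)) (by omega) (by omega)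
    have k₂ : ∀ r, r ≠ 13 → r ≠ 14 → Function.update (Function.update ρ₁ 13 (G.b + 1 + G.w)) 14
        (G.b + 1 + G.w + (2 * j + 1)) r = ρ₁ r := fun r h1 h2 => by
      rw [Function.update_of_ne h2, Function.update_of_ne h1]
    generalize Function.update (Function.update ρ₁ 13 (G.b + 1 + G.w)) 14
      (G.b + 1 + G.w + (2 * j + 1)) = ρ₂ at hat hg₂ k₂
    -- both cases end in the same way
    have fin : ∀ ρ₃ m₃, Good G A q 𝒞 n N₀ (b + j * Y + Y) (G.markF F v fun j' => j' < j + 1) ρ₃ m₃ →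
        Kept ρ₂ m₁ ρ₃ m₃ → ρ₃ 17 = j ∧
        Good G A q 𝒞 n N₀ (b + (j + 1) * Y) (G.markF F v fun j' => j' < j + 1)
          (Function.update ρ₃ 17 (j + 1)) m₃ ∧ Function.update ρ₃ 17 (j + 1) 12 = n ∧
          Function.update ρ₃ 17 (j + 1) 17 = j + 1 ∧
          ∀ a : List ℕ, a.head? ≠ some 8 → a.head? ≠ some 9 → m₃ a = m a := by
      intro ρ₃ m₃ hg₃ hk₃
      refine ⟨by rw [hk₃.1, k₂] <;> omega, (hg₃.asg (by omega) (by omega)).mono ?_, ?_, by simp,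
        fun a h1 h2 => (hk₃.2 a h1 h2).trans (hm₁ a h1 h2)⟩
      · rw [Nat.succ_mul]; omega
      · rw [Function.update_of_ne (by omega), hk₃.1, k₂] <;> omega
    have hval : (Ex.ld 0 (.reg 17)).eval ρ₂ m₁ = v j := by
      simp only [Ex.eval]
      rw [k₂ 17 (by omega) (by omega), e17, hm₁ _ (by simp) (by simp), hv j hj]
    refine .ifE ⟨Nat.zero_le _, trivial⟩ (fun h1 => ?_) fun h1 => ?_
    · refine tri_insert E G.ψy_mem (by omega) hj hat (by omega) hg₂ fun ρ₃ m₃ hg₃ hk₃ =>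
        fin _ _ (hg₃.congr fun ψ _ i' j' => ?_) hk₃
      rw [hval] at h1
      simp only [markF]
      constructor
      · rintro ((h2 | ⟨h2, h3, h4⟩) | ⟨h2, h3, rfl⟩)
        · exact .inl h2
        · exact .inr ⟨h2, h3, by omega, h4.2⟩
        · exact .inr ⟨h2, h3, by omega, h1⟩
      · rintro (h2 | ⟨h2, h3, h4, h5⟩)
        · exact .inl (.inl h2)
        · rcases Nat.lt_succ_iff_lt_or_eq.1 h4 with h6 | rfl
          · exact .inl (.inr ⟨h2, h3, h6, h5⟩)
          · exact .inr ⟨h2, h3, rfl⟩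
    · refine .skip (fin _ _ ((hg₂.congr fun ψ _ i' j' => ?_).mono (by omega)) (.refl _ _))
      rw [hval] at h1
      simp only [markF]
      refine or_congr_right (and_congr_right fun _ => and_congr_right fun _ => ?_)
      constructor
      · exact fun h2 => ⟨by omega, h2.2⟩
      · rintro ⟨h2, h3⟩
        rcases Nat.lt_succ_iff_lt_or_eq.1 h2 with h6 | rfl
        · exact ⟨h6, h3⟩
        · exact absurd h1 h3
  · rintro ρ₁ m₁ ⟨hg₁, e12, _, hm₁⟩
    exact h _ _ hg₁ e12 hm₁

/-- Afterwards the database encodes the matrix only, ready for the next vector. -/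
theorem tri_unmark (E : Env G A q 𝒞 n N₀ B τ Y) (h12 : ρ 12 = n) (hnS : n ≤ S)
    (hb : b + n * Y ≤ B) {v : ℕ → ℕ} (hF : ∀ i j, ¬ F G.ψy i j)
    (hg : Good G A q 𝒞 n N₀ b (G.markF F v fun j => j < n) ρ m)
    (h : ∀ ρ' m', Good G A q 𝒞 n N₀ (b + n * Y) F ρ' m' →
      ρ' 12 = n → (∀ a : List ℕ, a.head? ≠ some 8 → a.head? ≠ some 9 → m' a = m a) → Q ρ' m') :
    Tri B S τ (unmark G A) ρ m Q := by
  have hc := E.consts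
  simp only [bound] at hc
  have hnB : n ≤ B := by omega
  refine .forE (fun j ρ' m' => Good G A q 𝒞 n N₀ (b + j * Y)
    (G.markF F v fun j' => j ≤ j' ∧ j' < n) ρ' m' ∧ ρ' 12 = n ∧ ρ' 17 = j ∧
    ∀ a : List ℕ, a.head? ≠ some 8 → a.head? ≠ some 9 → m' a = m a) n hnS hnB ?_ ?_ ?_ ?_
  · exact ⟨((hg.asg (by omega) (by omega)).congr (by simp [markF])).mono (by omega), by simpa,
      by simp, fun _ _ _ => rfl⟩
  · rintro j ρ m - ⟨_, h1, h2, _⟩; exact ⟨h2, h1, trivial⟩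
  · rintro j hj ρ₁ m₁ ⟨hg₁, e12, e17, hm₁⟩
    have hbj : b + (j + 1) * Y ≤ B := (Nat.add_le_add_left (Nat.mul_le_mul_right _ hj) _).trans hb
    rw [Nat.succ_mul] at hbj
    refine .seq (.asg (by simp only [Ex.Ok]; omega) ?_)
    simp only [Ex.eval]
    refine .seq (.asg (colEx_ok E trivial (by simp [e17]; omega)) ?_)
    rw [colEx_eval]
    simp only [Ex.eval, Function.update_of_ne (show (17 : ℕ) ≠ 13 by omega), e17]
    refine tri_erase E (i₀ := 0) (j₀ := j) G.ψy_mem (by omega) hj ⟨by simp, by simp⟩ (by omega)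
      ((hg₁.asg (by omega) (by omega)).asg (by omega) (by omega)) fun ρ₃ m₃ hg₃ hk₃ => ?_
    have k₃ : ∀ r, 12 ≤ r → r < 40 → r ≠ 13 → r ≠ 14 → ρ₃ r = ρ₁ r := fun r h1 h2 h3 h4 => by
      rw [hk₃.1 r h1 h2, Function.update_of_ne h4, Function.update_of_ne h3]
    refine ⟨by rw [k₃] <;> omega, ((hg₃.asg (by omega) (by omega)).congr fun ψ hψ i' j' => ?_).mono
      (by rw [Nat.succ_mul]; omega), ?_, by simp,
      fun a h1 h2 => (hk₃.2 a h1 h2).trans (hm₁ a h1 h2)⟩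
    · simp only [markF]
      constructor
      · rintro ⟨h1 | ⟨rfl, rfl, h1, h2⟩, h3⟩
        · exact .inl h1
        · refine .inr ⟨rfl, rfl, ⟨?_, h1.2⟩, h2⟩
          have : j' ≠ j := by rintro rfl; exact h3 rfl
          omega
      · rintro (h1 | ⟨rfl, rfl, h1, h2⟩)
        · refine ⟨.inl h1, fun h3 => hF i' j' ?_⟩
          rwa [← eq_of_fact_eq hψ G.ψy_mem h3]
        · refine ⟨.inr ⟨rfl, rfl, by omega, h2⟩, fun h3 => ?_⟩
          have := congrArg (fun a : Dom => (a : ℕ)) (eval_eq_of_fact_eq h3 G.y_mem_y)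
          simp only [val_y] at this; omega
    · rw [Function.update_of_ne (by omega), k₃] <;> omega
  · rintro ρ₁ m₁ ⟨hg₁, e12, _, hm₁⟩
    refine h _ _ (hg₁.congr fun ψ _ i' j' => ?_) e12 hm₁
    simp only [markF]
    constructor
    · rintro (h1 | ⟨_, _, h1, _⟩)
      · exact h1
      · omega
    · exact .inl

/-- Run the update routine for the third atom of the gadget, if there is one. -/
def cmdX (G : Gadget c) (A : DynAlg) (ins : Bool) : PL :=
  match G.ψx with
  | none => .skip
  | some ψ => cmd G A ins ψ

/-- The facts in `F` together with the fact for `ψx` in row `i₀`. -/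
def rowF (G : Gadget c) (F : Atom σ → ℕ → ℕ → Prop) (i₀ : ℕ) : Atom σ → ℕ → ℕ → Prop :=
  fun ψ i j => F ψ i j ∨ (ψ ∈ G.ψx ∧ i = i₀ ∧ j = 0)

/-- Compute and output the entries of the product one by one. -/
def rows (G : Gadget c) (A : DynAlg) : PL :=
  forE 16 (.reg 12) (asg 13 (G.rowEx (.reg 16)) ;; asg 14 (.lit (G.b + 1 + G.w + 1)) ;;
    cmdX G A true ;; testRow G A ;; st 1 (.reg 16) (.reg 18) ;; cmdX G A false)

theorem mem_of_mem_ψx {ψ : Atom σ} (h : ψ ∈ G.ψx) : ψ ∈ c.atoms := by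
  rcases G.x_cases with ⟨ψ', h1, h2, _⟩ | ⟨h1, _⟩
  · rw [Option.mem_unique h h1]; exact h2
  · rw [h1] at h; cases h

theorem tri_cmdX_true (E : Env G A q 𝒞 n N₀ B τ Y) {i₀ : ℕ} (hi : i₀ < n) (hat : G.At i₀ 0 ρ)
    (hb : b + Y ≤ B) (hg : Good G A q 𝒞 n N₀ b F ρ m)
    (h : ∀ ρ' m', Good G A q 𝒞 n N₀ (b + Y) (G.rowF F i₀) ρ' m' → Kept ρ m ρ' m' → Q ρ' m') :
    Tri B S τ (cmdX G A true) ρ m Q := by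
  simp only [cmdX]
  split
  · rename_i hx
    exact .skip (h _ _ ((hg.congr (by simp [rowF, hx])).mono (by omega)) (.refl _ _))
  · rename_i ψ hx
    refine tri_insert E (mem_of_mem_ψx hx) hi (by omega) hat hb hg fun ρ' m' hg' hk' =>
      h _ _ (hg'.congr fun ψ' _ i j => ?_) hk'
    simp [rowF, hx, eq_comm]

theorem tri_cmdX_false (E : Env G A q 𝒞 n N₀ B τ Y) {i₀ : ℕ} (hi : i₀ < n) (hat : G.At i₀ 0 ρ)
    (hb : b + Y ≤ B) (hF : ∀ ψ ∈ G.ψx, ∀ i j, ¬ F ψ i j)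
    (hg : Good G A q 𝒞 n N₀ b (G.rowF F i₀) ρ m)
    (h : ∀ ρ' m', Good G A q 𝒞 n N₀ (b + Y) F ρ' m' → Kept ρ m ρ' m' → Q ρ' m') :
    Tri B S τ (cmdX G A false) ρ m Q := by
  simp only [cmdX]
  split
  · rename_i hx
    exact .skip (h _ _ ((hg.congr (by simp [rowF, hx])).mono (by omega)) (.refl _ _))
  · rename_i ψ hx
    refine tri_erase E (mem_of_mem_ψx hx) hi (by omega) hat hb hg fun ρ' m' hg' hk' =>
      h _ _ (hg'.congr fun ψ' hψ' i j => ?_) hk'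
    simp only [rowF, hx, Option.mem_def, Option.some.injEq]
    constructor
    · rintro ⟨h1 | ⟨rfl, rfl, rfl⟩, h2⟩
      · exact h1
      · exact absurd rfl h2
    · refine fun h1 => ⟨.inl h1, fun h2 => hF ψ hx i j ?_⟩
      rwa [← eq_of_fact_eq hψ' (mem_of_mem_ψx hx) h2]

open Classical in
/-- Each entry of the product costs one test and at most two updates. -/
theorem tri_rows (E : Env G A q 𝒞 n N₀ B τ Y) (h12 : ρ 12 = n) (hnS : n ≤ S)
    (hb : b + n * (3 * Y) ≤ B) (hF : ∀ ψ ∈ G.ψx, ∀ i j, ¬ F ψ i j) {p : ℕ → Prop}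
    (hp : ∀ i < n, ∀ D, G.Rep D (G.rowF F i) → (G.tuple i ∈ c.result D ↔ p i))
    (hg : Good G A q 𝒞 n N₀ b F ρ m)
    (h : ∀ ρ' m', Good G A q 𝒞 n N₀ (b + n * (3 * Y)) F ρ' m' → ρ' 12 = n →
      (∀ i < n, m' [1, i] = if p i then 1 else 0) → Q ρ' m') :
    Tri B S τ (rows G A) ρ m Q := by
  have hc := E.consts
  simp only [bound] at hc
  have hnB : n ≤ B := by omega
  refine .forE (fun i ρ' m' => Good G A q 𝒞 n N₀ (b + i * (3 * Y)) F ρ' m' ∧ ρ' 12 = n ∧ ρ' 16 = i ∧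
    ∀ i' < i, m' [1, i'] = if p i' then 1 else 0) n hnS hnB ?_ ?_ ?_ ?_
  · exact ⟨(hg.asg (by omega) (by omega)).mono (by omega), by simpa, by simp, by simp⟩
  · rintro j ρ m - ⟨_, h1, h2, _⟩; exact ⟨h2, h1, trivial⟩
  · rintro i hi ρ₁ m₁ ⟨hg₁, e12, e16, hm₁⟩
    have hbi : b + (i + 1) * (3 * Y) ≤ B :=
      (Nat.add_le_add_left (Nat.mul_le_mul_right _ hi) _).trans hb
    rw [Nat.succ_mul] at hbi
    refine .seq (.asg (rowEx_ok E trivial (by simp [e16]; omega)) ?_)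
    rw [rowEx_eval]
    simp only [Ex.eval, e16]
    refine .seq (.asg (by simp only [Ex.Ok]; omega) ?_)
    simp only [Ex.eval]
    have hat : G.At i 0 (Function.update (Function.update ρ₁ 13 (G.b + 1 + G.w + 2 * i)) 14
        (G.b + 1 + G.w + 1)) := ⟨by simp, by simp⟩
    have hg₂ := (hg₁.asg (d := 13) (v := G.b + 1 + G.w + 2 * i) (by omega) (by omega)).asg
      (d := 14) (v := G.b + 1 + G.w + 1) (by omega) (by omega)
    have k₂ : ∀ r, r ≠ 13 → r ≠ 14 → Function.update (Function.update ρ₁ 13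
        (G.b + 1 + G.w + 2 * i)) 14 (G.b + 1 + G.w + 1) r = ρ₁ r := fun r h1 h2 => by
      rw [Function.update_of_ne h2, Function.update_of_ne h1]
    generalize Function.update (Function.update ρ₁ 13 (G.b + 1 + G.w + 2 * i)) 14
      (G.b + 1 + G.w + 1) = ρ₂ at hat hg₂ k₂
    have hat' : ∀ {ρ'}, (∀ r, 12 ≤ r → r < 18 → ρ' r = ρ₂ r) → G.At i 0 ρ' := fun h =>
      ⟨(h 13 (by omega) (by omega)).trans hat.1, (h 14 (by omega) (by omega)).trans hat.2⟩
    refine .seq (tri_cmdX_true E hi hat (by omega) hg₂ fun ρ₃ m₃ hg₃ hk₃ => .seq ?_)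
    have k₃ : ∀ r, 12 ≤ r → r < 18 → ρ₃ r = ρ₂ r := fun r h1 h2 => hk₃.1 r h1 (by omega)
    refine tri_testRow E hi (hat' k₃) (by omega) hg₃ (hp i hi) fun ρ₄ m₄ hg₄ hk₄ => .seq ?_
    have k₄ : ∀ r, 12 ≤ r → r < 18 → ρ₄ r = ρ₂ r := fun r h1 h2 => by
      rw [hk₄.1 r h1 (by omega), Function.update_of_ne (by omega), k₃ r h1 h2]
    have e18 : ρ₄ 18 = if p i then 1 else 0 := by
      rw [hk₄.1 18 (by omega) (by omega)]; simp
    have e16' : ρ₄ 16 = i := by rw [k₄ 16 (by omega) (by omega), k₂ 16 (by omega) (by omega), e16]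
    refine .st (by omega) trivial trivial ?_
    simp only [Ex.eval, e16', e18]
    refine tri_cmdX_false E hi (hat' k₄) (by omega) hF (hg₄.frame (fun _ _ => rfl) fun a ha =>
      Function.update_of_ne (by rintro rfl; simp at ha) _ _) fun ρ₅ m₅ hg₅ hk₅ => ?_
    have k₅ : ∀ r, 12 ≤ r → r < 18 → ρ₅ r = ρ₂ r := fun r h1 h2 =>
      (hk₅.1 r h1 (by omega)).trans (k₄ r h1 h2)
    refine ⟨?_, (hg₅.asg (by omega) (by omega)).mono (by rw [Nat.succ_mul i (3 * Y)]; omega), ?_,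
      by simp, fun i' hi' => ?_⟩
    · rw [k₅ 16 (by omega) (by omega), k₂ 16 (by omega) (by omega), e16]
    · rw [Function.update_of_ne (by omega), k₅ 12 (by omega) (by omega),
        k₂ 12 (by omega) (by omega), e12]
    · rw [hk₅.2 _ (by simp) (by simp)]
      by_cases h1 : i' = i
      · subst h1; simp
      · rw [Function.update_of_ne (by simpa using h1), hk₄.2 _ (by simp) (by simp),
          hk₃.2 _ (by simp) (by simp), hm₁ i' (by omega)]
  · rintro ρ₁ m₁ ⟨hg₁, e12, _, hm₁⟩
    exact h _ _ hg₁ e12 hm₁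

end Gadget

end DynCQ

namespace DynCQ

variable {σ : Schema} {k : ℕ}

namespace Gadget

variable {c : CQ σ k} {G : Gadget c} {A : DynAlg} {q : CQ σ k} {𝒞 : Set (Database σ)}
  {n N₀ B S τ Y b : ℕ} {F F' : Atom σ → ℕ → ℕ → Prop} {ρ ρ' : ℕ → ℕ} {m m' : Mem}
  {Q : (ℕ → ℕ) → Mem → Prop}

open Classical in
/-- The atoms other than `ψy` and `ψx`, whose facts do not depend on the input vector. -/
noncomputable def base (G : Gadget c) : List (Atom σ) :=
  c.atoms.filter fun ψ => ψ ≠ G.ψy ∧ ψ ∉ G.ψx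

theorem mem_base {ψ : Atom σ} : ψ ∈ G.base ↔ ψ ∈ c.atoms ∧ ψ ≠ G.ψy ∧ ψ ∉ G.ψx := by
  simp [base]

theorem ψx_y {ψ : Atom σ} (h : ψ ∈ G.ψx) : G.x ∈ ψ.vars ∧ G.y ∉ ψ.vars := by
  rcases G.x_cases with ⟨ψ', h1, _, h2⟩ | ⟨h1, _⟩
  · rw [Option.mem_unique h h1]; exact h2
  · rw [h1] at h; cases h

/-- The test for row `i` computes the entry number `i` of the product. -/
theorem tuple_mem_result_iff (hc : c.IsCore) {bit : ℕ → ℕ → ℕ} {v : ℕ → ℕ} {D : Database σ} {i : ℕ}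
    (hi : i < n)
    (h : G.Rep D (G.rowF (G.markF (G.fillF G.base bit fun i j => i < n ∧ j < n) v
      fun j => j < n) i)) :
    G.tuple i ∈ c.result D ↔ ∃ j < n, bit i j ≠ 0 ∧ v j ≠ 0 := by
  have hxy_y : G.ψxy ≠ G.ψy := fun e => G.x_notMem_y (e ▸ G.x_mem_xy)
  have hxy_x : G.ψxy ∉ G.ψx := fun e => (ψx_y e).2 G.y_mem_xy
  have hy_x : G.ψy ∉ G.ψx := fun e => G.x_notMem_y (ψx_y e).1
  refine (h.tuple_mem_result hc (M := fun i j => i < n ∧ j < n ∧ bit i j ≠ 0)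
    (v := fun j => j < n ∧ v j ≠ 0) ?_ ?_ ?_ ?_).trans ?_
  · rintro i' j' ((⟨⟨h1, h2⟩, _, h3⟩ | ⟨h1, _⟩) | ⟨h1, _⟩)
    · exact ⟨h1, h2, h3 rfl⟩
    · exact absurd h1 hxy_y
    · exact absurd h1 hxy_x
  · rintro i' j' ((⟨_, h1, _⟩ | ⟨_, _, h1⟩) | ⟨h1, _⟩)
    · exact absurd rfl (mem_base.1 h1).2.1
    · exact h1
    · exact absurd h1 hy_x
  · rintro ψ hψ i' j' ((⟨_, h1, _⟩ | ⟨rfl, _⟩) | ⟨_, h1, _⟩)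
    · exact absurd hψ (mem_base.1 h1).2.2
    · exact absurd hψ hy_x
    · exact h1
  · rintro j ⟨_, hj, hb⟩ ⟨_, hv⟩ ψ hψ
    by_cases h1 : ψ = G.ψy
    · subst h1
      exact ⟨0, j, .inl (.inr ⟨rfl, rfl, hj, hv⟩),
        fact_congr (fun h => absurd h G.x_notMem_y) fun _ => rfl⟩
    · by_cases h2 : ψ ∈ G.ψx
      · exact ⟨i, 0, .inr ⟨h2, rfl, rfl⟩, fact_congr (fun _ => rfl) fun h => absurd h (ψx_y h2).2⟩
      · exact ⟨i, j, .inl (.inl ⟨⟨hi, hj⟩, mem_base.2 ⟨hψ, h1, h2⟩, fun _ => hb⟩), rfl⟩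
  · constructor
    · rintro ⟨j, ⟨_, h1, h2⟩, _, h3⟩; exact ⟨j, h1, h2, h3⟩
    · rintro ⟨j, h1, h2, h3⟩; exact ⟨j, ⟨hi, h1, h2⟩, h1, h3⟩

/-- The multiplication of the matrix by a vector. -/
def multPL (G : Gadget c) (A : DynAlg) : PL := mark G A ;; rows G A ;; unmark G A

open Classical in
/-- One round of the online multiplication is correct, and it restores the encoding of the matrix.
-/
theorem tri_mult (E : Env G A q 𝒞 n N₀ B τ Y) (hc : c.IsCore) (h12 : ρ 12 = n) (hnS : n ≤ S)
    (hb : b + n * (5 * Y) ≤ B) {bit : ℕ → ℕ → ℕ} {v : ℕ → ℕ} (hv : ∀ j < n, m [0, j] = v j)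
    (hg : Good G A q 𝒞 n N₀ b (G.fillF G.base bit fun i j => i < n ∧ j < n) ρ m)
    (h : ∀ ρ' m', Good G A q 𝒞 n N₀ (b + n * (5 * Y))
      (G.fillF G.base bit fun i j => i < n ∧ j < n) ρ' m' → ρ' 12 = n →
      (∀ i < n, m' [1, i] = if ∃ j < n, bit i j ≠ 0 ∧ v j ≠ 0 then 1 else 0) → Q ρ' m') :
    Tri B S τ (multPL G A) ρ m Q := by
  have e5 : n * (5 * Y) = n * Y + n * (3 * Y) + n * Y := by ring
  rw [e5] at hb h
  refine .seq (tri_mark E h12 hnS (by omega) hv hg fun ρ₁ m₁ hg₁ e₁ _ => .seq ?_)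
  refine tri_rows E e₁ hnS (by omega) ?_ (fun i hi D hD => tuple_mem_result_iff hc hi hD) hg₁
    fun ρ₂ m₂ hg₂ e₂ hm₂ => ?_
  · rintro ψ hψ i j (⟨_, h1, _⟩ | ⟨rfl, _⟩)
    · exact (mem_base.1 h1).2.2 hψ
    · exact G.x_notMem_y (ψx_y hψ).1
  · refine tri_unmark E e₂ hnS (by omega) (fun i j h1 => (mem_base.1 h1.2.1).2.1 rfl) hg₂
      fun ρ₃ m₃ hg₃ e₃ hm₃ => h _ _ (hg₃.mono (by omega)) e₃ fun i hi => ?_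
    rw [hm₃ _ (by simp) (by simp), hm₂ i hi]
    split_ifs <;> rfl

/-- The preprocessing of the matrix. -/
noncomputable def prePL (G : Gadget c) (A : DynAlg) (q : CQ σ k) : PL :=
  asg 12 (.ld 0 (.lit 0)) ;; callOn ((preprocessInput q []).map .lit) A.preprocess ;;
    fill G A G.base

/-- The preprocessing starts the simulated algorithm on the empty database, and then encodes the
matrix into the database by at most quadratically many updates. -/
theorem tri_pre (E : Env G A q 𝒞 n N₀ B τ Y) (hnS : n ≤ S) (hn : n * n + 1 ≤ B) {t₀ : ℕ}
    {D₀ : Database σ} {s₀ : State} (hD₀ : ∀ R, D₀ R = ∅) (hD₀' : D₀ ∈ 𝒞)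
    (hex : Exec (inputSize q D₀ (preprocessInput q []) ^ A.wordExp) A.preprocess
      (State.init.input (preprocessInput q [])) t₀ s₀)
    (hN : inputSize q D₀ (preprocessInput q []) ≤ N₀) (ht : 16 * t₀ ≤ τ)
    (hb : 4 * (preprocessInput q []).length + t₀ + n * (n * (G.base.length * Y)) ≤ B)
    {bit : ℕ → ℕ → ℕ} (h0 : m [0, 0] = n) (hm : ∀ a : List ℕ, a.head? ≠ some 0 → m a = 0)
    (hbit : ∀ i < n, ∀ j < n, m [0, 1 + (i * n + j)] = bit i j)
    (h : ∀ ρ' m', Good G A q 𝒞 n N₀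
      (4 * (preprocessInput q []).length + t₀ + n * (n * (G.base.length * Y)))
      (G.fillF G.base bit fun i j => i < n ∧ j < n) ρ' m' → ρ' 12 = n → Q ρ' m') :
    Tri B S τ (prePL G A q) (fun _ => 0) m Q := by
  refine .seq (.asg ⟨Nat.zero_le _, Nat.zero_le _⟩ (.seq ?_))
  simp only [Ex.eval, h0]
  have hs : Sim .init [] (Function.update (fun _ => 0) 12 n) m :=
    Sim.init.congr (fun i hi => Function.update_of_ne (by omega) _ _) fun a ha =>
      hm a (by rcases ha with h | h <;> simp [h])
  have hev : ((preprocessInput q []).map Ex.lit).map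
      (Ex.eval (Function.update (fun _ => 0) 12 n) m) = preprocessInput q [] := by
    simp [Function.comp_def]
  have h2 : Function.update (fun _ => 0) 12 n 2 = 0 := by simp
  refine .callOn (t := t₀) hs E.nine_le ((Nat.pow_le_pow_left hN _).trans E.pow_le) ?_ ?_ ?_ ?_
    (by rw [hev]; exact hex) ht fun v ρ₁ m₁ sv₁ hs₁ hc₁ hk₁ => ?_
  · rw [h2, List.length_map]; omega
  · rw [List.length_map]; omega
  · intro e he
    obtain ⟨x, _, rfl⟩ := List.mem_map.1 he
    trivial
  · intro e he
    obtain ⟨x, hx, rfl⟩ := List.mem_map.1 he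
    exact (le_maxWord hx).trans ((Nat.le_add_left _ _).trans (hN.trans E.size_le_word))
  · rw [h2, List.length_map] at hc₁
    have hk := hk₁.kept
    refine tri_fill E (fun ψ hψ => (mem_base.1 hψ).1) ?_ hnS hn hb (bit := bit) ?_
      (b := 4 * (preprocessInput q []).length + t₀) ?_ fun ρ₂ m₂ hg₂ e₂ _ => h _ _ hg₂ e₂
    · rw [hk.1 12 (by omega) (by omega)]; simp
    · intro i hi j hj
      rw [hk.2 _ (by simp) (by simp), hbit i hi j hj]
    · refine ⟨D₀, _, s₀, sv₁, fun f => ?_, fun _ _ _ _ h => h.elim,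
        .preprocess hD₀' ⟨List.nodup_nil, fun R t => ?_⟩ hex, hN, hs₁, by omega⟩
      · rw [hD₀]; simp
      · rw [hD₀]; simp

/-- All rounds of the online multiplication, started in a configuration that encodes the matrix. The
simulation creates at most `n * (5 * Y)` nodes in each round. -/
theorem exists_omvRounds (E : Env G A q 𝒞 n N₀ B τ Y) (hc : c.IsCore)
    (M : Matrix (Fin n) (Fin n) Bool) {bit : ℕ → ℕ → ℕ}
    (hbit : ∀ i j : Fin n, bit i j = (M i j).toNat) (vs : List (Fin n → Bool)) :
    ∀ (b : ℕ) (s : State), b + vs.length * (n * (5 * Y)) ≤ B → s.Bdd B → s.vars 12 = n →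
      Good G A q 𝒞 n N₀ b (G.fillF G.base bit fun i j => i < n ∧ j < n) s.vars s.mem →
      ∃ T, OMvRounds B (multPL G A).prog M s vs T ∧ T ≤ vs.length * (multPL G A).cost n τ := by
  induction vs with
  | nil => exact fun b s _ _ _ _ => ⟨0, .nil s, Nat.zero_le _⟩
  | cons v vs ih =>
    intro b s hb hs h12 hg
    rw [List.length_cons, Nat.succ_mul] at hb
    have h9 := E.nine_le
    let w : ℕ → ℕ := fun j => if h : j < n then (v ⟨j, h⟩).toNat else 0
    have hin : (s.input (vectorInput v)).Bdd B := by
      refine ⟨hs.1, fun a => ?_⟩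
      simp only [State.input]
      split
      · rename_i i
        rcases lt_or_ge i n with hi | hi
        · have : (v ⟨i, hi⟩).toNat ≤ 1 := Bool.toNat_le _
          simp only [vectorInput, List.getElem?_ofFn, hi, dite_true, Option.getD_some]
          omega
        · simp only [vectorInput, List.getElem?_ofFn, not_lt.2 hi, dite_false, Option.getD_none]
          exact hs.2 _
      · exact hs.2 _
    have hg' : Good G A q 𝒞 n N₀ b (G.fillF G.base bit fun i j => i < n ∧ j < n) s.vars
        (s.input (vectorInput v)).mem := by
      refine hg.frame (fun _ _ => rfl) fun a ha => ?_
      simp only [State.input]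
      split
      · simp at ha
      · rfl
    have hw : ∀ j < n, (s.input (vectorInput v)).mem [0, j] = w j := fun j hj => by
      simp [State.input, vectorInput, w, hj, List.getElem?_ofFn]
    obtain ⟨t, s', h1, h2, h3, h4, h5, h6⟩ := tri_mult (S := n) (Q := fun ρ' m' =>
        Good G A q 𝒞 n N₀ (b + n * (5 * Y)) (G.fillF G.base bit fun i j => i < n ∧ j < n) ρ' m' ∧
        ρ' 12 = n ∧ ∀ i < n, m' [1, i] = if ∃ j < n, bit i j ≠ 0 ∧ w j ≠ 0 then 1 else 0)
      E hc h12 le_rfl (by omega) (v := w) hw hg' (fun ρ' m' h1 h2 h3 => ⟨h1, h2, h3⟩)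
      (s.input (vectorInput v)) hin rfl rfl
    obtain ⟨T, h7, h8⟩ := ih _ s' (by omega) h3 h5 h4
    refine ⟨t + T, .cons h1 (fun i => ?_) h7, ?_⟩
    · have hiff : (∃ j < n, bit i j ≠ 0 ∧ w j ≠ 0) ↔ ∃ j, M i j = true ∧ v j = true := by
        constructor
        · rintro ⟨j, hj, h9, h10⟩
          refine ⟨⟨j, hj⟩, ?_, ?_⟩
          · rw [hbit i ⟨j, hj⟩] at h9; simpa using h9
          · simpa [w, hj] using h10
        · rintro ⟨j, h9, h10⟩
          exact ⟨j, j.2, by simp [hbit, h9], by simp [w, h10]⟩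
      have := h6 i i.2
      rw [State.output, this]
      refine ⟨fun h => if_pos (hiff.2 h), fun h => if_neg fun h' => h (hiff.1 h')⟩
    · rw [List.length_cons, Nat.succ_mul]; omega

end Gadget

end DynCQ

namespace DynCQ

variable {σ : Schema} {k : ℕ}

/-! ### Polynomial bounds -/

/-- `f` is bounded by a polynomial. -/
def PolyBdd (f : ℕ → ℕ) : Prop := ∃ c, ∀ n, f n ≤ (n + 2) ^ c

namespace PolyBdd

variable {f g : ℕ → ℕ}

theorem mono (hg : PolyBdd g) (h : ∀ n, f n ≤ g n) : PolyBdd f :=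
  let ⟨c, hc⟩ := hg
  ⟨c, fun n => (h n).trans (hc n)⟩

theorem const (a : ℕ) : PolyBdd fun _ => a :=
  ⟨a, fun n => (Nat.lt_two_pow_self (n := a)).le.trans (Nat.pow_le_pow_left (by omega) _)⟩

theorem id : PolyBdd fun n => n := ⟨1, fun n => by simp⟩

theorem add (hf : PolyBdd f) (hg : PolyBdd g) : PolyBdd fun n => f n + g n := by
  obtain ⟨a, ha⟩ := hf
  obtain ⟨b, hb⟩ := hg
  refine ⟨max a b + 1, fun n => ?_⟩
  have h1 : (n + 2) ^ a ≤ (n + 2) ^ max a b := Nat.pow_le_pow_right (by omega) (le_max_left _ _)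
  have h2 : (n + 2) ^ b ≤ (n + 2) ^ max a b := Nat.pow_le_pow_right (by omega) (le_max_right _ _)
  have h3 : (n + 2) ^ max a b * 2 ≤ (n + 2) ^ max a b * (n + 2) :=
    Nat.mul_le_mul_left _ (by omega)
  have := ha n
  have := hb n
  rw [pow_succ]
  change f n + g n ≤ _
  omega

theorem mul (hf : PolyBdd f) (hg : PolyBdd g) : PolyBdd fun n => f n * g n := by
  obtain ⟨a, ha⟩ := hf
  obtain ⟨b, hb⟩ := hg
  exact ⟨a + b, fun n => by rw [pow_add]; exact Nat.mul_le_mul (ha n) (hb n)⟩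

theorem pow (hf : PolyBdd f) (a : ℕ) : PolyBdd fun n => f n ^ a := by
  obtain ⟨c, hc⟩ := hf
  exact ⟨c * a, fun n => by rw [pow_mul]; exact Nat.pow_le_pow_left (hc n) _⟩

theorem sum {ι : Type*} (s : Finset ι) {f : ι → ℕ → ℕ} (h : ∀ i, PolyBdd (f i)) :
    PolyBdd fun n => ∑ i ∈ s, f i n := by
  classical
  induction s using Finset.induction_on with
  | empty => simpa using const 0
  | insert i s hi ih => simpa [Finset.sum_insert hi] using (h i).add ih

end PolyBdd

theorem SolvesTesting.mono {q : CQ σ k} {A : DynAlg} {𝒞 : Set (Database σ)}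
    {tp tu tt tp' tu' tt' : Database σ → ℝ} (h : SolvesTesting A q 𝒞 tp tu tt)
    (hp : ∀ D, tp D ≤ tp' D) (hu : ∀ D, tu D ≤ tu' D) (ht : ∀ D, tt D ≤ tt' D) :
    SolvesTesting A q 𝒞 tp' tu' tt' where
  preprocess D hD L hL := by
    obtain ⟨t, s, h1, h2⟩ := h.preprocess D hD L hL
    exact ⟨t, s, h1, h2.trans (hp D)⟩
  update N D s hs u hu' := by
    obtain ⟨t, s, h1, h2⟩ := h.update N D s hs u hu'
    exact ⟨t, s, h1, h2.trans (hu D)⟩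
  test N D s hs a := by
    obtain ⟨t, s, h1, h2, h3⟩ := h.test N D s hs a
    exact ⟨t, s, h1, h2.trans (ht D), h3⟩

/-! ### Nesting depths of the driver programs -/

theorem Ex.depth_comp (e : Ex) : ∀ t, (e.comp t).depth = 0 := by
  induction e <;> intro t <;> simp_all [Ex.comp, PL.depth]

theorem depth_asg (d : ℕ) (e : Ex) : (asg d e).depth = 0 := by
  simp [asg, PL.depth, e.depth_comp]

theorem depth_simInstr (i : Instr) : (simInstr i).depth = 0 := by
  cases i <;> simp [simInstr, PL.depth]

theorem depth_callOn (es : List Ex) (p : Prog) : (callOn es p).depth = 0 := by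
  have h : ∀ i, (wrs i es).depth = 0 := by
    induction es with
    | nil => exact fun _ => rfl
    | cons e es ih =>
      intro i
      simp [wrs, wr, goto, goback, PL.depth, depth_asg, depth_simInstr, ih]
  simp [callOn, PL.depth, h]

namespace Gadget

variable {c : CQ σ k} (G : Gadget c) (A : DynAlg)

theorem depth_insAll (l : List (Atom σ)) : (insAll G A l).depth = 0 := by
  induction l with
  | nil => rfl
  | cons ψ l ih =>
    simp only [insAll, PL.depth, ih]
    split_ifs <;> simp [ifE, PL.depth, cmd, depth_callOn, Ex.depth_comp]

theorem depth_prePL (q : CQ σ k) : (prePL G A q).depth = 2 := by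
  simp [prePL, fill, forE, PL.depth, depth_asg, depth_callOn, Ex.depth_comp, depth_insAll]

theorem depth_multPL : (multPL G A).depth = 1 := by
  have h : ∀ b, (cmdX G A b).depth = 0 := fun b => by
    simp only [cmdX]
    split
    · rfl
    · exact depth_callOn _ _
  simp [multPL, mark, unmark, rows, forE, PL.depth, depth_asg, Ex.depth_comp, cmd, depth_callOn,
    ifE, st, testRow, rd, goto, goback, depth_simInstr, h]

end Gadget

/-! ### The lower bound -/

theorem mem_matrixInput {n : ℕ} (M : Matrix (Fin n) (Fin n) Bool) (i j : Fin n) :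
    (matrixInput M)[1 + ((i : ℕ) * n + j)]? = some (M i j).toNat := by
  have h := List.ofFn_mul (m := n) (n := n) fun l : Fin (n * n) =>
    (M (finProdFinEquiv.symm l).1 (finProdFinEquiv.symm l).2).toNat
  have h' : ∀ (i j : Fin n) (h), finProdFinEquiv.symm (⟨(i : ℕ) * n + j, h⟩ : Fin (n * n)) =
      (i, j) := fun i j h => by
    rw [Equiv.symm_apply_eq]
    ext
    simp [finProdFinEquiv, Nat.mul_comm, Nat.add_comm]
  simp only [h'] at h
  have hij : (i : ℕ) * n + j < n * n := by
    have := Nat.mul_le_mul_right n (show (i : ℕ) + 1 ≤ n from i.2)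
    rw [Nat.succ_mul] at this; omega
  rw [matrixInput, ← h, Nat.add_comm 1, List.getElem?_cons_succ, List.getElem?_ofFn, dif_pos hij, h']

theorem le_of_mem_matrixInput {n : ℕ} (M : Matrix (Fin n) (Fin n) Bool) :
    ∀ x ∈ matrixInput M, x ≤ n + 1 := by
  intro x hx
  simp only [matrixInput, List.mem_cons, List.mem_flatten, List.mem_ofFn] at hx
  rcases hx with rfl | ⟨_, ⟨i, rfl⟩, hx⟩
  · omega
  · obtain ⟨j, rfl⟩ := (List.mem_ofFn' _ _).1 hx
    change (M i j).toNat ≤ _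
    have : (M i j).toNat ≤ 1 := Bool.toNat_le _
    omega

theorem Database.mapsInto_empty {q : CQ σ k} {D : Database σ} (hD : ∀ R, D R = ∅) :
    D.MapsInto q := by
  refine ⟨fun a => .const a, fun a ha => ?_, fun R t ht => ?_⟩
  · simp [Database.adom, hD] at ha
  · simp [hD] at ht

/-- Quadratically many calls, each in time `O(n ^ (1 - δ))`, take time `O(n ^ (3 - δ))`. -/
theorem cubic_bound {n L T τ : ℕ} {K δ : ℝ} (h : T ≤ L * (n + 1) ^ 2 * (τ + 1))
    (hτ : (τ : ℝ) + 1 ≤ K * ((n : ℝ) + 1) ^ (1 - δ)) :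
    (T : ℝ) ≤ (L : ℝ) * K * ((n : ℝ) + 1) ^ (3 - δ) := by
  have hpow : ((n : ℝ) + 1) ^ (3 - δ) = ((n : ℝ) + 1) ^ 2 * ((n : ℝ) + 1) ^ (1 - δ) := by
    rw [← Real.rpow_natCast, ← Real.rpow_add (by positivity)]
    congr 1
    push_cast
    ring
  calc (T : ℝ) ≤ ((L * (n + 1) ^ 2 * (τ + 1) : ℕ) : ℝ) := by exact_mod_cast h
    _ = (L : ℝ) * ((n : ℝ) + 1) ^ 2 * (τ + 1) := by push_cast; ring
    _ ≤ (L : ℝ) * ((n : ℝ) + 1) ^ 2 * (K * ((n : ℝ) + 1) ^ (1 - δ)) :=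
      mul_le_mul_of_nonneg_left hτ (by positivity)
    _ = _ := by rw [hpow]; ring

/-- A dynamic algorithm with sublinear update and testing times solves the problem OMv in
subcubic time. The databases that occur map homomorphically into the query. -/
theorem not_sublinearTesting {q : CQ σ k} (h : q.CoreNotTHierarchical) {ε : ℝ} (hε : 0 < ε)
    (hOMv : OMvConjecture) {𝒞 : Set (Database σ)} (h𝒞 : {D | D.MapsInto q} ⊆ 𝒞) :
    ¬ SublinearTesting q 𝒞 ε := by
  rintro ⟨A, tp, C, hA⟩
  obtain ⟨c, ⟨hc, hce⟩, hct⟩ := h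
  obtain ⟨G⟩ := CQ.exists_gadget hct
  obtain ⟨f, hf⟩ := hce.exists_preHom
  -- the exponent may be assumed to be small, and the constant to be nonnegative
  obtain ⟨δ, hδ0, hδ1, hδε⟩ : ∃ δ : ℝ, 0 < δ ∧ δ ≤ 1 / 2 ∧ δ ≤ ε :=
    ⟨min ε (1 / 2), by positivity, min_le_right _ _, min_le_left _ _⟩
  have hC' : (0 : ℝ) ≤ max C 0 := le_max_right _ _
  have hmono : ∀ D : Database σ, C * ((D.adom.card : ℝ) + 1) ^ (1 - ε) ≤
      max C 0 * ((D.adom.card : ℝ) + 1) ^ (1 - δ) := fun D => by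
    refine mul_le_mul (le_max_left _ _) ?_ (by positivity) hC'
    exact Real.rpow_le_rpow_of_exponent_le (by simp) (by linarith)
  replace hA := hA.mono (fun D => le_rfl) hmono hmono
  generalize max C 0 = C' at hA hC'
  let D₀ : Database σ := fun _ => ∅
  have hD₀ : D₀ ∈ 𝒞 := h𝒞 (Database.mapsInto_empty fun _ => rfl)
  obtain ⟨t₀, s₀, hex, -⟩ := hA.preprocess D₀ hD₀ [] ⟨List.nodup_nil, by simp [D₀]⟩
  -- the parameters of the simulation in dimension `n`
  let I := inputSize q D₀ (preprocessInput q [])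
  let τ : ℕ → ℕ := fun n => 16 * (⌊C' * ((G.bound n : ℝ) + 1) ^ (1 - δ)⌋₊ + t₀)
  let Y : ℕ → ℕ := fun n => 4 * (2 + ∑ R, σ.ar R + k) + τ n + 4
  let N₀ : ℕ → ℕ := fun n => q.size + σ.dbBound (G.bound n) + (G.bound n + σ.numRel + 1) + I
  have pbound : PolyBdd G.bound := (PolyBdd.const _).add ((PolyBdd.const _).mul .id)
  have hrpow : ∀ n : ℕ, ((n : ℝ) + 1) ^ (1 - δ) ≤ (n : ℝ) + 1 := fun n => by
    conv_rhs => rw [← Real.rpow_one ((n : ℝ) + 1)]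
    exact Real.rpow_le_rpow_of_exponent_le (by simp) (by linarith)
  have pτ : PolyBdd τ := by
    refine (PolyBdd.const 16).mul (PolyBdd.add (PolyBdd.mono
      (g := fun n => ⌈C'⌉₊ * (G.bound n + 1)) ((PolyBdd.const _).mul (pbound.add (.const 1)))
      fun n => ?_) (.const t₀))
    refine Nat.floor_le_of_le ?_
    push_cast
    exact mul_le_mul (Nat.le_ceil _) (hrpow _) (by positivity) (by positivity)
  have pY : PolyBdd Y := ((PolyBdd.const _).add pτ).add (.const _)
  have pN₀ : PolyBdd N₀ := by
    refine (((PolyBdd.const _).add (((PolyBdd.const _).add pbound).add (PolyBdd.sum _ fun R =>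
      (PolyBdd.const _).mul (pbound.pow _)))).add ((pbound.add (.const _)).add (.const _))).add
      (.const _)
  obtain ⟨e, he⟩ : PolyBdd fun n => 9 + N₀ n ^ A.wordExp + N₀ n + (G.bound n + 2) + (n * n + 1) +
      (4 * (preprocessInput q []).length + t₀ + n * (n * (G.base.length * Y n)) + n * (n * (5 * Y n))) := by
    refine (((((PolyBdd.const _).add (pN₀.pow _)).add pN₀).add (pbound.add (.const _))).add
      ((PolyBdd.id.mul .id).add (.const _))).add (((PolyBdd.const _).add
      (PolyBdd.id.mul (PolyBdd.id.mul ((PolyBdd.const _).mul pY)))).add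
      (PolyBdd.id.mul (PolyBdd.id.mul ((PolyBdd.const _).mul pY))))
  have hcard : ∀ {n D F}, G.Rep D F → Gadget.Adm c n F → D.adom.card ≤ G.bound n :=
    fun hD hF => Database.card_adom_le (hD.le_bound hF)
  have htime : ∀ {n D F} {t : ℕ}, G.Rep D F → Gadget.Adm c n F →
      (t : ℝ) ≤ C' * ((D.adom.card : ℝ) + 1) ^ (1 - δ) → 16 * t ≤ τ n := by
    intro n D F t hD hF ht
    have h1 : t ≤ ⌊C' * ((G.bound n : ℝ) + 1) ^ (1 - δ)⌋₊ := by
      refine Nat.le_floor (ht.trans (mul_le_mul_of_nonneg_left ?_ hC'))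
      refine Real.rpow_le_rpow (by positivity) ?_ (by linarith)
      have := hcard hD hF
      gcongr
    simp only [τ]
    omega
  have E : ∀ n, G.Env A q 𝒞 n (N₀ n) ((n + 2) ^ e) (τ n) (Y n) := by
    intro n
    have hB := he n
    beta_reduce at hB
    refine ⟨by omega, by omega, by omega, fun D F hD _ => h𝒞 (hD.mapsInto hf), ?_, ?_, ?_, ?_, ?_,
      by omega⟩
    · intro D F hD hF
      have := Database.size_le (hD.le_bound hF)
      simp only [N₀]
      omega
    · intro N D s F hs hD hF u hu
      obtain ⟨t, s', h1, h2⟩ := hA.update N D s hs u hu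
      exact ⟨t, s', h1, htime hD hF h2⟩
    · intro N D s F hs hD hF a
      obtain ⟨t, s', h1, h2, h3⟩ := hA.test N D s hs a
      rw [hce D]
      exact ⟨t, s', h1, htime hD hF h2, h3⟩
    · intro R
      have : σ.ar R ≤ ∑ R, σ.ar R := Finset.single_le_sum (fun _ _ => Nat.zero_le _)
        (Finset.mem_univ R)
      simp only [Y]
      omega
    · simp only [Y]
      omega
  let P : ℝ := G.b + 1 + G.w + 3
  let K' : ℝ := 16 * (C' * P ^ (1 - δ)) + 16 * t₀ + 1
  have hP : 0 ≤ P := by positivity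
  have hτ : ∀ n, (τ n : ℝ) + 1 ≤ K' * ((n : ℝ) + 1) ^ (1 - δ) := fun n => by
    have h1 : (1 : ℝ) ≤ ((n : ℝ) + 1) ^ (1 - δ) :=
      Real.one_le_rpow (by simp) (by linarith)
    have h2 : (⌊C' * ((G.bound n : ℝ) + 1) ^ (1 - δ)⌋₊ : ℝ) ≤
        C' * P ^ (1 - δ) * ((n : ℝ) + 1) ^ (1 - δ) := by
      refine (Nat.floor_le (by positivity)).trans ?_
      rw [mul_assoc, ← Real.mul_rpow hP (by positivity)]
      refine mul_le_mul_of_nonneg_left (Real.rpow_le_rpow (by positivity) ?_ (by linarith)) hC'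
      simp only [Gadget.bound, P]
      push_cast
      have : 0 ≤ ((G.b : ℝ) + 1 + G.w + 1) * n := by positivity
      nlinarith
    simp only [τ, K']
    push_cast
    have h3 : (16 * (t₀ : ℝ) + 1) * 1 ≤ (16 * (t₀ : ℝ) + 1) * ((n : ℝ) + 1) ^ (1 - δ) :=
      mul_le_mul_of_nonneg_left h1 (by positivity)
    nlinarith
  refine hOMv ⟨δ, hδ0, ((G.prePL A q).len + (G.multPL A).len : ℕ) * K', (G.prePL A q).prog,
    (G.multPL A).prog, e, fun n M v => ?_⟩
  have hB := he n
  beta_reduce at hB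
  let bit : ℕ → ℕ → ℕ := fun i j => if h : i < n ∧ j < n then (M ⟨i, h.1⟩ ⟨j, h.2⟩).toNat else 0
  have hbit : ∀ i j : Fin n, bit i j = (M i j).toNat := fun i j => by simp [bit]
  have hnn : n ≤ n * n := Nat.le_mul_self n
  have hbdd : (State.init.input (matrixInput M)).Bdd ((n + 2) ^ e) := by
    refine ⟨fun _ => Nat.zero_le _, fun a => ?_⟩
    simp only [State.input]
    split
    · rename_i i
      cases hi : (matrixInput M)[i]? with
      | none => exact Nat.zero_le _
      | some x =>
        have := le_of_mem_matrixInput M x (List.mem_of_getElem? hi)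
        simp only [Option.getD_some]
        omega
    · exact Nat.zero_le _
  obtain ⟨t, s, h1, h2, h3, h4, h5⟩ := Gadget.tri_pre (S := n) (D₀ := D₀)
    (Q := fun ρ' m' => Gadget.Good G A q 𝒞 n (N₀ n)
      (4 * (preprocessInput q []).length + t₀ + n * (n * (G.base.length * Y n)))
      (G.fillF G.base bit fun i j => i < n ∧ j < n) ρ' m' ∧ ρ' 12 = n)
    (E n) le_rfl (by omega) (fun _ => rfl) hD₀ hex (Nat.le_add_left _ _)
    (by simp only [τ]; omega) (by omega) (bit := bit)
    (m := (State.init.input (matrixInput M)).mem) (by simp [State.input, matrixInput])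
    (fun a ha => by
      simp only [State.input]
      split
      · simp at ha
      · rfl)
    (fun i hi j hj => by
      have := mem_matrixInput M ⟨i, hi⟩ ⟨j, hj⟩
      simp only at this
      simp [State.input, this, bit, hi, hj])
    (fun ρ' m' h1 h2 => ⟨h1, h2⟩) _ hbdd rfl rfl
  obtain ⟨T, h6, h7⟩ := Gadget.exists_omvRounds (E n) hc M hbit (List.ofFn v) _ s
    (by rw [List.length_ofFn]; omega) h3 h5 h4
  refine ⟨t, T, s, h1, h6, ?_⟩
  have hpre := (G.prePL A q).cost_le n (τ n)
  have hmul := (G.multPL A).cost_le n (τ n)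
  rw [Gadget.depth_prePL] at hpre
  rw [Gadget.depth_multPL, pow_one] at hmul
  rw [List.length_ofFn] at h7
  have htot : t + T ≤ ((G.prePL A q).len + (G.multPL A).len) * (n + 1) ^ 2 * (τ n + 1) := by
    have h8 : T ≤ (G.multPL A).len * (n + 1) ^ 2 * (τ n + 1) := by
      refine h7.trans ((Nat.mul_le_mul (Nat.le_succ n) hmul).trans (le_of_eq ?_))
      rw [Nat.succ_eq_add_one]; ring
    calc t + T ≤ (G.prePL A q).len * (n + 1) ^ 2 * (τ n + 1) +
          (G.multPL A).len * (n + 1) ^ 2 * (τ n + 1) := add_le_add (h2.trans hpre) h8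
      _ = _ := by ring
  exact cubic_bound htot (hτ n)

end DynCQ

namespace DynCQ

/-! ### Elimination of quantified variables with counters -/

section Elimination

variable (As : ℕ → Finset ℕ) (z : ℕ → ℕ) (T : ℕ → (ℕ → ℕ) → Prop)

/-- Partial assignments are functions to `ℕ`, with the value `0` for undefined variables. `T p β`
says that the atom number `p` holds under the assignment `β` to its variables, `z 0, z 1, …` are
the variables to be eliminated, and `As j` is the set of the atoms that contain `z j`.
`Val j p β` is the truth value that is attached to atom `p` after the elimination of
`z 0, …, z (j - 1)`: elimination of `z j` replaces all atoms in `As j` by one and the same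
formula, that some value for `z j` satisfies all of them. -/
def Val : ℕ → ℕ → (ℕ → ℕ) → Prop
  | 0, p, β => T p β
  | j + 1, p, β => (p ∈ As j ∧ β (z j) = 0 ∧
      ∃ a, a ≠ 0 ∧ ∀ p' ∈ As j, Val j p' (Function.update β (z j) a)) ∨ (p ∉ As j ∧ Val j p β)

/-- The values for `z j` that satisfy all atoms in `As j`. -/
def Wit (j : ℕ) (β : ℕ → ℕ) : Set ℕ :=
  {a | a ≠ 0 ∧ ∀ p' ∈ As j, Val As z T j p' (Function.update β (z j) a)}

open Classical in
/-- The number of atoms in `As j` that hold under `β`. -/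
noncomputable def cnt (j : ℕ) (β : ℕ → ℕ) : ℕ := {p ∈ As j | Val As z T j p β}.card

open Classical in
/-- The number of values for `z j` that satisfy all atoms in `As j`. -/
noncomputable def wit (j : ℕ) (β : ℕ → ℕ) : ℕ := if β (z j) = 0 then (Wit As z T j β).ncard else 0

variable {As z T} {T' : ℕ → (ℕ → ℕ) → Prop} {H : Finset ℕ} {j p : ℕ} {β : ℕ → ℕ}

theorem Val.range (hT : ∀ p β, T p β → ∀ x, β x = 0 ∨ β x ∈ H) :
    ∀ {j p β}, Val As z T j p β → ∀ x, β x = 0 ∨ β x ∈ H := by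
  intro j
  induction j with
  | zero => exact fun h => hT _ _ h
  | succ j ih =>
    rintro p β (⟨hp, h0, a, _, h⟩ | ⟨_, h⟩) x
    · by_cases hx : x = z j
      · exact .inl (hx ▸ h0)
      · simpa [Function.update_of_ne hx] using ih (h p hp) x
    · exact ih h x

theorem wit_subset (hT : ∀ p β, T p β → ∀ x, β x = 0 ∨ β x ∈ H) (hA : (As j).Nonempty) :
    Wit As z T j β ⊆ H := by
  rintro a ⟨h0, h⟩
  obtain ⟨p, hp⟩ := hA
  simpa [h0] using (h p hp).range hT (z j)

theorem finite_wit (hT : ∀ p β, T p β → ∀ x, β x = 0 ∨ β x ∈ H) (hA : (As j).Nonempty) :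
    (Wit As z T j β).Finite := H.finite_toSet.subset (wit_subset hT hA)

theorem wit_le (hT : ∀ p β, T p β → ∀ x, β x = 0 ∨ β x ∈ H) (hA : (As j).Nonempty) :
    wit As z T j β ≤ H.card := by
  rw [wit]
  split_ifs
  · rw [← Set.ncard_coe_finset]
    exact Set.ncard_le_ncard (wit_subset hT hA) H.finite_toSet
  · exact Nat.zero_le _

theorem cnt_le : cnt As z T j β ≤ (As j).card := by
  classical
  rw [cnt]
  exact Finset.card_filter_le _ _

/-- The truth value after the elimination of `z j` can be read off from a counter. -/
theorem val_succ_of_mem (hT : ∀ p β, T p β → ∀ x, β x = 0 ∨ β x ∈ H) (hp : p ∈ As j) :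
    Val As z T (j + 1) p β ↔ wit As z T j β ≠ 0 := by
  have hfin := finite_wit (As := As) (z := z) (β := β) hT ⟨p, hp⟩
  simp only [Val, hp, true_and, not_true, false_and, or_false, wit]
  split_ifs with h0
  · rw [← Nat.pos_iff_ne_zero, Set.ncard_pos hfin]
    exact ⟨fun h => h.2, fun h => ⟨h0, h⟩⟩
  · exact ⟨fun h => absurd h.1 h0, fun h => absurd rfl h⟩

theorem val_succ_of_notMem (hp : p ∉ As j) : Val As z T (j + 1) p β ↔ Val As z T j p β := by
  simp [Val, hp]

theorem cnt_eq_card : cnt As z T j β = (As j).card ↔ ∀ p ∈ As j, Val As z T j p β := by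
  classical
  rw [cnt]
  exact Finset.card_filter_eq_iff

/-- The truth values at level `j` for `T` and `T'` are the same, except possibly for the atoms in
`K` and the assignment `β`, where, if `act` holds, they are false for `T` and true for `T'`. -/
def Diff (As : ℕ → Finset ℕ) (z : ℕ → ℕ) (T T' : ℕ → (ℕ → ℕ) → Prop) (j : ℕ) (act : Prop)
    (K : Finset ℕ) (β : ℕ → ℕ) : Prop :=
  (∀ p γ, Val As z T' j p γ ↔ Val As z T j p γ ∨ (act ∧ p ∈ K ∧ γ = β)) ∧
    (act → ∀ p ∈ K, ¬ Val As z T j p β)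

variable {act : Prop} {K : Finset ℕ}

/-- Eliminating a variable that does not occur in the atoms of an active change leaves the change
as it is, and the counters of this level unchanged. -/
theorem Diff.skip (h : Diff As z T T' j act K β) (hK : act → Disjoint K (As j)) :
    Diff As z T T' (j + 1) act K β ∧ (∀ γ, cnt As z T' j γ = cnt As z T j γ) ∧
      ∀ γ, wit As z T' j γ = wit As z T j γ := by
  have h1 : ∀ p ∈ As j, ∀ γ, Val As z T' j p γ ↔ Val As z T j p γ := fun p hp γ =>
    (h.1 p γ).trans (or_iff_left fun h2 => Finset.disjoint_left.1 (hK h2.1) h2.2.1 hp)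
  have hW : ∀ γ, Wit As z T' j γ = Wit As z T j γ := fun γ => by
    ext a
    exact and_congr_right fun _ => forall₂_congr fun p hp => h1 p hp _
  refine ⟨⟨fun p γ => ?_, fun ha p hp => ?_⟩, fun γ => ?_, fun γ => by rw [wit, wit, hW]⟩
  · by_cases hp : p ∈ As j
    · have h2 : ¬ (act ∧ p ∈ K ∧ γ = β) := fun h2 =>
        Finset.disjoint_left.1 (hK h2.1) h2.2.1 hp
      have h3 : ∀ a, a ∈ Wit As z T' j γ ↔ a ∈ Wit As z T j γ := fun a => by rw [hW]
      simp only [Val, hp, true_and, not_true, false_and, or_false, h2]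
      exact and_congr_right fun _ => exists_congr h3
    · rw [val_succ_of_notMem hp, val_succ_of_notMem hp, h.1]
  · rw [val_succ_of_notMem (Finset.disjoint_left.1 (hK ha) hp)]
    exact h.2 ha p hp
  · rw [cnt, cnt]
    congr 1
    ext p
    simp only [Finset.mem_filter]
    exact and_congr_right fun hp => h1 p hp γ

open Classical in
/-- Eliminating a variable `z j` from all atoms of a change. The change concerns one assignment
`β` only. So the number of satisfied atoms changes for `β` only, the number of witnesses changes
only for the assignment `β` without its value for `z j`, and by one at most, and the truth values
of the next level change for this assignment only, namely if the number of witnesses changes from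
zero to one. -/
theorem Diff.step (h : Diff As z T T' j True K β) (hK : K ⊆ As j) (hne : K.Nonempty)
    (hz : β (z j) ≠ 0) (hT : ∀ p β, T p β → ∀ x, β x = 0 ∨ β x ∈ H)
    (hT' : ∀ p β, T' p β → ∀ x, β x = 0 ∨ β x ∈ H) :
    (∀ γ, cnt As z T' j γ = cnt As z T j γ + if γ = β then K.card else 0) ∧
    (∀ γ, wit As z T' j γ = wit As z T j γ +
      if γ = Function.update β (z j) 0 ∧ cnt As z T' j β = (As j).card then 1 else 0) ∧
    Diff As z T T' (j + 1)
      (cnt As z T' j β = (As j).card ∧ wit As z T j (Function.update β (z j) 0) = 0) (As j)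
      (Function.update β (z j) 0) := by
  obtain ⟨h1, h2⟩ := h
  simp only [true_and] at h1
  replace h2 := h2 trivial
  have hA := hne.mono hK
  have hup : ∀ {γ : ℕ → ℕ} {a}, γ (z j) = 0 → (Function.update γ (z j) a = β ↔
      γ = Function.update β (z j) 0 ∧ a = β (z j)) := by
    intro γ a h0
    constructor
    · rintro rfl
      simp [← h0]
    · rintro ⟨rfl, rfl⟩
      simp
  have hcnt : ∀ γ, cnt As z T' j γ = cnt As z T j γ + if γ = β then K.card else 0 := by
    intro γ
    rw [cnt, cnt]
    split_ifs with hγ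
    · subst hγ
      rw [← Finset.card_union_of_disjoint]
      · congr 1
        ext p
        simp only [Finset.mem_filter, Finset.mem_union, h1, and_true]
        constructor
        · rintro ⟨h3, h4 | h4⟩
          · exact .inl ⟨h3, h4⟩
          · exact .inr h4
        · rintro (h3 | h3)
          · exact ⟨h3.1, .inl h3.2⟩
          · exact ⟨hK h3, .inr h3⟩
      · exact Finset.disjoint_left.2 fun p hp hp' => h2 p hp' (Finset.mem_filter.1 hp).2
    · simp [h1, hγ]
  have hWsub : ∀ γ, γ (z j) = 0 → Wit As z T' j γ = Wit As z T j γ ∪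
      {a | a = β (z j) ∧ γ = Function.update β (z j) 0 ∧ cnt As z T' j β = (As j).card} := by
    intro γ h0
    ext a
    rw [cnt_eq_card]
    simp only [Wit, Set.mem_union, Set.mem_ofPred_eq]
    constructor
    · rintro ⟨ha, h3⟩
      by_cases he : Function.update γ (z j) a = β
      · obtain ⟨h4, h5⟩ := (hup h0).1 he
        exact .inr ⟨h5, h4, by rwa [he] at h3⟩
      · refine .inl ⟨ha, fun p hp => ((h1 p _).1 (h3 p hp)).resolve_right fun h4 => he h4.2⟩
    · rintro (⟨ha, h3⟩ | ⟨rfl, rfl, h3⟩)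
      · exact ⟨ha, fun p hp => (h1 p _).2 (.inl (h3 p hp))⟩
      · refine ⟨hz, fun p hp => ?_⟩
        rw [(hup (by simp)).2 ⟨rfl, rfl⟩]
        exact h3 p hp
  have hnot : ∀ γ, γ (z j) = 0 → γ = Function.update β (z j) 0 → β (z j) ∉ Wit As z T j γ := by
    intro γ h0 hγ h3
    obtain ⟨p, hp⟩ := hne
    have := h3.2 p (hK hp)
    rw [(hup h0).2 ⟨hγ, rfl⟩] at this
    exact h2 p hp this
  have hwit : ∀ γ, wit As z T' j γ = wit As z T j γ +
      if γ = Function.update β (z j) 0 ∧ cnt As z T' j β = (As j).card then 1 else 0 := by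
    intro γ
    rw [wit, wit]
    by_cases h0 : γ (z j) = 0
    · rw [if_pos h0, if_pos h0, hWsub γ h0]
      split_ifs with h3
      · have : {a | a = β (z j) ∧ γ = Function.update β (z j) 0 ∧
            cnt As z T' j β = (As j).card} = {β (z j)} := by
          ext a; simp [h3]
        rw [this, Set.union_singleton, Set.ncard_insert_of_notMem (hnot γ h0 h3.1)
          (finite_wit hT hA)]
      · have : {a | a = β (z j) ∧ γ = Function.update β (z j) 0 ∧
            cnt As z T' j β = (As j).card} = ∅ := by
          ext a
          simp only [Set.mem_ofPred_eq, Set.mem_empty_iff_false, iff_false]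
          exact fun h => h3 h.2
        rw [this, Set.union_empty, Nat.add_zero]
    · rw [if_neg h0, if_neg h0, if_neg]
      rintro ⟨rfl, _⟩
      simp at h0
  refine ⟨hcnt, hwit, fun p γ => ?_, fun h3 p hp => ?_⟩
  · by_cases hp : p ∈ As j
    · rw [val_succ_of_mem hT' hp, val_succ_of_mem hT hp, hwit]
      by_cases h3 : γ = Function.update β (z j) 0
      · subst h3
        simp only [hp, true_and, and_true]
        split_ifs with h4
        · simp only [h4, true_and]; omega
        · simp [h4]
      · simp [h3]
    · rw [val_succ_of_notMem hp, val_succ_of_notMem hp, h1]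
      have h3 : p ∉ K := fun h => hp (hK h)
      simp [h3, hp]
  · rw [val_succ_of_mem hT hp, not_not]
    exact h3.2

/-! ### Correctness of the elimination -/

open Classical in
/-- The restriction of an assignment. -/
noncomputable def restr (V : Set ℕ) (γ : ℕ → ℕ) : ℕ → ℕ := fun x => if x ∈ V then γ x else 0

/-- The variables of an atom that are left after the elimination of `z 0, …, z (j - 1)`. -/
def rem (z : ℕ → ℕ) (vs : ℕ → Set ℕ) (j p : ℕ) : Set ℕ := {x | x ∈ vs p ∧ ∀ i < j, x ≠ z i}

theorem restr_update {V V' : Set ℕ} {γ : ℕ → ℕ} {x a : ℕ} (h : ∀ y, y ∈ V' ↔ y ∈ V ∨ y = x) :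
    Function.update (restr V γ) x a = restr V' (Function.update γ x a) := by
  classical
  funext y
  by_cases hy : y = x
  · subst hy; simp [restr, h]
  · simp [restr, h, hy]

theorem restr_congr {V : Set ℕ} {γ γ' : ℕ → ℕ} (h : ∀ x ∈ V, γ x = γ' x) :
    restr V γ = restr V γ' := by
  classical
  funext x
  simp only [restr]
  split_ifs with hx
  · exact h x hx
  · rfl

/-- All atoms in `Ps` can be satisfied by values for the variables `z 0, …, z (m - 1)` iff the
truth values after the elimination of these variables are all true. -/
theorem exists_val_iff {m : ℕ} {Ps : Finset ℕ} {vs : ℕ → Set ℕ} {α : ℕ → ℕ} (hα : ∀ x, α x ≠ 0)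
    (hAs : ∀ j < m, ∀ p, p ∈ As j ↔ p ∈ Ps ∧ z j ∈ vs p) (hne : ∀ j < m, (As j).Nonempty)
    (hinj : ∀ j < m, ∀ i < j, z j ≠ z i)
    (hrem : ∀ j < m, ∀ p ∈ As j, ∀ p' ∈ As j, rem z vs j p = rem z vs j p') :
    (∃ γ : ℕ → ℕ, (∀ x, γ x ≠ 0) ∧ (∀ x, (∀ i < m, x ≠ z i) → γ x = α x) ∧
      ∀ p ∈ Ps, T p (restr (vs p) γ)) ↔ ∀ p ∈ Ps, Val As z T m p (restr (rem z vs m p) α) := by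
  have key : ∀ j ≤ m, (∃ γ : ℕ → ℕ, (∀ x, γ x ≠ 0) ∧ (∀ x, (∀ i < m, x ≠ z i) → γ x = α x) ∧
      ∀ p ∈ Ps, T p (restr (vs p) γ)) ↔
      ∃ γ : ℕ → ℕ, (∀ x, γ x ≠ 0) ∧ (∀ x, (∀ i < m, x ≠ z i) → γ x = α x) ∧
      ∀ p ∈ Ps, Val As z T j p (restr (rem z vs j p) γ) := by
    intro j
    induction j with
    | zero => intro _; simp [Val, rem]
    | succ j ih =>
      intro hj
      rw [ih (by omega)]
      have hz : ∀ p ∈ As j, ∀ y, y ∈ rem z vs j p ↔ y ∈ rem z vs (j + 1) p ∨ y = z j := by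
        intro p hp y
        have hp' := ((hAs j hj p).1 hp).2
        simp only [rem, Set.mem_ofPred_eq, Nat.lt_succ_iff_lt_or_eq]
        constructor
        · rintro ⟨h1, h2⟩
          by_cases hy : y = z j
          · exact .inr hy
          · refine .inl ⟨h1, ?_⟩
            rintro i (hi | rfl)
            · exact h2 i hi
            · exact hy
        · rintro (⟨h1, h2⟩ | rfl)
          · exact ⟨h1, fun i hi => h2 i (.inl hi)⟩
          · exact ⟨hp', hinj j hj⟩
      have hz' : ∀ p ∈ Ps, p ∉ As j → rem z vs (j + 1) p = rem z vs j p := by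
        intro p hp hp'
        ext y
        simp only [rem, Set.mem_ofPred_eq, Nat.lt_succ_iff_lt_or_eq]
        refine and_congr_right fun h1 => ⟨fun h2 i hi => h2 i (.inl hi), ?_⟩
        rintro h2 i (hi | rfl)
        · exact h2 i hi
        · rintro rfl; exact hp' ((hAs _ hj p).2 ⟨hp, h1⟩)
      constructor
      · rintro ⟨γ, h0, h1, h2⟩
        refine ⟨γ, h0, h1, fun p hp => ?_⟩
        by_cases hpA : p ∈ As j
        · refine .inl ⟨hpA, ?_, γ (z j), h0 _, fun p' hp' => ?_⟩
          · exact if_neg fun h => h.2 j (by omega) rfl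
          · have := h2 p' ((hAs j hj p').1 hp').1
            rwa [restr_update (hz p hpA), Function.update_eq_self, hrem j hj p hpA p' hp']
        · exact .inr ⟨hpA, hz' p hp hpA ▸ h2 p hp⟩
      · rintro ⟨γ, h0, h1, h2⟩
        obtain ⟨p₀, hp₀⟩ := hne j hj
        obtain ⟨_, _, a, ha, h3⟩ | ⟨h3, _⟩ := h2 p₀ ((hAs j hj p₀).1 hp₀).1
        · refine ⟨Function.update γ (z j) a, fun x => ?_, fun x hx => ?_, fun p hp => ?_⟩
          · by_cases hx : x = z j
            · subst hx; simpa using ha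
            · rw [Function.update_of_ne hx]; exact h0 x
          · rw [Function.update_of_ne (hx j hj)]; exact h1 x hx
          · by_cases hpA : p ∈ As j
            · have := h3 p hpA
              rwa [restr_update (hz p₀ hp₀), hrem j hj p₀ hp₀ p hpA] at this
            · obtain ⟨h4, _⟩ | ⟨_, h4⟩ := h2 p hp
              · exact absurd h4 hpA
              · rw [hz' p hp hpA] at h4
                rwa [restr_congr (γ' := γ)]
                intro x hx
                refine Function.update_of_ne ?_ _ _
                rintro rfl
                exact hpA ((hAs j hj p).2 ⟨hp, hx.1⟩)
        · exact absurd hp₀ h3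
  rw [key m le_rfl]
  have hr : ∀ γ : ℕ → ℕ, (∀ x, (∀ i < m, x ≠ z i) → γ x = α x) → ∀ p,
      restr (rem z vs m p) γ = restr (rem z vs m p) α := fun γ h p =>
    restr_congr fun x hx => h x hx.2
  constructor
  · rintro ⟨γ, _, h1, h2⟩ p hp
    rw [← hr γ h1]
    exact h2 p hp
  · exact fun h => ⟨α, hα, fun _ _ => rfl, h⟩

end Elimination

end DynCQ

namespace DynCQ

/-! ### Data structure on the machine -/

/-- Whether a term is a constant. -/
def Term.kind : Term → ℕ
  | .var _ => 0
  | .const _ => 1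

/-- The number of a variable, or the value of a constant. -/
def Term.num : Term → ℕ
  | .var x => x
  | .const a => a

/-- The value of a term under a partial assignment with numbers as values. -/
def Term.ev (β : ℕ → ℕ) : Term → ℕ
  | .var x => β x
  | .const a => a

theorem Term.code_eq (t : Term) : t.code = [t.kind, t.num] := by cases t <;> rfl

/-- The tables that the preprocessing computes from the query: the argument lists of the head
(with number `0`) and of the atoms (with numbers `1, …, d`), the relation symbols of the atoms,
a list `X` of numbers that contains all variables, and the variables `z 0, …, z (ℓ - 1)`
in the order of their elimination. -/
structure Layout where
  d : ℕ
  ℓ : ℕ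
  args : ℕ → List Term
  rel : ℕ → ℕ
  X : List ℕ
  z : ℕ → ℕ

namespace Layout

variable (Y : Layout)

open Classical in
/-- The numbers of the atoms that contain the variable `z j`. -/
noncomputable def As (j : ℕ) : Finset ℕ := {p ∈ Finset.Icc 1 Y.d | .var (Y.z j) ∈ Y.args p}

/-- The variables of the atom number `p`. -/
def vs (p : ℕ) : Set ℕ := {x | .var x ∈ Y.args p}

open Classical in
/-- The tables in memory: the list `X` is stored in the array `4`, the relation symbols and the
arities in the arrays `10` and `11`, kinds and numbers of the arguments in the arrays `12` and `13`,
the incidence matrix of atoms and variables in the array `14`, the variables `z j` in the array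
`15`, and the numbers of atoms that contain them in the array `16`. -/
structure Static (ρ : ℕ → ℕ) (m : Mem) : Prop where
  reg_d : ρ 20 = Y.d
  reg_ℓ : ρ 21 = Y.ℓ
  reg_X : ρ 22 = Y.X.length
  X : ∀ e (h : e < Y.X.length), m [4, e] = Y.X[e]
  rel : ∀ p, 1 ≤ p → p ≤ Y.d → m [10, p] = Y.rel p
  ar : ∀ p ≤ Y.d, m [11, p] = (Y.args p).length
  kind : ∀ p ≤ Y.d, ∀ l (h : l < (Y.args p).length), m [12, p, l] = ((Y.args p)[l]).kind
  num : ∀ p ≤ Y.d, ∀ l (h : l < (Y.args p).length), m [13, p, l] = ((Y.args p)[l]).num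
  occ : ∀ p ≤ Y.d, ∀ x, m [14, p, x] = if .var x ∈ Y.args p then 1 else 0
  z : ∀ j < Y.ℓ, m [15, j] = Y.z j
  w : ∀ j < Y.ℓ, m [16, j] = (Y.As j).card

/-- Properties of the tables for a `t`-hierarchical query. -/
structure Wf : Prop where
  mem_X : ∀ p ≤ Y.d, ∀ x, .var x ∈ Y.args p → x ∈ Y.X
  nonempty : ∀ j < Y.ℓ, (Y.As j).Nonempty
  laminar : ∀ j < Y.ℓ, ∀ i < j, Y.As i ⊆ Y.As j ∨ Disjoint (Y.As i) (Y.As j)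
  z_ne : ∀ j < Y.ℓ, ∀ i < j, Y.z j ≠ Y.z i
  rem_eq : ∀ j < Y.ℓ, ∀ p ∈ Y.As j, ∀ p' ∈ Y.As j, rem Y.z Y.vs j p = rem Y.z Y.vs j p'
  head : ∀ j < Y.ℓ, .var (Y.z j) ∉ Y.args 0
  free : ∀ p, 1 ≤ p → p ≤ Y.d → ∀ x, .var x ∈ Y.args p → (∀ i < Y.ℓ, x ≠ Y.z i) → .var x ∈ Y.args 0

variable {Y}

theorem Static.frame {ρ ρ' : ℕ → ℕ} {m m' : Mem} (h : Y.Static ρ m)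
    (hρ : ∀ r, 20 ≤ r → r ≤ 22 → ρ' r = ρ r)
    (hm : ∀ a : List ℕ, a.head? ≠ some 0 → a.head? ≠ some 1 → a.head? ≠ some 5 →
      a.head? ≠ some 6 → m' a = m a) : Y.Static ρ' m' where
  reg_d := (hρ 20 (by omega) (by omega)).trans h.reg_d
  reg_ℓ := (hρ 21 (by omega) (by omega)).trans h.reg_ℓ
  reg_X := (hρ 22 (by omega) (by omega)).trans h.reg_X
  X e he := by rw [hm _ (by simp) (by simp) (by simp) (by simp)]; exact h.X e he
  rel p h1 h2 := by rw [hm _ (by simp) (by simp) (by simp) (by simp)]; exact h.rel p h1 h2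
  ar p hp := by rw [hm _ (by simp) (by simp) (by simp) (by simp)]; exact h.ar p hp
  kind p hp l hl := by rw [hm _ (by simp) (by simp) (by simp) (by simp)]; exact h.kind p hp l hl
  num p hp l hl := by rw [hm _ (by simp) (by simp) (by simp) (by simp)]; exact h.num p hp l hl
  occ p hp x := by rw [hm _ (by simp) (by simp) (by simp) (by simp)]; exact h.occ p hp x
  z j hj := by rw [hm _ (by simp) (by simp) (by simp) (by simp)]; exact h.z j hj
  w j hj := by rw [hm _ (by simp) (by simp) (by simp) (by simp)]; exact h.w j hj

end Layout

/-- The registers outside `s` are kept. -/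
def RegEq (s : List ℕ) (ρ ρ' : ℕ → ℕ) : Prop := ∀ r, r ∉ s → ρ' r = ρ r

theorem RegEq.refl (s : List ℕ) (ρ : ℕ → ℕ) : RegEq s ρ ρ := fun _ _ => rfl

theorem RegEq.trans {s : List ℕ} {ρ ρ' ρ'' : ℕ → ℕ} (h : RegEq s ρ ρ') (h' : RegEq s ρ' ρ'') :
    RegEq s ρ ρ'' := fun r hr => (h' r hr).trans (h r hr)

theorem RegEq.mono {s s' : List ℕ} {ρ ρ' : ℕ → ℕ} (h : RegEq s ρ ρ') (hs : s ⊆ s') :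
    RegEq s' ρ ρ' := fun r hr => h r fun h' => hr (hs h')

theorem RegEq.update {s : List ℕ} {ρ ρ' : ℕ → ℕ} (h : RegEq s ρ ρ') {d v : ℕ} (hd : d ∈ s) :
    RegEq s ρ (Function.update ρ' d v) := fun r hr =>
  (Function.update_of_ne (fun e => hr (by rwa [e])) _ _).trans (h r hr)

/-- The memory is kept except for pointer cells, that is cells of the array `6` with less than
`M` further indices. -/
def PtrEq (M : ℕ) (m m' : Mem) : Prop :=
  ∀ a : List ℕ, (a.head? = some 6 → 3 + M ≤ a.length) → m' a = m a

theorem PtrEq.refl (M : ℕ) (m : Mem) : PtrEq M m m := fun _ _ => rfl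

theorem length_pathAddr (m : Mem) (a : List ℕ) (k : ℕ) :
    (pathAddr m a k).length = a.length + k := by
  induction k with
  | zero => rfl
  | succ k ih => rw [pathAddr, List.length_append, ih]; rfl

theorem pathAddr_congr {m m' : Mem} {a : List ℕ} {k : ℕ}
    (h : ∀ b : List ℕ, b.length < a.length + k → m' b = m b) : pathAddr m' a k = pathAddr m a k := by
  induction k with
  | zero => rfl
  | succ k ih =>
    rw [pathAddr, pathAddr, ih fun b hb => h b (by omega), h _ (by rw [length_pathAddr]; omega)]

namespace Layout

variable {Y : Layout}

open Classical in
/-- The part of the current assignment, which is stored in the array `5`, that concerns the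
variables of the atom number `p`. -/
noncomputable def key (Y : Layout) (p : ℕ) (m : Mem) : ℕ → ℕ := fun x =>
  if .var x ∈ Y.args p then m [5, x] else 0

/-- Build the address of the cell for the current assignment to the variables of an atom, where
the logical registers `24`, `33`, `34` hold the number of the atom and the first two indices of
the cell. -/
def keyPL : PL :=
  forE 35 (.reg 22) (asg 36 (.mul (.ld₂ 14 (.reg 24) (.ld 4 (.reg 35))) (.ld 5 (.ld 4 (.reg 35)))) ;;
    walkSt 6 33 34 35 36)

variable {B S τ : ℕ} {ρ : ℕ → ℕ} {m : Mem} {Q : (ℕ → ℕ) → Mem → Prop} {p : ℕ}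

/-- The entries of the address are the values of all the variables in the list `X`, with `0` for
those that do not occur in the atom. -/
theorem tri_key (hst : Y.Static ρ m) (hB : 16 ≤ B) (hX : Y.X.length ≤ B) (hXS : Y.X.length ≤ S)
    (hp : p ≤ Y.d) (h24 : ρ 24 = p)
    (h : ∀ ρ' m', RegEq [35, 36] ρ ρ' → PtrEq Y.X.length m m' →
      pathAddr m' [6, ρ 33, ρ 34] Y.X.length = 6 :: ρ 33 :: ρ 34 :: Y.X.map (Y.key p m) → Q ρ' m') :
    Tri B S τ keyPL ρ m Q := by
  refine .bdd fun _ hmB => ?_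
  refine .forE (fun e ρ' m' => RegEq [35, 36] ρ ρ' ∧ ρ' 35 = e ∧ PtrEq Y.X.length m m' ∧
    pathAddr m' [6, ρ 33, ρ 34] e = 6 :: ρ 33 :: ρ 34 :: (Y.X.take e).map (Y.key p m))
    Y.X.length hXS hX ?_ ?_ ?_ ?_
  · exact ⟨(RegEq.refl _ _).update (by simp), by simp, .refl _ _, by simp [pathAddr]⟩
  · rintro e ρ' m' _ ⟨h1, h2, _⟩
    exact ⟨h2, (h1 22 (by simp)).trans hst.reg_X, trivial⟩
  · rintro e he ρ' m' ⟨h1, h35, hm, ha⟩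
    have e24 : ρ' 24 = p := (h1 24 (by simp)).trans h24
    have eX : m' [4, e] = Y.X[e] := (hm _ (by simp)).trans (hst.X e he)
    have eocc : ∀ x, m' [14, p, x] = m [14, p, x] := fun x => hm _ (by simp)
    have e5 : ∀ x, m' [5, x] = m [5, x] := fun x => hm _ (by simp)
    have hval : (Ex.mul (.ld₂ 14 (.reg 24) (.ld 4 (.reg 35))) (.ld 5 (.ld 4 (.reg 35)))).eval ρ' m' =
        Y.key p m Y.X[e] := by
      simp only [Ex.eval, h35, e24, eX, eocc, e5, hst.occ p hp, key]
      split_ifs <;> simp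
    have hkey : Y.key p m Y.X[e] ≤ B := by
      rw [key]
      split_ifs
      · exact hmB _
      · omega
    refine .seq (.asg ⟨?_, ?_, ?_⟩ ?_)
    · simp; omega
    · simp; omega
    · rw [Ex.eval] at hval
      rw [hval]; exact hkey
    rw [hval]
    refine .walkSt (by omega) (by omega) (by simp [h35]; omega) ?_
    have e33 : ρ' 33 = ρ 33 := h1 33 (by simp)
    have e34 : ρ' 34 = ρ 34 := h1 34 (by simp)
    have hu : ∀ r, r ≠ 36 → Function.update ρ' 36 (Y.key p m Y.X[e]) r = ρ' r := fun r hr =>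
      Function.update_of_ne hr _ _
    rw [hu 33 (by omega), hu 34 (by omega), hu 35 (by omega), e33, e34, h35, ha,
      Function.update_self]
    refine ⟨rfl, ⟨(h1.update (by simp)).update (by simp), by simp,
      fun a h2 => ?_, ?_⟩⟩
    · rw [Function.update_of_ne, hm a h2]
      rintro rfl
      have := h2 rfl
      simp at this
      omega
    · have htake : Y.X.take (e + 1) = Y.X.take e ++ [Y.X[e]] := by
        rw [List.take_add_one, List.getElem?_eq_getElem he]; rfl
      have h2 : ∀ b : List ℕ, b.length < 3 + e → Function.update m'
          (6 :: ρ 33 :: ρ 34 :: (Y.X.take e).map (Y.key p m)) (Y.key p m Y.X[e]) b = m' b := by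
        intro b hb
        refine Function.update_of_ne ?_ _ _
        rintro rfl
        simp at hb
        omega
      rw [pathAddr, pathAddr_congr (by simpa [Nat.add_comm] using h2), ha, Function.update_self,
        htake, List.map_append]
      rfl
  · rintro ρ' m' ⟨h1, _, hm, ha⟩
    rw [List.take_length] at ha
    exact h _ _ h1 hm ha

/-- Load from a cell for the current assignment to the variables of an atom. -/
def get (tag id : Ex) (r : ℕ) : PL :=
  asg 33 tag ;; asg 34 id ;; keyPL ;; walkLd 6 33 34 22 r

/-- Store in a cell for the current assignment to the variables of an atom. -/
def put (tag id : Ex) (r : ℕ) : PL :=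
  asg 33 tag ;; asg 34 id ;; keyPL ;; walkSt 6 33 34 22 r

theorem tri_get (hst : Y.Static ρ m) (hB : 16 ≤ B) (hX : Y.X.length ≤ B) (hXS : Y.X.length ≤ S)
    (hp : p ≤ Y.d) (h24 : ρ 24 = p) {tag id : Ex} (ht : tag.Ok B ρ m)
    (hi : ∀ v, id.Ok B (Function.update ρ 33 v) m ∧ id.eval (Function.update ρ 33 v) m = id.eval ρ m)
    {r : ℕ}
    (h : ∀ ρ' m', RegEq [33, 34, 35, 36, r] ρ ρ' → PtrEq Y.X.length m m' →
      ρ' r = m (6 :: tag.eval ρ m :: id.eval ρ m :: Y.X.map (Y.key p m)) → Q ρ' m') :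
    Tri B S τ (get tag id r) ρ m Q := by
  refine .seq (.asg ht (.seq (.asg (hi _).1 ?_)))
  rw [(hi _).2]
  set ρ₁ := Function.update (Function.update ρ 33 (tag.eval ρ m)) 34 (id.eval ρ m) with hρ₁
  have h1 : RegEq [33, 34, 35, 36, r] ρ ρ₁ :=
    ((RegEq.refl _ _).update (by simp)).update (by simp)
  have e33 : ρ₁ 33 = tag.eval ρ m := by simp [hρ₁]
  have e34 : ρ₁ 34 = id.eval ρ m := by simp [hρ₁]
  have hu : ∀ x, x ≠ 33 → x ≠ 34 → ρ₁ x = ρ x := fun x h1 h2 => by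
    rw [hρ₁, Function.update_of_ne h2, Function.update_of_ne h1]
  refine .seq (tri_key (hst.frame (fun r h2 h3 => hu r (by omega) (by omega)) fun _ _ _ _ _ => rfl)
    hB hX hXS hp ((hu 24 (by omega) (by omega)).trans h24) fun ρ₂ m₂ h2 h3 h4 => ?_)
  have f22 : ρ₂ 22 = Y.X.length := by
    rw [h2 22 (by simp), hu 22 (by omega) (by omega), hst.reg_X]
  refine .walkLd (by omega) (by omega) (by omega) ?_
  rw [f22, h2 33 (by simp), h2 34 (by simp), h4, e33, e34]
  refine h _ _ ((h1.trans (h2.mono (by simp))).update (by simp)) h3 ?_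
  rw [Function.update_self]
  exact h3 _ fun _ => by simp; omega

theorem tri_put (hst : Y.Static ρ m) (hB : 16 ≤ B) (hX : Y.X.length ≤ B) (hXS : Y.X.length ≤ S)
    (hp : p ≤ Y.d) (h24 : ρ 24 = p) {tag id : Ex} (ht : tag.Ok B ρ m)
    (hi : ∀ v, id.Ok B (Function.update ρ 33 v) m ∧ id.eval (Function.update ρ 33 v) m = id.eval ρ m)
    {r : ℕ} (hr : r ∉ [33, 34, 35, 36])
    (h : ∀ ρ' m', RegEq [33, 34, 35, 36] ρ ρ' → PtrEq Y.X.length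
      (Function.update m (6 :: tag.eval ρ m :: id.eval ρ m :: Y.X.map (Y.key p m)) (ρ r)) m' →
      Q ρ' m') :
    Tri B S τ (put tag id r) ρ m Q := by
  refine .seq (.asg ht (.seq (.asg (hi _).1 ?_)))
  rw [(hi _).2]
  set ρ₁ := Function.update (Function.update ρ 33 (tag.eval ρ m)) 34 (id.eval ρ m) with hρ₁
  have h1 : RegEq [33, 34, 35, 36] ρ ρ₁ := ((RegEq.refl _ _).update (by simp)).update (by simp)
  have e33 : ρ₁ 33 = tag.eval ρ m := by simp [hρ₁]
  have e34 : ρ₁ 34 = id.eval ρ m := by simp [hρ₁]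
  have hu : ∀ x, x ≠ 33 → x ≠ 34 → ρ₁ x = ρ x := fun x h1 h2 => by
    rw [hρ₁, Function.update_of_ne h2, Function.update_of_ne h1]
  refine .seq (tri_key (hst.frame (fun r h2 h3 => hu r (by omega) (by omega)) fun _ _ _ _ _ => rfl)
    hB hX hXS hp ((hu 24 (by omega) (by omega)).trans h24) fun ρ₂ m₂ h2 h3 h4 => ?_)
  have f22 : ρ₂ 22 = Y.X.length := by
    rw [h2 22 (by simp), hu 22 (by omega) (by omega), hst.reg_X]
  have h5 := h1.trans (h2.mono (s' := [33, 34, 35, 36]) (by simp))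
  refine .walkSt (by omega) (by omega) (by omega) ?_
  rw [f22, h2 33 (by simp), h2 34 (by simp), h4, e33, e34, h5 r hr]
  refine h _ _ h5 fun a ha => ?_
  by_cases h6 : a = 6 :: tag.eval ρ m :: id.eval ρ m :: Y.X.map (Y.key p m)
  · rw [h6, Function.update_self, Function.update_self]
  · rw [Function.update_of_ne h6, Function.update_of_ne h6, h3 a ha]

/-! ### Matching the arguments of an atom with a tuple -/

/-- Match the arguments of the atom whose number is in the logical register `24` with the
tuple that starts at the input cell whose number is in the logical register `25`. The
assignment is stored in the array `5`, and the logical register `28` tells if there is one. -/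
def matchPL : PL :=
  forE 35 (.reg 22) (st 5 (.ld 4 (.reg 35)) (.lit 0)) ;; asg 28 (.lit 1) ;;
    forE 29 (.ld 11 (.reg 24)) (asg 36 (.ld 0 (.add (.reg 25) (.reg 29))) ;;
      asg 37 (.ld₂ 13 (.reg 24) (.reg 29)) ;;
      ifE (.ld₂ 12 (.reg 24) (.reg 29))
        (ifE (.eq (.reg 36) (.reg 37)) .skip (asg 28 (.lit 0)))
        (ifE (.ld 5 (.reg 37)) (ifE (.eq (.ld 5 (.reg 37)) (.reg 36)) .skip (asg 28 (.lit 0)))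
          (st 5 (.reg 37) (.reg 36))))

/-- The matching is successful if and only if some assignment maps the arguments to the tuple; the
value `0`, which does not occur in tuples, marks the variables without a value. -/
theorem tri_match (hst : Y.Static ρ m) (hY : Y.Wf) (hB : 16 ≤ B) (hX : Y.X.length ≤ B)
    (hXS : Y.X.length ≤ S) (hp : p ≤ Y.d) (h24 : ρ 24 = p) {t : List ℕ}
    (hlen : t.length = (Y.args p).length) (hS : t.length ≤ S) (ht : ∀ u ∈ t, u ≠ 0)
    (hseg : ∀ l (h : l < t.length), m [0, ρ 25 + l] = t[l]) (hb : ρ 25 + t.length ≤ B)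
    (h : ∀ ρ' m' β, RegEq [28, 29, 35, 36, 37] ρ ρ' →
      (∀ a : List ℕ, a.head? ≠ some 5 → m' a = m a) → (∀ x ∈ Y.X, m' [5, x] = β x) →
      (∀ x ∉ Y.X, β x = 0) →
      (ρ' 28 = 1 ∧ (∀ x, β x ≠ 0 ↔ .var x ∈ Y.args p) ∧ (Y.args p).map (Term.ev β) = t) ∨
      (ρ' 28 = 0 ∧ ∀ β', (Y.args p).map (Term.ev β') ≠ t) → Q ρ' m') :
    Tri B S τ matchPL ρ m Q := by
  refine .seq' (R := fun ρ' m' => RegEq [28, 29, 35, 36, 37] ρ ρ' ∧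
      (∀ a : List ℕ, a.head? ≠ some 5 → m' a = m a) ∧ ∀ x ∈ Y.X, m' [5, x] = 0) ?_ ?_
  · refine .forE (fun e ρ' m' => RegEq [28, 29, 35, 36, 37] ρ ρ' ∧ ρ' 35 = e ∧
      (∀ a : List ℕ, a.head? ≠ some 5 → m' a = m a) ∧ ∀ x ∈ Y.X.take e, m' [5, x] = 0)
      Y.X.length hXS hX ?_ ?_ ?_ ?_
    · exact ⟨(RegEq.refl _ _).update (by simp), by simp, fun _ _ => rfl, by simp⟩
    · rintro e ρ' m' _ ⟨h1, h2, _⟩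
      exact ⟨h2, (h1 22 (by simp)).trans hst.reg_X, trivial⟩
    · rintro e he ρ' m' ⟨h1, h35, hm, h5⟩
      have eX : m' [4, e] = Y.X[e] := (hm _ (by simp)).trans (hst.X e he)
      refine .st (by omega) (by simp; omega) (by simp) ?_
      simp only [Ex.eval, h35, eX]
      refine ⟨trivial, h1.update (by simp), by simp, fun a ha => ?_, fun x hx => ?_⟩
      · rw [Function.update_of_ne (by rintro rfl; simp at ha), hm a ha]
      · by_cases hxe : x = Y.X[e]
        · subst hxe; simp
        · rw [Function.update_of_ne (by simpa using hxe)]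
          rw [List.take_add_one, List.getElem?_eq_getElem he] at hx
          simp only [Option.toList_some, List.mem_append, List.mem_singleton, hxe, or_false] at hx
          exact h5 x hx
    · rintro ρ' m' ⟨h1, _, hm, h5⟩
      rw [List.take_length] at h5
      exact ⟨h1, hm, h5⟩
  · rintro ρ₁ m₁ ⟨h1, hm₁, h5⟩
    refine .seq (.asg (by simp; omega) ?_)
    simp only [Ex.eval]
    refine .forE (fun l ρ' m' => RegEq [28, 29, 35, 36, 37] ρ ρ' ∧ ρ' 29 = l ∧
      (∀ a : List ℕ, a.head? ≠ some 5 → m' a = m a) ∧ ∃ β : ℕ → ℕ,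
      (∀ x ∈ Y.X, m' [5, x] = β x) ∧ (∀ x ∉ Y.X, β x = 0) ∧
      ((ρ' 28 = 1 ∧ (∀ x, β x ≠ 0 ↔ .var x ∈ (Y.args p).take l) ∧
        ((Y.args p).take l).map (Term.ev β) = t.take l) ∨
      (ρ' 28 = 0 ∧ ∀ β', (Y.args p).map (Term.ev β') ≠ t))) t.length hS (by omega) ?_ ?_ ?_ ?_
    · refine ⟨(h1.update (by simp)).update (by simp), by simp, hm₁, fun _ => 0, h5,
        fun _ _ => rfl, .inl ⟨by simp, by simp, by simp⟩⟩
    · rintro l ρ' m' _ ⟨h1, h2, hm, _⟩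
      have e24 : ρ' 24 = p := (h1 24 (by simp)).trans h24
      refine ⟨h2, ?_, by simp; omega⟩
      simp only [Ex.eval, e24]
      rw [hm _ (by simp), hst.ar p hp, hlen]
    · rintro l hl ρ₂ m₂ ⟨h2, h29, hm₂, β, hβ, hβ0, hok⟩
      have hl' : l < (Y.args p).length := hlen ▸ hl
      have e24 : ρ₂ 24 = p := (h2 24 (by simp)).trans h24
      have e25 : ρ₂ 25 = ρ 25 := h2 25 (by simp)
      have r36 : (Ex.ld 0 (.add (.reg 25) (.reg 29))).eval ρ₂ m₂ = t[l] := by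
        simp only [Ex.eval, h29, e25]
        rw [hm₂ _ (by simp), hseg l hl]
      have htl : t[l] ≠ 0 := ht _ (List.getElem_mem hl)
      have ttake : t.take (l + 1) = t.take l ++ [t[l]] := by
        rw [List.take_add_one, List.getElem?_eq_getElem hl]; rfl
      have atake : (Y.args p).take (l + 1) = (Y.args p).take l ++ [(Y.args p)[l]] := by
        rw [List.take_add_one, List.getElem?_eq_getElem hl']; rfl
      -- a mismatch at position `l` rules out all assignments
      have hbad : ∀ β' : ℕ → ℕ, (Y.args p).map (Term.ev β') = t →
          ((Y.args p).take l).map (Term.ev β') = t.take l ∧ ((Y.args p)[l]).ev β' = t[l] := by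
        rintro β' rfl
        exact ⟨List.map_take, by simp⟩
      refine .seq (.asg (by simp; omega) ?_)
      rw [r36]
      refine .seq (.asg (by simp; omega) ?_)
      have r37 : (Ex.ld₂ 13 (.reg 24) (.reg 29)).eval (Function.update ρ₂ 36 t[l]) m₂ =
          ((Y.args p)[l]).num := by
        simp only [Ex.eval]
        rw [Function.update_of_ne (by omega), Function.update_of_ne (by omega), h29, e24,
          hm₂ _ (by simp), hst.num p hp l hl']
      rw [r37]
      set ρ₃ := Function.update (Function.update ρ₂ 36 t[l]) 37 ((Y.args p)[l]).num with hρ₃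
      have h3 : RegEq [28, 29, 35, 36, 37] ρ ρ₃ := (h2.update (by simp)).update (by simp)
      have f : ∀ r, r ≠ 36 → r ≠ 37 → ρ₃ r = ρ₂ r := fun r h1 h2 => by
        rw [hρ₃, Function.update_of_ne h2, Function.update_of_ne h1]
      have f24 : ρ₃ 24 = p := (f _ (by omega) (by omega)).trans e24
      have f29 : ρ₃ 29 = l := (f _ (by omega) (by omega)).trans h29
      have f28 : ρ₃ 28 = ρ₂ 28 := f _ (by omega) (by omega)
      have f36 : ρ₃ 36 = t[l] := by simp [hρ₃]
      have f37 : ρ₃ 37 = ((Y.args p)[l]).num := by simp [hρ₃]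
      clear_value ρ₃
      rw [← f28] at hok
      have rk : (Ex.ld₂ 12 (.reg 24) (.reg 29)).eval ρ₃ m₂ = ((Y.args p)[l]).kind := by
        simp only [Ex.eval]
        rw [f24, f29, hm₂ _ (by simp), hst.kind p hp l hl']
      -- the two outcomes without change of the assignment
      have good : ((Y.args p)[l]).ev β = t[l] →
          ((ρ₃ 28 = 1 ∧ (∀ x, β x ≠ 0 ↔ .var x ∈ (Y.args p).take l)) →
            ∀ x, (Y.args p)[l] = .var x → β x ≠ 0) → ρ₃ 29 = l ∧
          RegEq [28, 29, 35, 36, 37] ρ (Function.update ρ₃ 29 (l + 1)) ∧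
          Function.update ρ₃ 29 (l + 1) 29 = l + 1 ∧
          (∀ a : List ℕ, a.head? ≠ some 5 → m₂ a = m a) ∧ ∃ β : ℕ → ℕ,
          (∀ x ∈ Y.X, m₂ [5, x] = β x) ∧ (∀ x ∉ Y.X, β x = 0) ∧
          ((Function.update ρ₃ 29 (l + 1) 28 = 1 ∧
            (∀ x, β x ≠ 0 ↔ .var x ∈ (Y.args p).take (l + 1)) ∧
            ((Y.args p).take (l + 1)).map (Term.ev β) = t.take (l + 1)) ∨
          (Function.update ρ₃ 29 (l + 1) 28 = 0 ∧ ∀ β', (Y.args p).map (Term.ev β') ≠ t)) := by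
        intro hev hsup
        refine ⟨f29, h3.update (by simp), by simp, hm₂, β, hβ, hβ0, ?_⟩
        rw [Function.update_of_ne (by omega)]
        rcases hok with ⟨h28, hs, he⟩ | hok
        · refine .inl ⟨h28, fun x => ?_, ?_⟩
          · rw [atake, List.mem_append, List.mem_singleton, hs x]
            refine ⟨.inl, ?_⟩
            rintro (h | h)
            · exact h
            · exact (hs x).1 (hsup ⟨h28, hs⟩ x h.symm)
          · rw [atake, ttake, List.map_append, he]; simp [hev]
        · exact .inr hok
      have bad : (ρ₃ 28 = 1 → ∀ β', (Y.args p).map (Term.ev β') ≠ t) →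
          Tri B S τ (asg 28 (.lit 0)) ρ₃ m₂ fun ρ' m' => ρ' 29 = l ∧
          RegEq [28, 29, 35, 36, 37] ρ (Function.update ρ' 29 (l + 1)) ∧
          Function.update ρ' 29 (l + 1) 29 = l + 1 ∧
          (∀ a : List ℕ, a.head? ≠ some 5 → m' a = m a) ∧ ∃ β : ℕ → ℕ,
          (∀ x ∈ Y.X, m' [5, x] = β x) ∧ (∀ x ∉ Y.X, β x = 0) ∧
          ((Function.update ρ' 29 (l + 1) 28 = 1 ∧
            (∀ x, β x ≠ 0 ↔ .var x ∈ (Y.args p).take (l + 1)) ∧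
            ((Y.args p).take (l + 1)).map (Term.ev β) = t.take (l + 1)) ∨
          (Function.update ρ' 29 (l + 1) 28 = 0 ∧ ∀ β', (Y.args p).map (Term.ev β') ≠ t)) := by
        intro hno
        refine .asg (Nat.zero_le _) ⟨by simpa using f29, (h3.update (by simp)).update (by simp),
          by simp, hm₂, β, hβ, hβ0, .inr ⟨by simp, ?_⟩⟩
        rcases hok with ⟨h28, _⟩ | hok
        · exact hno h28
        · exact hok.2
      -- only the part of the tuple before position `l` determines the assignment
      have uniq : ∀ β' : ℕ → ℕ, ρ₃ 28 = 1 → (Y.args p).map (Term.ev β') = t → ∀ x, β x ≠ 0 →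
          β' x = β x := by
        intro β' h28 hβ' x hx
        obtain ⟨_, hs, he⟩ := hok.resolve_right (by omega)
        have h6 := (hbad β' hβ').1.trans he.symm
        obtain ⟨i, hi, h7⟩ := List.getElem_of_mem ((hs x).1 hx)
        have := congrArg (fun L => L[i]?) h6
        simp only [List.getElem?_map, List.getElem?_eq_getElem hi, h7, Option.map_some,
          Option.some.injEq] at this
        exact this
      refine .bdd fun hρB hmB => ?_
      have hl36 := hρB 36
      have hl37 := hρB 37
      have hm37 := hmB [5, ρ₃ 37]
      refine .ifE (by simp; omega) (fun hk => ?_) fun hk => ?_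
      · -- a constant
        rw [rk] at hk
        cases harg : (Y.args p)[l] with
        | var x => rw [harg] at hk; exact absurd rfl hk
        | const a =>
          rw [harg] at f37 good
          refine .ifE (by simp [Ex.eq]; omega) (fun he => .skip ?_) fun he => bad fun _ β' hβ' => ?_
          · refine good ?_ (fun _ x h => by cases h)
            simp only [Ex.eval_eq, Ex.eval, f36, f37, Term.num] at he
            simp only [Term.ev]
            by_contra h7
            rw [if_neg fun h8 => h7 h8.symm] at he
            exact he rfl
          · have := (hbad β' hβ').2
            rw [harg, Term.ev] at this
            simp [Ex.eval_eq, f36, f37, Term.num, this] at he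
      · -- a variable
        rw [rk] at hk
        cases harg : (Y.args p)[l] with
        | const a => rw [harg] at hk; exact absurd hk (by simp [Term.kind])
        | var x =>
          rw [harg, Term.num] at f37
          rw [harg] at good
          have hxa : .var x ∈ Y.args p := harg ▸ List.getElem_mem hl'
          have hxX := hY.mem_X p hp x hxa
          have r5 : (Ex.ld 5 (.reg 37)).eval ρ₃ m₂ = β x := by
            simp only [Ex.eval, f37]; exact hβ x hxX
          refine .ifE (by simp; omega) (fun h6 => ?_) fun h6 => ?_
          · rw [r5] at h6
            simp only [Ex.eval, f37, hβ x hxX] at r5 hm37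
            refine .ifE (by simp [Ex.eq, f37, hβ x hxX]; omega) (fun he => .skip ?_)
              fun he => bad fun h28 β' hβ' => ?_
            · refine good ?_ fun _ y h => by cases h; exact h6
              simp only [Ex.eval_eq, Ex.eval, f36, f37, hβ x hxX] at he
              by_contra h7
              exact he (if_neg h7)
            · have h7 := (hbad β' hβ').2
              rw [harg, Term.ev, uniq β' h28 hβ' x h6] at h7
              simp [Ex.eval_eq, f36, f37, hβ x hxX, h7] at he
          · rw [r5] at h6
            refine .st (by omega) (by simp) (by simp) ?_
            simp only [Ex.eval, f36, f37]
            refine ⟨f29, h3.update (by simp), by simp, fun a ha => ?_, Function.update β x t[l],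
              fun y hy => ?_, fun y hy => ?_, ?_⟩
            · rw [Function.update_of_ne (by rintro rfl; simp at ha), hm₂ a ha]
            · by_cases hyx : y = x
              · subst hyx; simp
              · rw [Function.update_of_ne (by simpa using hyx), Function.update_of_ne hyx, hβ y hy]
            · rw [Function.update_of_ne (by rintro rfl; exact hy hxX), hβ0 y hy]
            · rw [Function.update_of_ne (by omega)]
              rcases hok with ⟨h28, hs, he⟩ | hok
              · have hx : Term.var x ∉ (Y.args p).take l := fun h7 => (hs x).2 h7 h6
                refine .inl ⟨h28, fun y => ?_, ?_⟩
                · rw [atake, List.mem_append, List.mem_singleton, harg, ← hs y]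
                  by_cases hyx : y = x
                  · subst hyx; simp [htl]
                  · rw [Function.update_of_ne hyx]
                    simp [hyx]
                · rw [atake, ttake, List.map_append, ← he]
                  refine congrArg₂ _ (List.map_congr_left fun s hs' => ?_) (by simp [harg, Term.ev])
                  cases s with
                  | var y =>
                    exact Function.update_of_ne (by rintro rfl; exact hx hs') _ _
                  | const a => rfl
              · exact .inr hok
    · rintro ρ' m' ⟨h1, _, hm, β, hβ, hβ0, hok⟩
      rw [List.take_length] at hok
      rw [hlen, List.take_length] at hok
      exact h ρ' m' β h1 hm hβ hβ0 hok

end Layout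

end DynCQ

namespace DynCQ

namespace Layout

variable {Y : Layout} {B S τ : ℕ} {ρ ρ' : ℕ → ℕ} {m m' : Mem} {Q : (ℕ → ℕ) → Mem → Prop}

/-! ### The contents of the counters -/

/-- The assignment concerns only variables of the query. -/
def Supp (Y : Layout) (β : ℕ → ℕ) : Prop := ∀ x, x ∉ Y.X → β x = 0

theorem Supp.eq_of_map {β γ : ℕ → ℕ} (hβ : Y.Supp β) (hγ : Y.Supp γ)
    (h : Y.X.map β = Y.X.map γ) : β = γ := by
  funext x
  by_cases hx : x ∈ Y.X
  · exact List.map_inj_left.1 h x hx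
  · rw [hβ x hx, hγ x hx]

/-- The kinds of cells: truth values of the atoms (`0`), numbers of satisfied atoms (`1`), and
numbers of witnesses (`2`). -/
def Valid (Y : Layout) (tag id : ℕ) : Prop :=
  tag = 0 ∧ 1 ≤ id ∧ id ≤ Y.d ∨ (tag = 1 ∨ tag = 2) ∧ id < Y.ℓ

/-- The cells of the array `6` hold the values given by `F`. -/
def Cells (Y : Layout) (m : Mem) (F : ℕ → ℕ → (ℕ → ℕ) → ℕ) : Prop :=
  ∀ tag id β, Y.Valid tag id → Y.Supp β → m (6 :: tag :: id :: Y.X.map β) = F tag id β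

open Classical in
/-- The values of the cells if the truth values are given by `T₀`, and the counters at level `i`
are up to date with `Tc i` and `Tw i`. -/
noncomputable def vals (Y : Layout) (T₀ : ℕ → (ℕ → ℕ) → Prop) (Tc Tw : ℕ → ℕ → (ℕ → ℕ) → Prop) :
    ℕ → ℕ → (ℕ → ℕ) → ℕ
  | 0, p, β => if T₀ p β then 1 else 0
  | 1, i, β => cnt Y.As Y.z (Tc i) i β
  | 2, i, β => wit Y.As Y.z (Tw i) i β
  | _, _, _ => 0

variable {F F' : ℕ → ℕ → (ℕ → ℕ) → ℕ}

theorem Cells.frame (h : Y.Cells m F)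
    (hm : ∀ a : List ℕ, a.head? = some 6 → 3 + Y.X.length ≤ a.length → m' a = m a) :
    Y.Cells m' F := fun tag id β hv hβ => by
  rw [hm _ rfl (by simp; omega)]
  exact h tag id β hv hβ

theorem Cells.ptrEq (h : Y.Cells m F) (hm : PtrEq Y.X.length m m') : Y.Cells m' F :=
  h.frame fun a _ h2 => hm a fun _ => h2

theorem Cells.congr (h : Y.Cells m F) (hF : ∀ tag id β, Y.Valid tag id → F' tag id β = F tag id β) :
    Y.Cells m F' := fun tag id β hv hβ => (h tag id β hv hβ).trans (hF tag id β hv).symm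

theorem Cells.put (h : Y.Cells m F) {tag id v : ℕ} {κ : ℕ → ℕ} (hκ : Y.Supp κ)
    (hF : ∀ tag' id' γ, ¬ (tag' = tag ∧ id' = id ∧ γ = κ) → F' tag' id' γ = F tag' id' γ)
    (hv : F' tag id κ = v) :
    Y.Cells (Function.update m (6 :: tag :: id :: Y.X.map κ) v) F' := by
  intro tag' id' γ hval hγ
  by_cases he : tag' = tag ∧ id' = id ∧ γ = κ
  · obtain ⟨rfl, rfl, rfl⟩ := he
    rw [Function.update_self, hv]
  · rw [Function.update_of_ne, hF _ _ _ he, h _ _ _ hval hγ]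
    intro h1
    simp only [List.cons.injEq, true_and] at h1
    exact he ⟨h1.1, h1.2.1, hγ.eq_of_map hκ h1.2.2⟩

/-! ### Propagation of a change -/

/-- The elimination step number `j` (logical register `30`) of the propagation of a change. The
register `26` tells if a fact is inserted, `31` if the change is still active, and `32` holds the
number of atoms for which the truth value has changed. -/
def levelPL : PL :=
  ifE (.mul (.reg 31) (.ld₂ 14 (.reg 24) (.ld 15 (.reg 30))))
    (get (.lit 1) (.reg 30) 37 ;;
      asg 38 (.add (.reg 37) (.mul (.reg 26) (.reg 32))) ;;
      asg 37 (.add (.sub (.reg 38) (.reg 32)) (.mul (.reg 26) (.reg 32))) ;;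
      put (.lit 1) (.reg 30) 37 ;;
      asg 32 (.ld 16 (.reg 30)) ;;
      st 5 (.ld 15 (.reg 30)) (.lit 0) ;;
      ifE (.eq (.reg 38) (.reg 32))
        (get (.lit 2) (.reg 30) 37 ;;
          asg 38 (.add (.reg 37) (.reg 26)) ;;
          asg 37 (.add (.sub (.reg 38) (.lit 1)) (.reg 26)) ;;
          put (.lit 2) (.reg 30) 37 ;;
          asg 31 (.eq (.reg 38) (.lit 1)))
        (asg 31 (.lit 0)))
    .skip

/-- Propagate a change of the truth value of an atom through all levels. -/
def propPL : PL := asg 31 (.lit 1) ;; asg 32 (.lit 1) ;; forE 30 (.reg 21) levelPL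

/-- Conditions on the bounds. -/
structure Bds (Y : Layout) (B S : ℕ) (H : Finset ℕ) : Prop where
  B_le : 16 ≤ B
  X_le : Y.X.length ≤ B
  X_leS : Y.X.length ≤ S
  d_le : Y.d + 1 ≤ B
  d_leS : Y.d ≤ S
  ℓ_le : Y.ℓ ≤ B
  ℓ_leS : Y.ℓ ≤ S
  H_le : H.card ≤ B

variable {H : Finset ℕ} {lo hi : ℕ → (ℕ → ℕ) → Prop} {ins p : ℕ}

open Classical in
/-- The situation after `j` steps of the propagation of a change from `lo` to `hi` or back. -/
def LevSt (Y : Layout) (lo hi : ℕ → (ℕ → ℕ) → Prop) (ins p j : ℕ) (ρ : ℕ → ℕ) (m : Mem) : Prop :=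
  Y.Static ρ m ∧ ρ 24 = p ∧ ρ 26 = ins ∧
  Y.Cells m (Y.vals (if ins = 1 then hi else lo)
    (fun i => if (i < j ↔ ins = 1) then hi else lo)
    (fun i => if (i < j ↔ ins = 1) then hi else lo)) ∧
  ∃ (act : Prop) (K : Finset ℕ) (β : ℕ → ℕ), Diff Y.As Y.z lo hi j act K β ∧
    (∀ x ∈ Y.X, m [5, x] = β x) ∧ ρ 31 = (if act then 1 else 0) ∧
    (act → (∀ x, β x ≠ 0 ↔ x ∈ rem Y.z Y.vs j p) ∧ ρ 32 = K.card ∧ p ∈ K ∧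
      ∀ i < Y.ℓ, j ≤ i → K ⊆ Y.As i ∨ Disjoint K (Y.As i))

theorem Wf.supp (hY : Y.Wf) (hp : p ≤ Y.d) {β : ℕ → ℕ} {j : ℕ}
    (hβ : ∀ x, β x ≠ 0 ↔ x ∈ rem Y.z Y.vs j p) : Y.Supp β := fun x hx => by
  by_contra h
  exact hx (hY.mem_X p hp x ((hβ x).1 h).1)

theorem Wf.key_eq (hY : Y.Wf) (hp : p ≤ Y.d) {β : ℕ → ℕ} {j : ℕ}
    (hβ : ∀ x, β x ≠ 0 ↔ x ∈ rem Y.z Y.vs j p) (hm : ∀ x ∈ Y.X, m [5, x] = β x) :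
    Y.key p m = β := by
  classical
  funext x
  rw [key]
  split_ifs with h
  · exact hm x (hY.mem_X p hp x h)
  · by_contra h1
    exact h ((hβ x).1 (Ne.symm h1)).1

theorem mem_As {j : ℕ} : p ∈ Y.As j ↔ (1 ≤ p ∧ p ≤ Y.d) ∧ .var (Y.z j) ∈ Y.args p := by
  simp [As]

theorem card_As_le {j : ℕ} : (Y.As j).card ≤ Y.d := by
  classical
  rw [As]
  refine (Finset.card_filter_le _ _).trans ?_
  simp

/-- The memory outside the arrays `5` and `6` is kept. -/
def MemEq (m m' : Mem) : Prop :=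
  ∀ a : List ℕ, a.head? ≠ some 5 → a.head? ≠ some 6 → m' a = m a

theorem MemEq.refl (m : Mem) : MemEq m m := fun _ _ _ => rfl

theorem MemEq.trans {m m' m'' : Mem} (h : MemEq m m') (h' : MemEq m' m'') : MemEq m m'' :=
  fun a h1 h2 => (h' a h1 h2).trans (h a h1 h2)

theorem _root_.DynCQ.PtrEq.memEq {M : ℕ} (h : PtrEq M m m') : MemEq m m' := fun a _ h2 =>
  h a fun h3 => absurd h3 h2

theorem MemEq.update (m : Mem) {n v : ℕ} {l : List ℕ} (hn : n = 5 ∨ n = 6) :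
    MemEq m (Function.update m (n :: l) v) := fun a h1 h2 =>
  Function.update_of_ne (by rintro rfl; rcases hn with rfl | rfl <;> simp at h1 h2) _ _

theorem Static.memEq (h : Y.Static ρ m) (hρ : ∀ r, 20 ≤ r → r ≤ 22 → ρ' r = ρ r)
    (hm : MemEq m m') : Y.Static ρ' m' := h.frame hρ fun a _ _ h5 h6 => hm a h5 h6

/-- The registers that the propagation changes. -/
def scratch : List ℕ := [31, 32, 33, 34, 35, 36, 37, 38]

/-- One level of the propagation, which is `Diff.skip` or `Diff.step` on the machine: as long as the
change is active it concerns a single assignment, so that one cell with a number of satisfied atoms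
and one cell with a number of witnesses have to be updated. A deletion is the same step from `hi`
to `lo`, and decreases the counters. -/
theorem tri_level (hY : Y.Wf) (hb : Y.Bds B S H) (hp1 : 1 ≤ p) (hp : p ≤ Y.d)
    (hlo : ∀ p β, lo p β → ∀ x, β x = 0 ∨ β x ∈ H) (hhi : ∀ p β, hi p β → ∀ x, β x = 0 ∨ β x ∈ H)
    (hins : ins = 0 ∨ ins = 1) {j : ℕ} (hj : j < Y.ℓ) (h30 : ρ 30 = j)
    (h : Y.LevSt lo hi ins p j ρ m) :
    Tri B S τ levelPL ρ m fun ρ' m' => RegEq scratch ρ ρ' ∧ MemEq m m' ∧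
      Y.LevSt lo hi ins p (j + 1) ρ' m' := by
  classical
  obtain ⟨hst, h24, h26, hcells, act, K, β, hdiff, h5, h31, hact⟩ := h
  have hbB := hb.B_le
  have hX := hb.X_le
  have hXS := hb.X_leS
  have hdB := hb.d_le
  have hcond : (Ex.mul (.reg 31) (.ld₂ 14 (.reg 24) (.ld 15 (.reg 30)))).eval ρ m =
      (if act then 1 else 0) * if .var (Y.z j) ∈ Y.args p then 1 else 0 := by
    simp only [Ex.eval, h31, h24, h30, hst.z j hj, hst.occ p hp]
  refine .ifE ⟨trivial, ⟨by omega, trivial, by omega, trivial⟩, ?_⟩ (fun hc => ?_) fun hc => ?_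
  · rw [Ex.eval] at hcond
    rw [hcond]
    split_ifs <;> omega
  · -- the change is active and concerns this level
    rw [hcond] at hc
    obtain ⟨ha, hz⟩ : act ∧ .var (Y.z j) ∈ Y.args p := by
      by_contra h1
      rw [not_and_or] at h1
      rcases h1 with h1 | h1 <;> simp [h1] at hc
    obtain ⟨hβ, h32, hpK, hK⟩ := hact ha
    have hpA : p ∈ Y.As j := mem_As.2 ⟨⟨hp1, hp⟩, hz⟩
    have hKj : K ⊆ Y.As j := (hK j hj le_rfl).resolve_right fun h1 =>
      Finset.disjoint_left.1 h1 hpK hpA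
    have hβz : β (Y.z j) ≠ 0 := (hβ _).2 ⟨hz, fun i hi => hY.z_ne j hj i hi⟩
    have hdiff' : Diff Y.As Y.z lo hi j True K β := by
      rwa [eq_true ha] at hdiff
    obtain ⟨hcnt, hwit, hnext⟩ := hdiff'.step hKj ⟨p, hpK⟩ hβz hlo hhi
    set β₁ := Function.update β (Y.z j) 0 with hβ₁
    have hsupp := hY.supp hp hβ
    have hβs₁ : ∀ x, β₁ x ≠ 0 ↔ x ∈ rem Y.z Y.vs (j + 1) p := by
      intro x
      by_cases hx : x = Y.z j
      · subst hx
        simp only [hβ₁, Function.update_self, ne_eq, not_true, false_iff]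
        exact fun h1 => h1.2 j (by omega) rfl
      · rw [hβ₁, Function.update_of_ne hx, hβ x]
        refine and_congr_right fun _ => ?_
        simp only [Nat.lt_succ_iff_lt_or_eq]
        constructor
        · rintro h1 i (h2 | rfl)
          · exact h1 i h2
          · exact hx
        · exact fun h1 i h2 => h1 i (.inl h2)
    have hsupp₁ := hY.supp hp hβs₁
    have hcard : cnt Y.As Y.z hi j β ≤ Y.d := cnt_le.trans card_As_le
    have hKc : K.card ≤ Y.d := (Finset.card_le_card hKj).trans card_As_le
    have hcntβ := hcnt β
    rw [if_pos rfl] at hcntβ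
    -- update of the number of satisfied atoms
    refine .seq (tri_get (tag := .lit 1) (id := .reg 30) hst hbB hX hXS hp h24 (by simp; omega)
      (fun v => ⟨trivial, by simp⟩)
      fun ρ₁ m₁ hr₁ hm₁ h37 => ?_)
    rw [hY.key_eq hp hβ h5] at h37
    simp only [Ex.eval, h30] at h37
    rw [hcells 1 j β (.inr ⟨.inl rfl, hj⟩) hsupp] at h37
    simp only [vals, lt_irrefl, false_iff] at h37
    have e26 : ρ₁ 26 = ins := (hr₁ 26 (by simp)).trans h26
    have e32 : ρ₁ 32 = K.card := (hr₁ 32 (by simp)).trans h32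
    have v38 : (Ex.add (.reg 37) (.mul (.reg 26) (.reg 32))).eval ρ₁ m₁ =
        cnt Y.As Y.z hi j β := by
      simp only [Ex.eval, e26, e32, h37]
      rcases hins with rfl | rfl
      · simp
      · simp [hcntβ]
    have hmul : ins * K.card ≤ Y.d := by
      rcases hins with rfl | rfl <;> omega
    refine .seq (.asg ⟨trivial, ⟨trivial, trivial, ?_⟩, ?_⟩ ?_)
    · simp only [Ex.eval, e26, e32]; omega
    · exact v38.trans_le (by omega)
    rw [v38]
    have v37 : (Ex.add (.sub (.reg 38) (.reg 32)) (.mul (.reg 26) (.reg 32))).eval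
        (Function.update ρ₁ 38 (cnt Y.As Y.z hi j β)) m₁ =
        cnt Y.As Y.z (if ins = 1 then hi else lo) j β := by
      simp only [Ex.eval, Function.update_self]
      rw [Function.update_of_ne (by omega), Function.update_of_ne (by omega), e26, e32]
      rcases hins with rfl | rfl
      · simp only [if_neg (show ¬ (0 : ℕ) = 1 by omega)]; omega
      · simp only [if_true]; omega
    have hcnt' : cnt Y.As Y.z (if ins = 1 then hi else lo) j β ≤ Y.d := cnt_le.trans card_As_le
    refine .seq (.asg ⟨⟨trivial, trivial⟩, ⟨trivial, trivial, ?_⟩, ?_⟩ ?_)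
    · simp only [Ex.eval]
      rw [Function.update_of_ne (by omega), Function.update_of_ne (by omega), e26, e32]; omega
    · exact v37.trans_le (by omega)
    rw [v37]
    set ρ₂ := Function.update (Function.update ρ₁ 38 (cnt Y.As Y.z hi j β)) 37
      (cnt Y.As Y.z (if ins = 1 then hi else lo) j β) with hρ₂
    have hr₂ : RegEq scratch ρ ρ₂ :=
      ((hr₁.mono (by simp [scratch])).update (by simp [scratch])).update (by simp [scratch])
    have f38 : ρ₂ 38 = cnt Y.As Y.z hi j β := by simp [hρ₂]
    have f37 : ρ₂ 37 = cnt Y.As Y.z (if ins = 1 then hi else lo) j β := by simp [hρ₂]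
    clear_value ρ₂
    have hreg : ∀ {ρ'}, RegEq scratch ρ ρ' → ∀ r, 20 ≤ r → r ≤ 22 → ρ' r = ρ r :=
      fun h r h1 h2 => h r (by simp [scratch]; omega)
    have h5₁ : ∀ x ∈ Y.X, m₁ [5, x] = β x := fun x hx => (hm₁ _ (by simp)).trans (h5 x hx)
    refine .seq (tri_put (tag := .lit 1) (id := .reg 30) (hst.memEq (hreg hr₂) hm₁.memEq) hbB hX hXS hp
      ((hr₂ 24 (by simp [scratch])).trans h24) (by simp; omega)
      (fun v => ⟨trivial, by simp⟩) (by simp) fun ρ₃ m₃ hr₃' hm₃ => ?_)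
    rw [hY.key_eq hp hβ h5₁, f37] at hm₃
    simp only [Ex.eval] at hm₃
    rw [hr₂ 30 (by simp [scratch]), h30] at hm₃
    have hcells₃ : Y.Cells m₃ (Y.vals (if ins = 1 then hi else lo)
        (fun i => if (i < j + 1 ↔ ins = 1) then hi else lo)
        (fun i => if (i < j ↔ ins = 1) then hi else lo)) := by
      refine ((hcells.ptrEq hm₁).put hsupp ?_ ?_).ptrEq hm₃
      · intro tag id γ hne
        match tag with
        | 0 => rfl
        | 1 =>
          simp only [vals]
          by_cases hid : id = j
          · subst hid
            have hγ : γ ≠ β := fun h1 => hne ⟨rfl, rfl, h1⟩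
            have := hcnt γ
            rw [if_neg hγ, Nat.add_zero] at this
            split_ifs <;> simp [this]
          · have : (id < j + 1) = (id < j) := by
              rw [eq_iff_iff]; omega
            simp only [this]
        | 2 => rfl
        | _ + 3 => rfl
      · simp [vals]
    have hr₃ := hr₂.trans (hr₃'.mono (s' := scratch) (by simp [scratch]))
    have g38 : ρ₃ 38 = cnt Y.As Y.z hi j β := (hr₃' 38 (by simp)).trans f38
    have hmem₃ : MemEq m m₃ := (hm₁.memEq.trans (MemEq.update _ (.inr rfl))).trans hm₃.memEq
    have hst₃ := hst.memEq (hreg hr₃) hmem₃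
    have g30 : ρ₃ 30 = j := (hr₃ 30 (by simp [scratch])).trans h30
    have h5₃ : ∀ x ∈ Y.X, m₃ [5, x] = β x := fun x hx => by
      rw [hm₃ _ (by simp), Function.update_of_ne (by simp), h5₁ x hx]
    clear hm₃ hm₁ hr₃' f37 f38 hr₂ h37 e26 e32 v37 v38 hr₁ hcells h5₁
    -- the assignment forgets the value of the eliminated variable
    have v32 : (Ex.ld 16 (.reg 30)).eval ρ₃ m₃ = (Y.As j).card := by
      simp only [Ex.eval, g30, hst₃.w j hj]
    refine .seq (.asg ⟨by omega, trivial⟩ (.seq (.st (by omega) ⟨by omega, trivial⟩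
      (Nat.zero_le _) ?_)))
    rw [v32]
    simp only [Ex.eval, Function.update_of_ne (show (30 : ℕ) ≠ 32 by omega), g30, hst₃.z j hj]
    set ρ₄ := Function.update ρ₃ 32 (Y.As j).card with hρ₄
    set m₄ := Function.update m₃ [5, Y.z j] 0 with hm₄
    have hr₄ : RegEq scratch ρ ρ₄ := hr₃.update (by simp [scratch])
    have hmem₄ : MemEq m m₄ := hmem₃.trans (MemEq.update _ (.inl rfl))
    have hst₄ := hst.memEq (hreg hr₄) hmem₄
    have k38 : ρ₄ 38 = cnt Y.As Y.z hi j β := by simp [hρ₄, g38]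
    have k32 : ρ₄ 32 = (Y.As j).card := by simp [hρ₄]
    have k30 : ρ₄ 30 = j := by simp [hρ₄, g30]
    have k24 : ρ₄ 24 = p := (hr₄ 24 (by simp [scratch])).trans h24
    have k26 : ρ₄ 26 = ins := (hr₄ 26 (by simp [scratch])).trans h26
    have h5₄ : ∀ x ∈ Y.X, m₄ [5, x] = β₁ x := fun x hx => by
      by_cases hxz : x = Y.z j
      · subst hxz; simp [hm₄, hβ₁]
      · rw [hm₄, Function.update_of_ne (by simpa using hxz), hβ₁, Function.update_of_ne hxz, h5₃ x hx]
    have hcells₄ := hcells₃.frame (m' := m₄) fun a h6 _ =>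
      Function.update_of_ne (by rintro rfl; simp at h6) _ _
    clear_value ρ₄ m₄
    -- the situation at the next level, where only the witness counter may still be missing
    have fin : ∀ ρ' m', RegEq scratch ρ ρ' → MemEq m m' →
        (∀ x ∈ Y.X, m' [5, x] = β₁ x) → ρ' 32 = (Y.As j).card →
        ρ' 31 = (if cnt Y.As Y.z hi j β = (Y.As j).card ∧ wit Y.As Y.z lo j β₁ = 0 then 1 else 0) →
        Y.Cells m' (Y.vals (if ins = 1 then hi else lo)
          (fun i => if (i < j + 1 ↔ ins = 1) then hi else lo)
          (fun i => if (i < j + 1 ↔ ins = 1) then hi else lo)) →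
        RegEq scratch ρ ρ' ∧ MemEq m m' ∧ Y.LevSt lo hi ins p (j + 1) ρ' m' := by
      intro ρ' m' hr hm h1 h2 h3 h4
      exact ⟨hr, hm, hst.memEq (hreg hr) hm, (hr 24 (by simp [scratch])).trans h24,
        (hr 26 (by simp [scratch])).trans h26, h4, _, _, _, hnext, h1, by convert h3, fun _ =>
        ⟨hβs₁, h2, hpA, fun i hi hji => hY.laminar i hi j (by omega)⟩⟩
    refine .bdd fun hρB _ => ?_
    have hB38 := hρB 38
    have hB32 := hρB 32
    refine .ifE (by simp [Ex.eq]; omega) (fun hfull => ?_) fun hfull => ?_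
    · simp only [Ex.eval_eq, Ex.eval, k38, k32] at hfull
      have hfull : cnt Y.As Y.z hi j β = (Y.As j).card := by
        by_contra h1
        exact hfull (if_neg h1)
      have hwitβ := hwit β₁
      rw [if_pos ⟨rfl, hfull⟩] at hwitβ
      have hle : wit Y.As Y.z hi j β₁ ≤ B := (wit_le hhi (hY.nonempty j hj)).trans hb.H_le
      refine .seq (tri_get (tag := .lit 2) (id := .reg 30) hst₄ hbB hX hXS hp k24 (by simp; omega)
        (fun v => ⟨trivial, by simp⟩) fun ρ₅ m₅ hr₅' hm₅ h37 => ?_)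
      rw [hY.key_eq hp hβs₁ h5₄] at h37
      simp only [Ex.eval, k30] at h37
      rw [hcells₄ 2 j β₁ (.inr ⟨.inr rfl, hj⟩) hsupp₁] at h37
      simp only [vals, lt_irrefl, false_iff] at h37
      have e26 : ρ₅ 26 = ins := (hr₅' 26 (by simp)).trans k26
      have v38 : (Ex.add (.reg 37) (.reg 26)).eval ρ₅ m₅ = wit Y.As Y.z hi j β₁ := by
        simp only [Ex.eval, e26, h37]
        rcases hins with rfl | rfl
        · simp
        · simp [hwitβ]
      refine .seq (.asg ⟨trivial, trivial, ?_⟩ ?_)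
      · exact v38.trans_le hle
      rw [v38]
      have v37 : (Ex.add (.sub (.reg 38) (.lit 1)) (.reg 26)).eval
          (Function.update ρ₅ 38 (wit Y.As Y.z hi j β₁)) m₅ =
          wit Y.As Y.z (if ins = 1 then hi else lo) j β₁ := by
        simp only [Ex.eval, Function.update_self]
        rw [Function.update_of_ne (by omega), e26]
        rcases hins with rfl | rfl
        · simp only [if_neg (show ¬ (0 : ℕ) = 1 by omega)]; omega
        · simp only [if_true]; omega
      have hle' : wit Y.As Y.z (if ins = 1 then hi else lo) j β₁ ≤ B := by
        split_ifs <;> omega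
      refine .seq (.asg ⟨⟨trivial, by simp; omega⟩, trivial, ?_⟩ ?_)
      · exact v37.trans_le hle'
      rw [v37]
      set ρ₆ := Function.update (Function.update ρ₅ 38 (wit Y.As Y.z hi j β₁)) 37
        (wit Y.As Y.z (if ins = 1 then hi else lo) j β₁) with hρ₆
      have hr₆ : RegEq scratch ρ ρ₆ := ((hr₄.trans
        (hr₅'.mono (by simp [scratch]))).update (by simp [scratch])).update (by simp [scratch])
      have f38 : ρ₆ 38 = wit Y.As Y.z hi j β₁ := by simp [hρ₆]
      have f37 : ρ₆ 37 = wit Y.As Y.z (if ins = 1 then hi else lo) j β₁ := by simp [hρ₆]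
      have f32 : ρ₆ 32 = (Y.As j).card := by simp [hρ₆, hr₅' 32, k32]
      clear_value ρ₆
      have h5₅ : ∀ x ∈ Y.X, m₅ [5, x] = β₁ x := fun x hx => (hm₅ _ (by simp)).trans (h5₄ x hx)
      refine .seq (tri_put (tag := .lit 2) (id := .reg 30) (hst.memEq (hreg hr₆) (hmem₄.trans hm₅.memEq)) hbB hX hXS hp
        ((hr₆ 24 (by simp [scratch])).trans h24) (by simp; omega)
        (fun v => ⟨trivial, by simp⟩) (by simp) fun ρ₇ m₇ hr₇ hm₇ => ?_)
      rw [hY.key_eq hp hβs₁ h5₅, f37] at hm₇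
      simp only [Ex.eval] at hm₇
      rw [hr₆ 30 (by simp [scratch]), h30] at hm₇
      have g38 : ρ₇ 38 = wit Y.As Y.z hi j β₁ := (hr₇ 38 (by simp)).trans f38
      refine .asg (by simp [Ex.eq]; omega) (fin _ _ ?_ ?_ ?_ ?_ ?_ ?_)
      · exact (hr₆.trans (hr₇.mono (by simp [scratch]))).update (by simp [scratch])
      · exact ((hmem₄.trans hm₅.memEq).trans (MemEq.update _ (.inr rfl))).trans hm₇.memEq
      · intro x hx
        rw [hm₇ _ (by simp), Function.update_of_ne (by simp), h5₅ x hx]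
      · simp [hr₇ 32, f32]
      · simp only [Ex.eval_eq, Ex.eval, Function.update_self, g38, hfull, true_and]
        rw [hwitβ]
        split_ifs <;> omega
      · refine ((hcells₄.ptrEq hm₅).put hsupp₁ ?_ ?_).ptrEq hm₇
        · intro tag id γ hne
          match tag with
          | 0 => rfl
          | 1 => rfl
          | 2 =>
            simp only [vals]
            by_cases hid : id = j
            · subst hid
              have hγ : γ ≠ β₁ := fun h1 => hne ⟨rfl, rfl, h1⟩
              have := hwit γ
              rw [if_neg fun h1 => hγ h1.1, Nat.add_zero] at this
              split_ifs <;> simp [this]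
            · have : (id < j + 1) = (id < j) := by
                rw [eq_iff_iff]; omega
              simp only [this]
          | _ + 3 => rfl
        · simp [vals]
    · simp only [Ex.eval_eq, Ex.eval, k38, k32] at hfull
      have hfull : ¬ cnt Y.As Y.z hi j β = (Y.As j).card := fun h1 => by simp [h1] at hfull
      refine .asg (Nat.zero_le _) (fin _ _ (hr₄.update (by simp [scratch])) hmem₄ h5₄
        (by simpa using k32) (by simp [hfull]) ?_)
      refine hcells₄.congr fun tag id γ _ => ?_
      match tag with
      | 0 => rfl
      | 1 => rfl
      | _ + 3 => rfl
      | 2 =>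
        simp only [vals]
        by_cases hid : id = j
        · subst hid
          have := hwit γ
          rw [if_neg fun h1 => hfull h1.2, Nat.add_zero] at this
          split_ifs <;> simp [this]
        · have : (id < j + 1) = (id < j) := by
            rw [eq_iff_iff]; omega
          simp only [this]
  · -- nothing changes at this level
    rw [hcond] at hc
    have hdis : act → Disjoint K (Y.As j) := fun ha => by
      obtain ⟨_, _, hpK, hK⟩ := hact ha
      refine (hK j hj le_rfl).resolve_left fun h1 => ?_
      have := (mem_As.1 (h1 hpK)).2
      simp [ha, this] at hc
    obtain ⟨hnext, hcnt, hwit⟩ := hdiff.skip hdis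
    refine .skip ⟨.refl _ _, .refl _, hst, h24, h26, hcells.congr fun tag id γ _ => ?_,
      act, K, β, hnext, h5, h31, fun ha => ?_⟩
    · by_cases hid : id = j
      · subst hid
        match tag with
        | 0 => rfl
        | 1 => simp only [vals]; split_ifs <;> simp [hcnt]
        | 2 => simp only [vals]; split_ifs <;> simp [hwit]
        | _ + 3 => rfl
      · have : (id < j + 1) = (id < j) := by
          rw [eq_iff_iff]; omega
        match tag with
        | 0 => rfl
        | 1 => simp only [vals, this]
        | 2 => simp only [vals, this]
        | _ + 3 => rfl
    · obtain ⟨h1, h2, h3, h4⟩ := hact ha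
      refine ⟨fun x => (h1 x).trans (and_congr_right fun hx => ?_), h2, h3,
        fun i hi hji => h4 i hi (by omega)⟩
      simp only [Nat.lt_succ_iff_lt_or_eq]
      constructor
      · rintro h5 i (h6 | rfl)
        · exact h5 i h6
        · rintro rfl
          have hpA : p ∈ Y.As i := mem_As.2 ⟨⟨hp1, hp⟩, hx⟩
          exact Finset.disjoint_left.1 (hdis ha) h3 hpA
      · exact fun h5 i h6 => h5 i (.inl h6)

end Layout

end DynCQ

namespace DynCQ

namespace Layout

variable {Y : Layout} {B S τ : ℕ} {ρ ρ' : ℕ → ℕ} {m m' : Mem} {Q : (ℕ → ℕ) → Mem → Prop}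
  {H : Finset ℕ} {lo hi : ℕ → (ℕ → ℕ) → Prop} {ins p : ℕ}

/-- The values of the cells for the truth values `T` of the atoms. -/
noncomputable def full (Y : Layout) (T : ℕ → (ℕ → ℕ) → Prop) : ℕ → ℕ → (ℕ → ℕ) → ℕ :=
  Y.vals T (fun _ => T) fun _ => T

theorem full_congr {T T' : ℕ → (ℕ → ℕ) → Prop} (h : ∀ p, 1 ≤ p → p ≤ Y.d → T p = T' p)
    {tag id : ℕ} {γ : ℕ → ℕ} (hval : Y.Valid tag id) : Y.full T tag id γ = Y.full T' tag id γ := by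
  classical
  have hv : ∀ j p γ, 1 ≤ p → p ≤ Y.d → (Val Y.As Y.z T j p γ ↔ Val Y.As Y.z T' j p γ) := by
    intro j
    induction j with
    | zero => intro p γ h1 h2; simp [Val, h p h1 h2]
    | succ j ih =>
      intro p γ h1 h2
      simp only [Val, ih p _ h1 h2]
      exact or_congr_left (and_congr_right fun _ => and_congr_right fun _ =>
        exists_congr fun a => and_congr_right fun _ => forall₂_congr fun p' hp' =>
          ih p' _ (mem_As.1 hp').1.1 (mem_As.1 hp').1.2)
  have hv' : ∀ j, ∀ p ∈ Y.As j, ∀ γ, (Val Y.As Y.z T j p γ ↔ Val Y.As Y.z T' j p γ) :=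
    fun j p hp γ => hv j p γ (mem_As.1 hp).1.1 (mem_As.1 hp).1.2
  rcases hval with ⟨rfl, h1, h2⟩ | ⟨rfl | rfl, hid⟩
  · simp only [full, vals, h id h1 h2]
  · simp only [full, vals, cnt]
    congr 1
    exact Finset.filter_congr fun p hp => hv' _ p hp _
  · simp only [full, vals, wit]
    have : Wit Y.As Y.z T id γ = Wit Y.As Y.z T' id γ := by
      ext a
      exact and_congr_right fun _ => forall₂_congr fun p hp => hv' _ p hp _
    rw [this]

/-- After a change of one truth value of one atom, all counters can be brought up to date in one
pass through the levels. -/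
theorem tri_prop (hY : Y.Wf) (hb : Y.Bds B S H) (hp1 : 1 ≤ p) (hp : p ≤ Y.d)
    (hlo : ∀ p β, lo p β → ∀ x, β x = 0 ∨ β x ∈ H) (hhi : ∀ p β, hi p β → ∀ x, β x = 0 ∨ β x ∈ H)
    (hins : ins = 0 ∨ ins = 1) {β : ℕ → ℕ} (hchg : ∀ q γ, hi q γ ↔ lo q γ ∨ (q = p ∧ γ = β))
    (hnot : ¬ lo p β) (hβ : ∀ x, β x ≠ 0 ↔ .var x ∈ Y.args p) (h5 : ∀ x ∈ Y.X, m [5, x] = β x)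
    (hst : Y.Static ρ m) (h24 : ρ 24 = p) (h26 : ρ 26 = ins)
    (hcells : Y.Cells m (Y.vals (if ins = 1 then hi else lo) (fun _ => if ins = 1 then lo else hi)
      fun _ => if ins = 1 then lo else hi))
    (h : ∀ ρ' m', RegEq (30 :: scratch) ρ ρ' → MemEq m m' →
      Y.Cells m' (Y.full (if ins = 1 then hi else lo)) → Q ρ' m') :
    Tri B S τ propPL ρ m Q := by
  classical
  have hB := hb.B_le
  refine .seq (.asg (by simp; omega) (.seq (.asg (by simp; omega) ?_)))
  simp only [Ex.eval]
  refine .forE (fun j ρ' m' => RegEq (30 :: scratch) ρ ρ' ∧ MemEq m m' ∧ ρ' 30 = j ∧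
    Y.LevSt lo hi ins p j ρ' m') Y.ℓ hb.ℓ_leS hb.ℓ_le ?_ ?_ ?_ ?_
  · have hr : RegEq (30 :: scratch) ρ
        (Function.update (Function.update (Function.update ρ 31 1) 32 1) 30 0) :=
      (((RegEq.refl _ _).update (by simp [scratch])).update (by simp [scratch])).update (by simp)
    refine ⟨hr, .refl _, by simp, hst.memEq (fun r h1 h2 => hr r (by simp [scratch]; omega))
      (.refl _), (hr 24 (by simp [scratch])).trans h24, (hr 26 (by simp [scratch])).trans h26,
      hcells.congr fun tag id γ _ => ?_, True, {p}, β, ⟨fun q γ => ?_, fun _ q hq => ?_⟩, h5,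
      by simp, fun _ => ⟨fun x => (hβ x).trans ?_, by simp, by simp, fun i hi _ => ?_⟩⟩
    · simp only [Nat.not_lt_zero, false_iff, ite_not]
    · simpa [Val] using hchg q γ
    · simpa [Val, Finset.mem_singleton.1 hq] using hnot
    · simp [rem, vs]
    · rw [Finset.singleton_subset_iff, Finset.disjoint_singleton_left]
      exact em _
  · rintro j ρ' m' _ ⟨h1, _, h2, hs, _⟩
    exact ⟨h2, hs.reg_ℓ, trivial⟩
  · rintro j hj ρ₁ m₁ ⟨h1, h2, h3, h4⟩
    refine (tri_level hY hb hp1 hp hlo hhi hins hj h3 h4).conseq fun ρ₂ m₂ ⟨h5, h6, h7⟩ => ?_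
    refine ⟨(h5 30 (by simp [scratch])).trans h3,
      (h1.trans (h5.mono (by simp))).update (by simp), h2.trans h6, by simp, ?_⟩
    obtain ⟨a1, a2, a3, a4, act, K, γ, a5, a6, a7, a8⟩ := h7
    exact ⟨a1.memEq (fun r h8 h9 => Function.update_of_ne (by omega) _ _) (.refl _), by simpa,
      by simpa, a4, act, K, γ, a5, a6, by simpa, by simpa using a8⟩
  · rintro ρ₁ m₁ ⟨h1, h2, _, _, _, _, h3, _⟩
    refine h _ _ h1 h2 (h3.congr fun tag id γ hv => ?_)
    rcases hv with ⟨rfl, _⟩ | ⟨rfl | rfl, hid⟩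
    · rfl
    · simp only [full, vals, hid, true_iff]
    · simp only [full, vals, hid, true_iff]

/-! ### Insertion or deletion of a fact -/

/-- The truth values of the atoms in the database with the facts `Dn`. -/
def tv (Y : Layout) (Dn : ℕ → List ℕ → Prop) (p : ℕ) (β : ℕ → ℕ) : Prop :=
  (∀ x, β x ≠ 0 ↔ .var x ∈ Y.args p) ∧ Dn (Y.rel p) ((Y.args p).map (Term.ev β))

theorem tv_range {Dn : ℕ → List ℕ → Prop} (hDn : ∀ r t, Dn r t → ∀ u ∈ t, u ∈ H) {β : ℕ → ℕ}
    (h : Y.tv Dn p β) (x : ℕ) : β x = 0 ∨ β x ∈ H := by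
  refine or_iff_not_imp_left.2 fun hx => hDn _ _ h.2 _ ?_
  exact List.mem_map.2 ⟨.var x, (h.1 x).1 hx, rfl⟩

theorem eq_of_map_ev {p : ℕ} {β γ : ℕ → ℕ} (hβ : ∀ x, β x ≠ 0 ↔ .var x ∈ Y.args p)
    (hγ : ∀ x, γ x ≠ 0 ↔ .var x ∈ Y.args p)
    (h : (Y.args p).map (Term.ev γ) = (Y.args p).map (Term.ev β)) : γ = β := by
  funext x
  by_cases hx : .var x ∈ Y.args p
  · exact List.map_inj_left.1 h _ hx
  · rw [not_not.1 (mt (hβ x).1 hx), not_not.1 (mt (hγ x).1 hx)]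

/-- The facts after insertion (`ins = 1`) or deletion (`ins = 0`) of `R t`. -/
def upd (Dn : ℕ → List ℕ → Prop) (ins R : ℕ) (t : List ℕ) : ℕ → List ℕ → Prop := fun r t' =>
  (r = R ∧ t' = t ∧ ins = 1) ∨ (¬ (r = R ∧ t' = t) ∧ Dn r t')

/-- Insertion or deletion of a fact. The logical register `26` tells which, the number of the
relation symbol is in the register `27`, and the tuple starts at the input cell whose number is in
the register `25`. All atoms with this relation symbol are treated one by one. -/
def corePL : PL :=
  forE 39 (.reg 20) (asg 24 (.add (.reg 39) (.lit 1)) ;;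
    ifE (.eq (.ld 10 (.reg 24)) (.reg 27))
      (matchPL ;;
        ifE (.reg 28)
          (get (.lit 0) (.reg 24) 30 ;;
            ifE (.eq (.reg 30) (.reg 26)) .skip (put (.lit 0) (.reg 24) 26 ;; propPL))
          .skip)
      .skip)

/-- The registers that an update changes. -/
def coreRegs : List ℕ := [24, 28, 29, 30, 31, 32, 33, 34, 35, 36, 37, 38, 39]

/-- The counters are maintained under the insertion or deletion of a fact. A fact determines at most
one assignment for each atom, so that there is at most one change for each atom. -/
theorem tri_core (hY : Y.Wf) (hb : Y.Bds B S H) {Dn : ℕ → List ℕ → Prop} {R : ℕ} {t : List ℕ}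
    (hDn : ∀ r t, Dn r t → ∀ u ∈ t, u ∈ H) (htH : ∀ u ∈ t, u ∈ H) (ht0 : ∀ u ∈ t, u ≠ 0)
    (hlen : ∀ p, 1 ≤ p → p ≤ Y.d → Y.rel p = R → t.length = (Y.args p).length)
    (hins : ins = 0 ∨ ins = 1) (hst : Y.Static ρ m) (h26 : ρ 26 = ins) (h27 : ρ 27 = R)
    (hS : ∀ p ≤ Y.d, (Y.args p).length ≤ S) (hseg : ∀ l (h : l < t.length), m [0, ρ 25 + l] = t[l])
    (h25 : ρ 25 + t.length ≤ B) (hcells : Y.Cells m (Y.full (Y.tv Dn)))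
    (h : ∀ ρ' m', RegEq coreRegs ρ ρ' → MemEq m m' →
      Y.Cells m' (Y.full (Y.tv (upd Dn ins R t))) → Q ρ' m') :
    Tri B S τ corePL ρ m Q := by
  classical
  have hB := hb.B_le
  have hX := hb.X_le
  have hXS := hb.X_leS
  have hd := hb.d_le
  have hreg : ∀ {ρ'}, RegEq coreRegs ρ ρ' → ∀ r, 20 ≤ r → r ≤ 22 → ρ' r = ρ r :=
    fun h r h1 h2 => h r (by simp [coreRegs]; omega)
  set Dn' := upd Dn ins R t with hDn'
  have hDn2 : ∀ r t, Dn' r t → ∀ u ∈ t, u ∈ H := by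
    rintro r t' (⟨_, rfl, _⟩ | ⟨_, h1⟩)
    · exact htH
    · exact hDn _ _ h1
  -- the truth values after the treatment of the first `i` atoms
  set T : ℕ → ℕ → (ℕ → ℕ) → Prop := fun i p => if p ≤ i then Y.tv Dn' p else Y.tv Dn p with hT
  have hTr : ∀ i p β, T i p β → ∀ x, β x = 0 ∨ β x ∈ H := by
    intro i p β h1
    simp only [hT] at h1
    split_ifs at h1
    · exact tv_range hDn2 h1
    · exact tv_range hDn h1
  refine .forE (fun i ρ' m' => RegEq coreRegs ρ ρ' ∧ MemEq m m' ∧ ρ' 39 = i ∧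
    Y.Cells m' (Y.full (T i))) Y.d hb.d_leS (by omega) ?_ ?_ ?_ ?_
  · refine ⟨(RegEq.refl _ _).update (by simp [coreRegs]), .refl _, by simp, ?_⟩
    exact hcells.congr fun tag id γ hval => full_congr (fun p h1 _ => if_neg (by omega)) hval
  · rintro i ρ' m' _ ⟨h1, _, h2, _⟩
    exact ⟨h2, (h1 20 (by simp [coreRegs])).trans hst.reg_d, trivial⟩
  · rintro i hi ρ₁ m₁ ⟨h1, hm₁, h39, hc⟩
    have hTi : ∀ q, q ≠ i + 1 → T (i + 1) q = T i q := by
      intro q hq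
      simp only [hT, show q ≤ i + 1 ↔ q ≤ i by omega]
    have hT1 : T (i + 1) (i + 1) = Y.tv Dn' (i + 1) := if_pos le_rfl
    have hT0 : T i (i + 1) = Y.tv Dn (i + 1) := if_neg (by omega)
    -- the invariant if the truth values of the atom are unchanged
    have same : (∀ γ, Y.tv Dn' (i + 1) γ ↔ Y.tv Dn (i + 1) γ) → T (i + 1) = T i := by
      intro h2
      funext q γ
      by_cases hq : q = i + 1
      · subst hq
        rw [hT1, hT0]
        exact propext (h2 γ)
      · rw [hTi q hq]
    have fin : ∀ ρ' m', RegEq coreRegs ρ ρ' → MemEq m m' → ρ' 39 = i →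
        Y.Cells m' (Y.full (T (i + 1))) → ρ' 39 = i ∧
          RegEq coreRegs ρ (Function.update ρ' 39 (i + 1)) ∧ MemEq m m' ∧
          Function.update ρ' 39 (i + 1) 39 = i + 1 ∧ Y.Cells m' (Y.full (T (i + 1))) :=
      fun ρ' m' a1 a2 a3 a4 => ⟨a3, a1.update (by simp [coreRegs]), a2, by simp, a4⟩
    refine .seq (.asg (by simp; omega) ?_)
    simp only [Ex.eval, h39]
    set ρ₂ := Function.update ρ₁ 24 (i + 1) with hρ₂
    have h2 : RegEq coreRegs ρ ρ₂ := h1.update (by simp [coreRegs])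
    have f24 : ρ₂ 24 = i + 1 := by simp [hρ₂]
    have f39 : ρ₂ 39 = i := by simp [hρ₂, h39]
    clear_value ρ₂
    have hst₂ := hst.memEq (hreg h2) hm₁
    refine .bdd fun hρB hmB => ?_
    have hB1 := hmB [10, i + 1]
    have hB2 := hρB 27
    refine .ifE (by simp [Ex.eq, f24]; omega) (fun hr => ?_) fun hr => .skip ?_
    swap
    · refine fin _ _ h2 hm₁ f39 ?_
      rw [same fun γ => ?_]
      · exact hc
      · have : Y.rel (i + 1) ≠ R := by
          intro h3
          simp [f24, h2 27 (by simp [coreRegs]), h27, hst₂.rel (i + 1) (by omega) (by omega), h3]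
            at hr
        simp [tv, hDn', upd, this]
    have hrel : Y.rel (i + 1) = R := by
      by_contra h3
      simp [f24, h2 27 (by simp [coreRegs]), h27, hst₂.rel (i + 1) (by omega) (by omega), h3] at hr
    have hl := hlen (i + 1) (by omega) (by omega) hrel
    have f25 : ρ₂ 25 = ρ 25 := h2 25 (by simp [coreRegs])
    refine .seq (tri_match hst₂ hY hB hX hXS (by omega) f24 hl (hl ▸ hS _ (by omega)) ht0
      (fun l hl => by rw [f25, hm₁ _ (by simp) (by simp)]; exact hseg l hl) (by omega)
      fun ρ₃ m₃ β h3 hm₃ h5 hβ0 hok => ?_)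
    have h3' : RegEq coreRegs ρ ρ₃ := h2.trans (h3.mono (by simp [coreRegs]))
    have hm₃' : MemEq m m₃ := hm₁.trans fun a h5 _ => hm₃ a h5
    have hc₃ := hc.frame (m' := m₃) fun a h6 _ => hm₃ a (by simp [h6])
    have g39 : ρ₃ 39 = i := (h3 39 (by simp)).trans f39
    have g24 : ρ₃ 24 = i + 1 := (h3 24 (by simp)).trans f24
    rcases hok with ⟨h28, hβ, hev⟩ | ⟨h28, hno⟩
    swap
    · refine .ifE trivial (fun h6 => absurd h28 h6) fun _ => .skip (fin _ _ h3' hm₃' g39 ?_)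
      rw [same fun γ => ?_]
      · exact hc₃
      · simp [tv, hDn', upd, hno γ]
    refine .ifE trivial (fun _ => ?_) fun h6 => absurd h28 (by simp at h6; omega)
    have hst₃ := hst.memEq (hreg h3') hm₃'
    have hkey : Y.key (i + 1) m₃ = β := hY.key_eq (j := 0) (by omega)
      (fun x => by simpa [rem, vs] using hβ x) h5
    have hsupp : Y.Supp β := hβ0
    refine .seq (tri_get (tag := .lit 0) (id := .reg 24) hst₃ hB hX hXS (by omega) g24
      (Nat.zero_le _) (fun v => ⟨trivial, by simp⟩) fun ρ₄ m₄ h4 hm₄ h30 => ?_)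
    simp only [Ex.eval, hkey, g24] at h30
    have tvβ : ∀ D : ℕ → List ℕ → Prop, Y.tv D (i + 1) β ↔ D R t := by
      intro D
      rw [tv, hev, hrel]
      exact and_iff_right hβ
    have tvne : ∀ γ, γ ≠ β → (Y.tv Dn' (i + 1) γ ↔ Y.tv Dn (i + 1) γ) := by
      intro γ hne
      refine and_congr_right fun hγ => ?_
      have : (Y.args (i + 1)).map (Term.ev γ) ≠ t := fun h6 =>
        hne (eq_of_map_ev hβ hγ (h6.trans hev.symm))
      simp [hDn', upd, this]
    have hDR : Dn' R t ↔ ins = 1 := by simp [hDn', upd]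
    rw [hc₃ 0 (i + 1) β (.inl ⟨rfl, by omega, by omega⟩) hsupp] at h30
    simp only [full, vals, hT0, tvβ] at h30
    have h4' : RegEq coreRegs ρ ρ₄ := h3'.trans (h4.mono (by simp [coreRegs]))
    have k26 : ρ₄ 26 = ins := (h4' 26 (by simp [coreRegs])).trans h26
    have k24 : ρ₄ 24 = i + 1 := (h4 24 (by simp)).trans g24
    have k39 : ρ₄ 39 = i := (h4 39 (by simp)).trans g39
    have hm₄' := hm₃'.trans hm₄.memEq
    have hc₄ := hc₃.ptrEq hm₄
    have hok4 : (Ex.eq (.reg 30) (.reg 26)).Ok B ρ₄ m₄ := by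
      simp only [Ex.eq, Ex.Ok, Ex.eval, k26, h30]
      refine ⟨by omega, ⟨trivial, trivial⟩, ⟨trivial, trivial⟩, ?_⟩
      split_ifs <;> omega
    refine .ifE hok4 (fun h6 => .skip (fin _ _ h4' hm₄' k39 ?_)) fun h6 => ?_
    · rw [same fun γ => ?_]
      · exact hc₄
      · by_cases hγ : γ = β
        · subst hγ
          rw [tvβ, tvβ, hDR]
          simp only [Ex.eval_eq, Ex.eval, h30, k26] at h6
          rcases hins with rfl | rfl <;> by_cases h7 : Dn R t <;> simp [h7] at h6 ⊢
        · exact tvne γ hγ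
    have hflip : Dn R t ↔ ¬ ins = 1 := by
      simp only [Ex.eval_eq, Ex.eval, h30, k26] at h6
      rcases hins with rfl | rfl <;> by_cases h7 : Dn R t <;> simp [h7] at h6 ⊢
    have hst₄ := hst.memEq (hreg h4') hm₄'
    have h5₄ : ∀ x ∈ Y.X, m₄ [5, x] = β x := fun x hx => (hm₄ _ (by simp)).trans (h5 x hx)
    have hkey₄ : Y.key (i + 1) m₄ = β := hY.key_eq (j := 0) (by omega)
      (fun x => by simpa [rem, vs] using hβ x) h5₄
    refine .seq (tri_put (tag := .lit 0) (id := .reg 24) hst₄ hB hX hXS (by omega) k24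
      (Nat.zero_le _) (fun v => ⟨trivial, by simp⟩) (by simp) fun ρ₅ m₅ h5 hm₅ => ?_)
    simp only [Ex.eval, hkey₄, k24, k26] at hm₅
    have h5' : RegEq coreRegs ρ ρ₅ := h4'.trans (h5.mono (by simp [coreRegs]))
    have hm₅' := (hm₄'.trans (MemEq.update _ (.inr rfl))).trans hm₅.memEq
    have hhilo : ∀ q γ, (if ins = 1 then T (i + 1) else T i) q γ ↔
        (if ins = 1 then T i else T (i + 1)) q γ ∨ (q = i + 1 ∧ γ = β) := by
      intro q γ
      by_cases hq : q = i + 1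
      · subst hq
        by_cases hγ : γ = β
        · subst hγ
          rcases hins with rfl | rfl <;> simp [hT1, hT0, tvβ, hDR, hflip]
        · rcases hins with rfl | rfl <;> simp [hT1, hT0, hγ, tvne γ hγ]
      · rcases hins with rfl | rfl <;> simp [hTi q hq, hq]
    refine tri_prop hY hb (lo := if ins = 1 then T i else T (i + 1))
      (hi := if ins = 1 then T (i + 1) else T i) (p := i + 1) (by omega) (by omega) ?_ ?_ hins
      hhilo ?_ hβ ?_ (hst.memEq (hreg h5') hm₅')
      ((h5 24 (by simp)).trans k24) ((h5 26 (by simp)).trans k26) ?_ fun ρ₆ m₆ h6 hm₆ hc₆ => ?_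
    · split_ifs <;> exact hTr _
    · split_ifs <;> exact hTr _
    · rcases hins with rfl | rfl <;> simp [hT1, hT0, tvβ, hDR, hflip]
    · intro x hx
      rw [hm₅ _ (by simp), Function.update_of_ne (by simp), h5₄ x hx]
    · refine (hc₄.put hsupp ?_ ?_).ptrEq hm₅
      · intro tag id γ hne
        match tag with
        | 0 =>
          have h7 : T (i + 1) id γ ↔ T i id γ := by
            by_cases hid : id = i + 1
            · subst hid
              rw [hT1, hT0]
              exact tvne γ fun h8 => hne ⟨rfl, rfl, h8⟩
            · rw [hTi id hid]
          rcases hins with rfl | rfl <;> simp [full, vals, h7]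
        | 1 => rcases hins with rfl | rfl <;> simp [full, vals]
        | 2 => rcases hins with rfl | rfl <;> simp [full, vals]
        | _ + 3 => rfl
      · rcases hins with rfl | rfl <;> simp [vals, hT1, tvβ, hDR]
    · refine fin _ _ (h5'.trans (h6.mono (by simp [coreRegs, scratch]))) (hm₅'.trans hm₆)
        ((h6 39 (by simp [scratch])).trans ((h5 39 (by simp)).trans k39)) ?_
      convert hc₆ using 2
      rcases hins with rfl | rfl <;> simp
  · rintro ρ' m' ⟨h1, h2, _, h3⟩
    exact h _ _ h1 h2 (h3.congr fun tag id γ hval =>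
      full_congr (fun p _ h4 => (if_pos h4).symm) hval)

end Layout

end DynCQ

namespace DynCQ

namespace Layout

variable {Y : Layout} {B S τ : ℕ} {ρ ρ' : ℕ → ℕ} {m m' : Mem} {Q : (ℕ → ℕ) → Mem → Prop}
  {H : Finset ℕ} {ins p : ℕ}

/-- The update routine. -/
def updatePL : PL := asg 26 (.ld 0 (.lit 0)) ;; asg 27 (.ld 0 (.lit 1)) ;; asg 25 (.lit 2) ;; corePL

theorem tri_update (hY : Y.Wf) (hb : Y.Bds B S H) {Dn : ℕ → List ℕ → Prop} {R : ℕ} {t : List ℕ}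
    (hDn : ∀ r t, Dn r t → ∀ u ∈ t, u ∈ H) (htH : ∀ u ∈ t, u ∈ H) (ht0 : ∀ u ∈ t, u ≠ 0)
    (hlen : ∀ p, 1 ≤ p → p ≤ Y.d → Y.rel p = R → t.length = (Y.args p).length)
    (hins : ins = 0 ∨ ins = 1) (hst : Y.Static ρ m) (h0 : m [0, 0] = ins) (h1 : m [0, 1] = R)
    (hS : ∀ p ≤ Y.d, (Y.args p).length ≤ S) (hseg : ∀ l (h : l < t.length), m [0, 2 + l] = t[l])
    (h25 : 2 + t.length ≤ B) (hcells : Y.Cells m (Y.full (Y.tv Dn))) :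
    Tri B S τ updatePL ρ m fun ρ' m' => Y.Static ρ' m' ∧
      Y.Cells m' (Y.full (Y.tv (upd Dn ins R t))) := by
  have hB := hb.B_le
  refine .seq (.asg (by simp) (.seq (.asg (by simp; omega) (.seq (.asg (by simp; omega) ?_)))))
  simp only [Ex.eval, h0, h1]
  set ρ₁ := Function.update (Function.update (Function.update ρ 26 ins) 27 R) 25 2 with hρ₁
  have hr : ∀ r, 20 ≤ r → r ≤ 22 → ρ₁ r = ρ r := fun r _ _ => by
    rw [hρ₁, Function.update_of_ne (by omega), Function.update_of_ne (by omega),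
      Function.update_of_ne (by omega)]
  have e25 : ρ₁ 25 = 2 := by simp [hρ₁]
  have hst₁ := hst.memEq hr (MemEq.refl m)
  refine tri_core hY hb hDn htH ht0 hlen hins hst₁ (by simp [hρ₁]) (by simp [hρ₁]) hS
    (by rwa [e25]) (by omega) hcells fun ρ' m' h2 h3 h4 => ⟨?_, h4⟩
  exact hst₁.memEq (fun r _ _ => h2 r (by simp [coreRegs]; omega)) h3

/-! ### Testing -/

/-- Find the cell that holds the truth value of the atom in the register `24` after all
eliminations. -/
def findPL : PL :=
  asg 26 (.lit 0) ;; asg 27 (.reg 24) ;;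
    forE 30 (.reg 21) (ifE (.ld₂ 14 (.reg 24) (.ld 15 (.reg 30)))
      (asg 26 (.lit 2) ;; asg 27 (.reg 30)) .skip)

/-- The truth value of an atom after all eliminations is found in the cell of the witnesses for the
last variable `z j` of the atom, or in the cell for the atom itself if it has no such variable. -/
theorem tri_find (hb : Y.Bds B S H) {T : ℕ → (ℕ → ℕ) → Prop}
    (hT : ∀ p β, T p β → ∀ x, β x = 0 ∨ β x ∈ H) (hst : Y.Static ρ m) (hp1 : 1 ≤ p) (hp : p ≤ Y.d)
    (h24 : ρ 24 = p) :
    Tri B S τ findPL ρ m fun ρ' m' => RegEq [26, 27, 30] ρ ρ' ∧ m' = m ∧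
      Y.Valid (ρ' 26) (ρ' 27) ∧
      ∀ γ, Val Y.As Y.z T Y.ℓ p γ ↔ Y.full T (ρ' 26) (ρ' 27) γ ≠ 0 := by
  classical
  have hB := hb.B_le
  refine .seq (.asg (by simp) (.seq (.asg (by simp) ?_)))
  refine .forE (fun j ρ' m' => RegEq [26, 27, 30] ρ ρ' ∧ m' = m ∧ ρ' 30 = j ∧
      Y.Valid (ρ' 26) (ρ' 27) ∧
      ∀ γ, Val Y.As Y.z T j p γ ↔ Y.full T (ρ' 26) (ρ' 27) γ ≠ 0)
    Y.ℓ hb.ℓ_leS hb.ℓ_le ?_ ?_ ?_ ?_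
  · refine ⟨(((RegEq.refl _ _).update (by simp)).update (by simp)).update (by simp), rfl, by simp,
      .inl ?_, fun γ => ?_⟩
    · simp; omega
    · simp [h24, Val, full, vals]
  · rintro j ρ' m' _ ⟨h1, _, h2, _⟩
    exact ⟨h2, (h1 21 (by simp)).trans hst.reg_ℓ, trivial⟩
  · rintro j hj ρ₁ m₁ ⟨h1, rfl, h30, hv, hval⟩
    have he : (Ex.ld₂ 14 (.reg 24) (.ld 15 (.reg 30))).eval ρ₁ m₁ =
        if .var (Y.z j) ∈ Y.args p then 1 else 0 := by
      simp only [Ex.eval, h1 24 (by simp), h24, h30, hst.z j hj, hst.occ p hp]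
    refine .ifE (by simp; omega) (fun h2 => ?_) fun h2 => .skip ?_
    · rw [he] at h2
      have hpA : p ∈ Y.As j := mem_As.2 ⟨⟨hp1, hp⟩, by by_contra h3; simp [h3] at h2⟩
      refine .seq (.asg (by simp; omega) (.asg (by simp) ?_))
      refine ⟨by simpa using h30, (((h1.update (by simp)).update (by simp)).update (by simp)), rfl,
        by simp, ?_, fun γ => ?_⟩
      · simp [h30, Valid, hj]
      · rw [val_succ_of_mem hT hpA]
        simp [h30, full, vals]
    · rw [he] at h2
      have hpA : p ∉ Y.As j := fun h3 => by simp [(mem_As.1 h3).2] at h2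
      refine ⟨h30, h1.update (by simp), rfl, by simp, by simpa using hv, fun γ => ?_⟩
      rw [val_succ_of_notMem hpA]
      simpa using hval γ
  · rintro ρ' m' ⟨h1, h2, _, h3, h4⟩
    exact ⟨h1, h2, h3, h4⟩

/-- The test routine. -/
def testPL : PL :=
  asg 24 (.lit 0) ;; asg 25 (.lit 0) ;; matchPL ;;
    ifE (.reg 28)
      (forE 39 (.reg 20) (asg 24 (.add (.reg 39) (.lit 1)) ;; findPL ;;
        get (.reg 26) (.reg 27) 37 ;; ifE (.reg 37) .skip (asg 28 (.lit 0))))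
      .skip ;;
    st 1 (.lit 0) (.reg 28)

/-- For a fixed tuple of values for the head variables, the query holds if and only if the truth
values after all eliminations are true for all atoms. -/
theorem exists_ev_iff (hY : Y.Wf) {Dn : ℕ → List ℕ → Prop} {β : ℕ → ℕ}
    (hβ : ∀ x, β x ≠ 0 ↔ .var x ∈ Y.args 0) :
    (∃ γ : ℕ → ℕ, (∀ x, γ x ≠ 0) ∧
      (Y.args 0).map (Term.ev γ) = (Y.args 0).map (Term.ev β) ∧
      ∀ p ∈ Finset.Icc 1 Y.d, Dn (Y.rel p) ((Y.args p).map (Term.ev γ))) ↔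
    ∀ p ∈ Finset.Icc 1 Y.d, Val Y.As Y.z (Y.tv Dn) Y.ℓ p (restr (Y.vs p) β) := by
  classical
  set α : ℕ → ℕ := fun x => if β x = 0 then 1 else β x with hα
  have hα0 : ∀ x, α x ≠ 0 := fun x => by by_cases h : β x = 0 <;> simp [hα, h]
  have hαβ : ∀ x, .var x ∈ Y.args 0 → α x = β x := fun x hx => if_neg ((hβ x).2 hx)
  have key : ∀ p ∈ Finset.Icc 1 Y.d, restr (Y.vs p) β = restr (rem Y.z Y.vs Y.ℓ p) α := by
    intro p hp
    rw [Finset.mem_Icc] at hp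
    funext x
    simp only [restr]
    by_cases hx : x ∈ Y.vs p
    · rw [if_pos hx]
      by_cases hz : ∀ i < Y.ℓ, x ≠ Y.z i
      · rw [if_pos ⟨hx, hz⟩, hαβ x (hY.free p hp.1 hp.2 x hx hz)]
      · rw [if_neg fun h => hz h.2]
        push Not at hz
        obtain ⟨i, hi, rfl⟩ := hz
        exact not_not.1 (mt (hβ _).1 (hY.head i hi))
    · rw [if_neg hx, if_neg fun h => hx h.1]
  have htv : ∀ γ : ℕ → ℕ, (∀ x, γ x ≠ 0) → ∀ p,
      (Y.tv Dn p (restr (Y.vs p) γ) ↔ Dn (Y.rel p) ((Y.args p).map (Term.ev γ))) := by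
    intro γ hγ p
    have : (Y.args p).map (Term.ev (restr (Y.vs p) γ)) = (Y.args p).map (Term.ev γ) := by
      refine List.map_congr_left fun s hs => ?_
      cases s with
      | var x => exact if_pos hs
      | const a => rfl
    rw [tv, this]
    refine and_iff_right fun x => ?_
    simp only [restr]
    by_cases hx : x ∈ Y.vs p
    · rw [if_pos hx]; exact iff_of_true (hγ x) hx
    · rw [if_neg hx]; exact iff_of_false (by simp) hx
  have hmain := exists_val_iff (T := Y.tv Dn) (As := Y.As) (z := Y.z) (m := Y.ℓ)
    (Ps := Finset.Icc 1 Y.d) (vs := Y.vs) hα0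
    (fun j _ p => by rw [mem_As, Finset.mem_Icc]; rfl) hY.nonempty hY.z_ne hY.rem_eq
  rw [forall₂_congr fun p hp => by rw [key p hp], ← hmain]
  constructor
  · rintro ⟨γ, h0, h1, h2⟩
    refine ⟨fun x => if (∃ i < Y.ℓ, x = Y.z i) then γ x else α x, fun x => ?_, fun x hx => ?_,
      fun p hp => ?_⟩
    · dsimp only; split_ifs
      · exact h0 x
      · exact hα0 x
    · exact if_neg fun ⟨i, hi, h⟩ => hx i hi h
    · have hp' := Finset.mem_Icc.1 hp
      rw [restr_congr (γ' := γ) fun x hx => ?_]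
      · exact (htv γ h0 p).2 (h2 p hp)
      · split_ifs with hz
        · rfl
        · push Not at hz
          have hx0 := hY.free p hp'.1 hp'.2 x hx hz
          rw [hαβ x hx0]
          exact (List.map_inj_left.1 h1 _ hx0).symm
  · rintro ⟨γ, h0, h1, h2⟩
    refine ⟨γ, h0, List.map_congr_left fun s hs => ?_, fun p hp => (htv γ h0 p).1 (h2 p hp)⟩
    cases s with
    | var x =>
      exact (h1 x fun i hi h => hY.head i hi (h ▸ hs)).trans (hαβ x hs)
    | const a => rfl

theorem ite_iff {P P' : Prop} {_ : Decidable P} {_ : Decidable P'} (h : P ↔ P') :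
    (if P then 1 else 0 : ℕ) = if P' then 1 else 0 := if_congr h rfl rfl

/-- The test routine decides membership of the tuple `t` in the query result. -/
theorem tri_test (hY : Y.Wf) (hb : Y.Bds B S H) {Dn : ℕ → List ℕ → Prop} {t : List ℕ}
    (hDn : ∀ r t, Dn r t → ∀ u ∈ t, u ∈ H) (ht0 : ∀ u ∈ t, u ≠ 0)
    (hlen : t.length = (Y.args 0).length) (hst : Y.Static ρ m)
    (hS : t.length ≤ S) (hseg : ∀ l (h : l < t.length), m [0, l] = t[l])
    (h25 : t.length ≤ B) (hcells : Y.Cells m (Y.full (Y.tv Dn))) :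
    Tri B S τ testPL ρ m fun ρ' m' => Y.Static ρ' m' ∧ Y.Cells m' (Y.full (Y.tv Dn)) ∧
      ((∃ γ : ℕ → ℕ, (∀ x, γ x ≠ 0) ∧ (Y.args 0).map (Term.ev γ) = t ∧
        ∀ p ∈ Finset.Icc 1 Y.d, Dn (Y.rel p) ((Y.args p).map (Term.ev γ))) → m' [1, 0] = 1) ∧
      ((¬ ∃ γ : ℕ → ℕ, (∀ x, γ x ≠ 0) ∧ (Y.args 0).map (Term.ev γ) = t ∧
        ∀ p ∈ Finset.Icc 1 Y.d, Dn (Y.rel p) ((Y.args p).map (Term.ev γ))) → m' [1, 0] = 0) := by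
  classical
  have hB := hb.B_le
  have hd := hb.d_le
  set P : Prop := ∃ γ : ℕ → ℕ, (∀ x, γ x ≠ 0) ∧ (Y.args 0).map (Term.ev γ) = t ∧
        ∀ p ∈ Finset.Icc 1 Y.d, Dn (Y.rel p) ((Y.args p).map (Term.ev γ)) with hP
  refine .seq (.asg (by simp) (.seq (.asg (by simp) ?_)))
  simp only [Ex.eval]
  set ρ₁ := Function.update (Function.update ρ 24 0) 25 0 with hρ₁
  set L : List ℕ := [24, 25, 26, 27, 28, 29, 30, 33, 34, 35, 36, 37, 39] with hL
  have h1 : RegEq L ρ ρ₁ := ((RegEq.refl _ _).update (by simp [L])).update (by simp [L])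
  have hreg : ∀ {ρ'}, RegEq L ρ ρ' → ∀ r, 20 ≤ r → r ≤ 22 → ρ' r = ρ r :=
    fun h r h1 h2 => h r (by simp [L]; omega)
  have e25 : ρ₁ 25 = 0 := by simp [hρ₁]
  have fin : ∀ ρ' m', RegEq L ρ ρ' → MemEq m m' → Y.Cells m' (Y.full (Y.tv Dn)) →
      ρ' 28 = (if P then 1 else 0) → Tri B S τ (st 1 (.lit 0) (.reg 28)) ρ' m' fun ρ' m' =>
      Y.Static ρ' m' ∧ Y.Cells m' (Y.full (Y.tv Dn)) ∧ (P → m' [1, 0] = 1) ∧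
        (¬ P → m' [1, 0] = 0) := by
    intro ρ' m' hr hm hc h28
    refine .st (by omega) (by simp) (by simp) ⟨?_, ?_, ?_, ?_⟩
    · refine (hst.memEq (hreg hr) hm).frame (fun _ _ _ => rfl) fun a _ h1 _ _ => ?_
      exact Function.update_of_ne (by rintro rfl; simp at h1) _ _
    · exact hc.frame fun a h6 _ => Function.update_of_ne (by rintro rfl; simp at h6) _ _
    · intro h; simp [h28, h]
    · intro h; simp [h28, h]
  refine .seq (tri_match (hst.memEq (hreg h1) (.refl _)) hY hB hb.X_le hb.X_leS (Nat.zero_le _)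
    (by simp [hρ₁]) hlen hS ht0 (by simpa [e25] using hseg) (by omega)
    fun ρ₂ m₂ β h2 hm₂ h5 hβ0 hok => ?_)
  have h2' : RegEq L ρ ρ₂ := h1.trans (h2.mono (by simp [L]))
  have hm₂' : MemEq m m₂ := fun a h5 _ => hm₂ a h5
  have hc₂ := hcells.frame (m' := m₂) fun a h6 _ => hm₂ a (by simp [h6])
  rcases hok with ⟨h28, hβ, hev⟩ | ⟨h28, hno⟩
  swap
  · refine .seq (.ifE trivial (fun h6 => absurd h28 h6) fun _ => .skip
      (fin _ _ h2' hm₂' hc₂ ?_))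
    rw [h28, if_neg]
    rintro ⟨γ, _, h3, _⟩
    exact hno γ h3
  rw [← hev, exists_ev_iff hY hβ] at hP
  refine .seq (.ifE trivial (fun _ => ?_) fun h6 => absurd h28 (by simp at h6; omega))
  refine .forE (fun i ρ' m' => RegEq L ρ ρ' ∧ MemEq m m' ∧ Y.Cells m' (Y.full (Y.tv Dn)) ∧
    ρ' 39 = i ∧ (∀ x ∈ Y.X, m' [5, x] = β x) ∧
    ρ' 28 = if ∀ p ∈ Finset.Icc 1 i, Val Y.As Y.z (Y.tv Dn) Y.ℓ p (restr (Y.vs p) β)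
      then 1 else 0) Y.d hb.d_leS (by omega) ?_ ?_ ?_ ?_
  · exact ⟨h2'.update (by simp [L]), hm₂', hc₂, by simp, h5, by simp [h28]⟩
  · rintro i ρ' m' _ ⟨h1, _, _, h2, _⟩
    exact ⟨h2, (h1 20 (by simp [L])).trans hst.reg_d, trivial⟩
  · rintro i hi ρ₃ m₃ ⟨h3, hm₃, hc₃, h39, h5₃, h28₃⟩
    refine .seq (.asg (by simp; omega) ?_)
    simp only [Ex.eval, h39]
    set ρ₄ := Function.update ρ₃ 24 (i + 1) with hρ₄
    have h4 : RegEq L ρ ρ₄ := h3.update (by simp [L])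
    have f24 : ρ₄ 24 = i + 1 := by simp [hρ₄]
    have f39 : ρ₄ 39 = i := by simp [hρ₄, h39]
    have f28 : ρ₄ 28 = ρ₃ 28 := by simp [hρ₄]
    clear_value ρ₄
    have hst₄ := hst.memEq (hreg h4) hm₃
    refine .seq' (tri_find (T := Y.tv Dn) hb (fun p β => tv_range hDn) hst₄ (p := i + 1) (by omega) (by omega)
      f24) ?_
    rintro ρ₅ m₅ ⟨h5, rfl, hv, hval⟩
    have h5' : RegEq L ρ ρ₅ := h4.trans (h5.mono (by simp [L]))
    refine .bdd fun hρB _ => ?_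
    refine .seq (tri_get (tag := .reg 26) (id := .reg 27) (hst.memEq (hreg h5') hm₃) hB hb.X_le
      hb.X_leS (show i + 1 ≤ Y.d by omega) ((h5 24 (by simp)).trans f24) trivial
      (fun v => ⟨trivial, by simp⟩) fun ρ₆ m₆ h6 hm₆ h37 => ?_)
    have hkey : Y.key (i + 1) m₅ = restr (Y.vs (i + 1)) β := by
      funext x
      simp only [key, restr]
      by_cases hx : .var x ∈ Y.args (i + 1)
      · rw [if_pos hx, if_pos (show x ∈ Y.vs (i + 1) from hx),
          h5₃ x (hY.mem_X _ (by omega) x hx)]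
      · rw [if_neg hx, if_neg (show x ∉ Y.vs (i + 1) from hx)]
    have hsupp : Y.Supp (restr (Y.vs (i + 1)) β) := fun x hx =>
      if_neg fun h => hx (hY.mem_X _ (by omega) x h)
    simp only [Ex.eval] at h37
    rw [hkey, hc₃ _ _ _ hv hsupp] at h37
    have h6' : RegEq L ρ ρ₆ := h5'.trans (h6.mono (by simp [L]))
    have g28 : ρ₆ 28 = ρ₃ 28 := by rw [h6 28 (by simp), h5 28 (by simp), f28]
    have g39 : ρ₆ 39 = i := by rw [h6 39 (by simp), h5 39 (by simp), f39]
    have hIcc : (∀ p ∈ Finset.Icc 1 (i + 1), Val Y.As Y.z (Y.tv Dn) Y.ℓ p (restr (Y.vs p) β)) ↔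
        (∀ p ∈ Finset.Icc 1 i, Val Y.As Y.z (Y.tv Dn) Y.ℓ p (restr (Y.vs p) β)) ∧
        Val Y.As Y.z (Y.tv Dn) Y.ℓ (i + 1) (restr (Y.vs (i + 1)) β) := by
      rw [← Finset.insert_Icc_right_eq_Icc_add_one (by omega), Finset.forall_mem_insert, and_comm]
    have next : ∀ ρ', RegEq L ρ ρ' → ρ' 39 = i →
        (ρ' 28 = if ∀ p ∈ Finset.Icc 1 (i + 1), Val Y.As Y.z (Y.tv Dn) Y.ℓ p (restr (Y.vs p) β)
          then 1 else 0) → ρ' 39 = i ∧ RegEq L ρ (Function.update ρ' 39 (i + 1)) ∧ MemEq m m₆ ∧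
        Y.Cells m₆ (Y.full (Y.tv Dn)) ∧ Function.update ρ' 39 (i + 1) 39 = i + 1 ∧
        (∀ x ∈ Y.X, m₆ [5, x] = β x) ∧ Function.update ρ' 39 (i + 1) 28 =
        if ∀ p ∈ Finset.Icc 1 (i + 1), Val Y.As Y.z (Y.tv Dn) Y.ℓ p (restr (Y.vs p) β)
          then 1 else 0 := fun ρ' a1 a2 a3 =>
      ⟨a2, a1.update (by simp [L]), hm₃.trans hm₆.memEq, hc₃.ptrEq hm₆, by simp,
        fun x hx => (hm₆ _ (by simp)).trans (h5₃ x hx), by simpa using a3⟩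
    refine .ifE trivial (fun h7 => .skip (next _ h6' g39 ?_)) fun h7 =>
      .asg (Nat.zero_le _) (next _ (h6'.update (by simp [L])) (by simpa using g39) ?_)
    · have := (hval _).2 (by rw [← h37]; exact h7)
      rw [g28, h28₃]
      exact ite_iff (by rw [hIcc]; exact (and_iff_left this).symm)
    · have : ¬ Val Y.As Y.z (Y.tv Dn) Y.ℓ (i + 1) (restr (Y.vs (i + 1)) β) := fun h8 =>
        (hval _).1 h8 (by rw [← h37]; exact h7)
      simp only [hIcc, this, and_false, if_false]
      simp
  · rintro ρ' m' ⟨h3, hm₃, hc₃, _, _, h28₃⟩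
    refine fin _ _ h3 hm₃ hc₃ ?_
    rw [h28₃]
    exact ite_iff (Eq.to_iff hP).symm

end Layout

end DynCQ

namespace DynCQ

section Call

variable {B S τ : ℕ} {ρ : ℕ → ℕ} {m : Mem} {Q : (ℕ → ℕ) → Mem → Prop}

theorem Tri.call {P : PL} {S' τ' : ℕ} (h : Tri B S' τ' P ρ m Q) (hτ : P.cost S' τ' ≤ τ) :
    Tri B S τ (.call P.prog) ρ m Q := fun s hs hρ hm => by
  obtain ⟨t, s', h1, h2, h3, h4⟩ := h s hs hρ hm
  exact ⟨t, s', h1, h2.trans hτ, h3, h4⟩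

end Call

/-! ### Reading the input -/

/-- The list `xs` is found in the input cells from position `pos` on. -/
def Seg (m : Mem) (pos : ℕ) (xs : List ℕ) : Prop := ∀ i (h : i < xs.length), m [0, pos + i] = xs[i]

theorem seg_append {m : Mem} {pos : ℕ} {xs ys : List ℕ} :
    Seg m pos (xs ++ ys) ↔ Seg m pos xs ∧ Seg m (pos + xs.length) ys := by
  constructor
  · intro h
    refine ⟨fun i hi => ?_, fun i hi => ?_⟩
    · rw [h i (by simp; omega), List.getElem_append_left hi]
    · rw [Nat.add_assoc, h _ (by simp; omega), List.getElem_append_right (by omega)]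
      simp
  · rintro ⟨h1, h2⟩ i hi
    by_cases hx : i < xs.length
    · rw [h1 i hx, List.getElem_append_left hx]
    · rw [List.getElem_append_right (by omega), ← h2 (i - xs.length)]
      congr 3; omega

theorem seg_cons {m : Mem} {pos x : ℕ} {xs : List ℕ} :
    Seg m pos (x :: xs) ↔ m [0, pos] = x ∧ Seg m (pos + 1) xs := by
  rw [← List.singleton_append, seg_append]
  refine and_congr_left fun _ => ⟨fun h => h 0 (by simp), fun h i hi => ?_⟩
  simp only [List.length_singleton, Nat.lt_one_iff] at hi
  subst hi
  simpa using h

theorem Seg.frame {m m' : Mem} {pos : ℕ} {xs : List ℕ} (h : Seg m pos xs)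
    (hm : ∀ i, m' [0, i] = m [0, i]) : Seg m' pos xs := fun i hi => (hm _).trans (h i hi)

theorem Seg.flatMap {m : Mem} {pos n i : ℕ} {f : ℕ → List ℕ}
    (h : Seg m pos ((List.range n).flatMap f)) (hi : i < n) :
    Seg m (pos + ((List.range i).flatMap f).length) (f i) := by
  induction n with
  | zero => omega
  | succ n ih =>
    rw [List.range_succ, List.flatMap_append, seg_append] at h
    rcases Nat.lt_succ_iff_lt_or_eq.1 hi with h1 | rfl
    · exact ih h.1 h1
    · simpa using h.2

/-- The code of a list of terms, preceded by its length. -/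
def codeArgs (as : List Term) : List ℕ := as.length :: as.flatMap Term.code

theorem length_flatMap_code (as : List Term) : (as.flatMap Term.code).length = 2 * as.length := by
  induction as with
  | nil => rfl
  | cons a as ih => simp [Term.code_eq, ih]; omega

theorem Seg.term {m : Mem} {pos : ℕ} {as : List Term} (h : Seg m pos (as.flatMap Term.code)) {l : ℕ}
    (hl : l < as.length) :
    m [0, pos + 2 * l] = (as[l]).kind ∧ m [0, pos + 2 * l + 1] = (as[l]).num := by
  induction as generalizing pos l with
  | nil => simp at hl
  | cons a as ih =>
    rw [List.flatMap_cons, Term.code_eq, List.cons_append, seg_cons, List.singleton_append,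
      seg_cons] at h
    cases l with
    | zero => exact ⟨h.1, h.2.1⟩
    | succ l =>
      obtain ⟨h1, h2⟩ := ih h.2.2 (l := l) (by simpa using hl)
      simp only [List.getElem_cons_succ]
      exact ⟨by rw [← h1]; congr 3; omega, by rw [← h2]; congr 3; omega⟩

/-- Read the argument list of the atom whose number is in the logical register `24` from the
position in the register `23`, and extend the list `X` by the numbers of its arguments. -/
def readArgsPL : PL :=
  st 11 (.reg 24) (.ld 0 (.reg 23)) ;; asg 23 (.add (.reg 23) (.lit 1)) ;;
    forE 29 (.ld 11 (.reg 24))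
      (asg 36 (.ld 0 (.reg 23)) ;; asg 37 (.ld 0 (.add (.reg 23) (.lit 1))) ;;
        asg 23 (.add (.reg 23) (.lit 2)) ;;
        st₂ 12 (.reg 24) (.reg 29) (.reg 36) ;; st₂ 13 (.reg 24) (.reg 29) (.reg 37) ;;
        st 4 (.reg 22) (.reg 37) ;; asg 22 (.add (.reg 22) (.lit 1)) ;;
        ifE (.reg 36) .skip (st₂ 14 (.reg 24) (.reg 37) (.lit 1)))

/-- The cells that are changed when the arguments of the atom number `p` are read. -/
def Touch (p : ℕ) (a : List ℕ) : Prop :=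
  a.head? = some 4 ∨ ∃ n ∈ [11, 12, 13, 14], ∃ l, a = n :: p :: l

open Classical in
/-- The first `l` of the arguments `as` of the atom number `p` are in the tables. -/
def ArgTab (p l : ℕ) (as : List Term) (m : Mem) : Prop :=
  m [11, p] = as.length ∧ (∀ i (h : i < as.length), i < l → m [12, p, i] = (as[i]).kind) ∧
  (∀ i (h : i < as.length), i < l → m [13, p, i] = (as[i]).num) ∧
  ∀ x, m [14, p, x] = if .var x ∈ as.take l then 1 else 0

/-- The list `X` is stored in the array `4`. -/
def XTab (X : List ℕ) (ρ : ℕ → ℕ) (m : Mem) : Prop :=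
  ρ 22 = X.length ∧ ∀ e (h : e < X.length), m [4, e] = X[e]

theorem tri_readArgs {B S τ : ℕ} {ρ : ℕ → ℕ} {m : Mem} {Q : (ℕ → ℕ) → Mem → Prop} {p : ℕ}
    {as : List Term} {X : List ℕ} (hB : 16 ≤ B) (hS : as.length ≤ S) (h24 : ρ 24 = p)
    (hpos : ρ 23 + 1 + 2 * as.length ≤ B) (hXB : X.length + as.length ≤ B)
    (hseg : Seg m (ρ 23) (codeArgs as)) (h14 : ∀ x, m [14, p, x] = 0) (hX : XTab X ρ m)
    (h : ∀ ρ' m', RegEq [22, 23, 29, 36, 37] ρ ρ' → (∀ a, ¬ Touch p a → m' a = m a) →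
      ρ' 23 = ρ 23 + (codeArgs as).length → ArgTab p as.length as m' →
      XTab (X ++ as.map Term.num) ρ' m' → Q ρ' m') :
    Tri B S τ readArgsPL ρ m Q := by
  classical
  rw [codeArgs, seg_cons] at hseg
  obtain ⟨hlen, hseg⟩ := hseg
  refine .bdd fun hρB _ => ?_
  have hB24 := hρB 24
  refine .seq (.st (by omega) (by simp) (by simp) (.seq (.asg (by simp; omega) ?_)))
  simp only [Ex.eval, h24, hlen]
  refine .forE (fun l ρ' m' => RegEq [22, 23, 29, 36, 37] ρ ρ' ∧ ρ' 29 = l ∧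
    (∀ a, ¬ Touch p a → m' a = m a) ∧ ρ' 23 = ρ 23 + 1 + 2 * l ∧ ArgTab p l as m' ∧
    XTab (X ++ (as.take l).map Term.num) ρ' m') as.length hS (by omega) ?_ ?_ ?_ ?_
  · refine ⟨((RegEq.refl _ _).update (by simp)).update (by simp), by simp, fun a ha => ?_, by simp,
      ⟨by simp, by simp, by simp, fun x => ?_⟩, ?_, fun e he => ?_⟩
    · exact Function.update_of_ne (by rintro rfl; exact ha (.inr ⟨11, by simp, _, rfl⟩)) _ _
    · simpa using h14 x
    · simpa using hX.1
    · rw [Function.update_of_ne (by simp)]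
      simpa using hX.2 e (by simpa using he)
  · rintro l ρ' m' _ ⟨h1, h2, _, _, h3, _⟩
    have e24 : ρ' 24 = p := (h1 24 (by simp)).trans h24
    exact ⟨h2, by simp only [Ex.eval, e24]; exact h3.1, by simp; omega⟩
  · rintro l hl ρ₁ m₁ ⟨h1, h29, hm, h23, ⟨ht1, ht2, ht3, ht4⟩, hx1, hx2⟩
    have e24 : ρ₁ 24 = p := (h1 24 (by simp)).trans h24
    have hxl : ρ₁ 22 = X.length + l := by
      rw [hx1]; simp; omega
    obtain ⟨c1, c2⟩ := hseg.term hl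
    have hm0 : ∀ i, m₁ [0, i] = m [0, i] := fun i => hm _ (by simp [Touch])
    have v36 : (Ex.ld 0 (.reg 23)).eval ρ₁ m₁ = (as[l]).kind := by
      simp only [Ex.eval, h23, hm0, c1]
    refine .seq (.asg (by simp) ?_)
    rw [v36]
    have v37 : (Ex.ld 0 (.add (.reg 23) (.lit 1))).eval (Function.update ρ₁ 36 (as[l]).kind) m₁ =
        (as[l]).num := by
      simp [h23, hm0, c2]
    refine .seq (.asg (by simp; omega) ?_)
    rw [v37]
    refine .seq (.asg (by simp; omega) ?_)
    have v23 : (Ex.add (.reg 23) (.lit 2)).eval (Function.update (Function.update ρ₁ 36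
        (as[l]).kind) 37 (as[l]).num) m₁ = ρ 23 + 1 + 2 * l + 2 := by simp [h23]
    rw [v23]
    set ρ₃ := Function.update (Function.update (Function.update ρ₁ 36
      (as[l]).kind) 37 (as[l]).num) 23 (ρ 23 + 1 + 2 * l + 2) with hρ₃
    have h3 : RegEq [22, 23, 29, 36, 37] ρ ρ₃ :=
      ((h1.update (by simp)).update (by simp)).update (by simp)
    have g24 : ρ₃ 24 = p := by simp [hρ₃, e24]
    have g22 : ρ₃ 22 = X.length + l := by simp [hρ₃, hxl]
    have g23 : ρ₃ 23 = ρ 23 + 1 + 2 * l + 2 := by simp [hρ₃]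
    have g29 : ρ₃ 29 = l := by simp [hρ₃, h29]
    have g36 : ρ₃ 36 = (as[l]).kind := by simp [hρ₃]
    have g37 : ρ₃ 37 = (as[l]).num := by simp [hρ₃]
    clear_value ρ₃
    refine .seq (.st₂ (by omega) (by simp) (by simp) (by simp) ?_)
    refine .seq (.st₂ (by omega) (by simp) (by simp) (by simp) ?_)
    refine .seq (.st (by omega) (by simp) (by simp) ?_)
    refine .seq (.asg (by simp; omega) ?_)
    simp only [Ex.eval, g22, g24, g29, g36, g37]
    set ρ₂ := Function.update ρ₃ 22 (X.length + l + 1) with hρ₂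
    have h2 : RegEq [22, 23, 29, 36, 37] ρ ρ₂ :=
      h3.update (by simp)
    have atake : as.take (l + 1) = as.take l ++ [as[l]] := by
      rw [List.take_add_one, List.getElem?_eq_getElem hl]; rfl
    have fin : ∀ m', (∀ a, ¬ Touch p a → m' a = m a) → m' [11, p] = m₁ [11, p] →
        (∀ i, m' [12, p, i] = if i = l then (as[l]).kind else m₁ [12, p, i]) →
        (∀ i, m' [13, p, i] = if i = l then (as[l]).num else m₁ [13, p, i]) →
        (∀ x, m' [14, p, x] = if as[l] = .var x then 1 else m₁ [14, p, x]) →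
        (∀ e, m' [4, e] = if e = X.length + l then (as[l]).num else m₁ [4, e]) →
        ρ₂ 29 = l ∧ RegEq [22, 23, 29, 36, 37] ρ (Function.update ρ₂ 29 (l + 1)) ∧
        Function.update ρ₂ 29 (l + 1) 29 = l + 1 ∧ (∀ a, ¬ Touch p a → m' a = m a) ∧
        Function.update ρ₂ 29 (l + 1) 23 = ρ 23 + 1 + 2 * (l + 1) ∧ ArgTab p (l + 1) as m' ∧
        XTab (X ++ (as.take (l + 1)).map Term.num) (Function.update ρ₂ 29 (l + 1)) m' := by
      intro m' a1 a2 a3 a4 a5 a6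
      refine ⟨by simp [hρ₂, g29], h2.update (by simp), by simp, a1, by simp [hρ₂, g23]; omega,
        ⟨a2.trans ht1, fun i hi hil => ?_, fun i hi hil => ?_, fun x => ?_⟩, ?_, fun e he => ?_⟩
      · rw [a3]
        split_ifs with h3
        · subst h3; rfl
        · exact ht2 i hi (by omega)
      · rw [a4]
        split_ifs with h3
        · subst h3; rfl
        · exact ht3 i hi (by omega)
      · rw [a5, ht4, atake]
        by_cases h3 : as[l] = .var x
        · simp [h3]
        · have h3' : ¬ Term.var x = as[l] := fun h => h3 h.symm
          rw [if_neg h3]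
          simp only [List.mem_append, List.mem_singleton, h3', or_false]
      · simp [hρ₂]; omega
      · rw [a6]
        simp only [atake, List.map_append, ← List.append_assoc]
        have hxl' : (X ++ (as.take l).map Term.num).length = X.length + l := by simp; omega
        split_ifs with h3
        · subst h3
          rw [List.getElem_append_right (by omega)]
          simp
        · have he' : e < (X ++ (as.take l).map Term.num).length := by
            simp at he; omega
          rw [List.getElem_append_left he', hx2 e he']
    have f24 : ρ₂ 24 = p := (h2 24 (by simp)).trans h24
    have f36 : ρ₂ 36 = (as[l]).kind := by simp [hρ₂, g36]
    have f37 : ρ₂ 37 = (as[l]).num := by simp [hρ₂, g37]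
    clear_value ρ₂
    have hne : ∀ a, ¬ Touch p a → ∀ n ∈ [11, 12, 13, 14], ∀ l, a ≠ n :: p :: l := fun a ha n hn l h3 =>
      ha (.inr ⟨n, hn, l, h3⟩)
    have hne4 : ∀ a, ¬ Touch p a → ∀ l, a ≠ 4 :: l := fun a ha l h3 => ha (.inl (by simp [h3]))
    refine .ifE trivial (fun hk => .skip (fin _ ?_ ?_ ?_ ?_ ?_ ?_))
      fun hk => .st₂ (by omega) trivial trivial (by simp; omega) (fin _ ?_ ?_ ?_ ?_ ?_ ?_)
    all_goals simp only [Ex.eval, f36] at hk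
    all_goals try simp only [Ex.eval, f24, f37]
    · intro a ha
      rw [Function.update_of_ne (hne4 a ha _), Function.update_of_ne (hne a ha 13 (by simp) _),
        Function.update_of_ne (hne a ha 12 (by simp) _), hm a ha]
    · simp
    · intro i; simp [Function.update_apply]
    · intro i; simp [Function.update_apply]
    · intro x
      have : as[l] ≠ .var x := fun h3 => hk (by rw [h3]; rfl)
      simp [this]
    · intro e; simp [Function.update_apply]
    · intro a ha
      rw [Function.update_of_ne (hne a ha 14 (by simp) _), Function.update_of_ne (hne4 a ha _),
        Function.update_of_ne (hne a ha 13 (by simp) _),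
        Function.update_of_ne (hne a ha 12 (by simp) _), hm a ha]
    · simp
    · intro i; simp [Function.update_apply]
    · intro i; simp [Function.update_apply]
    · intro x
      have : as[l] = .var x ↔ x = (as[l]).num := by
        cases h3 : as[l] with
        | var y => simp [Term.num, eq_comm]
        | const a => rw [h3] at hk; simp [Term.kind] at hk
      simp [Function.update_apply, this]
    · intro e; simp [Function.update_apply]
  · rintro ρ' m' ⟨h1, _, h2, h3, h4, h5⟩
    rw [List.take_length] at h5
    refine h _ _ h1 h2 ?_ h4 h5
    rw [h3, codeArgs, List.length_cons, length_flatMap_code]; omega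

end DynCQ

namespace DynCQ

variable {B S τ : ℕ} {ρ : ℕ → ℕ} {m : Mem} {Q : (ℕ → ℕ) → Mem → Prop}

/-- The numbers of all arguments of the first `n` atoms. -/
def allNums (args : ℕ → List Term) (n : ℕ) : List ℕ :=
  (List.range n).flatMap fun p => (args p).map Term.num

theorem allNums_succ (args : ℕ → List Term) (n : ℕ) :
    allNums args (n + 1) = allNums args n ++ (args n).map Term.num := by
  simp [allNums, List.range_succ]

/-- The code of the atom number `i + 1`. -/
def codeAtom (args : ℕ → List Term) (rel : ℕ → ℕ) (i : ℕ) : List ℕ :=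
  rel (i + 1) :: codeArgs (args (i + 1))

/-- The code of a query. -/
def codeQuery (args : ℕ → List Term) (rel : ℕ → ℕ) (d : ℕ) (qs : List ℕ) : List ℕ :=
  codeArgs (args 0) ++ (qs.length :: qs) ++ (d :: (List.range d).flatMap (codeAtom args rel))

theorem length_codeArgs (as : List Term) : (codeArgs as).length = 1 + 2 * as.length := by
  rw [codeArgs, List.length_cons, length_flatMap_code]; omega

/-- Read the query. -/
def readPL : PL :=
  asg 23 (.lit 0) ;; asg 22 (.lit 0) ;; asg 24 (.lit 0) ;; readArgsPL ;; asg 25 (.reg 23) ;;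
    asg 23 (.add (.add (.reg 25) (.lit 1)) (.ld 0 (.reg 25))) ;; asg 20 (.ld 0 (.reg 23)) ;;
    asg 23 (.add (.reg 23) (.lit 1)) ;;
    forE 39 (.reg 20)
      (asg 24 (.add (.reg 39) (.lit 1)) ;; st 10 (.reg 24) (.ld 0 (.reg 23)) ;;
        asg 23 (.add (.reg 23) (.lit 1)) ;; readArgsPL)

/-- Reading the code of a query fills the tables for its head and its atoms. -/
theorem tri_read {args : ℕ → List Term} {rel : ℕ → ℕ} {d : ℕ} {qs : List ℕ} (hB : 16 ≤ B)
    (hlB : (codeQuery args rel d qs).length ≤ B) (hS : ∀ p ≤ d, (args p).length ≤ S) (hdS : d ≤ S)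
    (hdB : d ≤ B) (hseg : Seg m 0 (codeQuery args rel d qs)) (h14 : ∀ p x, m [14, p, x] = 0)
    (h : ∀ ρ' m', (∀ a, a.head? ∉ [some 4, some 10, some 11, some 12, some 13, some 14] →
        m' a = m a) → ρ' 20 = d → XTab (allNums args (d + 1)) ρ' m' →
      ρ' 23 = (codeQuery args rel d qs).length → ρ' 25 = (codeArgs (args 0)).length →
      (∀ p, 1 ≤ p → p ≤ d → m' [10, p] = rel p) →
      (∀ p ≤ d, ArgTab p (args p).length (args p) m') → Q ρ' m') :
    Tri B S τ readPL ρ m Q := by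
  classical
  have hlen : (codeQuery args rel d qs).length = 1 + 2 * (args 0).length + (1 + qs.length) + 1 +
      ((List.range d).flatMap (codeAtom args rel)).length := by
    simp [codeQuery, length_codeArgs]; omega
  rw [hlen] at hlB
  rw [codeQuery, seg_append, seg_append, seg_cons, seg_cons] at hseg
  obtain ⟨⟨hs1, hs2, _⟩, hs3, hs4⟩ := hseg
  simp only [List.length_append, List.length_cons, length_codeArgs, Nat.zero_add] at hs2 hs3 hs4
  refine .seq (.asg (by simp) (.seq (.asg (by simp) (.seq (.asg (by simp) ?_)))))
  simp only [Ex.eval]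
  refine .seq (tri_readArgs (p := 0) (as := args 0) (X := []) hB (hS 0 (Nat.zero_le _)) (by simp)
    (by simp; omega) (by simp; omega) (by simpa using hs1) (h14 0)
    ⟨by simp, fun e he => by simp at he⟩ ?_)
  intro ρ₁ m₁ hr₁ hm₁ h23 ht hx
  simp only [length_codeArgs, List.nil_append] at h23 hx
  have e23 : ρ₁ 23 = 1 + 2 * (args 0).length := by simp [h23]
  have hm0 : ∀ i, m₁ [0, i] = m [0, i] := fun i => hm₁ _ (by simp [Touch])
  refine .seq (.asg trivial (.seq (.asg ?_ ?_)))
  · simp [e23, hm0, hs2]; omega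
  have v23 : (Ex.add (.add (.reg 25) (.lit 1)) (.ld 0 (.reg 25))).eval
      (Function.update ρ₁ 25 ((Ex.reg 23).eval ρ₁ m₁)) m₁ =
      1 + 2 * (args 0).length + (qs.length + 1) := by
    simp [e23, hm0, hs2]; omega
  rw [v23]
  refine .seq (.asg (by simp) ?_)
  have v20 : (Ex.ld 0 (.reg 23)).eval (Function.update (Function.update ρ₁ 25
      ((Ex.reg 23).eval ρ₁ m₁)) 23 (1 + 2 * (args 0).length + (qs.length + 1))) m₁ = d := by
    simp [hm0, hs3]
  rw [v20]
  refine .seq (.asg (by simp; omega) ?_)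
  set ρ₂ := Function.update (Function.update (Function.update (Function.update ρ₁ 25
      ((Ex.reg 23).eval ρ₁ m₁)) 23 (1 + 2 * (args 0).length + (qs.length + 1))) 20 d) 23
      ((Ex.add (.reg 23) (.lit 1)).eval (Function.update (Function.update (Function.update ρ₁ 25
      ((Ex.reg 23).eval ρ₁ m₁)) 23 (1 + 2 * (args 0).length + (qs.length + 1))) 20 d) m₁) with hρ₂
  have f23 : ρ₂ 23 = 1 + 2 * (args 0).length + (qs.length + 1) + 1 := by simp [hρ₂]
  have f25 : ρ₂ 25 = 1 + 2 * (args 0).length := by simp [hρ₂, e23]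
  have f20 : ρ₂ 20 = d := by simp [hρ₂]
  have f22 : ρ₂ 22 = ρ₁ 22 := by simp [hρ₂]
  clear_value ρ₂
  refine .forE (fun i ρ' m' => ρ' 39 = i ∧
    (∀ a, a.head? ∉ [some 4, some 10, some 11, some 12, some 13, some 14] → m' a = m a) ∧
    ρ' 20 = d ∧ XTab (allNums args (i + 1)) ρ' m' ∧
    ρ' 23 = 1 + 2 * (args 0).length + (qs.length + 1) + 1 +
      ((List.range i).flatMap (codeAtom args rel)).length ∧
    ρ' 25 = 1 + 2 * (args 0).length ∧
    (allNums args (i + 1)).length ≤ ρ' 23 ∧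
    (∀ p, 1 ≤ p → p ≤ i → m' [10, p] = rel p) ∧
    (∀ p ≤ i, ArgTab p (args p).length (args p) m') ∧ ∀ p, i < p → ∀ x, m' [14, p, x] = 0)
    d hdS hdB ?_ ?_ ?_ ?_
  · refine ⟨by simp, fun a ha => hm₁ a ?_, by simpa using f20, ?_, by simpa using f23,
      by simpa using f25, ?_, fun p h1 h2 => by omega, fun p hp => ?_, fun p hp x => ?_⟩
    · rintro (h1 | ⟨n, hn, l, rfl⟩)
      · simp [h1] at ha
      · simp at ha hn
        omega
    · have : allNums args (0 + 1) = (args 0).map Term.num := by simp [allNums]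
      rw [this]
      exact ⟨by simpa [f22] using hx.1, hx.2⟩
    · simp [allNums, f23]; omega
    · obtain rfl : p = 0 := by omega
      exact ht
    · rw [hm₁ _ (by simp [Touch]; omega)]
      exact h14 p x
  · rintro i ρ' m' _ ⟨h1, _, h2, _⟩
    exact ⟨h1, h2, trivial⟩
  · rintro i hi ρ₃ m₃ ⟨h39, hm₃, h20, hx₃, h23₃, h25, hxl, hrel, htab, hz⟩
    have hm0₃ : ∀ i, m₃ [0, i] = m [0, i] := fun i => hm₃ _ (by simp)
    have hseg := hs4.flatMap hi
    rw [codeAtom, seg_cons] at hseg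
    have hlen_i : ((List.range (i + 1)).flatMap (codeAtom args rel)).length =
        ((List.range i).flatMap (codeAtom args rel)).length + (1 + (1 + 2 * (args (i + 1)).length))
        := by
      rw [List.range_succ, List.flatMap_append, List.length_append]
      simp [codeAtom, length_codeArgs]; omega
    have hmono : ((List.range (i + 1)).flatMap (codeAtom args rel)).length ≤
        ((List.range d).flatMap (codeAtom args rel)).length :=
      ((List.range_sublist.2 (show i + 1 ≤ d by omega)).flatMap _).length_le
    set pos := 1 + 2 * (args 0).length + (qs.length + 1) + 1 +
      ((List.range i).flatMap (codeAtom args rel)).length with hpos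
    refine .seq (.asg (by simp; omega) (.seq (.st (by omega) (by simp) (by simp)
      (.seq (.asg (by simp; omega) ?_)))))
    simp only [Ex.eval, h39, Function.update_self]
    rw [Function.update_of_ne (show (23 : ℕ) ≠ 24 by omega), h23₃, hm0₃, hseg.1]
    set ρ₄ := Function.update (Function.update ρ₃ 24 (i + 1)) 23 (pos + 1) with hρ₄
    have g23 : ρ₄ 23 = pos + 1 := by simp [hρ₄]
    have g24 : ρ₄ 24 = i + 1 := by simp [hρ₄]
    have g : ∀ r, r ≠ 23 → r ≠ 24 → ρ₄ r = ρ₃ r := fun r h1 h2 => by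
      rw [hρ₄, Function.update_of_ne h1, Function.update_of_ne h2]
    clear_value ρ₄
    refine tri_readArgs (p := i + 1) (as := args (i + 1)) (X := allNums args (i + 1)) hB
      (hS _ (by omega)) g24 (by omega) (by omega) ?_ (fun x => ?_)
      ⟨by rw [g 22 (by omega) (by omega)]; exact hx₃.1, fun e he => ?_⟩ ?_
    · rw [g23]
      exact hseg.2.frame fun j => by rw [Function.update_of_ne (by simp), hm0₃]
    · rw [Function.update_of_ne (by simp)]; exact hz _ (by omega) x
    · rw [Function.update_of_ne (by simp)]; exact hx₃.2 e he
    intro ρ₅ m₅ hr₅ hm₅ k23 ktab kx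
    have k : ∀ r, r ∉ [22, 23, 24, 29, 36, 37] → ρ₅ r = ρ₃ r := fun r hr => by
      simp at hr
      rw [hr₅ r (by simp; omega), g r (by omega) (by omega)]
    refine ⟨(k 39 (by simp)).trans h39, by simp, fun a ha => ?_, ?_, ?_, ?_, ?_, ?_, fun p h1 h2 => ?_,
      fun p hp => ?_, fun p hp x => ?_⟩
    · rw [hm₅ a, Function.update_of_ne (by rintro rfl; simp at ha), hm₃ a ha]
      rintro (h1 | ⟨n, hn, l, rfl⟩)
      · simp [h1] at ha
      · simp at ha hn
        omega
    · simpa using (k 20 (by simp)).trans h20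
    · rw [allNums_succ]
      exact ⟨by simpa using kx.1, kx.2⟩
    · rw [Function.update_of_ne (by omega), k23, g23, length_codeArgs, hlen_i]; omega
    · simpa using (k 25 (by simp)).trans h25
    · rw [Function.update_of_ne (by omega), k23, g23, length_codeArgs, allNums_succ]
      simp; omega
    · rw [hm₅ _ (by simp [Touch])]
      by_cases hpi : p = i + 1
      · subst hpi; simp
      · rw [Function.update_of_ne (by simpa using hpi)]
        exact hrel p h1 (by omega)
    · by_cases hpi : p = i + 1
      · subst hpi; exact ktab
      · obtain ⟨t1, t2, t3, t4⟩ := htab p (by omega)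
        have hm : ∀ n l, n ∈ [11, 12, 13, 14] → m₅ (n :: p :: l) = m₃ (n :: p :: l) := by
          intro n l hn
          simp only [List.mem_cons, List.not_mem_nil, or_false] at hn
          rw [hm₅ _ (by simp [Touch]; omega), Function.update_of_ne (by simp; omega)]
        exact ⟨by rw [hm _ _ (by simp), t1],
          fun l hl hl' => by rw [hm _ _ (by simp), t2 l hl hl'],
          fun l hl hl' => by rw [hm _ _ (by simp), t3 l hl hl'],
          fun x => by rw [hm _ _ (by simp), t4 x]⟩
    · rw [hm₅ _ (by simp [Touch]; omega), Function.update_of_ne (by simp)]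
      exact hz p (by omega) x
  · rintro ρ' m' ⟨_, h1, h2, h3, h4, h5, _, h6, h7, _⟩
    refine h _ _ h1 h2 h3 ?_ ?_ h6 h7
    · rw [h4, hlen]; omega
    · rw [h5, length_codeArgs]

/-! ### The order of elimination -/

open Classical in
/-- The number of atoms that contain the variable `y`. -/
noncomputable def weight (args : ℕ → List Term) (d y : ℕ) : ℕ :=
  {p ∈ Finset.Icc 1 d | .var y ∈ args p}.card

/-- The quantified variables that are contained in at most `v` atoms, and in at least one, ordered
by the number of atoms. -/
noncomputable def elimOrder (args : ℕ → List Term) (d : ℕ) (qs : List ℕ) (v : ℕ) : List ℕ :=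
  (List.range v).flatMap fun v => qs.filter fun y => weight args d y = v + 1

theorem weight_le (args : ℕ → List Term) (d y : ℕ) : weight args d y ≤ d := by
  classical
  rw [weight]
  refine (Finset.card_filter_le _ _).trans ?_
  simp

theorem length_elimOrder_le (args : ℕ → List Term) (d : ℕ) (qs : List ℕ) (v : ℕ) :
    (elimOrder args d qs v).length ≤ v * qs.length := by
  induction v with
  | zero => simp [elimOrder]
  | succ v ih =>
    have := List.length_filter_le (fun y => decide (weight args d y = v + 1)) qs
    rw [elimOrder] at ih ⊢
    rw [List.range_succ, List.flatMap_append, List.length_append, Nat.succ_mul]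
    simpa using add_le_add ih this

/-- Compute the order of elimination. -/
def sortPL : PL :=
  asg 21 (.lit 0) ;; forE 38 (.reg 20) (forE 34 (.ld 0 (.reg 25))
    (asg 37 (.ld 0 (.add (.add (.reg 25) (.lit 1)) (.reg 34))) ;; asg 36 (.lit 0) ;;
      forE 35 (.reg 20)
        (asg 36 (.add (.reg 36) (.ld₂ 14 (.add (.reg 35) (.lit 1)) (.reg 37)))) ;;
      ifE (.eq (.reg 36) (.add (.reg 38) (.lit 1)))
        (st 15 (.reg 21) (.reg 37) ;; st 16 (.reg 21) (.reg 36) ;;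
          asg 21 (.add (.reg 21) (.lit 1)))
        .skip))

/-- The list `zs` and the weights of its members are stored in the arrays `15` and `16`. -/
def OrdTab (w : ℕ → ℕ) (zs : List ℕ) (ρ : ℕ → ℕ) (m : Mem) : Prop :=
  ρ 21 = zs.length ∧ ∀ j (h : j < zs.length), m [15, j] = zs[j] ∧ m [16, j] = w zs[j]

/-- The variables are sorted by counting: for every weight, the list of the quantified variables is
searched for those of this weight. This takes polynomial time in the size of the query. -/
theorem tri_sort {args : ℕ → List Term} {d : ℕ} {qs : List ℕ} (hB : 16 ≤ B)
    (hdS : d ≤ S) (hdB : d + 1 ≤ B) (hqS : qs.length ≤ S) (hz : d * qs.length + qs.length ≤ B)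
    (h20 : ρ 20 = d) (h25 : ρ 25 + 1 + qs.length ≤ B) (hseg : Seg m (ρ 25) (qs.length :: qs))
    [∀ (p : ℕ) (x : ℕ), Decidable (.var x ∈ args p)]
    (h14 : ∀ p ≤ d, ∀ x, m [14, p, x] = if .var x ∈ args p then 1 else 0)
    (h : ∀ ρ' m', RegEq [21, 34, 35, 36, 37, 38] ρ ρ' →
      (∀ a, a.head? ∉ [some 15, some 16] → m' a = m a) →
      OrdTab (weight args d) (elimOrder args d qs d) ρ' m' → Q ρ' m') :
    Tri B S τ sortPL ρ m Q := by
  set w := weight args d with hw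
  set L := [21, 34, 35, 36, 37, 38] with hL
  rw [seg_cons] at hseg
  refine .seq (.asg (by simp) ?_)
  simp only [Ex.eval]
  refine .forE (fun v ρ' m' => RegEq L ρ ρ' ∧ ρ' 38 = v ∧
    (∀ a, a.head? ∉ [some 15, some 16] → m' a = m a) ∧ OrdTab w (elimOrder args d qs v) ρ' m')
    d hdS (by omega) ?_ ?_ ?_ ?_
  · exact ⟨((RegEq.refl _ _).update (by simp [L])).update (by simp [L]), by simp, fun _ _ => rfl,
      by simp [OrdTab, elimOrder]⟩
  · rintro v ρ' m' _ ⟨h1, h2, _⟩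
    exact ⟨h2, (h1 20 (by simp [L])).trans h20, trivial⟩
  · rintro v hv ρ₁ m₁ ⟨hr₁, h38, hm₁, ho₁⟩
    refine .forE (fun e ρ' m' => RegEq L ρ ρ' ∧ ρ' 38 = v ∧ ρ' 34 = e ∧
      (∀ a, a.head? ∉ [some 15, some 16] → m' a = m a) ∧ OrdTab w (elimOrder args d qs v ++
        (qs.take e).filter fun y => w y = v + 1) ρ' m') qs.length hqS (by omega) ?_ ?_ ?_ ?_
    · refine ⟨hr₁.update (by simp [L]), by simpa using h38, by simp, hm₁, ?_⟩
      rw [List.take_zero, List.filter_nil, List.append_nil]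
      exact ⟨by simpa using ho₁.1, ho₁.2⟩
    · rintro e ρ' m' _ ⟨h1, h2, h3, h4, _⟩
      have e25 : ρ' 25 = ρ 25 := h1 25 (by simp [L])
      exact ⟨h3, by rw [Ex.eval, Ex.eval, e25, h4 _ (by simp), hseg.1], by simp⟩
    · rintro e he ρ₂ m₂ ⟨hr₂, g38, g34, hm₂, ho₂⟩
      have g25 : ρ₂ 25 = ρ 25 := hr₂ 25 (by simp [L])
      refine .seq (.asg (by simp; omega) (.seq (.asg (by simp) ?_)))
      have v37 : (Ex.ld 0 (.add (.add (.reg 25) (.lit 1)) (.reg 34))).eval ρ₂ m₂ = qs[e] := by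
        simp only [Ex.eval, g25, g34]
        rw [hm₂ _ (by simp), hseg.2 e he]
      rw [v37]
      simp only [Ex.eval]
      refine .seq' (R := fun ρ' m' => RegEq [35, 36, 37] ρ₂ ρ' ∧ m' = m₂ ∧ ρ' 37 = qs[e] ∧
        ρ' 36 = w qs[e]) ?_ ?_
      · refine .forE (fun i ρ' m' => RegEq [35, 36, 37] ρ₂ ρ' ∧ m' = m₂ ∧ ρ' 35 = i ∧
          ρ' 37 = qs[e] ∧ ρ' 36 = weight args i qs[e]) d hdS (by omega) ?_ ?_ ?_ ?_
        · exact ⟨(((RegEq.refl _ _).update (by simp)).update (by simp)).update (by simp), rfl,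
            by simp, by simp, by simp [weight]⟩
        · rintro i ρ' m' _ ⟨h1, _, h2, _⟩
          refine ⟨h2, ?_, trivial⟩
          rw [Ex.eval, h1 20 (by simp), hr₂ 20 (by simp [L]), h20]
        · rintro i hi ρ₃ m₃ ⟨h1, rfl, h35, h37, h36⟩
          have hle := weight_le args (i + 1) qs[e]
          have hval : (Ex.add (.reg 36) (.ld₂ 14 (.add (.reg 35) (.lit 1)) (.reg 37))).eval ρ₃ m₃ =
              weight args (i + 1) qs[e] := by
            simp only [Ex.eval, h35, h36, h37]
            rw [hm₂ _ (by simp), h14 _ (by omega)]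
            rw [weight, weight, ← Finset.insert_Icc_right_eq_Icc_add_one (by omega),
              Finset.filter_insert]
            split_ifs with h3
            · rw [Finset.card_insert_of_notMem (by simp)]
            · rfl
          refine .asg ⟨trivial, ⟨by omega, ⟨trivial, by simp; omega, by simp [h35]; omega⟩,
            trivial⟩, hval.trans_le (by omega)⟩ ?_
          rw [hval]
          exact ⟨by simpa using h35, (h1.update (by simp)).update (by simp), rfl, by simp,
            by simpa using h37, by simp⟩
        · rintro ρ' m' ⟨h1, h2, _, h3, h4⟩
          exact ⟨h1, h2, h3, h4⟩
      · rintro ρ₃ m₃ ⟨hr₃, rfl, h37, h36⟩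
        have hwle : w qs[e] ≤ d := weight_le _ _ _
        have k38 : ρ₃ 38 = v := (hr₃ 38 (by simp)).trans g38
        have k34 : ρ₃ 34 = e := (hr₃ 34 (by simp)).trans g34
        have k21 : ρ₃ 21 = ρ₂ 21 := hr₃ 21 (by simp)
        have hr₃' : RegEq L ρ ρ₃ := hr₂.trans (hr₃.mono (by simp [L]))
        have htake : qs.take (e + 1) = qs.take e ++ [qs[e]] := by
          rw [List.take_add_one, List.getElem?_eq_getElem he]; rfl
        refine .ifE (by simp [Ex.eq, h36, k38]; omega) (fun h1 => ?_) fun h1 => .skip ?_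
        · have hwe : w qs[e] = v + 1 := by
            by_contra h2
            simp [h36, k38, h2] at h1
          set zs := elimOrder args d qs v ++ (qs.take e).filter fun y => w y = v + 1 with hzs
          have hzl : zs.length + 1 ≤ B := by
            have h2 := length_elimOrder_le args d qs v
            have h3 := List.length_filter_le (fun y => decide (w y = v + 1)) (qs.take e)
            have h4 : v * qs.length ≤ d * qs.length := Nat.mul_le_mul_right _ (by omega)
            rw [List.length_take] at h3
            rw [hzs, List.length_append]
            omega
          have k21' : ρ₃ 21 = zs.length := k21.trans ho₂.1
          refine .seq (.st (by omega) (by simp) (by simp) (.seq (.st (by omega) (by simp) (by simp)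
            (.asg (by simp [k21']; omega) ?_))))
          simp only [Ex.eval, k21', h36, h37]
          refine ⟨by simpa using k34, (hr₃'.update (by simp [L])).update (by simp [L]),
            by simpa using k38, by simp, fun a ha => ?_, ?_⟩
          · rw [Function.update_of_ne (by rintro rfl; simp at ha),
              Function.update_of_ne (by rintro rfl; simp at ha), hm₂ a ha]
          · rw [htake, List.filter_append, ← List.append_assoc, ← hzs]
            have : [qs[e]].filter (fun y => decide (w y = v + 1)) = [qs[e]] := by simp [hwe]
            rw [this]
            refine ⟨by simp, fun j hj => ?_⟩
            by_cases hjz : j = zs.length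
            · subst hjz
              rw [List.getElem_append_right le_rfl]
              simp
            · have hj' : j < zs.length := by simp at hj; omega
              rw [List.getElem_append_left hj', Function.update_of_ne (by simp),
                Function.update_of_ne (by simpa using hjz),
                Function.update_of_ne (by simpa using hjz), Function.update_of_ne (by simp)]
              exact ho₂.2 j hj'
        · have hwe : ¬ w qs[e] = v + 1 := fun h2 => by simp [h36, k38, h2] at h1
          refine ⟨k34, hr₃'.update (by simp [L]), by simpa using k38, by simp, hm₂, ?_⟩
          have : [qs[e]].filter (fun y => decide (w y = v + 1)) = [] := by simp [hwe]
          rw [htake, List.filter_append, this, List.append_nil]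
          exact ⟨by simpa [k21] using ho₂.1, ho₂.2⟩
    · rintro ρ' m' ⟨h1, h2, _, h3, h4⟩
      refine ⟨h2, h1.update (by simp [L]), by simp, h3, ?_⟩
      rw [List.take_length] at h4
      have : elimOrder args d qs (v + 1) = elimOrder args d qs v ++
          qs.filter fun y => w y = v + 1 := by
        simp [elimOrder, List.range_succ, hw]
      rw [this]
      exact ⟨by simpa using h4.1, h4.2⟩
  · rintro ρ' m' ⟨h1, _, h2, h3⟩
    exact h _ _ h1 h2 h3

end DynCQ

namespace DynCQ

theorem flatMap_range_getElem? {α β : Type*} (l : List α) (f : α → List β) :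
    ((List.range l.length).flatMap fun i => (l[i]?).elim [] f) = l.flatMap f := by
  induction l using List.reverseRecOn with
  | nil => rfl
  | append_singleton l a ih =>
    rw [List.length_append, List.length_singleton, List.range_succ, List.flatMap_append,
      List.flatMap_append, ← ih]
    congr 1
    · refine List.flatMap_congr fun i hi => ?_
      rw [List.getElem?_append_left (by simpa using hi)]
    · simp

namespace CQ

variable {σ : Schema} {k : ℕ} (q : CQ σ k)

/-- The arguments of the head (number `0`) and of the atoms. -/
def argTable : ℕ → List Term
  | 0 => List.ofFn q.head
  | p + 1 => (q.atoms[p]?).elim [] fun ψ => List.ofFn ψ.args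

/-- The relation symbols of the atoms. -/
def relTable : ℕ → ℕ
  | 0 => 0
  | p + 1 => (q.atoms[p]?).elim 0 fun ψ => (ψ.rel : ℕ)

/-- The tables for a query. -/
noncomputable def layout : Layout where
  d := q.atoms.length
  ℓ := (elimOrder q.argTable q.atoms.length q.quant q.atoms.length).length
  args := q.argTable
  rel := q.relTable
  X := allNums q.argTable (q.atoms.length + 1)
  z j := (elimOrder q.argTable q.atoms.length q.quant q.atoms.length).getD j 0

theorem argTable_succ {p : ℕ} (hp : p < q.atoms.length) :
    q.argTable (p + 1) = List.ofFn q.atoms[p].args := by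
  simp [argTable, hp]

theorem relTable_succ {p : ℕ} (hp : p < q.atoms.length) :
    q.relTable (p + 1) = q.atoms[p].rel := by
  simp [relTable, hp]

theorem code_eq : q.code = codeQuery q.argTable q.relTable q.atoms.length q.quant := by
  have : (List.range q.atoms.length).flatMap (codeAtom q.argTable q.relTable) =
      q.atoms.flatMap Atom.code := by
    rw [← flatMap_range_getElem? q.atoms]
    refine List.flatMap_congr fun i hi => ?_
    have hi : i < q.atoms.length := by simpa using hi
    rw [codeAtom, argTable_succ q hi, relTable_succ q hi, List.getElem?_eq_getElem hi]
    simp [codeArgs, Atom.code]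
  rw [codeQuery, this]
  simp [code, codeArgs, argTable]

theorem length_allNums : (allNums q.argTable (q.atoms.length + 1)).length =
    k + (q.atoms.map fun ψ => σ.ar ψ.rel).sum := by
  rw [allNums, List.length_flatMap, List.range_succ_eq_map, List.map_cons, List.sum_cons,
    List.map_map]
  congr 1
  · simp [argTable]
  · congr 1
    refine List.ext_getElem (by simp) fun i h1 h2 => ?_
    have hi : i < q.atoms.length := by simpa using h1
    simp [argTable_succ q hi]

theorem sum_map_one_add : (q.atoms.map fun ψ => 1 + σ.ar ψ.rel).sum =
    q.atoms.length + (q.atoms.map fun ψ => σ.ar ψ.rel).sum := by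
  induction q.atoms with
  | nil => rfl
  | cons a l ih => simp [ih]; omega

theorem length_code : q.code.length = 3 + 2 * k + q.quant.length + 2 * q.atoms.length +
    2 * (q.atoms.map fun ψ => σ.ar ψ.rel).sum := by
  have h : ∀ l : List (Atom σ), (l.flatMap Atom.code).length =
      2 * l.length + 2 * (l.map fun ψ => σ.ar ψ.rel).sum := by
    intro l
    induction l with
    | nil => rfl
    | cons a l ih => simp [-List.length_flatMap, ih, Atom.code, length_flatMap_code]; omega
  simp [-List.length_flatMap, code, h, length_flatMap_code]
  omega

theorem length_argTable_le (p : ℕ) : (q.argTable p).length ≤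
    k + (q.atoms.map fun ψ => σ.ar ψ.rel).sum := by
  rw [← length_allNums]
  by_cases hp : p < q.atoms.length + 1
  · rw [allNums, List.length_flatMap]
    have := List.single_le_sum (l := (List.range (q.atoms.length + 1)).map
      fun p => ((q.argTable p).map Term.num).length) (fun _ _ => Nat.zero_le _) (q.argTable p).length
      (List.mem_map.2 ⟨p, by simpa using hp, by simp⟩)
    exact this
  · obtain ⟨p, rfl⟩ : ∃ p', p = p' + 1 := ⟨p - 1, by omega⟩
    have : q.atoms[p]? = none := List.getElem?_eq_none (by omega)
    simp [argTable, this]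

theorem layout_le : 7 + q.layout.X.length + 2 * q.quant.length + q.layout.d ≤ q.size ∧
    q.code.length ≤ 2 * q.size ∧ q.layout.ℓ ≤ q.layout.d * q.quant.length := by
  refine ⟨?_, ?_, length_elimOrder_le _ _ _ _⟩
  · simp only [layout, length_allNums, size, sum_map_one_add]
    omega
  · rw [length_code, size, sum_map_one_add]
    omega

theorem mem_argTable {p x : ℕ} (hp1 : 1 ≤ p) (hp : p ≤ q.atoms.length) :
    .var x ∈ q.argTable p ↔ x ∈ (q.atoms[p - 1]'(by omega)).vars := by
  obtain ⟨p, rfl⟩ : ∃ p', p = p' + 1 := ⟨p - 1, by omega⟩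
  rw [argTable_succ q (by omega), List.mem_ofFn]
  rfl

theorem mem_argTable_zero {x : ℕ} : .var x ∈ q.argTable 0 ↔ ∃ i, q.head i = .var x := by
  rw [argTable, List.mem_ofFn]

open Classical in
theorem mem_filter_iff {p x : ℕ} :
    p ∈ Finset.filter (fun p => .var x ∈ q.argTable p) (Finset.Icc 1 q.atoms.length) ↔
      ∃ h : 1 ≤ p ∧ p ≤ q.atoms.length, q.atoms[p - 1]'(by omega) ∈ q.atomsOf x := by
  rw [Finset.mem_filter, Finset.mem_Icc]
  constructor
  · rintro ⟨h, hx⟩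
    exact ⟨h, List.getElem_mem _, (q.mem_argTable h.1 h.2).1 hx⟩
  · rintro ⟨h, _, hx⟩
    exact ⟨h, (q.mem_argTable h.1 h.2).2 hx⟩

theorem mem_elimOrder {y : ℕ} :
    y ∈ elimOrder q.argTable q.atoms.length q.quant q.atoms.length ↔
      y ∈ q.quant ∧ weight q.argTable q.atoms.length y ≠ 0 := by
  have := weight_le q.argTable q.atoms.length y
  simp only [elimOrder, List.mem_flatMap, List.mem_range, List.mem_filter, decide_eq_true_eq]
  constructor
  · rintro ⟨v, _, h1, h2⟩
    exact ⟨h1, by omega⟩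
  · rintro ⟨h1, h2⟩
    exact ⟨weight q.argTable q.atoms.length y - 1, by omega, h1, by omega⟩

theorem elimOrder_pairwise (v : ℕ) :
    (elimOrder q.argTable q.atoms.length q.quant v).Pairwise fun x y =>
      x ≠ y ∧ weight q.argTable q.atoms.length x ≤ weight q.argTable q.atoms.length y := by
  induction v with
  | zero => simp [elimOrder]
  | succ v ih =>
    rw [elimOrder, List.range_succ, List.flatMap_append, List.pairwise_append]
    refine ⟨ih, ?_, ?_⟩
    · rw [List.flatMap_singleton]
      refine List.Pairwise.imp_of_mem ?_ (q.quant_nodup.filter _)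
      intro x y hx hy hxy
      simp only [List.mem_filter, decide_eq_true_eq] at hx hy
      exact ⟨hxy, by omega⟩
    · intro x hx y hy
      simp only [List.mem_flatMap, List.mem_range, List.mem_filter, decide_eq_true_eq,
        List.mem_singleton] at hx hy
      obtain ⟨u, hu, _, hx⟩ := hx
      obtain ⟨_, rfl, _, hy⟩ := hy
      exact ⟨by rintro rfl; omega, by omega⟩

theorem layout_z {j : ℕ} (hj : j < q.layout.ℓ) :
    q.layout.z j = (elimOrder q.argTable q.atoms.length q.quant q.atoms.length)[j]'hj := by
  exact List.getD_eq_getElem _ _ _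

theorem card_layout_As (j : ℕ) :
    (q.layout.As j).card = weight q.argTable q.atoms.length (q.layout.z j) := by
  rfl

theorem mem_layout_As {j p : ℕ} :
    p ∈ q.layout.As j ↔ ∃ h : 1 ≤ p ∧ p ≤ q.atoms.length,
      q.atoms[p - 1]'(by omega) ∈ q.atomsOf (q.layout.z j) := q.mem_filter_iff

/-- Since the variables are ordered by the number of atoms that contain them, hierarchy means that
`As i` is contained in `As j` or disjoint from it for `i < j`. Moreover, two atoms in `As j` have
the same variables from `z j` on: a quantified variable with at least as many atoms as `z j` that
occurs in one of them is contained in all, and the second condition on `t`-hierarchical queries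
says the same of the free variables. -/
theorem layout_wf (hq : q.THierarchical) : q.layout.Wf := by
  classical
  have hz : ∀ j < q.layout.ℓ, q.layout.z j ∈ q.quant ∧
      weight q.argTable q.atoms.length (q.layout.z j) ≠ 0 := fun j hj => by
    rw [layout_z q hj]
    exact q.mem_elimOrder.1 (List.getElem_mem _)
  have hpair : ∀ j < q.layout.ℓ, ∀ i < j, q.layout.z i ≠ q.layout.z j ∧
      (q.layout.As i).card ≤ (q.layout.As j).card := fun j hj i hi => by
    rw [card_layout_As, card_layout_As, layout_z q hj, layout_z q (hi.trans hj)]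
    exact List.pairwise_iff_getElem.1 (q.elimOrder_pairwise _) i j (hi.trans hj) hj hi
  have hquant : ∀ {x}, x ∈ q.quant → x ∈ q.vars \ q.free := fun hx =>
    ⟨.inl hx, fun h => h.2 hx⟩
  have hsub : ∀ i j, q.atomsOf (q.layout.z i) ⊆ q.atomsOf (q.layout.z j) →
      q.layout.As i ⊆ q.layout.As j := fun i j h p hp => by
    rw [mem_layout_As] at hp ⊢
    obtain ⟨h1, h2⟩ := hp
    exact ⟨h1, h h2⟩
  have hlam : ∀ j < q.layout.ℓ, ∀ i < j, q.layout.As i ⊆ q.layout.As j ∨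
      Disjoint (q.layout.As i) (q.layout.As j) := by
    intro j hj i hi
    rcases hq.1 _ (hquant (hz i (hi.trans hj)).1) _ (hquant (hz j hj).1) with h | h | h
    · exact .inl (hsub _ _ h)
    · exact .inl (Finset.eq_of_subset_of_card_le (hsub _ _ h) (hpair j hj i hi).2).ge
    · refine .inr (Finset.disjoint_left.2 fun p hp hp' => ?_)
      rw [mem_layout_As] at hp hp'
      obtain ⟨_, h1⟩ := hp
      obtain ⟨_, h2⟩ := hp'
      exact Set.eq_empty_iff_forall_notMem.1 h _ ⟨h1, h2⟩
  have hmem : ∀ {p x}, 1 ≤ p → p ≤ q.atoms.length → .var x ∈ q.argTable p →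
      x ∈ q.vars ∧ (x ∉ q.quant → ∃ i, q.head i = .var x) := by
    intro p x h1 h2 h3
    have h4 : ∃ ψ ∈ q.atoms, x ∈ ψ.vars := ⟨_, List.getElem_mem _, (q.mem_argTable h1 h2).1 h3⟩
    exact ⟨.inr h4, fun h5 => (q.head_free x).2 ⟨h4, h5⟩⟩
  have hord : ∀ {p x}, 1 ≤ p → p ≤ q.atoms.length → .var x ∈ q.argTable p → x ∈ q.quant →
      ∃ i < q.layout.ℓ, x = q.layout.z i := by
    intro p x h1 h2 h3 h4
    have : x ∈ elimOrder q.argTable q.atoms.length q.quant q.atoms.length := by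
      refine q.mem_elimOrder.2 ⟨h4, ?_⟩
      rw [weight, Finset.card_ne_zero]
      exact ⟨p, by simp [h1, h2, h3]⟩
    obtain ⟨i, hi, h5⟩ := List.getElem_of_mem this
    exact ⟨i, hi, by rw [layout_z q hi, h5]⟩
  refine ⟨fun p hp x hx => ?_, fun j hj => ?_, hlam, fun j hj i hi => (hpair j hj i hi).1.symm, ?_,
    fun j hj h => ?_, fun p h1 h2 x hx hxz => ?_⟩
  · simp only [layout, allNums, List.mem_flatMap, List.mem_range, List.mem_map]
    exact ⟨p, Nat.lt_succ_of_le hp, _, hx, rfl⟩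
  · rw [← Finset.card_ne_zero, card_layout_As]
    exact (hz j hj).2
  · -- the remaining variables of an atom with `z j` are in all atoms with `z j`
    have key : ∀ j < q.layout.ℓ, ∀ p ∈ q.layout.As j, ∀ p' ∈ q.layout.As j,
        rem q.layout.z q.layout.vs j p ⊆ rem q.layout.z q.layout.vs j p' := by
      rintro j hj p hp p' hp' x ⟨hx, hxz⟩
      refine ⟨?_, hxz⟩
      obtain ⟨⟨h1, h2⟩, h3⟩ := q.mem_layout_As.1 hp
      obtain ⟨⟨h1', h2'⟩, h3'⟩ := q.mem_layout_As.1 hp'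
      have hxp : q.atoms[p - 1]'(by omega) ∈ q.atomsOf x :=
        ⟨List.getElem_mem _, (q.mem_argTable h1 h2).1 hx⟩
      by_cases hxq : x ∈ q.quant
      · obtain ⟨i, hi, rfl⟩ := hord h1 h2 hx hxq
        have hji : j ≤ i := by
          by_contra h
          exact hxz i (by omega) rfl
        rcases hji.eq_or_lt with rfl | hji
        · exact (Layout.mem_As.1 hp').2
        · rcases hlam i hi j hji with h | h
          · exact (Layout.mem_As.1 (h hp')).2
          · exact absurd (Layout.mem_As.2 ⟨⟨h1, h2⟩, hx⟩) (Finset.disjoint_left.1 h hp)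
      · have hxf : x ∈ q.free := ⟨(hmem h1 h2 hx).1, hxq⟩
        rcases hq.2 x hxf _ (hquant (hz j hj).1) with h | h
        · exact absurd ⟨hxp, h3⟩ (Set.eq_empty_iff_forall_notMem.1 h _)
        · exact (q.mem_argTable h1' h2').2 (h h3').2
    exact fun j hj p hp p' hp' => (key j hj p hp p' hp').antisymm (key j hj p' hp' p hp)
  · obtain ⟨i, hi⟩ := q.mem_argTable_zero.1 h
    exact ((q.head_free _).1 ⟨i, hi⟩).2 (hz j hj).1
  · by_cases hxq : x ∈ q.quant
    · obtain ⟨i, hi, h⟩ := hord h1 h2 hx hxq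
      exact absurd h (hxz i hi)
    · exact q.mem_argTable_zero.2 ((hmem h1 h2 hx).2 hxq)

end CQ

end DynCQ

namespace DynCQ

variable {B S τ : ℕ} {ρ : ℕ → ℕ} {m : Mem} {Q : (ℕ → ℕ) → Mem → Prop}

/-! ### Preprocessing -/

/-- Compute the tables for the query. -/
def buildPL : PL := readPL ;; sortPL

theorem CQ.layout_bds {σ : Schema} {k : ℕ} (q : CQ σ k) {H : Finset ℕ}
    (hB : q.size * q.size ≤ B) (hS : q.size * q.size ≤ S) (hH : H.card ≤ B) :
    q.layout.Bds B S H := by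
  obtain ⟨h1, -, h2⟩ := q.layout_le
  have h3 : q.layout.d * q.quant.length ≤ q.size * q.size := Nat.mul_le_mul (by omega) (by omega)
  have h4 : 8 * q.size ≤ q.size * q.size := by
    have : 1 ≤ q.layout.d := List.length_pos_iff.2 q.atoms_ne_nil
    exact Nat.mul_le_mul_right _ (by omega)
  have : 1 ≤ q.layout.d := List.length_pos_iff.2 q.atoms_ne_nil
  exact ⟨by omega, by omega, by omega, by omega, by omega, by omega, by omega, hH⟩

theorem CQ.length_args_le {σ : Schema} {k : ℕ} (q : CQ σ k) (p : ℕ) :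
    (q.layout.args p).length ≤ q.layout.X.length :=
  (q.length_argTable_le p).trans q.length_allNums.ge

/-- The preprocessing of the query computes the tables, and it leaves the array of the counters
empty. -/
theorem tri_build {σ : Schema} {k : ℕ} (q : CQ σ k) (hB : q.size * q.size ≤ B)
    (hS : q.size * q.size ≤ S) (hseg : Seg m 0 q.code) (h0 : ∀ a, a.head? ≠ some 0 → m a = 0) :
    Tri B S τ buildPL ρ m fun ρ' m' => q.layout.Static ρ' m' ∧ ρ' 23 = q.code.length ∧
      ∀ a, a.head? = some 0 ∨ a.head? = some 6 → m' a = m a := by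
  classical
  obtain ⟨h1, h2, -⟩ := q.layout_le
  have hb := q.layout_bds (H := ∅) hB hS (Nat.zero_le _)
  have hd1 : 1 ≤ q.layout.d := List.length_pos_iff.2 q.atoms_ne_nil
  have hd : q.layout.d = q.atoms.length := rfl
  have hBl := hb.B_le
  have h4 : 8 * q.size ≤ q.size * q.size := Nat.mul_le_mul_right _ (by omega)
  have h3 : (q.layout.d + 1) * q.quant.length ≤ q.size * q.size :=
    Nat.mul_le_mul (by omega) (by omega)
  rw [Nat.succ_mul] at h3
  have hargs := q.length_args_le
  rw [q.code_eq] at hseg h2 ⊢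
  refine .seq (tri_read (args := q.argTable) (rel := q.relTable) (d := q.atoms.length)
    (qs := q.quant) hBl (by omega) (fun p _ => (hargs p).trans hb.X_leS) hb.d_leS
    (by omega) hseg (fun p x => h0 _ (by simp)) ?_)
  intro ρ₁ m₁ hm₁ h20 hX h23 h25 hrel htab
  have hm0 : ∀ i, m₁ [0, i] = m [0, i] := fun i => hm₁ _ (by simp)
  have hseg' := hseg.frame hm0
  rw [codeQuery, seg_append, seg_append] at hseg'
  have hlen : (codeArgs (q.argTable 0)).length + 1 + q.quant.length ≤
      (codeQuery q.argTable q.relTable q.atoms.length q.quant).length := by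
    simp [codeQuery]; omega
  refine tri_sort (args := q.argTable) (d := q.atoms.length) (qs := q.quant) hBl hb.d_leS hb.d_le
    (by have := hb.X_leS; omega) (by rw [← hd]; omega) h20 (by omega)
    (by simpa [h25] using hseg'.1.2) (fun p hp x => ?_) fun ρ₂ m₂ hr₂ hm₂ hord => ?_
  · rw [(htab p hp).2.2.2, List.take_length]
  · refine ⟨⟨?_, ?_, ?_, fun e he => ?_, fun p hp1 hp => ?_, fun p hp => ?_, fun p hp l hl => ?_,
      fun p hp l hl => ?_, fun p hp x => ?_, fun j hj => ?_, fun j hj => ?_⟩, ?_, fun a ha => ?_⟩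
    · rw [hr₂ 20 (by simp), h20, hd]
    · exact hord.1
    · rw [hr₂ 22 (by simp)]; exact hX.1
    · rw [hm₂ _ (by simp)]; exact hX.2 e he
    · rw [hm₂ _ (by simp)]; exact hrel p hp1 hp
    · rw [hm₂ _ (by simp)]; exact (htab p hp).1
    · rw [hm₂ _ (by simp)]; exact (htab p hp).2.1 l hl hl
    · rw [hm₂ _ (by simp)]; exact (htab p hp).2.2.1 l hl hl
    · rw [hm₂ _ (by simp), (htab p hp).2.2.2, List.take_length]; rfl
    · rw [q.layout_z hj]; exact (hord.2 j hj).1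
    · rw [q.card_layout_As, q.layout_z hj]; exact (hord.2 j hj).2
    · rw [hr₂ 23 (by simp), h23]
    · rw [hm₂ a (by rcases ha with h | h <;> simp [h]),
        hm₁ a (by rcases ha with h | h <;> simp [h])]

theorem not_val {As : ℕ → Finset ℕ} {z : ℕ → ℕ} {T : ℕ → (ℕ → ℕ) → Prop} (hT : ∀ p β, ¬ T p β)
    (j p : ℕ) (β : ℕ → ℕ) : ¬ Val As z T j p β := by
  induction j generalizing p β with
  | zero => exact hT p β
  | succ j ih =>
    rintro (⟨hp, _, a, _, h⟩ | ⟨_, h⟩)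
    · exact ih _ _ (h p hp)
    · exact ih _ _ h

/-- The initial memory represents the empty database. -/
theorem Layout.Wf.cells_zero {Y : Layout} (hY : Y.Wf) (h0 : ∀ a, a.head? = some 6 → m a = 0) :
    Y.Cells m (Y.full (Y.tv fun _ _ => False)) := by
  intro tag id β hv _
  rw [h0 _ rfl]
  have hT : ∀ p β, ¬ Y.tv (fun _ _ => False) p β := fun p β h => h.2
  rcases hv with ⟨rfl, _⟩ | ⟨rfl | rfl, hid⟩
  · simp [full, vals, hT]
  · simp [full, vals, cnt, not_val hT]
  · obtain ⟨p, hp⟩ := hY.nonempty id hid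
    have : Wit Y.As Y.z (Y.tv fun _ _ => False) id β = ∅ :=
      Set.eq_empty_of_forall_notMem fun a ha => not_val hT _ _ _ (ha.2 p hp)
    simp [full, vals, wit, this]

/-- The code of a fact. -/
def codeFact (f : ℕ × List ℕ) : List ℕ := f.1 :: f.2

/-- Insert the facts of the initial database one by one. The register `23` holds the position of
the code of the schema. -/
def factsPL : PL :=
  asg 19 (.add (.reg 23) (.lit 1)) ;; asg 23 (.add (.reg 19) (.ld 0 (.reg 23))) ;;
    asg 18 (.ld 0 (.reg 23)) ;; asg 23 (.add (.reg 23) (.lit 1)) ;; asg 26 (.lit 1) ;;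
    forE 17 (.reg 18)
      (asg 27 (.ld 0 (.reg 23)) ;; asg 25 (.add (.reg 23) (.lit 1)) ;; .call Layout.corePL.prog ;;
        asg 23 (.add (.reg 25) (.ld 0 (.add (.reg 19) (.reg 27)))))

/-- After the insertion of all facts into the empty database the counters are correct. Each
insertion takes time that depends only on the query. -/
theorem tri_facts {Y : Layout} {S' : ℕ} {H : Finset ℕ} (hY : Y.Wf) (hb : Y.Bds B S' H)
    (hargs : ∀ p ≤ Y.d, (Y.args p).length ≤ S') (hτ : Layout.corePL.cost S' 0 ≤ τ)
    {ars : List ℕ} {fs : List (ℕ × List ℕ)} (hfS : fs.length ≤ S)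
    (hst : Y.Static ρ m) (hcells : Y.Cells m (Y.full (Y.tv fun _ _ => False)))
    (hseg : Seg m (ρ 23) (ars.length :: ars ++ (fs.length :: fs.flatMap codeFact)))
    (hBl : ρ 23 + (ars.length :: ars ++ (fs.length :: fs.flatMap codeFact)).length ≤ B)
    (har : ∀ f ∈ fs, ars[f.1]? = some f.2.length) (h0 : ∀ f ∈ fs, ∀ u ∈ f.2, u ≠ 0)
    (hH : ∀ f ∈ fs, ∀ u ∈ f.2, u ∈ H)
    (hlen : ∀ f ∈ fs, ∀ p, 1 ≤ p → p ≤ Y.d → Y.rel p = f.1 → f.2.length = (Y.args p).length) :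
    Tri B S τ factsPL ρ m fun ρ' m' => Y.Static ρ' m' ∧
      Y.Cells m' (Y.full (Y.tv fun r t => (r, t) ∈ fs)) := by
  classical
  have hB := hb.B_le
  have hfl : fs.length ≤ (fs.flatMap codeFact).length := by
    clear har h0 hH hlen hfS hseg hBl
    induction fs with
    | nil => simp
    | cons f fs ih => simp [-List.length_flatMap, codeFact]; omega
  simp only [List.length_append, List.length_cons] at hBl
  rw [seg_append, seg_cons, seg_cons] at hseg
  obtain ⟨⟨hs1, hs2⟩, hs3, hs4⟩ := hseg
  simp only [List.length_cons] at hs3 hs4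
  set p₀ := ρ 23 with hp₀
  set p₁ := p₀ + (ars.length + 1) + 1 with hp₁
  have e1 : ∀ v, (Ex.add (.reg 19) (.ld 0 (.reg 23))).eval
      (Function.update ρ 19 v) m = v + ars.length := by
    intro v; simp [← hp₀, hs1]
  refine .seq (.asg (by simp; omega) (.seq (.asg ⟨trivial, by simp, ?_⟩ ?_)))
  · refine (e1 _).trans_le ?_
    simp; omega
  rw [e1]
  simp only [Ex.eval, ← hp₀]
  refine .seq (.asg (by simp) ?_)
  have e2 : (Ex.ld 0 (.reg 23)).eval (Function.update (Function.update ρ 19 (p₀ + 1)) 23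
      (p₀ + 1 + ars.length)) m = fs.length := by
    rw [← hs3]; simp; congr 3; omega
  rw [e2]
  refine .seq (.asg (by simp; omega) (.seq (.asg (by simp; omega) ?_)))
  simp only [Ex.eval]
  set ρ₁ := Function.update (Function.update (Function.update (Function.update (Function.update ρ 19
    (p₀ + 1)) 23 (p₀ + 1 + ars.length)) 18 fs.length) 23 (Function.update (Function.update
    (Function.update ρ 19 (p₀ + 1)) 23 (p₀ + 1 + ars.length)) 18 fs.length 23 + 1)) 26 1 with hρ₁
  have f23 : ρ₁ 23 = p₁ := by simp [hρ₁, hp₁]; omega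
  have f19 : ρ₁ 19 = p₀ + 1 := by simp [hρ₁]
  have f18 : ρ₁ 18 = fs.length := by simp [hρ₁]
  have f26 : ρ₁ 26 = 1 := by simp [hρ₁]
  have fr : ∀ r, 20 ≤ r → r ≤ 22 → ρ₁ r = ρ r := fun r h1 h2 => by
    have : r ≠ 26 ∧ r ≠ 23 ∧ r ≠ 18 ∧ r ≠ 19 := by omega
    simp [hρ₁, this]
  clear_value ρ₁
  refine .forE (fun i ρ' m' => ρ' 17 = i ∧ Y.Static ρ' m' ∧ Layout.MemEq m m' ∧ ρ' 19 = p₀ + 1 ∧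
    ρ' 18 = fs.length ∧ ρ' 26 = 1 ∧ ρ' 23 = p₁ + ((fs.take i).flatMap codeFact).length ∧
    Y.Cells m' (Y.full (Y.tv fun r t => (r, t) ∈ fs.take i))) fs.length hfS (by omega) ?_ ?_ ?_ ?_
  · refine ⟨by simp, hst.memEq (fun r h1 h2 => ?_) (.refl _), .refl _, by simpa using f19,
      by simpa using f18, by simpa using f26, by simpa using f23, by simpa using hcells⟩
    rw [Function.update_of_ne (by omega), fr r h1 h2]
  · rintro i ρ' m' _ ⟨h1, _, _, _, h2, _⟩
    exact ⟨h1, h2, trivial⟩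
  · rintro i hi ρ₂ m₂ ⟨h17, hst₂, hm₂, h19, h18, h26, h23, hc₂⟩
    have hmem : fs[i] ∈ fs := List.getElem_mem hi
    have hsplit : fs = fs.take i ++ fs[i] :: fs.drop (i + 1) := by
      rw [← List.drop_eq_getElem_cons, List.take_append_drop]
    have htake : fs.take (i + 1) = fs.take i ++ [fs[i]] := by
      rw [List.take_add_one, List.getElem?_eq_getElem hi]; rfl
    have hlt : (fs.flatMap codeFact).length = ((fs.take i).flatMap codeFact).length +
        (1 + (fs[i]).2.length + ((fs.drop (i + 1)).flatMap codeFact).length) := by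
      have := congrArg (fun l => (l.flatMap codeFact).length) hsplit
      simp only [List.flatMap_append, List.flatMap_cons, List.length_append, codeFact,
        List.length_cons] at this
      rw [this]
      omega
    have hseg : Seg m₂ (p₁ + ((fs.take i).flatMap codeFact).length) (codeFact fs[i]) := by
      refine Seg.frame (m := m) ?_ fun j => hm₂ _ (by simp) (by simp)
      rw [hsplit, List.flatMap_append, seg_append, List.flatMap_cons, seg_append] at hs4
      exact hs4.2.1
    rw [codeFact, seg_cons] at hseg
    have hars := har _ hmem
    obtain ⟨hR, hars⟩ := List.getElem?_eq_some_iff.1 hars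
    set pos := p₁ + ((fs.take i).flatMap codeFact).length with hpos
    refine .seq (.asg (by simp) (.seq (.asg (by simp; omega) ?_)))
    simp only [Ex.eval, h23, hseg.1]
    rw [Function.update_of_ne (show (23 : ℕ) ≠ 27 by omega), h23]
    set ρ₃ := Function.update (Function.update ρ₂ 27 (fs[i]).1) 25 (pos + 1) with hρ₃
    have g25 : ρ₃ 25 = pos + 1 := by simp [hρ₃]
    have g27 : ρ₃ 27 = (fs[i]).1 := by simp [hρ₃]
    have g : ∀ r, r ≠ 25 → r ≠ 27 → ρ₃ r = ρ₂ r := fun r h1 h2 => by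
      rw [hρ₃, Function.update_of_ne h1, Function.update_of_ne h2]
    clear_value ρ₃
    have hst₃ : Y.Static ρ₃ m₂ :=
      hst₂.memEq (fun r h1 h2 => g r (by omega) (by omega)) (.refl _)
    refine .seq (.call (P := Layout.corePL) (S' := S') (τ' := 0) (Layout.tri_core hY hb
      (Dn := fun r t => (r, t) ∈ fs.take i) (R := (fs[i]).1) (t := (fs[i]).2)
      (fun r t h => hH _ (List.mem_of_mem_take h)) (hH _ hmem) (h0 _ hmem) (hlen _ hmem)
      (ins := 1) (.inr rfl) hst₃ ((g 26 (by omega) (by omega)).trans h26) g27 hargs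
      (by rw [g25]; exact hseg.2) (by rw [g25]; omega) hc₂ ?_) hτ)
    intro ρ₄ m₄ hr₄ hm₄ hc₄
    have k25 : ρ₄ 25 = pos + 1 := (hr₄ 25 (by simp [Layout.coreRegs])).trans g25
    have k27 : ρ₄ 27 = (fs[i]).1 := (hr₄ 27 (by simp [Layout.coreRegs])).trans g27
    have k : ∀ r, r ∉ Layout.coreRegs → r ≠ 25 → r ≠ 27 → ρ₄ r = ρ₂ r := fun r h1 h2 h3 =>
      (hr₄ r h1).trans (g r h2 h3)
    have k19 : ρ₄ 19 = p₀ + 1 := (k 19 (by simp [Layout.coreRegs]) (by omega) (by omega)).trans h19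
    have hm₄' : Layout.MemEq m m₄ := hm₂.trans hm₄
    have e3 : (Ex.add (.reg 25) (.ld 0 (.add (.reg 19) (.reg 27)))).eval ρ₄ m₄ =
        pos + 1 + (fs[i]).2.length := by
      simp only [Ex.eval, k25, k19, k27]
      rw [hm₄' _ (by simp) (by simp), hs2 _ hR, hars]
    refine .asg ⟨trivial, ⟨Nat.zero_le _, trivial, trivial, by simp [k19, k27]; omega⟩,
      e3.trans_le (by omega)⟩ ?_
    rw [e3]
    have kk : ∀ r, r ∉ Layout.coreRegs → r ≠ 25 → r ≠ 27 → r ≠ 23 → r ≠ 17 →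
        Function.update (Function.update ρ₄ 23 (pos + 1 + (fs[i]).2.length)) 17 (i + 1) r = ρ₂ r :=
      fun r h1 h2 h3 h4 h5 => by
        rw [Function.update_of_ne h5, Function.update_of_ne h4, k r h1 h2 h3]
    refine ⟨?_, by simp, ?_, hm₄', ?_, ?_, ?_, ?_, ?_⟩
    · rw [Function.update_of_ne (by omega), k 17 (by simp [Layout.coreRegs]) (by omega) (by omega)]
      exact h17
    · exact hst₂.memEq (fun r h1 h2 => kk r (by simp [Layout.coreRegs]; omega) (by omega) (by omega)
        (by omega) (by omega)) hm₄
    · rw [kk 19 (by simp [Layout.coreRegs]) (by omega) (by omega) (by omega) (by omega), h19]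
    · rw [kk 18 (by simp [Layout.coreRegs]) (by omega) (by omega) (by omega) (by omega), h18]
    · rw [kk 26 (by simp [Layout.coreRegs]) (by omega) (by omega) (by omega) (by omega), h26]
    · rw [Function.update_of_ne (by omega), Function.update_self, htake, List.flatMap_append,
        List.length_append]
      simp [-List.length_flatMap, codeFact]
      omega
    · convert hc₄ using 3
      funext r t
      rw [htake, List.mem_append, List.mem_singleton, Prod.ext_iff]
      simp only [Layout.upd, and_true]
      refine propext ?_
      tauto
  · rintro ρ' m' ⟨_, h1, _, _, _, _, _, h2⟩
    rw [List.take_length] at h2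
    exact ⟨h1, h2⟩

end DynCQ

namespace DynCQ

variable {σ : Schema} {k : ℕ}

/-! ### Databases and facts -/

/-- The tuple of a fact as a list of numbers. -/
def Fact.nums (f : Fact σ) : List ℕ := List.ofFn fun i => (f.2 i : ℕ)

/-- The facts of a database in terms of numbers. -/
def Database.facts (D : Database σ) (r : ℕ) (t : List ℕ) : Prop :=
  ∃ f : Fact σ, f.2 ∈ D f.1 ∧ (f.1 : ℕ) = r ∧ f.nums = t

theorem Fact.eq_of_nums {f g : Fact σ} (h : (f.1 : ℕ) = g.1) (h' : f.nums = g.nums) : f = g := by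
  obtain ⟨R, t⟩ := f
  obtain ⟨R', t'⟩ := g
  obtain rfl : R = R' := Fin.ext h
  have : (fun i => (t i : ℕ)) = fun i => (t' i : ℕ) := List.ofFn_injective h'
  congr 1
  funext i
  exact PNat.eq (congrFun this i)

theorem Database.facts_nums {D : Database σ} {f : Fact σ} :
    D.facts f.1 f.nums ↔ f.2 ∈ D f.1 :=
  ⟨fun ⟨g, h1, h2, h3⟩ => by rw [← Fact.eq_of_nums h2 h3]; exact h1, fun h => ⟨f, h, rfl, rfl⟩⟩


theorem Database.facts_apply (D : Database σ) (u : Update σ) :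
    (D.apply u).facts =
      Layout.upd D.facts u.ins.toNat u.rel (Fact.nums ⟨u.rel, u.tuple⟩) := by
  have key : ∀ f : Fact σ, f.2 ∈ D.apply u f.1 ↔
      (f = ⟨u.rel, u.tuple⟩ ∧ u.ins = true) ∨ (f ≠ ⟨u.rel, u.tuple⟩ ∧ f.2 ∈ D f.1) := by
    obtain ⟨ins, R, t⟩ := u
    intro f
    cases ins with
    | true =>
      rw [mem_apply_insert]
      by_cases h : f = ⟨R, t⟩ <;> simp [h]
    | false =>
      rw [mem_apply_erase]
      simp
  funext r t
  refine propext ?_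
  simp only [Layout.upd]
  have hins : u.ins.toNat = 1 ↔ u.ins = true := by cases u.ins <;> simp
  constructor
  · rintro ⟨f, h1, rfl, rfl⟩
    rcases (key f).1 h1 with ⟨rfl, h2⟩ | ⟨h2, h3⟩
    · exact .inl ⟨rfl, rfl, hins.2 h2⟩
    · exact .inr ⟨fun h4 => h2 (Fact.eq_of_nums h4.1 h4.2), f, h3, rfl, rfl⟩
  · rintro (⟨rfl, rfl, h⟩ | ⟨h, f, h1, rfl, rfl⟩)
    · exact ⟨_, (key ⟨u.rel, u.tuple⟩).2 (.inl ⟨rfl, hins.1 h⟩), rfl, rfl⟩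
    · exact ⟨f, (key f).2 (.inr ⟨by rintro rfl; exact h ⟨rfl, rfl⟩, h1⟩), rfl, rfl⟩

/-- The active domain as a set of numbers. -/
def Database.words (D : Database σ) : Finset ℕ := D.adom.image PNat.val

theorem Database.mem_words {D : Database σ} {r : ℕ} {t : List ℕ} (h : D.facts r t) :
    ∀ u ∈ t, u ∈ D.words := by
  obtain ⟨f, h1, rfl, rfl⟩ := h
  intro u hu
  obtain ⟨i, rfl⟩ := List.mem_ofFn.1 hu
  refine Finset.mem_image.2 ⟨f.2 i, ?_, rfl⟩
  simp only [adom, Finset.mem_biUnion, Finset.mem_univ, true_and, Finset.mem_image]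
  exact ⟨f.1, f.2, h1, i, rfl⟩

theorem Fact.nums_ne_zero {f : Fact σ} : ∀ u ∈ f.nums, u ≠ 0 := fun u hu => by
  obtain ⟨i, rfl⟩ := List.mem_ofFn.1 hu
  exact (f.2 i).ne_zero

theorem Fact.length_nums (f : Fact σ) : f.nums.length = σ.ar f.1 := by simp [nums]

theorem Lists.sum {L : List (Fact σ)} {D : Database σ} (h : Lists L D) (g : Fin σ.numRel → ℕ) :
    (L.map fun f => g f.1).sum = ∑ R, g R * (D R).card := by
  classical
  have hL : L.toFinset = Finset.univ.sigma fun R => D R := by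
    ext f
    simp only [List.mem_toFinset, Finset.mem_sigma, Finset.mem_univ, true_and]
    exact h.2 f.1 f.2
  rw [← List.sum_toFinset _ h.1, hL, Finset.sum_sigma]
  refine Finset.sum_congr rfl fun R _ => ?_
  simp [mul_comm]

theorem Lists.length_le {L : List (Fact σ)} {D : Database σ} (h : Lists L D) :
    L.length ≤ σ.numRel + ∑ R, σ.ar R * (D R).card := by
  have h1 := h.sum fun _ => 1
  simp only [List.map_const', List.sum_replicate, smul_eq_mul, mul_one, one_mul] at h1
  suffices h2 : ∑ R, (D R).card ≤ ∑ R, (1 + σ.ar R * (D R).card) by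
    rw [Finset.sum_add_distrib] at h2
    simpa [h1] using h2
  refine Finset.sum_le_sum fun R _ => ?_
  by_cases hR : σ.ar R = 0
  · have : IsEmpty (Fin (σ.ar R)) := by rw [hR]; infer_instance
    have : (D R).card ≤ 1 := Finset.card_le_one.2 fun a _ b _ => Subsingleton.elim a b
    omega
  · have : (D R).card ≤ σ.ar R * (D R).card := Nat.le_mul_of_pos_left _ (by omega)
    omega

theorem Lists.length_flatMap {L : List (Fact σ)} {D : Database σ} (h : Lists L D) :
    (L.flatMap Fact.code).length = L.length + ∑ R, σ.ar R * (D R).card := by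
  rw [← h.sum]
  clear h
  induction L with
  | nil => rfl
  | cons f L ih =>
    rw [List.flatMap_cons, List.length_append, ih]
    simp [Fact.code]
    omega

theorem Lists.size_le {L : List (Fact σ)} {D : Database σ} (h : Lists L D) (q : CQ σ k) :
    (preprocessInput q L).length ≤ 2 * q.size + 2 * D.size + 2 ∧ L.length ≤ D.size ∧
      1 ≤ D.size := by
  have h1 := h.length_le
  have h2 := q.layout_le.2.1
  have h3 : 1 ≤ σ.numRel := by
    obtain ⟨ψ, hψ⟩ := List.exists_mem_of_ne_nil _ q.atoms_ne_nil
    have := ψ.rel.isLt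
    omega
  simp only [preprocessInput, Schema.code, Database.size, Schema.size, List.length_append,
    List.length_cons, List.length_ofFn, h.length_flatMap]
  omega

/-! ### The query result -/

theorem Term.ev_coe (β : ℕ → Dom) (s : Term) : s.ev (fun x => (β x : ℕ)) = (s.eval β : ℕ) := by
  cases s <;> rfl

/-- Membership in the query result in terms of the tables of the layout. -/
theorem CQ.mem_result_iff (q : CQ σ k) (D : Database σ) (a : Fin k → Dom) :
    a ∈ q.result D ↔ ∃ γ : ℕ → ℕ, (∀ x, γ x ≠ 0) ∧
      (q.layout.args 0).map (Term.ev γ) = testInput a ∧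
      ∀ p ∈ Finset.Icc 1 q.layout.d, D.facts (q.layout.rel p)
        ((q.layout.args p).map (Term.ev γ)) := by
  have key : ∀ β : ℕ → Dom, (q.IsHomDB D β ∧ ∀ i, a i = (q.head i).eval β) ↔
      (q.layout.args 0).map (Term.ev fun x => (β x : ℕ)) = testInput a ∧
      ∀ p ∈ Finset.Icc 1 q.layout.d, D.facts (q.layout.rel p)
        ((q.layout.args p).map (Term.ev fun x => (β x : ℕ))) := by
    intro β
    rw [and_comm]
    refine and_congr ?_ ?_
    · change _ ↔ (List.ofFn q.head).map _ = List.ofFn _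
      rw [List.map_ofFn, List.ofFn_injective.eq_iff, funext_iff]
      refine forall_congr' fun i => ?_
      rw [Function.comp_apply, Term.ev_coe, PNat.coe_inj, eq_comm]
    · have h : ∀ p (hp : p < q.atoms.length), D.facts (q.relTable (p + 1))
          ((q.argTable (p + 1)).map (Term.ev fun x => (β x : ℕ))) ↔
          (fun i => ((q.atoms[p]).args i).eval β) ∈ D (q.atoms[p]).rel := by
        intro p hp
        rw [← Database.facts_nums (f := ⟨(q.atoms[p]).rel, _⟩), q.argTable_succ hp,
          q.relTable_succ hp, List.map_ofFn, Fact.nums]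
        simp only [Function.comp_def, Term.ev_coe]
      constructor
      · intro h1 p hp
        rw [Finset.mem_Icc] at hp
        obtain ⟨p, rfl⟩ : ∃ p', p = p' + 1 := ⟨p - 1, by omega⟩
        have hp' : p < q.atoms.length := Nat.lt_of_succ_le hp.2
        exact (h p hp').2 (h1 _ (List.getElem_mem hp'))
      · intro h1 ψ hψ
        obtain ⟨p, hp, rfl⟩ := List.getElem_of_mem hψ
        exact (h p hp).1 (h1 (p + 1) (Finset.mem_Icc.2 ⟨by omega, Nat.succ_le_of_lt hp⟩))
  constructor
  · rintro ⟨β, h⟩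
    exact ⟨fun x => β x, fun x => (β x).ne_zero, (key β).1 h⟩
  · rintro ⟨γ, h0, h⟩
    exact ⟨fun x => ⟨γ x, Nat.pos_of_ne_zero (h0 x)⟩,
      (key fun x => ⟨γ x, Nat.pos_of_ne_zero (h0 x)⟩).2 h⟩

/-! ### The dynamic algorithm for `t`-hierarchical queries -/

/-- The preprocessing routine. -/
def initPL : PL := .call buildPL.prog ;; factsPL

/-- The dynamic algorithm. -/
def tAlg : DynAlg := ⟨initPL.prog, Layout.updatePL.prog, Layout.testPL.prog, 2⟩

/-- The data structure represents the database. -/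
structure Inv (q : CQ σ k) (N : ℕ) (D : Database σ) (s : State) : Prop where
  bdd : s.Bdd (N ^ 2)
  size_le : q.size + D.size ≤ N
  static : q.layout.Static s.vars s.mem
  cells : q.layout.Cells s.mem (q.layout.full (q.layout.tv D.facts))

theorem input_seg (s : State) (xs : List ℕ) : Seg (s.input xs).mem 0 xs := fun i hi => by
  simp [State.input, hi]

theorem input_mem (s : State) (xs : List ℕ) {a : List ℕ} (ha : a.head? ≠ some 0) :
    (s.input xs).mem a = s.mem a := by
  simp only [State.input]
  split
  · simp at ha
  · rfl

theorem input_bdd {s : State} {xs : List ℕ} {B : ℕ} (hs : s.Bdd B) (hx : maxWord xs ≤ B) :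
    (s.input xs).Bdd B := by
  refine ⟨hs.1, fun a => ?_⟩
  simp only [State.input]
  split
  · rename_i i
    by_cases hi : i < xs.length
    · rw [List.getElem?_eq_getElem hi]
      exact (le_maxWord (List.getElem_mem hi)).trans hx
    · rw [List.getElem?_eq_none (by omega)]
      exact hs.2 _
  · exact hs.2 _

theorem Inv.input {q : CQ σ k} {N : ℕ} {D : Database σ} {s : State} (h : Inv q N D s)
    (xs : List ℕ) : q.layout.Static (s.input xs).vars (s.input xs).mem ∧
      q.layout.Cells (s.input xs).mem (q.layout.full (q.layout.tv D.facts)) :=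
  ⟨h.static.frame (fun _ _ _ => rfl) fun _ ha _ _ _ => input_mem s xs ha,
    h.cells.frame fun _ ha _ => input_mem s xs (by simp [ha])⟩

theorem CQ.eight_le (q : CQ σ k) : 8 ≤ q.size := by
  have h1 := q.layout_le.1
  have : 1 ≤ q.layout.d := List.length_pos_iff.2 q.atoms_ne_nil
  omega

theorem mul_self_le_pow {a N : ℕ} (h : a ≤ N) : a * a ≤ N ^ 2 := by
  rw [pow_two]; exact Nat.mul_le_mul h h

theorem Schema.ar_le (σ : Schema) (R : Fin σ.numRel) : σ.ar R ≤ σ.size :=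
  (Finset.single_le_sum (fun _ _ => Nat.zero_le _) (Finset.mem_univ R)).trans
    (Nat.le_add_left _ _)

theorem length_args_eq {q : CQ σ k} {p : ℕ} (h1 : 1 ≤ p) (h2 : p ≤ q.layout.d) {f : Fact σ}
    (h : q.layout.rel p = f.1) : f.nums.length = (q.layout.args p).length := by
  obtain ⟨p, rfl⟩ : ∃ p', p = p' + 1 := ⟨p - 1, by omega⟩
  have hp : p < q.atoms.length := Nat.lt_of_succ_le h2
  change q.relTable (p + 1) = _ at h
  change _ = (q.argTable (p + 1)).length
  rw [q.relTable_succ hp] at h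
  rw [f.length_nums, q.argTable_succ hp, List.length_ofFn, Fin.ext h]

/-- The preprocessing establishes the data structure, in time linear in the size of the database. -/
theorem pre_spec {q : CQ σ k} (hq : q.THierarchical) {D : Database σ} {L : List (Fact σ)}
    (hL : Lists L D) : ∃ t s, Exec (inputSize q D (preprocessInput q L) ^ 2) initPL.prog
      (State.init.input (preprocessInput q L)) t s ∧
      t ≤ initPL.cost D.size (buildPL.cost (q.size * q.size) 0 +
        Layout.corePL.cost (q.size * q.size) 0) ∧
      Inv q (inputSize q D (preprocessInput q L)) D s := by
  set N := inputSize q D (preprocessInput q L) with hN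
  set xs := preprocessInput q L with hxs
  obtain ⟨hlen, hLD, _⟩ := hL.size_le q
  rw [← hxs] at hlen
  have hqN : q.size ≤ N := by rw [hN, inputSize]; omega
  have hsN : q.size + D.size ≤ N := by rw [hN, inputSize]; omega
  have h8 := q.eight_le
  have hB := mul_self_le_pow hqN
  have h8N : 8 * N ≤ N ^ 2 := by rw [pow_two]; exact Nat.mul_le_mul_right _ (by omega)
  have hH : D.words.card ≤ N ^ 2 := by
    have h1 : D.words.card ≤ D.adom.card := Finset.card_image_le
    have h2 : D.adom.card ≤ D.size := by simp only [Database.size]; omega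
    omega
  have hb := q.layout_bds (S := q.size * q.size) hB le_rfl hH
  have hY := q.layout_wf hq
  have hinit : (State.init.input xs).Bdd (N ^ 2) := by
    refine input_bdd ⟨fun _ => Nat.zero_le _, fun _ => Nat.zero_le _⟩ ?_
    have : maxWord xs ≤ N := by rw [hN, inputSize]; omega
    omega
  set fs : List (ℕ × List ℕ) := L.map fun f => ((f.1 : ℕ), f.nums) with hfs
  have hfsx : xs = q.code ++ ((List.ofFn σ.ar).length :: List.ofFn σ.ar ++
      (fs.length :: fs.flatMap codeFact)) := by
    rw [hxs, preprocessInput, Schema.code, List.length_ofFn, List.append_assoc, hfs,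
      List.length_map, List.flatMap_map]
    rfl
  have hfacts : (fun r t => (r, t) ∈ fs) = D.facts := by
    funext r t
    refine propext ?_
    simp only [hfs, List.mem_map, Prod.mk.injEq, Database.facts]
    exact exists_congr fun f => and_congr_left fun _ => hL.2 f.1 f.2
  have hall : ∀ {P : ℕ × List ℕ → Prop}, (∀ f ∈ L, P ((f.1 : ℕ), f.nums)) → ∀ f ∈ fs, P f := by
    intro P h f hf
    obtain ⟨g, hg, rfl⟩ := List.mem_map.1 hf
    exact h g hg
  have hseg := input_seg State.init xs
  rw [hfsx, seg_append, ← hfsx] at hseg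
  have hTri : Tri (N ^ 2) D.size (buildPL.cost (q.size * q.size) 0 +
      Layout.corePL.cost (q.size * q.size) 0) initPL (State.init.input xs).vars
      (State.init.input xs).mem fun ρ m => q.layout.Static ρ m ∧
        q.layout.Cells m (q.layout.full (q.layout.tv D.facts)) := by
    refine .seq (.call (S' := q.size * q.size) (τ' := 0) ((tri_build q hB le_rfl hseg.1
      fun a ha => input_mem _ _ ha).conseq fun ρ' m' ⟨h1, h2, h3⟩ => ?_) (Nat.le_add_right _ _))
    rw [← hfacts]
    have hlen' := congrArg List.length hfsx
    rw [List.length_append] at hlen'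
    refine tri_facts (ars := List.ofFn σ.ar) (fs := fs) hY hb
      (fun p _ => (q.length_args_le p).trans hb.X_leS) (Nat.le_add_left _ _)
      (by simpa [hfs] using hLD) h1
      (hY.cells_zero fun a ha => (h3 a (.inr ha)).trans (input_mem _ _ (by simp [ha])))
      ?_ ?_ (hall fun f _ => ?_) (hall fun f _ => f.nums_ne_zero) (hall fun f hf => ?_)
      (hall fun f _ p hp1 hp hr => length_args_eq hp1 hp hr)
    · rw [h2]
      exact (by simpa using hseg.2 : Seg _ q.code.length _).frame fun i => h3 _ (.inl rfl)
    · rw [h2, ← hlen']; omega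
    · simp [Fact.length_nums]
    · exact Database.mem_words (Database.facts_nums.2 ((hL.2 f.1 f.2).1 hf))
  obtain ⟨t, s, h1, h2, h3, h4, h5⟩ := hTri _ hinit rfl rfl
  exact ⟨t, s, h1, h2, h3, hsN, h4, h5⟩

/-- The update routine maintains the data structure, in time that depends only on the query. -/
theorem update_spec {q : CQ σ k} (hq : q.THierarchical) {D : Database σ} {N : ℕ} {s : State}
    (h : Inv q N D s) (u : Update σ) :
    ∃ t s', Exec (max N (inputSize q (D.apply u) (updateInput u)) ^ 2) Layout.updatePL.prog
      (s.input (updateInput u)) t s' ∧ t ≤ Layout.updatePL.cost (q.size * q.size) 0 ∧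
      Inv q (max N (inputSize q (D.apply u) (updateInput u))) (D.apply u) s' := by
  set N' := max N (inputSize q (D.apply u) (updateInput u)) with hN'
  have hNN : N ≤ N' := le_max_left _ _
  have hIN : inputSize q (D.apply u) (updateInput u) ≤ N' := le_max_right _ _
  rw [inputSize] at hIN
  have hDN := h.size_le
  have h8 := q.eight_le
  have hB := mul_self_le_pow (show q.size ≤ N' by omega)
  have h8N : 8 * N' ≤ N' ^ 2 := by rw [pow_two]; exact Nat.mul_le_mul_right _ (by omega)
  set f : Fact σ := ⟨u.rel, u.tuple⟩ with hf
  have hfl : f.nums.length ≤ N' := by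
    rw [f.length_nums]
    have h1 := σ.ar_le f.1
    have h2 : σ.size ≤ D.size := by simp only [Database.size]; omega
    omega
  have hH : (D.words ∪ f.nums.toFinset).card ≤ N' ^ 2 := by
    have h1 : D.words.card ≤ D.adom.card := Finset.card_image_le
    have h2 : D.adom.card ≤ D.size := by simp only [Database.size]; omega
    have h3 := Finset.card_union_le D.words f.nums.toFinset
    have h4 := f.nums.toFinset_card_le
    omega
  obtain ⟨hst, hc⟩ := h.input (updateInput u)
  have hseg : Seg (s.input (updateInput u)).mem 0 (u.ins.toNat :: (u.rel : ℕ) :: f.nums) :=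
    input_seg s (updateInput u)
  rw [seg_cons, seg_cons] at hseg
  have hb := q.layout_bds (S := q.size * q.size) hB le_rfl hH
  have hTri := Layout.tri_update (τ := 0) (q.layout_wf hq) hb (Dn := D.facts) (R := u.rel)
    (t := f.nums) (ins := u.ins.toNat)
    (fun r t h u hu => Finset.mem_union_left _ (Database.mem_words h u hu))
    (fun u hu => Finset.mem_union_right _ (List.mem_toFinset.2 hu)) f.nums_ne_zero
    (fun p h1 h2 hr => length_args_eq h1 h2 hr) (by cases u.ins <;> simp) hst hseg.1 hseg.2.1
    (fun p _ => (q.length_args_le p).trans hb.X_leS) hseg.2.2 (by omega) hc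
  have hbdd : (s.input (updateInput u)).Bdd (N' ^ 2) :=
    input_bdd (h.bdd.mono (Nat.pow_le_pow_left hNN 2)) (by omega)
  obtain ⟨t, s', h1, h2, h3, h4, h5⟩ := hTri _ hbdd rfl rfl
  rw [← D.facts_apply u] at h5
  exact ⟨t, s', h1, h2, h3, by omega, h4, h5⟩

/-- The test routine is correct and keeps the data structure, in time that depends only on the
query. -/
theorem test_spec {q : CQ σ k} (hq : q.THierarchical) {D : Database σ} {N : ℕ} {s : State}
    (h : Inv q N D s) (a : Fin k → Dom) :
    ∃ t s', Exec (max N (inputSize q D (testInput a)) ^ 2) Layout.testPL.prog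
      (s.input (testInput a)) t s' ∧ t ≤ Layout.testPL.cost (q.size * q.size) 0 ∧
      Inv q (max N (inputSize q D (testInput a))) D s' ∧
      (a ∈ q.result D → s'.output 0 = 1) ∧ (a ∉ q.result D → s'.output 0 = 0) := by
  set N' := max N (inputSize q D (testInput a)) with hN'
  have hNN : N ≤ N' := le_max_left _ _
  have hIN : inputSize q D (testInput a) ≤ N' := le_max_right _ _
  rw [inputSize] at hIN
  have hDN := h.size_le
  have h8 := q.eight_le
  have hB := mul_self_le_pow (show q.size ≤ N' by omega)
  have h8N : 8 * N' ≤ N' ^ 2 := by rw [pow_two]; exact Nat.mul_le_mul_right _ (by omega)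
  have hH : D.words.card ≤ N' ^ 2 := by
    have h1 : D.words.card ≤ D.adom.card := Finset.card_image_le
    have h2 : D.adom.card ≤ D.size := by simp only [Database.size]; omega
    omega
  obtain ⟨hst, hc⟩ := h.input (testInput a)
  have hb := q.layout_bds (S := q.size * q.size) hB le_rfl hH
  have hlen : (testInput a).length = (q.layout.args 0).length := by
    change _ = (List.ofFn q.head).length
    simp [testInput]
  have hX := q.length_args_le 0
  have hTri := Layout.tri_test (τ := 0) (q.layout_wf hq) hb (Dn := D.facts) (t := testInput a)
    (fun r t h => Database.mem_words h)
    (fun u hu => by obtain ⟨i, rfl⟩ := List.mem_ofFn.1 hu; exact (a i).ne_zero)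
    hlen hst (hlen ▸ hX.trans hb.X_leS) (by simpa [Seg] using input_seg s (testInput a))
    (hlen ▸ hX.trans hb.X_le) hc
  have hbdd : (s.input (testInput a)).Bdd (N' ^ 2) :=
    input_bdd (h.bdd.mono (Nat.pow_le_pow_left hNN 2)) (by omega)
  obtain ⟨t, s', h1, h2, h3, h4, h5, h6⟩ := hTri _ hbdd rfl rfl
  rw [← q.mem_result_iff] at h6
  exact ⟨t, s', h1, h2, ⟨h3, by omega, h4, h5⟩, h6⟩

/-- Executions are deterministic, so that every configuration that can be reached is the one of the
correctness proofs. -/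
theorem inv_of_reachable {q : CQ σ k} (hq : q.THierarchical) {𝒞 : Set (Database σ)} {N : ℕ}
    {D : Database σ} {s : State} (h : Reachable tAlg q 𝒞 N D s) : Inv q N D s := by
  induction h with
  | preprocess _ hL he =>
    obtain ⟨t, s, h1, _, h2⟩ := pre_spec hq hL
    rwa [(Exec.det he h1).2]
  | update u _ _ he ih =>
    obtain ⟨t, s, h1, _, h2⟩ := update_spec hq ih u
    rwa [(Exec.det he h1).2]
  | test a _ he ih =>
    obtain ⟨t, s, h1, _, h2, _⟩ := test_spec hq ih a
    rwa [(Exec.det he h1).2]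

theorem cost_le_size (P : PL) (q : CQ σ k) :
    P.cost (q.size * q.size) 0 ≤ P.len * q.size ^ (3 * P.depth) := by
  have h8 := q.eight_le
  refine (P.cost_le _ _).trans ?_
  rw [Nat.zero_add, mul_one, pow_mul]
  have : q.size * q.size + 1 ≤ q.size ^ 3 := by
    have h1 : q.size ^ 3 = q.size * (q.size * q.size) := by ring
    have h2 : 8 * (q.size * q.size) ≤ q.size * (q.size * q.size) := Nat.mul_le_mul_right _ h8
    have h3 : 1 * 1 ≤ q.size * q.size := Nat.mul_le_mul (by omega) (by omega)
    omega
  gcongr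

/-- There is a single dynamic algorithm for all `t`-hierarchical queries, with constant update and
testing time apart from a polynomial in the size of the query. -/
theorem exists_solvesTesting : ∃ (A : DynAlg) (c : ℕ), ∀ (σ : Schema) (k : ℕ) (q : CQ σ k),
    q.THierarchical → SolvesTesting A q Set.univ
        (fun D => ((c * q.size ^ c * D.size : ℕ) : ℝ))
        (fun _ => ((c * q.size ^ c : ℕ) : ℝ))
        (fun _ => ((c * q.size ^ c : ℕ) : ℝ)) := by
  have hdepth : initPL.depth = 1 := by
    simp [initPL, factsPL, PL.depth, depth_asg, forE, Ex.depth_comp]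
  set P : PL := buildPL ;; Layout.corePL ;; Layout.updatePL ;; Layout.testPL
  set c := 2 * initPL.len * (2 * P.len + 1) + P.len + 3 * P.depth with hc
  have bound : ∀ {σ : Schema} {k : ℕ} (q : CQ σ k) (P' : PL), P'.len ≤ P.len →
      P'.depth ≤ P.depth → P'.cost (q.size * q.size) 0 ≤ P.len * q.size ^ (3 * P.depth) := by
    intro σ k q P' h1 h2
    refine (cost_le_size P' q).trans (Nat.mul_le_mul h1 ?_)
    exact Nat.pow_le_pow_right (by have := q.eight_le; omega) (by omega)
  have hP : P.len = buildPL.len + (Layout.corePL.len + (Layout.updatePL.len + Layout.testPL.len)) :=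
    rfl
  have hPd : P.depth = max buildPL.depth (max Layout.corePL.depth
    (max Layout.updatePL.depth Layout.testPL.depth)) := rfl
  have small : ∀ {σ : Schema} {k : ℕ} (q : CQ σ k),
      P.len * q.size ^ (3 * P.depth) ≤ c * q.size ^ c := by
    intro σ k q
    refine Nat.mul_le_mul (by omega) (Nat.pow_le_pow_right (by have := q.eight_le; omega) (by omega))
  refine ⟨tAlg, c, fun σ k q hq => ⟨fun D _ L hL => ?_, fun N D s hr u _ => ?_,
    fun N D s hr a => ?_⟩⟩
  · obtain ⟨t, s, h1, h2, _⟩ := pre_spec hq hL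
    refine ⟨t, s, h1, Nat.cast_le.2 (h2.trans ?_)⟩
    have hD := (hL.size_le q).2.2
    have h8 := q.eight_le
    have hpow : 1 ≤ q.size ^ (3 * P.depth) := Nat.one_le_pow _ _ (by omega)
    have h3 := bound q buildPL (by omega) (by omega)
    have h4 := bound q Layout.corePL (by omega) (by omega)
    refine (PL.cost_le _ _ _).trans ?_
    rw [hdepth, pow_one]
    calc initPL.len * (D.size + 1) * (buildPL.cost (q.size * q.size) 0 +
          Layout.corePL.cost (q.size * q.size) 0 + 1)
        ≤ initPL.len * (2 * D.size) * ((2 * P.len + 1) * q.size ^ (3 * P.depth)) := by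
          gcongr
          · omega
          · rw [Nat.add_mul, one_mul, Nat.mul_assoc]; omega
      _ = 2 * initPL.len * (2 * P.len + 1) * q.size ^ (3 * P.depth) * D.size := by ring
      _ ≤ c * q.size ^ c * D.size := by
          exact Nat.mul_le_mul_right _ (Nat.mul_le_mul (Nat.le_add_right _ _ |>.trans
            (Nat.le_add_right _ _)) (Nat.pow_le_pow_right (by omega) (Nat.le_add_left _ _)))
  · obtain ⟨t, s', h1, h2, _⟩ := update_spec hq (inv_of_reachable hq hr) u
    exact ⟨t, s', h1, Nat.cast_le.2
      (h2.trans ((bound q Layout.updatePL (by omega) (by omega)).trans (small q)))⟩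
  · obtain ⟨t, s', h1, h2, _, h3⟩ := test_spec hq (inv_of_reachable hq hr) a
    exact ⟨t, s', h1, Nat.cast_le.2
      (h2.trans ((bound q Layout.testPL (by omega) (by omega)).trans (small q))), h3⟩

end DynCQ

theorem mainTheorem1 :
    (∃ (A : DynAlg) (c : ℕ), ∀ (σ : Schema) (k : ℕ) (q : CQ σ k), q.THierarchical →
      SolvesTesting A q Set.univ
        (fun D => ((c * q.size ^ c * D.size : ℕ) : ℝ))
        (fun _ => ((c * q.size ^ c : ℕ) : ℝ))
        (fun _ => ((c * q.size ^ c : ℕ) : ℝ))) ∧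
    (∀ (σ : Schema) (k : ℕ) (q : CQ σ k),
      (q.CoreNotTHierarchical ↔ ∀ q' : CQ σ k, q.Equivalent q' → ¬ q'.THierarchical) ∧
      (q.CoreNotTHierarchical → ∀ ε : ℝ, 0 < ε → OMvConjecture →
        ¬ SublinearTesting q Set.univ ε ∧
        ¬ SublinearTesting q {D | D.MapsInto q} ε)) := by
  refine ⟨exists_solvesTesting, fun σ k q => ⟨CQ.coreNotTHierarchical_iff, fun h ε hε hO =>
    ⟨not_sublinearTesting h hε hO (Set.subset_univ _), not_sublinearTesting h hε hO subset_rfl⟩⟩⟩
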